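/- A $k$-expression over a vertex set $V$ is an algebraic expression built from the operations $i(v)$ (a new isolated vertex $v\in V$ with label $i\in\{1,\dots,k\}$), $\oplus$ (disjoint union), $\eta(i,j)$ with $i\neq j$ (join all vertices labeled $i$ to all vertices labeled $j$) and $\rho(i,j)$ (every vertex labeled $i$ gets the label $j$); its size $L$ is its number of operations. It generates a graph $G=(V,E)$ if every vertex of $G$ is introduced exactly once and the graph obtained by forgetting the labels is $G$; a graph has clique-width at most $k$ if some $k$-expression generates it. Graphs are finite, simple, and possibly disconnected; $d_G(u,v)\in\mathbb N\cup\{+\infty\}$ is the number of edges of a shortest $uv$-path, and $+\infty$ if there is none. Write $\lg n=\lfloor\log_2 n\rfloor+1$. The computation model is the word RAM: registers and memory cells hold $w$-bit words; an assignment, a memory access, a comparison, or an arithmetic operation ($+,-,\times$, integer division, remainder) on words takes one step, and programs may not overflow. **Theorem.** There are a decoding function $D:\{0,1\}^*\times\{0,1\}^*\to\mathbb N\cup\{+\infty\}$, two word-RAM programs (preprocessing and query) and absolute constants $c,\kappa$ such that the following holds. Let $G$ be a graph with vertex set $\{0,\dots,n-1\}$ and with $m$ edges, given by adjacency lists together with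 a $k$-expression of size $L$ generating it (so that $G$ has clique-width at most $k$). Then there are labels $C_G(v)\in\{0,1\}^*$, $v\in V$, such that: 1. $D(C_G(u),C_G(v))=d_G(u,v)$ for all $u,v\in V$; 2. every label has at most $c\,k\,(\lg n)^2$ bits, i.e. $O(k\log^2 n)$ bits; 3. for every word size $w\ge\kappa\lg(k+L)$, the preprocessing program computes all the labels from the adjacency lists and the $k$-expression in at most $c\,k\,(L+(n+m)\lg n)$ steps; in particular, in $O(k(n+m)\log n)$ time for $k$-expressions of size $L=O(n+m)$ (the usual case, of expressions without unnecessary operations); 4. for every word size $w\ge\kappa\lg n$ and all $u,v\in V$, the query program, given only the two labels $C_G(u)$ and $C_G(v)$, computes $d_G(u,v)=D(C_G(u),C_G(v))$ in at most $c\,k\,\lg n$ steps, i.e. in $O(k\log n)$ time. In items 3 and 4 a label is stored in memory as its length followed by its bits, $\lg n$ bits per word. -/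

import Mathlib

/-! ### Clique-width expressions -/

/-- Clique-width `k`-expressions over a set `V` of vertex names, with labels in `Fin k`. -/
inductive CWExpr (V : Type) (k : ℕ) : Type
  /-- `i(v)`: the new isolated vertex `v`, with label `i`. -/
  | vertex (i : Fin k) (v : V) : CWExpr V k
  /-- `e ⊕ f`: disjoint union. -/
  | union (e f : CWExpr V k) : CWExpr V k
  /-- `η(i,j)`: join all vertices with label `i` to all vertices with label `j`. -/
  | join (i j : Fin k) (hij : i ≠ j) (e : CWExpr V k) : CWExpr V k
  /-- `ρ(i,j)`: every vertex with label `i` gets label `j`. -/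
  | relabel (i j : Fin k) (e : CWExpr V k) : CWExpr V k

namespace CWExpr

variable {V : Type} {k : ℕ}

/-- The vertices introduced by the expression, one entry for each operation `i(v)`. -/
def leaves : CWExpr V k → List V
  | vertex _ v => [v]
  | union e f => e.leaves ++ f.leaves
  | join _ _ _ e => e.leaves
  | relabel _ _ e => e.leaves

/-- `e.HasLabel v l`: in the labeled graph built by `e`, the vertex `v` has label `l`. -/
def HasLabel : CWExpr V k → V → Fin k → Prop
  | vertex i u, v, l => v = u ∧ l = i
  | union e f, v, l => e.HasLabel v l ∨ f.HasLabel v l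
  | join _ _ _ e, v, l => e.HasLabel v l
  | relabel i j e, v, l => ∃ l', e.HasLabel v l' ∧ l = if l' = i then j else l'

/-- Adjacency in the labeled graph built by the expression. -/
def Adj : CWExpr V k → V → V → Prop
  | vertex _ _, _, _ => False
  | union e f, u, v => e.Adj u v ∨ f.Adj u v
  | join i j _ e, u, v => e.Adj u v ∨
      (e.HasLabel u i ∧ e.HasLabel v j) ∨ (e.HasLabel u j ∧ e.HasLabel v i)
  | relabel _ _ e, u, v => e.Adj u v

/-- The size of an expression: its number of operations. -/
def size : CWExpr V k → ℕ
  | vertex _ _ => 1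
  | union e f => e.size + f.size + 1
  | join _ _ _ e => e.size + 1
  | relabel _ _ e => e.size + 1

/-- The expression `e` generates the graph `G`: every vertex of `G` is introduced exactly once (so
all unions are disjoint), and the edges are those of `G`. The graphs generated by some
`e : CWExpr V k` are the graphs of clique-width at most `k`. -/
def Generates (e : CWExpr V k) (G : SimpleGraph V) : Prop :=
  e.leaves.Nodup ∧ (∀ v, v ∈ e.leaves) ∧ ∀ u v, G.Adj u v ↔ e.Adj u v

/-- The expression in postfix notation, three numbers for each operation. -/
def tokens {n k : ℕ} : CWExpr (Fin n) k → List ℕ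
  | vertex i v => [0, (i : ℕ), (v : ℕ)]
  | union e f => e.tokens ++ f.tokens ++ [1, 0, 0]
  | join i j _ e => e.tokens ++ [2, (i : ℕ), (j : ℕ)]
  | relabel i j e => e.tokens ++ [3, (i : ℕ), (j : ℕ)]

end CWExpr

/-! ### Adjacency lists -/

/-- `adj` is an adjacency-list representation of `G` (each list in any order). -/
def IsAdjLists {n : ℕ} (G : SimpleGraph (Fin n)) (adj : Fin n → List (Fin n)) : Prop :=
  ∀ v, (adj v).Nodup ∧ ∀ u, u ∈ adj v ↔ G.Adj v u

/-- Adjacency lists written one after the other, each one preceded by its length. -/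
def adjTokens {n : ℕ} (adj : Fin n → List (Fin n)) : List ℕ :=
  (List.finRange n).flatMap fun v => (adj v).length :: (adj v).map fun u => (u : ℕ)

/-! ### The word RAM

A machine has registers and a memory, both holding words, i.e. natural numbers below `2 ^ w`.
A program is a fixed structured program over these; it mentions finitely many registers and
constants. Each assignment, memory access, arithmetic operation and test costs one step. An
operation whose result does not fit into a word has no outcome. -/

namespace WordRAM

/-- Arithmetic operations; `sub` is truncated at `0`. -/
inductive BinOp : Type
  | add | sub | mul | div | mod

/-- The value of an arithmetic operation. -/
def BinOp.eval : BinOp → ℕ → ℕ → ℕ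
  | add, x, y => x + y
  | sub, x, y => x - y
  | mul, x, y => x * y
  | div, x, y => x / y
  | mod, x, y => x % y

/-- Tests comparing the contents of two registers. -/
inductive Test : Type
  | lt (a b : ℕ) | le (a b : ℕ) | eq (a b : ℕ) | ne (a b : ℕ)

/-- Truth of a test for the register contents `R`. -/
def Test.Holds (R : ℕ → ℕ) : Test → Prop
  | lt a b => R a < R b
  | le a b => R a ≤ R b
  | eq a b => R a = R b
  | ne a b => R a ≠ R b

/-- Programs. Here `r`, `a`, `b` are numbers of registers. -/
inductive Prog : Type
  | skip : Prog
  /-- `R[r] := c` -/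
  | const (r c : ℕ) : Prog
  /-- `R[r] := R[a]` -/
  | move (r a : ℕ) : Prog
  /-- `R[r] := R[a] o R[b]` -/
  | op (o : BinOp) (r a b : ℕ) : Prog
  /-- `R[r] := M[R[a]]` -/
  | load (r a : ℕ) : Prog
  /-- `M[R[a]] := R[r]` -/
  | store (a r : ℕ) : Prog
  | seq (p q : Prog) : Prog
  | ite (b : Test) (p q : Prog) : Prog
  /-- While the test holds, repeat the body. -/
  | loop (b : Test) (p : Prog) : Prog

/-- A machine state: contents of the registers and of the memory cells. -/
structure State : Type where
  regs : ℕ → ℕ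
  mem : ℕ → ℕ

/-- Write `x` into register `r`. -/
def State.setReg (s : State) (r x : ℕ) : State := ⟨Function.update s.regs r x, s.mem⟩

/-- Write `x` into memory cell `a`. -/
def State.setMem (s : State) (a x : ℕ) : State := ⟨s.regs, Function.update s.mem a x⟩

/-- `Exec w p s t s'`: with word size `w`, the program `p` started in the state `s` halts after
exactly `t` steps in the state `s'`. -/
inductive Exec (w : ℕ) : Prog → State → ℕ → State → Prop
  | skip (s : State) : Exec w .skip s 1 s
  | const (s : State) (r c : ℕ) (hc : c < 2 ^ w) : Exec w (.const r c) s 1 (s.setReg r c)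
  | move (s : State) (r a : ℕ) : Exec w (.move r a) s 1 (s.setReg r (s.regs a))
  | op (s : State) (o : BinOp) (r a b : ℕ) (ho : o.eval (s.regs a) (s.regs b) < 2 ^ w) :
      Exec w (.op o r a b) s 1 (s.setReg r (o.eval (s.regs a) (s.regs b)))
  | load (s : State) (r a : ℕ) : Exec w (.load r a) s 1 (s.setReg r (s.mem (s.regs a)))
  | store (s : State) (a r : ℕ) : Exec w (.store a r) s 1 (s.setMem (s.regs a) (s.regs r))
  | seq {p q : Prog} {s₀ s₁ s₂ : State} {t₁ t₂ : ℕ}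
      (hp : Exec w p s₀ t₁ s₁) (hq : Exec w q s₁ t₂ s₂) : Exec w (.seq p q) s₀ (t₁ + t₂) s₂
  | iteTrue {b : Test} {p q : Prog} {s s' : State} {t : ℕ}
      (hb : b.Holds s.regs) (hp : Exec w p s t s') : Exec w (.ite b p q) s (t + 1) s'
  | iteFalse {b : Test} {p q : Prog} {s s' : State} {t : ℕ}
      (hb : ¬ b.Holds s.regs) (hq : Exec w q s t s') : Exec w (.ite b p q) s (t + 1) s'
  | loopStop {b : Test} {p : Prog} {s : State}
      (hb : ¬ b.Holds s.regs) : Exec w (.loop b p) s 1 s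
  | loopStep {b : Test} {p : Prog} {s₀ s₁ s₂ : State} {t₁ t₂ : ℕ}
      (hb : b.Holds s₀.regs) (hp : Exec w p s₀ t₁ s₁) (hl : Exec w (.loop b p) s₁ t₂ s₂) :
      Exec w (.loop b p) s₀ (t₁ + t₂ + 1) s₂

/-- The initial state for an input: the input occupies the first memory cells, everything else
is `0`. -/
def inputState (input : List ℕ) : State := ⟨fun _ => 0, fun a => input.getD a 0⟩

/-- The word formed by the bits number `j * b, …, j * b + b - 1` of the bit string `x`, padded by
zeros at its end, least significant bit first. -/
def block (b : ℕ) (x : List Bool) (j : ℕ) : ℕ :=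
  ∑ i ∈ Finset.range b, (x.getD (j * b + i) false).toNat * 2 ^ i

/-- The bit string `x` is stored in the memory `M` from address `p` on: first its length, then its
bits, `b` of them per word. -/
def StoredAt (w b : ℕ) (M : ℕ → ℕ) (p : ℕ) (x : List Bool) : Prop :=
  p < 2 ^ w ∧ M p = x.length ∧
    ∀ j, j * b < x.length → p + 1 + j < 2 ^ w ∧ M (p + 1 + j) = block b x j

/-- How a distance is returned in a register: `0` for `+∞`, and `d + 1` for a finite `d`. -/
def distCode : ℕ∞ → ℕ
  | ⊤ => 0
  | (d : ℕ) => d + 1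

end WordRAM

/-- The input of the preprocessing: `n`, `k`, the size of the `k`-expression, the `k`-expression,
and the graph as adjacency lists. -/
def dlsInput {n k : ℕ} (e : CWExpr (Fin n) k) (adj : Fin n → List (Fin n)) : List ℕ :=
  [n, k, e.size] ++ e.tokens ++ adjTokens adj

/-- `⌊log₂ n⌋ + 1`, the number of binary digits of a positive integer `n`. -/
def lg (n : ℕ) : ℕ := Nat.log 2 n + 1

/-- The preprocessing program `enc`, on words of `w` bits, halts on the given input after at most
`T` steps and leaves all labels in memory: register `0` holds the address of a table, whose
`v`-th entry is the address of the label of `v`, stored with `lg n` bits per word. -/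
def ComputesLabels {n k : ℕ} (w : ℕ) (enc : WordRAM.Prog) (e : CWExpr (Fin n) k)
    (adj : Fin n → List (Fin n)) (label : Fin n → List Bool) (T : ℕ) : Prop :=
  ∃ t s, WordRAM.Exec w enc (WordRAM.inputState (dlsInput e adj)) t s ∧ t ≤ T ∧
    ∀ v : Fin n, s.regs 0 + v < 2 ^ w ∧
      WordRAM.StoredAt w (lg n) s.mem (s.mem (s.regs 0 + v)) (label v)

/-- The query program `dec`, on words of `w` bits, answers `d` after at most `T` steps on the pair
of labels `x`, `y`. Registers `0` and `1` hold the addresses of the labels, which are stored with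
`b` bits per word; nothing else is known about the initial state. The answer is left in
register `0`. -/
def AnswersQuery (w b : ℕ) (dec : WordRAM.Prog) (x y : List Bool) (d : ℕ∞) (T : ℕ) : Prop :=
  ∀ s : WordRAM.State,
    WordRAM.StoredAt w b s.mem (s.regs 0) x → WordRAM.StoredAt w b s.mem (s.regs 1) y →
      ∃ t s', WordRAM.Exec w dec s t s' ∧ t ≤ T ∧ s'.regs 0 = WordRAM.distCode d

/-! ### A structured language with registers and arrays, and its compilation to the word RAM -/

set_option linter.unusedSectionVars false

namespace WordRAM

/-! The proof joins a separator argument on the tree of the expression to a verified implementation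
of it.

Tree. Joins and relabelings create no nodes, so the tree has one leaf per vertex and one binary node
per union, that is `2n - 1` nodes. Vertices with the same label at a node are treated alike by all
later operations; hence the vertices below a node fall into at most `k` classes with respect to
their neighbors that are not below it (`CWExpr.exists_classes`). In a component of the cut tree with
at least two vertices, the first node in postorder that has at least a third of these vertices below
it has at most two thirds of them: it is a leaf, or it has at most two children in the component,
each with less than a third (`CutTree.Selected.count_le`). Cutting every component there shrinks the
pieces geometrically (`CutTree.card_next`, `size_next`), and after `2 * (lg n - 1)` levels all
pieces are single vertices.

Distances. The edges of a piece between the part cut off and the rest are covered by at most `K =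
min k n` complete bipartite graphs with sides `X r` and `N r`. A shortest path of the piece either
stays inside one of the two parts or uses such an edge, so the distance of `u` and `v` in the piece
is the minimum of their distance inside the parts and of `d(u, X r) + 1 + d(N r, v)` and `d(u, N r)
+ 1 + d(X r, v)` over all `r` (`SimpleGraph.edist_eq_min_of_separator`). A label stores for every
level the side of its vertex and the `2 * K` distances to these sets: `O(K * lg n)` words of `lg n`
bits. A query evaluates the levels until the two vertices are separated.

Preprocessing. The classes are found from the graph alone. In each of the `K` rounds of a level, all
pieces are treated at the same time: every piece that still has a pending vertex picks one as
representative, the neighborhood of the representative across the cut is marked, the vertices with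
the same neighborhood are recognized by comparing cardinalities (`across_eq_of_card`), and two
breadth-first searches give the distances. A round is linear in the graph plus the tree, and it
removes at least one class from each piece that has some (`rounds_runs`).

Machine. The programs are written in a small language with counted loops and compiled with an exact
step count (`Stmt.exec_compile`). Overflow is treated once and for all: a stored value grows by at
most 8 per step unless it is checked against a fixed bound, and expressions have degree at most 4,
so everything stays polynomial in the size of the input (`Stmt.ok_of_safe`). -/

/-- Expressions over registers `ρ` and arrays `α`. -/
inductive Exp (ρ α : Type) : Type
  | reg (r : ρ) : Exp ρ α
  | const (c : ℕ) : Exp ρ α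
  | op (o : BinOp) (x y : Exp ρ α) : Exp ρ α
  | get (a : α) (i : Exp ρ α) : Exp ρ α

/-- Comparisons. -/
inductive Cmp : Type
  | lt | le | eq | ne

/-- The relation of a comparison. -/
def Cmp.Rel : Cmp → ℕ → ℕ → Prop
  | lt, x, y => x < y
  | le, x, y => x ≤ y
  | eq, x, y => x = y
  | ne, x, y => x ≠ y

instance (c : Cmp) (x y : ℕ) : Decidable (c.Rel x y) := by
  cases c <;> unfold Cmp.Rel <;> infer_instance

/-- The machine test of a comparison. -/
def Cmp.test : Cmp → ℕ → ℕ → Test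
  | lt => Test.lt
  | le => Test.le
  | eq => Test.eq
  | ne => Test.ne

theorem Cmp.test_holds (c : Cmp) (a b : ℕ) (R : ℕ → ℕ) :
    (c.test a b).Holds R ↔ c.Rel (R a) (R b) := by
  cases c <;> rfl

/-- Statements; all loops have a number of rounds that is fixed when they are entered. -/
inductive Stmt (ρ α : Type) : Type
  | set (r : ρ) (e : Exp ρ α) : Stmt ρ α
  | put (a : α) (i e : Exp ρ α) : Stmt ρ α
  | seq (p q : Stmt ρ α) : Stmt ρ α
  | cond (c : Cmp) (x y : Exp ρ α) (p : Stmt ρ α) : Stmt ρ α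
  | loop (r : ρ) (e : Exp ρ α) (p : Stmt ρ α) : Stmt ρ α

/-- Contents of registers and arrays. -/
structure Store (ρ α : Type) : Type where
  reg : ρ → ℕ
  arr : α → ℕ → ℕ

/-- `iter f m s` applies `f 0`, …, `f (m - 1)` to `s`. -/
def iter {σ : Type} (f : ℕ → σ → σ) : ℕ → σ → σ
  | 0, s => s
  | m + 1, s => f m (iter f m s)

variable {ρ α : Type} [DecidableEq ρ] [DecidableEq α]

/-- Write a register. -/
def Store.set (s : Store ρ α) (r : ρ) (x : ℕ) : Store ρ α :=
  ⟨fun r' => if r' = r then x else s.reg r', s.arr⟩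

/-- Write an array entry. -/
def Store.put (s : Store ρ α) (a : α) (i x : ℕ) : Store ρ α :=
  ⟨s.reg, fun a' i' => if a' = a ∧ i' = i then x else s.arr a' i'⟩

@[simp] theorem Store.set_reg (s : Store ρ α) (r r' : ρ) (x : ℕ) :
    (s.set r x).reg r' = if r' = r then x else s.reg r' := rfl
@[simp] theorem Store.set_arr (s : Store ρ α) (r : ρ) (x : ℕ) : (s.set r x).arr = s.arr := rfl
@[simp] theorem Store.put_reg (s : Store ρ α) (a : α) (i x : ℕ) : (s.put a i x).reg = s.reg := rfl
@[simp] theorem Store.put_arr (s : Store ρ α) (a a' : α) (i i' x : ℕ) :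
    (s.put a i x).arr a' i' = if a' = a ∧ i' = i then x else s.arr a' i' := rfl

/-- The value of an expression. -/
def Exp.eval : Exp ρ α → Store ρ α → ℕ
  | reg r, s => s.reg r
  | const c, _ => c
  | op o x y, s => o.eval (x.eval s) (y.eval s)
  | get a i, s => s.arr a (i.eval s)

/-- The number of machine steps of the evaluation. -/
def Exp.cost : Exp ρ α → ℕ
  | reg _ => 1
  | const _ => 1
  | op _ x y => x.cost + y.cost + 1
  | get _ i => i.cost + 2

/-- The effect of a statement. -/
def Stmt.den : Stmt ρ α → Store ρ α → Store ρ α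
  | set r e, s => s.set r (e.eval s)
  | put a i e, s => s.put a (i.eval s) (e.eval s)
  | seq p q, s => q.den (p.den s)
  | cond c x y p, s => if c.Rel (x.eval s) (y.eval s) then p.den s else s
  | loop r e p, s => iter (fun i s' => p.den (s'.set r i)) (e.eval s) s

/-- The number of machine steps of a statement. -/
def Stmt.cost : Stmt ρ α → Store ρ α → ℕ
  | set _ e, _ => e.cost + 1
  | put _ i e, _ => i.cost + e.cost + 2
  | seq p q, s => p.cost s + q.cost (p.den s)
  | cond c x y p, s =>
      x.cost + y.cost + 1 + if c.Rel (x.eval s) (y.eval s) then p.cost s else 1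
  | loop r e p, s => e.cost + 2 +
      ∑ i ∈ Finset.range (e.eval s),
        (p.cost ((iter (fun i s' => p.den (s'.set r i)) i s).set r i) + 4)

/-- All intermediate values fit into a word and all array indices are valid. -/
def Exp.Ok (w : ℕ) (valid : α → ℕ → Prop) : Exp ρ α → Store ρ α → Prop
  | reg _, _ => True
  | const c, _ => c < 2 ^ w
  | op o x y, s => x.Ok w valid s ∧ y.Ok w valid s ∧ o.eval (x.eval s) (y.eval s) < 2 ^ w
  | get a i, s => i.Ok w valid s ∧ valid a (i.eval s)

/-- All intermediate values fit into a word and all array indices are valid. -/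
def Stmt.Ok (w : ℕ) (valid : α → ℕ → Prop) : Stmt ρ α → Store ρ α → Prop
  | set _ e, s => e.Ok w valid s
  | put a i e, s => i.Ok w valid s ∧ e.Ok w valid s ∧ valid a (i.eval s)
  | seq p q, s => p.Ok w valid s ∧ q.Ok w valid (p.den s)
  | cond c x y p, s => x.Ok w valid s ∧ y.Ok w valid s ∧
      (c.Rel (x.eval s) (y.eval s) → p.Ok w valid s)
  | loop r e p, s => e.Ok w valid s ∧ 1 < 2 ^ w ∧ e.eval s < 2 ^ w ∧ ∀ i < e.eval s,
      p.Ok w valid ((iter (fun i s' => p.den (s'.set r i)) i s).set r i)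

/-- The registers that a statement may write. -/
def Stmt.wregs : Stmt ρ α → List ρ
  | set r _ => [r]
  | put _ _ _ => []
  | seq p q => p.wregs ++ q.wregs
  | cond _ _ _ p => p.wregs
  | loop r _ p => r :: p.wregs

/-- The arrays that a statement may write. -/
def Stmt.warrs : Stmt ρ α → List α
  | set _ _ => []
  | put a _ _ => [a]
  | seq p q => p.warrs ++ q.warrs
  | cond _ _ _ p => p.warrs
  | loop _ _ p => p.warrs

/-! ### Compilation to machine code and its correctness. -/

/-- Placement of registers and of array base addresses in machine registers; the registers from
`top` on are used for intermediate values. -/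
structure Layout (ρ α : Type) : Type where
  enc : ρ → ℕ
  breg : α → ℕ
  top : ℕ
  enc_inj : Function.Injective enc
  enc_lt : ∀ r, enc r < top
  breg_lt : ∀ a, breg a < top
  enc_ne : ∀ r a, breg a ≠ enc r

/-- The machine code of an expression; the result is left in register `d`. -/
def Exp.compile (ℓ : Layout ρ α) : ℕ → Exp ρ α → Prog
  | d, reg r => .move d (ℓ.enc r)
  | d, const c => .const d c
  | d, op o x y => .seq (.seq (x.compile ℓ d) (y.compile ℓ (d + 1))) (.op o d d (d + 1))
  | d, get a i => .seq (.seq (i.compile ℓ d) (.op .add d (ℓ.breg a) d)) (.load d d)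

/-- The machine code of a statement, using the registers from `d` on for intermediate values. -/
def Stmt.compile (ℓ : Layout ρ α) : ℕ → Stmt ρ α → Prog
  | d, set r e => .seq (e.compile ℓ d) (.move (ℓ.enc r) d)
  | d, put a i e => .seq (.seq (.seq (i.compile ℓ d) (e.compile ℓ (d + 1)))
      (.op .add d (ℓ.breg a) d)) (.store d (d + 1))
  | d, seq p q => .seq (p.compile ℓ d) (q.compile ℓ d)
  | d, cond c x y p => .seq (.seq (x.compile ℓ d) (y.compile ℓ (d + 1)))
      (.ite (c.test d (d + 1)) (p.compile ℓ d) .skip)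
  | d, loop r e p => .seq (.seq (e.compile ℓ d) (.const (d + 1) 0))
      (.loop (.lt (d + 1) d) (.seq (.seq (.seq (.move (ℓ.enc r) (d + 1)) (p.compile ℓ (d + 2)))
        (.const (d + 2) 1)) (.op .add (d + 1) (d + 1) (d + 2))))

/-- The machine state `t` represents the store `s`, with arrays at the given base addresses. -/
structure Represents (ℓ : Layout ρ α) (base : α → ℕ) (valid : α → ℕ → Prop) (s : Store ρ α)
    (t : State) : Prop where
  reg : ∀ r, t.regs (ℓ.enc r) = s.reg r
  breg : ∀ a, t.regs (ℓ.breg a) = base a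
  mem : ∀ a i, valid a i → t.mem (base a + i) = s.arr a i

variable {w : ℕ} {valid : α → ℕ → Prop} {ℓ : Layout ρ α} {base : α → ℕ}

theorem Represents.congr {s : Store ρ α} {t t' : State} (h : Represents ℓ base valid s t)
    (hr : ∀ r < ℓ.top, t'.regs r = t.regs r) (hm : t'.mem = t.mem) :
    Represents ℓ base valid s t' :=
  ⟨fun r => by rw [hr _ (ℓ.enc_lt r), h.reg], fun a => by rw [hr _ (ℓ.breg_lt a), h.breg],
    fun a i hi => by rw [hm, h.mem a i hi]⟩

/-- Evaluation into register `d` never touches a register below `d` or the memory. Hence the left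
operand, kept in `d`, survives the evaluation of the right operand into `d + 1`. -/
theorem Exp.exec_compile (hbase : ∀ a i, valid a i → base a + i < 2 ^ w) (e : Exp ρ α) :
    ∀ (d : ℕ) (s : Store ρ α) (t : State), ℓ.top ≤ d → Represents ℓ base valid s t →
      e.Ok w valid s → ∃ t', Exec w (e.compile ℓ d) t e.cost t' ∧ t'.regs d = e.eval s ∧
        (∀ r < d, t'.regs r = t.regs r) ∧ t'.mem = t.mem := by
  induction e with
  | reg r =>
    intro d s t hd h _
    exact ⟨_, Exec.move t d _, by simp [State.setReg, Exp.eval, h.reg],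
      fun r hr => by simp [State.setReg, hr.ne], rfl⟩
  | const c =>
    intro d s t hd h ok
    exact ⟨_, Exec.const t d c ok, by simp [State.setReg, Exp.eval],
      fun r hr => by simp [State.setReg, hr.ne], rfl⟩
  | op o x y ihx ihy =>
    intro d s t hd h ok
    obtain ⟨okx, oky, hlt⟩ := ok
    obtain ⟨t₁, ex, hx, fx, mx⟩ := ihx d s t hd h okx
    have h₁ : Represents ℓ base valid s t₁ := h.congr (fun r hr => fx r (by omega)) mx
    obtain ⟨t₂, ey, hy, fy, my⟩ := ihy (d + 1) s t₁ (by omega) h₁ oky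
    have hd2 : t₂.regs d = x.eval s := by rw [fy d (by omega), hx]
    refine ⟨_, Exec.seq (Exec.seq ex ey) (Exec.op t₂ o d d (d + 1) ?_), ?_, ?_, ?_⟩
    · rw [hd2, hy]; exact hlt
    · simp [State.setReg, hd2, hy, Exp.eval]
    · intro r hr
      simp only [State.setReg, Function.update_of_ne hr.ne]
      rw [fy r (by omega), fx r hr]
    · simp [State.setReg, my, mx]
  | get a i ih =>
    intro d s t hd h ok
    obtain ⟨oki, hv⟩ := ok
    obtain ⟨t₁, ei, hi, fi, mi⟩ := ih d s t hd h oki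
    have hb : t₁.regs (ℓ.breg a) = base a := by
      rw [fi _ (lt_of_lt_of_le (ℓ.breg_lt a) hd), h.breg]
    have hlt : BinOp.add.eval (t₁.regs (ℓ.breg a)) (t₁.regs d) < 2 ^ w := by
      rw [hb, hi]; exact hbase a _ hv
    have ex := Exec.seq (Exec.seq ei (Exec.op t₁ .add d _ d hlt)) (Exec.load _ d d)
    refine ⟨_, ex, ?_, ?_, ?_⟩
    · simp [State.setReg, BinOp.eval, hb, hi, mi, h.mem a _ hv, Exp.eval]
    · intro r hr
      simp [State.setReg, Function.update_of_ne hr.ne, fi r hr]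
    · simp [State.setReg, mi]

/-- A simulation with exactly `p.cost s` machine steps. Disjointness is demanded only for arrays
that are written, so arrays that are merely read may overlap; the query needs this, as its two
labels may be the same one. The last clause protects the counters of enclosing loops, which live in
registers between `ℓ.top` and `d`. -/
theorem Stmt.exec_compile (hbase : ∀ a i, valid a i → base a + i < 2 ^ w) (p : Stmt ρ α)
    (hdis : ∀ a ∈ p.warrs, ∀ a' i i', valid a i → valid a' i' → base a' + i' = base a + i →
      a' = a ∧ i' = i) :
    ∀ (d : ℕ) (s : Store ρ α) (t : State), ℓ.top ≤ d → Represents ℓ base valid s t →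
      p.Ok w valid s → ∃ t', Exec w (p.compile ℓ d) t (p.cost s) t' ∧
        Represents ℓ base valid (p.den s) t' ∧ ∀ r < d, ℓ.top ≤ r → t'.regs r = t.regs r := by
  induction p with
  | set r e =>
    intro d s t hd h ok
    obtain ⟨t₁, ee, he, fe, me⟩ := e.exec_compile hbase d s t hd h ok
    refine ⟨_, Exec.seq ee (Exec.move _ _ _), ⟨?_, ?_, ?_⟩, ?_⟩
    · intro r'
      by_cases hr : r' = r
      · subst hr; simp [State.setReg, Stmt.den, he]
      · have := ℓ.enc_inj.ne hr
        simp [State.setReg, Stmt.den, hr, Function.update_of_ne this,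
          fe _ (lt_of_lt_of_le (ℓ.enc_lt r') hd), h.reg]
    · intro a
      simp [State.setReg, Function.update_of_ne (ℓ.enc_ne r a),
        fe _ (lt_of_lt_of_le (ℓ.breg_lt a) hd), h.breg]
    · intro a i hi
      simp [State.setReg, Stmt.den, me, h.mem a i hi]
    · intro r' hr' htop
      have : r' ≠ ℓ.enc r := by have := ℓ.enc_lt r; omega
      simp [State.setReg, Function.update_of_ne this, fe r' hr']
  | put a i e =>
    intro d s t hd h ok
    obtain ⟨oki, oke, hv⟩ := ok
    obtain ⟨t₁, ei, hi, fi, mi⟩ := i.exec_compile hbase d s t hd h oki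
    have h₁ : Represents ℓ base valid s t₁ := h.congr (fun r hr => fi r (by omega)) mi
    obtain ⟨t₂, ee, he, fe, me⟩ := e.exec_compile hbase (d + 1) s t₁ (by omega) h₁ oke
    have hb : t₂.regs (ℓ.breg a) = base a := by
      have := ℓ.breg_lt a
      rw [fe _ (by omega), fi _ (by omega), h.breg]
    have hd2 : t₂.regs d = i.eval s := by rw [fe d (by omega), hi]
    have hlt : BinOp.add.eval (t₂.regs (ℓ.breg a)) (t₂.regs d) < 2 ^ w := by
      rw [hb, hd2]; exact hbase a _ hv
    have ex := Exec.seq (Exec.seq (Exec.seq ei ee) (Exec.op t₂ .add d _ d hlt))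
      (Exec.store _ d (d + 1))
    refine ⟨_, ex, ⟨?_, ?_, ?_⟩, ?_⟩
    · intro r
      have := ℓ.enc_lt r
      have hne : ℓ.enc r ≠ d := by omega
      simp [State.setReg, State.setMem, Stmt.den, Function.update_of_ne hne, fe _ (show ℓ.enc r < d + 1 by omega),
        fi _ (show ℓ.enc r < d by omega), h.reg]
    · intro a'
      have := ℓ.breg_lt a'
      have hne : ℓ.breg a' ≠ d := by omega
      simp [State.setReg, State.setMem, Function.update_of_ne hne, fe _ (show ℓ.breg a' < d + 1 by omega),
        fi _ (show ℓ.breg a' < d by omega), h.breg]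
    · intro a' i' hi'
      simp only [State.setReg, State.setMem, Stmt.den, BinOp.eval, Function.update_self, hb, hd2,
        Store.put_arr]
      rw [Function.update_of_ne (show d + 1 ≠ d by omega), he]
      by_cases hc : a' = a ∧ i' = i.eval s
      · rw [if_pos hc, hc.1, hc.2, Function.update_self]
      · rw [if_neg hc, Function.update_of_ne, me, mi, h.mem a' i' hi']
        intro heq
        exact hc (hdis a (by simp [Stmt.warrs]) a' _ _ hv hi' heq)
    · intro r' hr' htop
      simp [State.setReg, State.setMem, Function.update_of_ne hr'.ne, fe _ (show r' < d + 1 by omega), fi _ hr']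
  | seq p q ihp ihq =>
    intro d s t hd h ok
    obtain ⟨t₁, ep, hp, fp⟩ := ihp (fun a ha => hdis a (by simp [Stmt.warrs, ha])) d s t hd h ok.1
    obtain ⟨t₂, eq, hq, fq⟩ :=
      ihq (fun a ha => hdis a (by simp [Stmt.warrs, ha])) d _ t₁ hd hp ok.2
    exact ⟨t₂, Exec.seq ep eq, hq, fun r hr ht => by rw [fq r hr ht, fp r hr ht]⟩
  | cond c x y p ihp =>
    intro d s t hd h ok
    obtain ⟨okx, oky, okp⟩ := ok
    obtain ⟨t₁, ex, hx, fx, mx⟩ := x.exec_compile hbase d s t hd h okx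
    have h₁ : Represents ℓ base valid s t₁ := h.congr (fun r hr => fx r (by omega)) mx
    obtain ⟨t₂, ey, hy, fy, my⟩ := y.exec_compile hbase (d + 1) s t₁ (by omega) h₁ oky
    have h₂ : Represents ℓ base valid s t₂ := h₁.congr (fun r hr => fy r (by omega)) my
    have hd2 : t₂.regs d = x.eval s := by rw [fy d (by omega), hx]
    have htest : (c.test d (d + 1)).Holds t₂.regs ↔ c.Rel (x.eval s) (y.eval s) := by
      rw [Cmp.test_holds, hd2, hy]
    by_cases hc : c.Rel (x.eval s) (y.eval s)
    · obtain ⟨t₃, ep, hp, fp⟩ := ihp hdis d s t₂ hd h₂ (okp hc)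
      have := Exec.seq (Exec.seq ex ey) (Exec.iteTrue (q := Prog.skip) (htest.2 hc) ep)
      refine ⟨t₃, ?_, ?_, ?_⟩
      · simp only [Stmt.compile, Stmt.cost, if_pos hc]
        convert this using 1
        omega
      · simpa only [Stmt.den, if_pos hc] using hp
      · intro r hr ht
        rw [fp r hr ht, fy r (by omega), fx r hr]
    · have := Exec.seq (Exec.seq ex ey)
        (Exec.iteFalse (p := p.compile ℓ d) (fun h => hc (htest.1 h)) (Exec.skip t₂))
      refine ⟨t₂, ?_, ?_, ?_⟩
      · simp only [Stmt.compile, Stmt.cost, if_neg hc]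
        convert this using 1
      · simpa only [Stmt.den, if_neg hc] using h₂
      · intro r hr ht
        rw [fy r (by omega), fx r hr]
  | loop r e p ihp =>
    intro d s t hd h ok
    obtain ⟨oke, h1, hlt, okp⟩ := ok
    obtain ⟨t₁, ee, he, fe, me⟩ := e.exec_compile hbase d s t hd h oke
    set N := e.eval s with hN
    set f := fun i (s' : Store ρ α) => p.den (s'.set r i) with hf
    set t₂ := t₁.setReg (d + 1) 0 with ht₂
    have h₂ : Represents ℓ base valid s t₂ := by
      refine h.congr (fun r hr => ?_) me
      rw [ht₂]
      simp only [State.setReg]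
      rw [Function.update_of_ne (by omega), fe r (by omega)]
    -- Induction on the number `m` of remaining rounds. The true counter is in register `d + 1` and
    -- only a copy of it goes to `r`, so a body that overwrites `r` cannot change the number of
    -- rounds.
    have main : ∀ (m i : ℕ) (u : State), i + m = N → Represents ℓ base valid (iter f i s) u →
        u.regs d = N → u.regs (d + 1) = i →
        ∃ u', Exec w (.loop (.lt (d + 1) d) (.seq (.seq (.seq (.move (ℓ.enc r) (d + 1))
          (p.compile ℓ (d + 2))) (.const (d + 2) 1)) (.op .add (d + 1) (d + 1) (d + 2)))) u
          (1 + ∑ j ∈ Finset.range m, (p.cost ((iter f (i + j) s).set r (i + j)) + 4)) u' ∧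
          Represents ℓ base valid (iter f N s) u' ∧
          ∀ r < d, ℓ.top ≤ r → u'.regs r = u.regs r := by
      intro m
      induction m with
      | zero =>
        intro i u him hu hud hui
        have : i = N := by omega
        subst this
        refine ⟨u, ?_, hu, fun _ _ _ => rfl⟩
        simpa using Exec.loopStop (w := w) (b := .lt (d + 1) d) (s := u)
          (by simp [Test.Holds, hud, hui])
      | succ m ih =>
        intro i u him hu hud hui
        have hu1 : Represents ℓ base valid ((iter f i s).set r i)
            (u.setReg (ℓ.enc r) (u.regs (d + 1))) := by
          refine ⟨?_, ?_, ?_⟩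
          · intro r'
            by_cases hr : r' = r
            · subst hr; simp [State.setReg, hui]
            · simp [State.setReg, hr, Function.update_of_ne (ℓ.enc_inj.ne hr), hu.reg]
          · intro a
            simp [State.setReg, Function.update_of_ne (ℓ.enc_ne r a), hu.breg]
          · intro a i hi
            simp [State.setReg, hu.mem a i hi]
        obtain ⟨u₂, ep, hu₂, fu₂⟩ :=
          ihp hdis (d + 2) _ _ (by omega) hu1 (okp i (by omega))
        have henc : ∀ x, ℓ.top ≤ x → x ≠ ℓ.enc r := fun x hx => by have := ℓ.enc_lt r; omega
        have hd₂ : u₂.regs d = N := by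
          rw [fu₂ d (by omega) hd]
          simp [State.setReg, Function.update_of_ne (henc d hd), hud]
        have hd₂' : u₂.regs (d + 1) = i := by
          rw [fu₂ (d + 1) (by omega) (by omega)]
          simp [State.setReg, Function.update_of_ne (henc (d + 1) (by omega)), hui]
        have e3 := Exec.const (w := w) u₂ (d + 2) 1 h1
        have e4 := Exec.op (w := w) (u₂.setReg (d + 2) 1) .add (d + 1) (d + 1) (d + 2) (by
          simp [State.setReg, BinOp.eval, hd₂']; omega)
        set u₄ := (u₂.setReg (d + 2) 1).setReg (d + 1) (BinOp.add.eval
          ((u₂.setReg (d + 2) 1).regs (d + 1)) ((u₂.setReg (d + 2) 1).regs (d + 2))) with hu₄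
        have hreg4 : ∀ x ≤ d, u₄.regs x = u₂.regs x := by
          intro x hx
          simp only [hu₄, State.setReg]
          rw [Function.update_of_ne (by omega), Function.update_of_ne (by omega)]
        have hd4 : u₄.regs (d + 1) = i + 1 := by
          simp [hu₄, State.setReg, BinOp.eval, hd₂']
        obtain ⟨u', el, hu', fu'⟩ := ih (i + 1) u₄ (by omega)
          (by
            refine hu₂.congr (fun x hx => hreg4 x (by omega)) rfl)
          (by rw [hreg4 d le_rfl, hd₂]) hd4
        refine ⟨u', ?_, hu', ?_⟩
        · have := Exec.loopStep (b := .lt (d + 1) d) (by simp [Test.Holds, hud, hui]; omega)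
            (Exec.seq (Exec.seq (Exec.seq (Exec.move u (ℓ.enc r) (d + 1)) ep) e3) e4) el
          convert this using 1
          rw [Finset.sum_range_succ', Finset.sum_congr rfl
            (fun j _ => by rw [show i + (j + 1) = i + 1 + j by omega])]
          simp only [Nat.add_zero]
          omega
        · intro x hx ht
          rw [fu' x hx ht, hreg4 x hx.le, fu₂ x (by omega) ht]
          simp [State.setReg, Function.update_of_ne (henc x ht)]
    obtain ⟨u', eu, hu', fu'⟩ := main N 0 t₂ (by omega) h₂
      (by simp [ht₂, State.setReg, he]) (by simp [ht₂, State.setReg])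
    simp only [zero_add] at eu
    refine ⟨u', ?_, hu', ?_⟩
    · have := Exec.seq (Exec.seq ee (Exec.const t₁ (d + 1) 0 (by positivity))) eu
      convert this using 1
      · rfl
      · change e.cost + 2 + ∑ x ∈ Finset.range N, (p.cost ((iter f x s).set r x) + 4) = _
        omega
    · intro x hx ht
      rw [fu' x hx ht, ht₂]
      simp only [State.setReg]
      rw [Function.update_of_ne (by omega), fe x hx]

/-! ### Frames -/

theorem iter_ind {σ : Type} {f : ℕ → σ → σ} {s : σ} {N : ℕ} (I : ℕ → σ → Prop) (h0 : I 0 s)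
    (hs : ∀ i < N, ∀ s', I i s' → I (i + 1) (f i s')) : ∀ i ≤ N, I i (iter f i s) := by
  intro i
  induction i with
  | zero => exact fun _ => h0
  | succ i ih => exact fun hi => hs i (by omega) _ (ih (by omega))

/-- `s'` differs from `s` only in registers and arrays that `p` writes. -/
structure Stmt.Frame (p : Stmt ρ α) (s s' : Store ρ α) : Prop where
  reg : ∀ r, r ∉ p.wregs → s'.reg r = s.reg r
  arr : ∀ a, a ∉ p.warrs → s'.arr a = s.arr a

theorem Stmt.frame_den (p : Stmt ρ α) : ∀ s, p.Frame s (p.den s) := by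
  induction p with
  | set r e =>
    intro s
    refine ⟨fun r' hr => ?_, fun a _ => rfl⟩
    simp only [Stmt.wregs, List.mem_singleton] at hr
    simp [Stmt.den, hr]
  | put a i e =>
    intro s
    refine ⟨fun r' hr => rfl, fun a' ha => ?_⟩
    simp only [Stmt.warrs, List.mem_singleton] at ha
    funext i'
    simp [Stmt.den, ha]
  | seq p q ihp ihq =>
    intro s
    refine ⟨fun r hr => ?_, fun a ha => ?_⟩
    · simp only [Stmt.wregs, List.mem_append, not_or] at hr
      rw [Stmt.den, (ihq _).reg r hr.2, (ihp s).reg r hr.1]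
    · simp only [Stmt.warrs, List.mem_append, not_or] at ha
      rw [Stmt.den, (ihq _).arr a ha.2, (ihp s).arr a ha.1]
  | cond c x y p ihp =>
    intro s
    simp only [Stmt.den]
    split_ifs
    · exact ⟨(ihp s).reg, (ihp s).arr⟩
    · exact ⟨fun _ _ => rfl, fun _ _ => rfl⟩
  | loop r e p ihp =>
    intro s
    refine iter_ind (N := e.eval s) (fun _ s' => (Stmt.loop r e p).Frame s s')
      ⟨fun _ _ => rfl, fun _ _ => rfl⟩ (fun i _ s' h => ⟨fun r' hr => ?_, fun a ha => ?_⟩) _ le_rfl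
    · have hr' := hr
      simp only [Stmt.wregs, List.mem_cons, not_or] at hr'
      rw [(ihp _).reg r' hr'.2, Store.set_reg, if_neg hr'.1, h.reg r' hr]
    · rw [(ihp _).arr a ha, Store.set_arr, h.arr a ha]

end WordRAM

/-! ### Safety from bounded growth, and rules for running statements -/

namespace WordRAM

variable {ρ α : Type} [DecidableEq ρ] [DecidableEq α]

/-- An expression whose value is at most any common bound for constants, registers and arrays. -/
def Exp.flat : Exp ρ α → Bool
  | reg _ => true
  | const c => c ≤ 8
  | get _ _ => true
  | op .sub x _ => x.flat
  | op .div x _ => x.flat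
  | op .mod x _ => x.flat
  | op _ _ _ => false

/-- An expression whose value exceeds a common bound for registers and arrays by at most `8`. -/
def Exp.slow : Exp ρ α → Bool
  | op .add x (const c) => x.flat && c ≤ 8
  | x => x.flat

/-- All values in the evaluation from a store with entries at most `V` are at most `V ^ deg`. -/
def Exp.deg : Exp ρ α → ℕ
  | reg _ => 1
  | const c => if c ≤ 8 then 1 else 100
  | op .mul x y => x.deg + y.deg
  | op _ x y => max x.deg y.deg + 1
  | get _ i => i.deg

/-- All expressions are of degree at most `D`, and loop bounds are flat. -/
def Stmt.fine (D : ℕ) : Stmt ρ α → Bool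
  | set _ e => e.deg ≤ D
  | put _ i e => i.deg ≤ D && e.deg ≤ D
  | seq p q => p.fine D && q.fine D
  | cond _ x y p => x.deg ≤ D && y.deg ≤ D && p.fine D
  | loop _ e p => e.deg ≤ D && e.flat && p.fine D

/-- Obligations left to the verification of a program: stored values that may grow fast have to be
at most `bound`, and array indices have to be valid. -/
structure Guard (α : Type) : Type where
  bound : ℕ
  valid : α → ℕ → Prop

/-- No obligation for array indices. -/
def Guard.free (α : Type) (M : ℕ) : Guard α := ⟨M, fun _ _ => True⟩

/-- Array indices are valid. -/
def Exp.Safe (Γ : Guard α) : Exp ρ α → Store ρ α → Prop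
  | reg _, _ => True
  | const _, _ => True
  | op _ x y, s => x.Safe Γ s ∧ y.Safe Γ s
  | get a i, s => i.Safe Γ s ∧ Γ.valid a (i.eval s)

/-- The obligations of `Guard` for a statement. -/
def Stmt.Safe (Γ : Guard α) : Stmt ρ α → Store ρ α → Prop
  | set _ e, s => e.Safe Γ s ∧ (e.slow = true ∨ e.eval s ≤ Γ.bound)
  | put a i e, s => i.Safe Γ s ∧ e.Safe Γ s ∧ Γ.valid a (i.eval s) ∧
      (e.slow = true ∨ e.eval s ≤ Γ.bound)
  | seq p q, s => p.Safe Γ s ∧ q.Safe Γ (p.den s)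
  | cond c x y p, s => x.Safe Γ s ∧ y.Safe Γ s ∧ (c.Rel (x.eval s) (y.eval s) → p.Safe Γ s)
  | loop r e p, s => e.Safe Γ s ∧ ∀ i < e.eval s,
      p.Safe Γ ((iter (fun i s' => p.den (s'.set r i)) i s).set r i)

/-- All registers and array entries are at most `V`. -/
def Store.Bdd (s : Store ρ α) (V : ℕ) : Prop := (∀ r, s.reg r ≤ V) ∧ ∀ a i, s.arr a i ≤ V

theorem Store.Bdd.mono {s : Store ρ α} {V V' : ℕ} (h : s.Bdd V) (hV : V ≤ V') : s.Bdd V' :=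
  ⟨fun r => (h.1 r).trans hV, fun a i => (h.2 a i).trans hV⟩

theorem Store.Bdd.set {s : Store ρ α} {V : ℕ} (h : s.Bdd V) (r : ρ) {x : ℕ} (hx : x ≤ V) :
    (s.set r x).Bdd V := by
  refine ⟨fun r' => ?_, h.2⟩
  rw [Store.set_reg]
  split_ifs
  exacts [hx, h.1 r']

theorem Store.Bdd.put {s : Store ρ α} {V : ℕ} (h : s.Bdd V) (a : α) (i : ℕ) {x : ℕ} (hx : x ≤ V) :
    (s.put a i x).Bdd V := by
  refine ⟨h.1, fun a' i' => ?_⟩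
  rw [Store.put_arr]
  split_ifs
  exacts [hx, h.2 a' i']

theorem Exp.eval_le_of_flat {s : Store ρ α} {V : ℕ} (h : s.Bdd V) (hV : 8 ≤ V) (e : Exp ρ α)
    (he : e.flat = true) : e.eval s ≤ V := by
  induction e with
  | reg r => exact h.1 r
  | const c => simp [Exp.flat] at he; simp [Exp.eval]; omega
  | get a i _ => exact h.2 a _
  | op o x y ihx _ =>
    cases o
    · simp [Exp.flat] at he
    · exact (Nat.sub_le _ _).trans (ihx he)
    · simp [Exp.flat] at he
    · exact (Nat.div_le_self _ _).trans (ihx he)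
    · exact (Nat.mod_le _ _).trans (ihx he)

theorem Exp.eval_le_of_slow {s : Store ρ α} {V : ℕ} (h : s.Bdd V) (hV : 8 ≤ V) (e : Exp ρ α)
    (he : e.slow = true) : e.eval s ≤ V + 8 := by
  have key : e.flat = true → e.eval s ≤ V + 8 := fun hf =>
    (e.eval_le_of_flat h hV hf).trans (Nat.le_add_right _ _)
  match e, he, key with
  | op .add x (const c), he, _ =>
    simp only [Exp.slow, Bool.and_eq_true, decide_eq_true_eq] at he
    have := x.eval_le_of_flat h hV he.1
    simp only [Exp.eval, BinOp.eval]
    omega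
  | reg _, he, key => exact key he
  | const _, he, key => exact key he
  | get _ _, he, key => exact key he
  | op .sub _ _, he, key => exact key he
  | op .mul _ _, he, key => exact key he
  | op .div _ _, he, key => exact key he
  | op .mod _ _, he, key => exact key he
  | op .add _ (reg _), he, key => exact key he
  | op .add _ (get _ _), he, key => exact key he
  | op .add _ (op _ _ _), he, key => exact key he

theorem Exp.deg_pos (e : Exp ρ α) : 1 ≤ e.deg := by
  induction e with
  | reg => simp [Exp.deg]
  | const c => simp only [Exp.deg]; split_ifs <;> omega
  | get a i ih => exact ih
  | op o x y ihx ihy => cases o <;> simp only [Exp.deg] <;> omega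

theorem Exp.eval_le_pow {s : Store ρ α} {V : ℕ} (h : s.Bdd V) (hV : 8 ≤ V) (e : Exp ρ α)
    (he : e.deg < 100) : e.eval s ≤ V ^ e.deg := by
  induction e with
  | reg r => simpa [Exp.deg, Exp.eval] using h.1 r
  | const c =>
    by_cases hc : c ≤ 8
    · simp [Exp.deg, Exp.eval, hc]; omega
    · simp [Exp.deg, hc] at he
  | get a i _ =>
    exact (h.2 a _).trans (Nat.le_self_pow (by have := Exp.deg_pos (Exp.get (ρ := ρ) a i); omega) V)
  | op o x y ihx ihy =>
    have mono : ∀ {a b : ℕ}, a ≤ b → V ^ a ≤ V ^ b := fun hab => Nat.pow_le_pow_right (by omega) hab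
    have hle : ∀ {a b c : ℕ}, c ≤ V ^ a → a ≤ b → c ≤ V ^ (b + 1) := fun h1 h2 =>
      h1.trans (mono (by omega))
    cases o <;> simp only [Exp.deg] at he ⊢ <;> simp only [Exp.eval, BinOp.eval] <;>
      have hx := ihx (by omega) <;> have hy := ihy (by omega)
    · have h1 := hx.trans (mono (le_max_left x.deg y.deg))
      have h2 := hy.trans (mono (le_max_right x.deg y.deg))
      rw [pow_succ]
      -- A sum is at most twice the larger power; as `2 ≤ V`, this is paid for by the additional
      -- degree of `deg`.
      have := Nat.mul_le_mul_left (V ^ max x.deg y.deg) (show 2 ≤ V by omega)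
      omega
    · exact (Nat.sub_le _ _).trans (hle hx (le_max_left _ _))
    · rw [pow_add]; exact Nat.mul_le_mul hx hy
    · exact (Nat.div_le_self _ _).trans (hle hx (le_max_left _ _))
    · exact (Nat.mod_le _ _).trans (hle hx (le_max_left _ _))

theorem Exp.ok_of_safe {s : Store ρ α} {V w D : ℕ} {Γ : Guard α} {valid : α → ℕ → Prop}
    (h : s.Bdd V) (hV : 8 ≤ V) (hD : D < 100) (hw : V ^ D < 2 ^ w)
    (hval : ∀ a i, Γ.valid a i → i ≤ V ^ D → valid a i) (e : Exp ρ α) (he : e.deg ≤ D)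
    (hs : e.Safe Γ s) : e.Ok w valid s := by
  have mono : ∀ {a b : ℕ}, a ≤ b → V ^ a ≤ V ^ b := fun hab => Nat.pow_le_pow_right (by omega) hab
  have hval' : ∀ x : Exp ρ α, x.deg ≤ D → x.eval s ≤ V ^ D := fun x hx =>
    (x.eval_le_pow h hV (by omega)).trans (mono hx)
  induction e with
  | reg r => trivial
  | const c => exact (hval' _ he).trans_lt hw
  | get a i ih => exact ⟨ih he hs.1, hval a _ hs.2 (hval' i he)⟩
  | op o x y ihx ihy =>
    have hx := x.deg_pos
    have hy := y.deg_pos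
    have hxy : x.deg ≤ D ∧ y.deg ≤ D := by
      cases o <;> simp only [Exp.deg] at he <;> omega
    exact ⟨ihx hxy.1 hs.1, ihy hxy.2 hs.2, (hval' _ he).trans_lt hw⟩

/-- Every write costs at least one step and raises the common bound by at most 8, or stores a value
below `Γ.bound`. So all contents are at most `V + 8 * p.cost s` at the end, and intermediate values
are at most the `D`-th power of `V'`. This frees the verification of the programs from overflow,
except for the few values covered by `Guard`. -/
theorem Stmt.ok_of_safe {V' w D : ℕ} {Γ : Guard α} {valid : α → ℕ → Prop}
    (hD : D < 100) (h1D : 1 ≤ D) (hw : V' ^ D < 2 ^ w)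
    (hval : ∀ a i, Γ.valid a i → i ≤ V' ^ D → valid a i) (p : Stmt ρ α) (hp : p.fine D = true) :
    ∀ (s : Store ρ α) (V : ℕ), 8 ≤ V → Γ.bound ≤ V → s.Bdd V → p.Safe Γ s →
      V + 8 * p.cost s ≤ V' → p.Ok w valid s ∧ (p.den s).Bdd (V + 8 * p.cost s) := by
  have hexp : ∀ (s : Store ρ α) (e : Exp ρ α) (V : ℕ), 8 ≤ V → s.Bdd V → V ≤ V' → e.deg ≤ D →
      e.Safe Γ s → e.Ok w valid s := fun s e V hV hb hle he hs =>
    e.ok_of_safe (hb.mono hle) (by omega) hD hw hval he hs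
  have hslow : ∀ (s : Store ρ α) (e : Exp ρ α) (V : ℕ), 8 ≤ V → Γ.bound ≤ V → s.Bdd V →
      (e.slow = true ∨ e.eval s ≤ Γ.bound) → e.eval s ≤ V + 8 := by
    rintro s e V hV hM hb (h | h)
    · exact e.eval_le_of_slow hb hV h
    · omega
  induction p with
  | set r e =>
    intro s V hV hM hb hs hc
    simp only [Stmt.fine, decide_eq_true_eq] at hp
    simp only [Stmt.cost] at hc ⊢
    refine ⟨hexp s e V hV hb (by omega) hp hs.1, ?_⟩
    exact (hb.mono (by omega)).set r ((hslow s e V hV hM hb hs.2).trans (by omega))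
  | put a i e =>
    intro s V hV hM hb hs hc
    simp only [Stmt.fine, Bool.and_eq_true, decide_eq_true_eq] at hp
    simp only [Stmt.cost] at hc ⊢
    refine ⟨⟨hexp s i V hV hb (by omega) hp.1 hs.1, hexp s e V hV hb (by omega) hp.2 hs.2.1,
      hval a _ hs.2.2.1 ?_⟩, ?_⟩
    · refine (i.eval_le_pow (hb.mono (show V ≤ V' by omega)) (by omega) (by omega)).trans
        (Nat.pow_le_pow_right (by omega) hp.1)
    · exact (hb.mono (by omega)).put a _ ((hslow s e V hV hM hb hs.2.2.2).trans (by omega))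
  | seq p q ihp ihq =>
    intro s V hV hM hb hs hc
    simp only [Stmt.fine, Bool.and_eq_true] at hp
    simp only [Stmt.cost] at hc ⊢
    obtain ⟨h1, h2⟩ := ihp hp.1 s V hV hM hb hs.1 (by omega)
    obtain ⟨h3, h4⟩ := ihq hp.2 _ (V + 8 * p.cost s) (by omega) (by omega) h2 hs.2 (by omega)
    exact ⟨⟨h1, h3⟩, h4.mono (by omega)⟩
  | cond c x y p ihp =>
    intro s V hV hM hb hs hc
    simp only [Stmt.fine, Bool.and_eq_true, decide_eq_true_eq] at hp
    simp only [Stmt.cost] at hc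
    have hx := hexp s x V hV hb (by omega) hp.1.1 hs.1
    have hy := hexp s y V hV hb (by omega) hp.1.2 hs.2.1
    by_cases h : c.Rel (x.eval s) (y.eval s)
    · rw [if_pos h] at hc
      obtain ⟨h1, h2⟩ := ihp hp.2 s V hV hM hb (hs.2.2 h) (by omega)
      refine ⟨⟨hx, hy, fun _ => h1⟩, ?_⟩
      simp only [Stmt.den, Stmt.cost, if_pos h]
      exact h2.mono (by omega)
    · refine ⟨⟨hx, hy, fun h' => absurd h' h⟩, ?_⟩
      simp only [Stmt.den, if_neg h]
      exact hb.mono (by omega)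
  | loop r e p ihp =>
    intro s V hV hM hb hs hc
    simp only [Stmt.fine, Bool.and_eq_true, decide_eq_true_eq] at hp
    simp only [Stmt.cost] at hc ⊢
    simp only [Stmt.den]
    set f := fun i (s' : Store ρ α) => p.den (s'.set r i) with hf
    set N := e.eval s with hN
    -- This is why loop bounds have to be flat: the loop register then never exceeds the bound that
    -- already holds on entry.
    have hNV : N ≤ V := e.eval_le_of_flat hb hV hp.1.2
    set c : ℕ → ℕ := fun m => ∑ i ∈ Finset.range m, (p.cost ((iter f i s).set r i) + 4) with hcdef
    have hcs : ∀ m, c (m + 1) = c m + (p.cost ((iter f m s).set r m) + 4) := fun m =>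
      Finset.sum_range_succ _ _
    have hcm : ∀ m ≤ N, c m ≤ c N := fun m hm =>
      Finset.sum_le_sum_of_subset (Finset.range_mono hm)
    have hcN : e.cost + 2 + c N ≤ e.cost + 2 + c N := le_rfl
    have hc' : V + 8 * (e.cost + 2 + c N) ≤ V' := hc
    have step : ∀ m < N, (iter f m s).Bdd (V + 8 * c m) →
        p.Ok w valid ((iter f m s).set r m) ∧ (iter f (m + 1) s).Bdd (V + 8 * c (m + 1)) := by
      intro m hm hbm
      have h1 := hcs m
      have h2 := hcm (m + 1) hm
      obtain ⟨h3, h4⟩ := ihp hp.2 ((iter f m s).set r m) (V + 8 * c m) (by omega) (by omega)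
        (hbm.set r (by omega)) (hs.2 m hm) (by omega)
      exact ⟨h3, h4.mono (by omega)⟩
    have hall : ∀ m ≤ N, (iter f m s).Bdd (V + 8 * c m) := by
      intro m
      induction m with
      | zero => intro _; exact hb.mono (by omega)
      | succ m ih => intro hm; exact (step m (by omega) (ih (by omega))).2
    have hwV : V' < 2 ^ w := (Nat.le_self_pow (by omega) V').trans_lt hw
    refine ⟨⟨hexp s e V hV hb (by omega) hp.1.1 hs.1, by omega, by omega,
      fun i hi => (step i hi (hall i hi.le)).1⟩, (hall N le_rfl).mono ?_⟩
    change V + 8 * c N ≤ V + 8 * (e.cost + 2 + c N)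
    omega

/-! ### Proof rules for safety, cost and effect of statements. -/

/-- Started in `s`, the statement meets its obligations, takes at most `c` steps, and ends in a
store with the property `Q`. -/
def Stmt.Runs (Γ : Guard α) (p : Stmt ρ α) (s : Store ρ α) (c : ℕ) (Q : Store ρ α → Prop) : Prop :=
  p.Safe Γ s ∧ p.cost s ≤ c ∧ Q (p.den s)

theorem Exp.safe_free {M : ℕ} (e : Exp ρ α) (s : Store ρ α) : e.Safe (Guard.free α M) s := by
  induction e with
  | reg => trivial
  | const => trivial
  | op o x y ihx ihy => exact ⟨ihx, ihy⟩
  | get a i ih => exact ⟨ih, trivial⟩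

/-- No stored value grows fast. -/
def Stmt.slow : Stmt ρ α → Bool
  | set _ e => e.slow
  | put _ _ e => e.slow
  | seq p q => p.slow && q.slow
  | cond _ _ _ p => p.slow
  | loop _ _ p => p.slow

/-- There are no loops. -/
def Stmt.straight : Stmt ρ α → Bool
  | set _ _ => true
  | put _ _ _ => true
  | seq p q => p.straight && q.straight
  | cond _ _ _ p => p.straight
  | loop _ _ _ => false

/-- An upper bound for the number of steps of a statement without loops. -/
def Stmt.maxCost : Stmt ρ α → ℕ
  | set _ e => e.cost + 1
  | put _ i e => i.cost + e.cost + 2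
  | seq p q => p.maxCost + q.maxCost
  | cond _ x y p => x.cost + y.cost + 1 + (p.maxCost + 1)
  | loop _ _ _ => 0

theorem Stmt.safe_of_slow {M : ℕ} (p : Stmt ρ α) (hp : p.slow = true) :
    ∀ s, p.Safe (Guard.free α M) s := by
  induction p with
  | set r e => exact fun s => ⟨e.safe_free s, Or.inl hp⟩
  | put a i e => exact fun s => ⟨i.safe_free s, e.safe_free s, trivial, Or.inl hp⟩
  | seq p q ihp ihq =>
    simp only [Stmt.slow, Bool.and_eq_true] at hp
    exact fun s => ⟨ihp hp.1 s, ihq hp.2 _⟩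
  | cond c x y p ihp => exact fun s => ⟨x.safe_free s, y.safe_free s, fun _ => ihp hp s⟩
  | loop r e p ihp => exact fun s => ⟨e.safe_free s, fun i _ => ihp hp _⟩

theorem Stmt.cost_le_maxCost (p : Stmt ρ α) (hp : p.straight = true) :
    ∀ s, p.cost s ≤ p.maxCost := by
  induction p with
  | set r e => exact fun s => le_rfl
  | put a i e => exact fun s => le_rfl
  | seq p q ihp ihq =>
    simp only [Stmt.straight, Bool.and_eq_true] at hp
    exact fun s => Nat.add_le_add (ihp hp.1 s) (ihq hp.2 _)
  | cond c x y p ihp =>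
    intro s
    have := ihp hp s
    simp only [Stmt.cost, Stmt.maxCost]
    split_ifs <;> omega
  | loop r e p ihp => simp [Stmt.straight] at hp

namespace Stmt.Runs

variable {Γ : Guard α} {M : ℕ} {p q : Stmt ρ α} {s : Store ρ α} {c c' : ℕ} {Q Q' : Store ρ α → Prop}

theorem mono (h : p.Runs Γ s c Q) (hc : c ≤ c') (hQ : ∀ s', p.Frame s s' → Q s' → Q' s') :
    p.Runs Γ s c' Q' := ⟨h.1, h.2.1.trans hc, hQ _ (p.frame_den s) h.2.2⟩

theorem straight (h1 : p.slow = true) (h2 : p.straight = true) (hc : p.maxCost ≤ c)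
    (hQ : Q (p.den s)) : p.Runs (Guard.free α M) s c Q :=
  ⟨p.safe_of_slow h1 s, (p.cost_le_maxCost h2 s).trans hc, hQ⟩

theorem seq {c₁ c₂ : ℕ} (hp : p.Runs Γ s c₁ Q')
    (hq : ∀ s', p.Frame s s' → Q' s' → q.Runs Γ s' c₂ Q) : (p.seq q).Runs Γ s (c₁ + c₂) Q := by
  obtain ⟨h1, h2, h3⟩ := hp
  obtain ⟨h4, h5, h6⟩ := hq _ (p.frame_den s) h3
  exact ⟨⟨h1, h4⟩, Nat.add_le_add h2 h5, h6⟩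

theorem cond {o : Cmp} {x y : Exp ρ α} (hx : x.Safe Γ s) (hy : y.Safe Γ s)
    (hp : o.Rel (x.eval s) (y.eval s) → p.Runs Γ s c Q)
    (hn : ¬ o.Rel (x.eval s) (y.eval s) → Q s) (hc : x.cost + y.cost + 2 + c ≤ c') :
    (Stmt.cond o x y p).Runs Γ s c' Q := by
  by_cases h : o.Rel (x.eval s) (y.eval s)
  · obtain ⟨h1, h2, h3⟩ := hp h
    refine ⟨⟨hx, hy, fun _ => h1⟩, ?_, ?_⟩
    · simp only [Stmt.cost, if_pos h]; omega
    · simpa only [Stmt.den, if_pos h] using h3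
  · refine ⟨⟨hx, hy, fun h' => absurd h' h⟩, ?_, ?_⟩
    · simp only [Stmt.cost, if_neg h]; omega
    · simpa only [Stmt.den, if_neg h] using hn h

/-- The rule for loops, with an amortized cost. -/
theorem loop_potential {r : ρ} {e : Exp ρ α} (I : ℕ → Store ρ α → Prop)
    (pot : ℕ → Store ρ α → ℕ) (he : e.Safe Γ s) (h0 : I 0 s)
    (hstep : ∀ i < e.eval s, ∀ s', (Stmt.loop r e p).Frame s s' → I i s' →
      ∃ c', p.Runs Γ (s'.set r i) c' fun s'' => I (i + 1) s'' ∧ c' + 4 + pot (i + 1) s'' ≤ pot i s')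
    (hc : e.cost + 2 + pot 0 s ≤ c) :
    (Stmt.loop r e p).Runs Γ s c fun s' => I (e.eval s) s' := by
  set f := fun i (s' : Store ρ α) => p.den (s'.set r i) with hf
  set N := e.eval s with hN
  have inv : ∀ i ≤ N, I i (iter f i s) ∧ (Stmt.loop r e p).Frame s (iter f i s) ∧
      (∀ j < i, p.Safe Γ ((iter f j s).set r j)) ∧
      ∑ j ∈ Finset.range i, (p.cost ((iter f j s).set r j) + 4) + pot i (iter f i s) ≤ pot 0 s := by
    intro i
    induction i with
    | zero =>
      exact fun _ => ⟨h0, ⟨fun _ _ => rfl, fun _ _ => rfl⟩, fun j hj => absurd hj (by omega),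
        by simp [iter]⟩
    | succ i ih =>
      intro hi
      obtain ⟨h1, h2, h3, h4⟩ := ih (by omega)
      obtain ⟨ci, h5, h6, h7, h8⟩ := hstep i (by omega) _ h2 h1
      refine ⟨h7, ⟨fun r' hr => ?_, fun a ha => ?_⟩, fun j hj => ?_, ?_⟩
      · have hr' := hr
        simp only [Stmt.wregs, List.mem_cons, not_or] at hr'
        change (p.den _).reg r' = _
        rw [(p.frame_den _).reg r' hr'.2, Store.set_reg, if_neg hr'.1, h2.reg r' hr]
      · change (p.den _).arr a = _
        rw [(p.frame_den _).arr a ha, Store.set_arr, h2.arr a ha]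
      · rcases Nat.lt_succ_iff_lt_or_eq.1 hj with hj | rfl
        exacts [h3 j hj, h5]
      · rw [Finset.sum_range_succ]
        change _ + pot (i + 1) (p.den _) ≤ _
        omega
  obtain ⟨h1, -, h3, h4⟩ := inv N le_rfl
  refine ⟨⟨he, h3⟩, ?_, h1⟩
  change e.cost + 2 + ∑ j ∈ Finset.range N, (p.cost ((iter f j s).set r j) + 4) ≤ c
  omega

/-- The rule for loops, with an invariant that mentions the remaining budget. -/
theorem loop_budget {r : ρ} {e : Exp ρ α} (I : ℕ → ℕ → Store ρ α → Prop) (B : ℕ)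
    (he : e.Safe Γ s) (h0 : I 0 B s)
    (hstep : ∀ i < e.eval s, ∀ m s', (Stmt.loop r e p).Frame s s' → I i m s' →
      ∃ c' m', c' + 4 + m' ≤ m ∧ p.Runs Γ (s'.set r i) c' (I (i + 1) m'))
    (hc : e.cost + 2 + B ≤ c) :
    (Stmt.loop r e p).Runs Γ s c fun s' => ∃ m, I (e.eval s) m s' := by
  -- The potential of a store is the least budget with which it satisfies the invariant.
  refine loop_potential (fun i s' => ∃ m, I i m s') (fun i s' => sInf {m | I i m s'}) he ⟨B, h0⟩
    (fun i hi s' hf hI => ?_) ?_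
  · obtain ⟨c', m', hm, hr⟩ := hstep i hi _ s' hf (Nat.sInf_mem (s := {m | I i m s'}) hI)
    refine ⟨c', hr.mono le_rfl fun s'' _ h => ⟨⟨m', h⟩, le_trans ?_ hm⟩⟩
    have := Nat.sInf_le (s := {m | I (i + 1) m s''}) h
    omega
  · have := Nat.sInf_le (s := {m | I 0 m s}) h0
    omega

theorem loop_sum {r : ρ} {e : Exp ρ α} (I : ℕ → Store ρ α → Prop) (b : ℕ → ℕ)
    (he : e.Safe Γ s) (h0 : I 0 s)
    (hstep : ∀ i < e.eval s, ∀ s', (Stmt.loop r e p).Frame s s' → I i s' →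
      p.Runs Γ (s'.set r i) (b i) (I (i + 1)))
    (hc : e.cost + 2 + ∑ i ∈ Finset.range (e.eval s), (b i + 4) ≤ c) :
    (Stmt.loop r e p).Runs Γ s c fun s' => I (e.eval s) s' := by
  -- The potential is the cost of the remaining rounds.
  refine loop_potential I (fun i _ => ∑ j ∈ Finset.Ico i (e.eval s), (b j + 4)) he h0
    (fun i hi s' hf hI => ⟨b i, (hstep i hi s' hf hI).mono le_rfl fun s'' _ h => ⟨h, ?_⟩⟩) ?_
  · rw [Finset.sum_eq_sum_Ico_succ_bot hi]
  · simpa using hc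

theorem loop_const {r : ρ} {e : Exp ρ α} (I : ℕ → Store ρ α → Prop) (b : ℕ)
    (he : e.Safe Γ s) (h0 : I 0 s)
    (hstep : ∀ i < e.eval s, ∀ s', (Stmt.loop r e p).Frame s s' → I i s' →
      p.Runs Γ (s'.set r i) b (I (i + 1)))
    (hc : e.cost + 2 + e.eval s * (b + 4) ≤ c) :
    (Stmt.loop r e p).Runs Γ s c fun s' => I (e.eval s) s' :=
  loop_sum I (fun _ => b) he h0 hstep (by simpa using hc)

end Stmt.Runs

end WordRAM

/-! ### Distances to sets, and distances across a separator -/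

namespace SimpleGraph

variable {V : Type}

/-- The distance of `v` from the set `S`. -/
noncomputable def setDist (H : SimpleGraph V) (S : Set V) (v : V) : ℕ∞ := ⨅ s ∈ S, H.edist v s

theorem setDist_le {H : SimpleGraph V} {S : Set V} {s : V} (hs : s ∈ S) (v : V) :
    H.setDist S v ≤ H.edist v s := iInf₂_le s hs

theorem setDist_eq_zero {H : SimpleGraph V} {S : Set V} {v : V} (hv : v ∈ S) :
    H.setDist S v = 0 := le_antisymm ((setDist_le hv v).trans (by simp)) bot_le

theorem setDist_le_succ {H : SimpleGraph V} (S : Set V) {v w : V} (h : H.Adj v w) :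
    H.setDist S v ≤ H.setDist S w + 1 := by
  have : H.setDist S w + 1 = ⨅ s ∈ S, (H.edist w s + 1) := by
    simp only [setDist, ENat.iInf_add]
  rw [this]
  refine le_iInf₂ fun s hs => (setDist_le hs v).trans ?_
  refine (SimpleGraph.edist_triangle (v := w)).trans ?_
  rw [edist_eq_one_iff_adj.2 h, add_comm]

/-- Infima of nonempty families in `ℕ∞` are attained, and the infimum over the empty set is `⊤`. -/
theorem exists_of_setDist_ne_top {H : SimpleGraph V} {S : Set V} {v : V}
    (h : H.setDist S v ≠ ⊤) : ∃ s ∈ S, H.setDist S v = H.edist v s := by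
  have hne : S.Nonempty := by
    by_contra hS
    rw [Set.not_nonempty_iff_eq_empty] at hS
    exact h (by simp [setDist, hS])
  have : Nonempty S := hne.to_subtype
  obtain ⟨s, hs⟩ := ciInf_mem (fun s : S => H.edist v s)
  exact ⟨s, s.2, by rw [setDist, iInf_subtype']; exact hs.symm⟩

/-- The graph without the edges between vertices with different `C`. -/
def restrict (G : SimpleGraph V) (C : V → ℕ) : SimpleGraph V where
  Adj u v := G.Adj u v ∧ C u = C v
  symm := ⟨fun _ _ h => ⟨h.1.symm, h.2.symm⟩⟩
  loopless := ⟨fun _ h => G.loopless.irrefl _ h.1⟩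

theorem restrict_reachable {G : SimpleGraph V} {C : V → ℕ} {u v : V}
    (h : (G.restrict C).Reachable u v) : C u = C v := by
  obtain ⟨p⟩ := h
  induction p with
  | nil => rfl
  | cons h _ ih => exact h.2.trans ih

theorem restrict_edist_of_ne {G : SimpleGraph V} {C : V → ℕ} {u v : V} (h : C u ≠ C v) :
    (G.restrict C).edist u v = ⊤ :=
  edist_eq_top_of_not_reachable fun hr => h (restrict_reachable hr)

/-- A finite distance inside `G.restrict C` is realized by a walk that keeps `C` constant, so the
nearest element of `S` lies in the piece of `v`. -/
theorem restrict_setDist {G : SimpleGraph V} {C : V → ℕ} {S : Set V} {v : V}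
    (h : (G.restrict C).setDist S v ≠ ⊤) :
    ∃ s ∈ S, C v = C s ∧ (G.restrict C).setDist S v = (G.restrict C).edist v s := by
  obtain ⟨s, hs, he⟩ := exists_of_setDist_ne_top h
  exact ⟨s, hs, restrict_reachable (reachable_of_edist_ne_top (he ▸ h)), he⟩

/-- Distances across a family of complete bipartite graphs that contain all edges of `H` that are
not in `H'`. -/
theorem edist_eq_min_of_separator {G : SimpleGraph V} {C C' : V → ℕ} {ι : Type*} {I : Set ι}
    {X N : ι → Set V} (hC : ∀ u v, C' u = C' v → C u = C v)
    (sound : ∀ i ∈ I, ∀ x ∈ X i, ∀ y ∈ N i, C x = C y → G.Adj x y)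
    (complete : ∀ x y, G.Adj x y → C x = C y → C' x ≠ C' y →
      ∃ i ∈ I, (x ∈ X i ∧ y ∈ N i) ∨ (y ∈ X i ∧ x ∈ N i)) {u v : V} (huv : C u = C v) :
    (G.restrict C).edist u v = min ((G.restrict C').edist u v)
      (⨅ i ∈ I, min ((G.restrict C).setDist (X i) u + 1 + (G.restrict C).setDist (N i) v)
        ((G.restrict C).setDist (N i) u + 1 + (G.restrict C).setDist (X i) v)) := by
  set H := G.restrict C with hH
  have hle : G.restrict C' ≤ H := fun a b h => ⟨h.1, hC _ _ h.2⟩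
  -- The route goes from `u` to a nearest `x ∈ A`, along the edge `xy`, and from a nearest `y ∈ B`
  -- to `v`. Both `x` and `y` lie in the common piece of `u` and `v`, so the edge is present.
  have upper : ∀ A B : Set V, (∀ x ∈ A, ∀ y ∈ B, C x = C y → G.Adj x y) →
      H.edist u v ≤ H.setDist A u + 1 + H.setDist B v := by
    intro A B hAB
    by_cases hA : H.setDist A u = ⊤
    · simp [hA]
    by_cases hB : H.setDist B v = ⊤
    · simp [hB]
    obtain ⟨x, hx, hux, ex⟩ := restrict_setDist hA
    obtain ⟨y, hy, hvy, ey⟩ := restrict_setDist hB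
    have hxy : C x = C y := by rw [← hux, huv, hvy]
    have hadj : H.Adj x y := ⟨hAB x hx y hy hxy, hxy⟩
    rw [ex, ey]
    calc H.edist u v ≤ H.edist u x + H.edist x v := SimpleGraph.edist_triangle
      _ ≤ H.edist u x + (H.edist x y + H.edist y v) := by gcongr; exact SimpleGraph.edist_triangle
      _ = _ := by rw [edist_eq_one_iff_adj.2 hadj, SimpleGraph.edist_comm (u := y), add_assoc]
  apply le_antisymm
  · refine le_min (edist_anti hle) (le_iInf₂ fun i hi => le_min (upper _ _ (sound i hi)) ?_)
    exact upper _ _ fun x hx y hy h => (sound i hi y hy x hx h.symm).symm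
  · by_cases htop : H.edist u v = ⊤
    · rw [htop]; exact le_top
    obtain ⟨p, hp⟩ := exists_walk_of_edist_ne_top htop
    rw [← hp]
    clear hp htop huv upper
    suffices h : (G.restrict C').edist u v ≤ p.length ∨ ∃ i ∈ I,
        H.setDist (X i) u + 1 + H.setDist (N i) v ≤ p.length ∨
        H.setDist (N i) u + 1 + H.setDist (X i) v ≤ p.length by
      rcases h with h | ⟨i, hi, h | h⟩
      · exact min_le_of_left_le h
      · exact min_le_of_right_le ((iInf₂_le i hi).trans (min_le_of_left_le h))
      · exact min_le_of_right_le ((iInf₂_le i hi).trans (min_le_of_right_le h))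
    -- Along a shortest walk, either no edge changes `C'`, or an edge that does lies in one of the
    -- bipartite graphs and yields a bound through its index.
    induction p with
    | nil => left; simp
    | @cons a b c hab p ih =>
      -- Case of a crossing first edge: `a` is in `A`, and the rest of the walk leads from `b ∈ B`
      -- to `c`.
      have hs : ∀ A B : Set V, a ∈ A → b ∈ B →
          H.setDist A a + 1 + H.setDist B c ≤ (p.length + 1 : ℕ) := by
        intro A B ha hb
        rw [setDist_eq_zero ha, zero_add, Nat.cast_add, Nat.cast_one, add_comm]
        gcongr
        refine (setDist_le hb c).trans ?_
        rw [SimpleGraph.edist_comm]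
        exact edist_le p
      -- Case of a later crossing: one more edge in front adds at most one to the distance from `A`.
      have ht : ∀ A B : Set V, H.setDist A b + 1 + H.setDist B c ≤ p.length →
          H.setDist A a + 1 + H.setDist B c ≤ (p.length + 1 : ℕ) := by
        intro A B h
        have h1 := setDist_le_succ A hab
        calc H.setDist A a + 1 + H.setDist B c
            ≤ H.setDist A b + 1 + 1 + H.setDist B c := by gcongr
          _ = (H.setDist A b + 1 + H.setDist B c) + 1 := by abel
          _ ≤ _ := by push_cast; gcongr
      rw [Walk.length_cons]
      by_cases hc : C' a = C' b
      · rcases ih with h | ⟨i, hi, h | h⟩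
        · left
          have hadj : (G.restrict C').Adj a b := ⟨hab.1, hc⟩
          refine SimpleGraph.edist_triangle (v := b) |>.trans ?_
          rw [edist_eq_one_iff_adj.2 hadj, Nat.cast_add, Nat.cast_one, add_comm]
          gcongr
        · exact Or.inr ⟨i, hi, Or.inl (ht _ _ h)⟩
        · exact Or.inr ⟨i, hi, Or.inr (ht _ _ h)⟩
      · obtain ⟨i, hi, ⟨h1, h2⟩ | ⟨h1, h2⟩⟩ := complete a b hab.1 hab.2 hc
        · exact Or.inr ⟨i, hi, Or.inl (hs _ _ h1 h2)⟩
        · exact Or.inr ⟨i, hi, Or.inr (hs _ _ h2 h1)⟩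

end SimpleGraph

/-! ### Codes of distances and a local certificate for breadth-first search. -/

namespace WordRAM

/-- The inverse of `distCode`. -/
def ofCode : ℕ → ℕ∞
  | 0 => ⊤
  | d + 1 => d

@[simp] theorem ofCode_distCode (d : ℕ∞) : ofCode (distCode d) = d := by
  cases d <;> rfl

@[simp] theorem distCode_ofCode (c : ℕ) : distCode (ofCode c) = c := by
  cases c <;> rfl

/-- Characterization of breadth-first search by local properties. -/
theorem eq_distCode_setDist {V : Type} {H : SimpleGraph V} {S : Set V} {D : V → ℕ}
    (h1 : ∀ v ∈ S, D v = 1) (h2 : ∀ v, D v ≠ 0 → ∃ s ∈ S, H.edist v s + 1 ≤ D v)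
    (h3 : ∀ u v, H.Adj u v → D u ≠ 0 → D v ≠ 0 ∧ D v ≤ D u + 1) (v : V) :
    D v = distCode (H.setDist S v) := by
  -- The local condition `h3` propagates along walks, so `D` is at most one more than the length of
  -- any walk from a source.
  have walk : ∀ (s v : V) (p : H.Walk s v), D s ≠ 0 → D v ≠ 0 ∧ D v ≤ D s + p.length := by
    intro s v p
    induction p with
    | nil => exact fun h => ⟨h, by simp⟩
    | cons h p ih =>
      intro hs
      obtain ⟨h4, h5⟩ := h3 _ _ h hs
      obtain ⟨h6, h7⟩ := ih h4
      exact ⟨h6, by rw [SimpleGraph.Walk.length_cons]; omega⟩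
  by_cases hv : D v = 0
  · suffices h : H.setDist S v = ⊤ by rw [hv, h]; rfl
    by_contra h
    obtain ⟨s, hs, he⟩ := SimpleGraph.exists_of_setDist_ne_top h
    obtain ⟨p⟩ := SimpleGraph.reachable_of_edist_ne_top (he ▸ h)
    exact (walk s v p.reverse (by rw [h1 s hs]; omega)).1 hv
  · obtain ⟨s, hs, he⟩ := h2 v hv
    have hlt : H.setDist S v ≠ ⊤ := by
      intro h
      have := (add_le_add_left (SimpleGraph.setDist_le (H := H) hs v) 1).trans he
      rw [h] at this
      simp at this
    obtain ⟨s', hs', he'⟩ := SimpleGraph.exists_of_setDist_ne_top hlt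
    obtain ⟨p, hp⟩ := SimpleGraph.exists_walk_of_edist_ne_top (he' ▸ hlt)
    have h4 := (walk s' v p.reverse (by rw [h1 s' hs']; omega)).2
    rw [SimpleGraph.Walk.length_reverse, h1 s' hs'] at h4
    have h5 : (p.length : ℕ∞) + 1 ≤ D v := by
      rw [hp, ← he']
      exact (add_le_add_left (SimpleGraph.setDist_le hs v) 1).trans he
    have h6 : p.length + 1 ≤ D v := by exact_mod_cast h5
    rw [he', ← hp]
    change D v = p.length + 1
    omega

/-- A shortest path visits distinct vertices, so its number of edges plus one is at most the number
of vertices. Codes of distances therefore fit into `lg n` bits. -/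
theorem distCode_edist_le {V : Type} [Fintype V] (H : SimpleGraph V) (u v : V) :
    distCode (H.edist u v) ≤ Fintype.card V := by
  classical
  by_cases h : H.edist u v = ⊤
  · rw [h]; exact Nat.zero_le _
  · have hr := SimpleGraph.reachable_of_edist_ne_top h
    obtain ⟨p, hp, hl⟩ := hr.exists_path_of_dist
    rw [← hr.coe_dist_eq_edist]
    change H.dist u v + 1 ≤ _
    rw [← hl]
    exact hp.length_lt

theorem distCode_setDist_le {V : Type} [Fintype V] (H : SimpleGraph V) (S : Set V) (v : V) :
    distCode (H.setDist S v) ≤ Fintype.card V := by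
  by_cases h : H.setDist S v = ⊤
  · rw [h]; exact Nat.zero_le _
  · obtain ⟨s, -, he⟩ := SimpleGraph.exists_of_setDist_ne_top h
    rw [he]
    exact distCode_edist_le H v s

/-! ### The evaluation of a query on the words of two labels -/

/-- Update the code `b` of a minimum by the code of the distance `x + 1 + y`. -/
def combine (b x y : ℕ) : ℕ := if x ≠ 0 ∧ y ≠ 0 ∧ (b = 0 ∨ x + y < b) then x + y else b

/-- The shift of the code by one accounts for the crossing edge: the sum of the codes of `d` and
`d'` is `(d + 1 + d') + 1`, the code of `d + 1 + d'`. -/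
theorem ofCode_combine (b x y : ℕ) :
    ofCode (combine b x y) = min (ofCode b) (ofCode x + 1 + ofCode y) := by
  unfold combine
  rcases x with _ | x
  · simp [ofCode]
  rcases y with _ | y
  · simp [ofCode]
  have h : ofCode (x + 1 + (y + 1)) = ofCode (x + 1) + 1 + ofCode (y + 1) := by
    rw [show x + 1 + (y + 1) = (x + 1 + y) + 1 by omega]
    simp [ofCode]
  rcases b with _ | b
  · simp only [ne_eq, Nat.add_eq_zero_iff, one_ne_zero, and_false, not_false_eq_true, true_or,
      and_self, if_true, h]
    simp [ofCode]
  · rw [← h]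
    have hlt : ∀ a b : ℕ, a ≤ b → ofCode (a + 1) ≤ ofCode (b + 1) := fun a b hab => by
      simpa [ofCode] using hab
    by_cases hc : x + 1 + (y + 1) < b + 1
    · rw [if_pos ⟨by omega, by omega, Or.inr hc⟩]
      exact (min_eq_right (hlt (x + 1 + y) b (by omega))).symm
    · rw [if_neg (by omega)]
      exact (min_eq_left (hlt b (x + 1 + y) (by omega))).symm

/-- The first position of the record of level `l` in a label. -/
def recPos (K l : ℕ) : ℕ := 3 + l * (2 * K + 1)

/-- One round of the evaluation of a query. -/
def queryRound (f g : ℕ → ℕ) (pos r b : ℕ) : ℕ :=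
  combine (combine b (f (pos + 1 + 2 * r)) (g (pos + 2 + 2 * r)))
    (f (pos + 2 + 2 * r)) (g (pos + 1 + 2 * r))

/-- The evaluation of a query at one level: `st.1` tells whether the two vertices have been
separated, `st.2` is the code of the best distance so far. -/
def queryLevel (K : ℕ) (f g : ℕ → ℕ) (l : ℕ) (st : ℕ × ℕ) : ℕ × ℕ :=
  if st.1 = 0 then (if f (recPos K l) = g (recPos K l) then 0 else 1,
    iter (queryRound f g (recPos K l)) K st.2) else st

/-- The evaluation of the first levels. -/
def queryFold (K : ℕ) (f g : ℕ → ℕ) (l : ℕ) : ℕ × ℕ := iter (queryLevel K f g) l (0, 0)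

/-- The code of the distance, from the words of the two labels. -/
def queryResult (f g : ℕ → ℕ) : ℕ :=
  if (queryFold (f 1) f g (f 2)).1 = 0 then 1 else (queryFold (f 1) f g (f 2)).2

theorem iter_congr {σ : Type} {f g : ℕ → σ → σ} {m : ℕ} (h : ∀ i < m, ∀ s, f i s = g i s) (s : σ) :
    iter f m s = iter g m s := by
  induction m with
  | zero => rfl
  | succ m ih => simp only [iter]; rw [ih fun i hi => h i (by omega), h m (by omega)]

theorem recPos_succ (K l : ℕ) : recPos K (l + 1) = recPos K l + (2 * K + 1) := by
  unfold recPos; ring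

theorem queryLevel_congr {K l : ℕ} {f f' g g' : ℕ → ℕ}
    (hf : ∀ p < recPos K (l + 1), f p = f' p) (hg : ∀ p < recPos K (l + 1), g p = g' p)
    (st : ℕ × ℕ) : queryLevel K f g l st = queryLevel K f' g' l st := by
  rw [recPos_succ] at hf hg
  unfold queryLevel
  rw [hf _ (by omega), hg _ (by omega), iter_congr (g := queryRound f' g' (recPos K l))]
  intro i hi b
  unfold queryRound
  rw [hf _ (by omega), hf _ (by omega), hg _ (by omega), hg _ (by omega)]

/-- The first `l` levels read only words before `recPos K l`. Thus records appended later leave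
their evaluation unchanged, and what follows the end of a label is irrelevant. -/
theorem queryFold_congr {K l : ℕ} {f f' g g' : ℕ → ℕ}
    (hf : ∀ p < recPos K l, f p = f' p) (hg : ∀ p < recPos K l, g p = g' p) :
    queryFold K f g l = queryFold K f' g' l := by
  refine iter_congr (fun i hi st => queryLevel_congr (fun p hp => hf p ?_) (fun p hp => hg p ?_) st)
    _ <;>
  · refine hp.trans_le ?_
    have := Nat.mul_le_mul_right (2 * K + 1) (show i + 1 ≤ l from hi)
    unfold recPos
    omega

theorem ofCode_iter_queryRound (f g : ℕ → ℕ) (pos b : ℕ) (m : ℕ) :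
    ofCode (iter (queryRound f g pos) m b) = min (ofCode b) (⨅ r ∈ Set.Iio m,
      min (ofCode (f (pos + 2 + 2 * r)) + 1 + ofCode (g (pos + 1 + 2 * r)))
        (ofCode (f (pos + 1 + 2 * r)) + 1 + ofCode (g (pos + 2 + 2 * r)))) := by
  induction m with
  | zero => simp [iter]
  | succ m ih =>
    have : Set.Iio (m + 1) = insert m (Set.Iio m) := by
      ext x; simp only [Set.mem_Iio, Set.mem_insert_iff]; omega
    rw [this, iInf_insert]
    simp only [iter]
    rw [queryRound, ofCode_combine, ofCode_combine, ih]
    simp only [min_assoc]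
    congr 1
    rw [min_comm]
    simp only [min_assoc]
    exact min_left_comm (α := ℕ∞) _ _ _

/-- The invariant of a query: the distance of `u` and `v` is the best distance found so far, or the
distance within the current piece if they have not been separated. -/
def QueryInv {V : Type} (G : SimpleGraph V) (C : V → ℕ) (u v : V) (st : ℕ × ℕ) : Prop :=
  (st.1 = 0 → C u = C v ∧ G.edist u v = min (ofCode st.2) ((G.restrict C).edist u v)) ∧
  (st.1 ≠ 0 → G.edist u v = ofCode st.2)

/-- While `u` and `v` share a piece, the record of a level provides exactly the terms of
`edist_eq_min_of_separator`. What remains is their distance in the finer pieces, which is left to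
the next levels. -/
theorem QueryInv.step {V : Type} {G : SimpleGraph V} {C C' side : V → ℕ} {X N : ℕ → Set V}
    {K l : ℕ} {u v : V} {f g : ℕ → ℕ} {st : ℕ × ℕ} (h : QueryInv G C u v st)
    (hC : ∀ u v, C' u = C' v ↔ C u = C v ∧ side u = side v)
    (sound : ∀ r < K, ∀ x ∈ X r, ∀ y ∈ N r, C x = C y → G.Adj x y)
    (complete : ∀ x y, G.Adj x y → C x = C y → side x ≠ side y →
      ∃ r < K, (x ∈ X r ∧ y ∈ N r) ∨ (y ∈ X r ∧ x ∈ N r))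
    (hf : f (recPos K l) = side u) (hg : g (recPos K l) = side v)
    (hfN : ∀ r < K, f (recPos K l + 1 + 2 * r) = distCode ((G.restrict C).setDist (N r) u))
    (hfX : ∀ r < K, f (recPos K l + 2 + 2 * r) = distCode ((G.restrict C).setDist (X r) u))
    (hgN : ∀ r < K, g (recPos K l + 1 + 2 * r) = distCode ((G.restrict C).setDist (N r) v))
    (hgX : ∀ r < K, g (recPos K l + 2 + 2 * r) = distCode ((G.restrict C).setDist (X r) v)) :
    QueryInv G C' u v (queryLevel K f g l st) := by
  unfold queryLevel
  by_cases h0 : st.1 = 0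
  · obtain ⟨huv, hd⟩ := h.1 h0
    rw [if_pos h0, hf, hg]
    have sep := SimpleGraph.edist_eq_min_of_separator (G := G) (C := C) (C' := C') (I := Set.Iio K)
      (X := X) (N := N) (fun a b hab => ((hC a b).1 hab).1) sound
      (fun x y hxy hc hc' => complete x y hxy hc fun hs => hc' ((hC x y).2 ⟨hc, hs⟩)) huv
    have hit : ofCode (iter (queryRound f g (recPos K l)) K st.2) = min (ofCode st.2)
        (⨅ i ∈ Set.Iio K,
          min ((G.restrict C).setDist (X i) u + 1 + (G.restrict C).setDist (N i) v)
          ((G.restrict C).setDist (N i) u + 1 + (G.restrict C).setDist (X i) v)) := by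
      rw [ofCode_iter_queryRound]
      congr 1
      refine iInf_congr fun r => iInf_congr fun hr => ?_
      rw [hfN r hr, hfX r hr, hgN r hr, hgX r hr]
      simp only [ofCode_distCode]
    by_cases hs : side u = side v
    · refine ⟨fun _ => ⟨(hC u v).2 ⟨huv, hs⟩, ?_⟩, fun hne => absurd (if_pos hs) hne⟩
      change _ = min (ofCode (iter (queryRound f g (recPos K l)) K st.2)) _
      rw [hd, sep, hit, min_assoc, min_comm ((G.restrict C').edist u v)]
    · refine ⟨fun hne => absurd hne (by simp [hs]), fun _ => ?_⟩
      change _ = ofCode (iter (queryRound f g (recPos K l)) K st.2)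
      -- The vertices are now in different pieces, their inner distance is `⊤`, and the best value
      -- so far is final.
      rw [hd, sep, hit, SimpleGraph.restrict_edist_of_ne (fun hc => hs ((hC u v).1 hc).2)]
      simp
  · rw [if_neg h0]
    exact ⟨fun hh => absurd hh h0, fun _ => h.2 h0⟩

theorem QueryInv.init {V : Type} {G : SimpleGraph V} {C : V → ℕ} (hC : ∀ u v, C u = C v) (u v : V) :
    QueryInv G C u v (0, 0) := by
  have : G.restrict C = G := by
    ext a b; exact ⟨fun h => h.1, fun h => ⟨h, hC a b⟩⟩
  refine ⟨fun _ => ⟨hC u v, ?_⟩, fun h => absurd rfl h⟩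
  rw [this]
  simp [ofCode]

/-- With single vertices as pieces, vertices that were never separated are equal; their distance 0
has the code 1, the default answer of `queryResult`. -/
theorem QueryInv.result {V : Type} {G : SimpleGraph V} {C : V → ℕ} {u v : V} {f g : ℕ → ℕ}
    (h : QueryInv G C u v (queryFold (f 1) f g (f 2))) (hC : ∀ u v, C u = C v → u = v) :
    ofCode (queryResult f g) = G.edist u v := by
  unfold queryResult
  split_ifs with h0
  · obtain ⟨huv, -⟩ := h.1 h0
    rw [hC u v huv]
    simp [ofCode]
  · exact (h.2 h0).symm

end WordRAM

/-! ### The decomposition tree of an expression -/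

/-- `a` is a descendant of `b`, or `a = b`, in the tree with nodes `o, …, r` (where `r` is the root)
and the given parents. -/
def TreeLE (par : ℕ → ℕ) (o r : ℕ) : ℕ → ℕ → Prop :=
  Relation.ReflTransGen fun a b => o ≤ a ∧ a < r ∧ par a = b

theorem TreeLE.le {par : ℕ → ℕ} {o r a b : ℕ} (hpar : ∀ x, o ≤ x → x < r → x < par x)
    (h : TreeLE par o r a b) : a ≤ b := by
  induction h with
  | refl => exact le_rfl
  | tail _ h ih => obtain ⟨h1, h2, rfl⟩ := h; exact ih.trans (hpar _ h1 h2).le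

theorem treeLE_root {par : ℕ → ℕ} {o r : ℕ} (hpar : ∀ x, o ≤ x → x < r → x < par x ∧ par x ≤ r) :
    ∀ a, o ≤ a → a ≤ r → TreeLE par o r a r := by
  suffices h : ∀ m a, r - a = m → o ≤ a → a ≤ r → TreeLE par o r a r from
    fun a => h _ a rfl
  intro m
  induction m using Nat.strong_induction_on with
  | _ m ih =>
    intro a hm ho hr
    rcases hr.lt_or_eq with hlt | rfl
    · obtain ⟨h1, h2⟩ := hpar a ho hlt
      exact (Relation.ReflTransGen.single ⟨ho, hlt, rfl⟩).trans
        (ih (r - par a) (by omega) (par a) rfl (by omega) h2)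
    · exact Relation.ReflTransGen.refl

namespace CWExpr

variable {V : Type} {k : ℕ}

/-- The number of nodes of the tree: operations `i(v)` and `⊕`. -/
def nodes : CWExpr V k → ℕ
  | vertex _ _ => 1
  | union e f => e.nodes + f.nodes + 1
  | join _ _ _ e => e.nodes
  | relabel _ _ e => e.nodes

theorem nodes_pos (e : CWExpr V k) : 0 < e.nodes := by
  induction e <;> simp only [nodes] <;> omega

/-- The parents in the tree of the expression, with nodes numbered from `o` on in postorder. -/
def parent : CWExpr V k → ℕ → ℕ → ℕ
  | vertex _ _, _, _ => 0
  | union e f, o, x =>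
      if x + 1 < o + e.nodes then e.parent o x
      else if x + 1 = o + e.nodes then o + e.nodes + f.nodes
      else if x + 1 < o + e.nodes + f.nodes then f.parent (o + e.nodes) x
      else o + e.nodes + f.nodes
  | join _ _ _ e, o, x => e.parent o x
  | relabel _ _ e, o, x => e.parent o x

/-- The leaf of the tree that belongs to a vertex. -/
def leafNode [DecidableEq V] : CWExpr V k → ℕ → V → ℕ
  | vertex _ _, o, _ => o
  | union e f, o, v => if v ∈ e.leaves then e.leafNode o v else f.leafNode (o + e.nodes) v
  | join _ _ _ e, o, v => e.leafNode o v
  | relabel _ _ e, o, v => e.leafNode o v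

/-- In postorder the root of a subtree is the last node of its range; all other nodes have a later
parent in the same range. -/
theorem parent_bounds (e : CWExpr V k) : ∀ o x, o ≤ x → x + 1 < o + e.nodes →
    x < e.parent o x ∧ e.parent o x < o + e.nodes := by
  induction e with
  | vertex i v => intro o x h1 h2; simp only [nodes] at h2; omega
  | join i j hij e ih => exact ih
  | relabel i j e ih => exact ih
  | union e f ihe ihf =>
    intro o x h1 h2
    simp only [nodes] at h2
    simp only [parent, nodes]
    split_ifs with h3 h4 h5
    · have := ihe o x h1 h3; omega
    · omega
    · have := ihf (o + e.nodes) x (by omega) h5; omega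
    · omega

section

variable [DecidableEq V]

theorem leafNode_bounds (e : CWExpr V k) : ∀ o, ∀ v ∈ e.leaves,
    o ≤ e.leafNode o v ∧ e.leafNode o v < o + e.nodes := by
  induction e with
  | vertex i v => intro o u _; simp [leafNode, nodes]
  | join i j hij e ih => exact ih
  | relabel i j e ih => exact ih
  | union e f ihe ihf =>
    intro o v hv
    simp only [leaves, List.mem_append] at hv
    simp only [leafNode, nodes]
    split_ifs with h
    · have := ihe o v h; omega
    · have := ihf (o + e.nodes) v (hv.resolve_left h); omega

theorem leafNode_injOn (e : CWExpr V k) : ∀ o, ∀ u ∈ e.leaves, ∀ v ∈ e.leaves,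
    e.leafNode o u = e.leafNode o v → u = v := by
  induction e with
  | vertex i v =>
    intro o u hu v' hv' _
    simp only [leaves, List.mem_singleton] at hu hv'
    rw [hu, hv']
  | join i j hij e ih => exact ih
  | relabel i j e ih => exact ih
  | union e f ihe ihf =>
    intro o u hu v hv h
    simp only [leaves, List.mem_append] at hu hv
    simp only [leafNode] at h
    split_ifs at h with h1 h2 h2
    · exact ihe o u h1 v h2 h
    · have := leafNode_bounds e o u h1
      have := leafNode_bounds f (o + e.nodes) v (hv.resolve_left h2)
      omega
    · have := leafNode_bounds e o v h2
      have := leafNode_bounds f (o + e.nodes) u (hu.resolve_left h1)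
      omega
    · exact ihf _ u (hu.resolve_left h1) v (hv.resolve_left h2) h

theorem parent_ne_leafNode (e : CWExpr V k) : ∀ o x, o ≤ x → x + 1 < o + e.nodes →
    ∀ v ∈ e.leaves, e.parent o x ≠ e.leafNode o v := by
  induction e with
  | vertex i v => intro o x h1 h2; simp only [nodes] at h2; omega
  | join i j hij e ih => exact ih
  | relabel i j e ih => exact ih
  | union e f ihe ihf =>
    intro o x h1 h2 v hv
    simp only [leaves, List.mem_append] at hv
    have hb : (union e f).leafNode o v < o + e.nodes ∧ v ∈ e.leaves ∨
        o + e.nodes ≤ (union e f).leafNode o v ∧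
          (union e f).leafNode o v < o + e.nodes + f.nodes ∧ v ∉ e.leaves ∧ v ∈ f.leaves := by
      simp only [leafNode]
      split_ifs with h
      · exact Or.inl ⟨(leafNode_bounds e o v h).2, h⟩
      · have := leafNode_bounds f (o + e.nodes) v (hv.resolve_left h)
        exact Or.inr ⟨this.1, this.2, h, hv.resolve_left h⟩
    simp only [parent]
    split_ifs with h3 h4 h5
    · rcases hb with ⟨_, h⟩ | ⟨h, _⟩
      · simpa only [leafNode, if_pos h] using ihe o x h1 h3 v h
      · have := parent_bounds e o x h1 h3; omega
    · omega
    · have hp := parent_bounds f (o + e.nodes) x (by omega) h5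
      rcases hb with ⟨_, h⟩ | ⟨h, _, h', h''⟩
      · omega
      · simpa only [leafNode, if_neg h'] using ihf (o + e.nodes) x (by omega) h5 v h''
    · omega

/-- Only unions have children, namely the last nodes of the ranges of their two arguments. -/
theorem card_children_le (e : CWExpr V k) : ∀ o y,
    ((Finset.Ico o (o + e.nodes - 1)).filter fun x => e.parent o x = y).card ≤ 2 := by
  induction e with
  | vertex i v => intro o y; simp [nodes]
  | join i j hij e ih => exact ih
  | relabel i j e ih => exact ih
  | union e f ihe ihf =>
    intro o y
    have hpe := e.nodes_pos
    have hpf := f.nodes_pos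
    have hcases : ∀ x ∈ Finset.Ico o (o + (union e f).nodes - 1),
        (x + 1 < o + e.nodes ∧ o ≤ x ∧ (union e f).parent o x = e.parent o x ∧
          e.parent o x < o + e.nodes) ∨
        (o + e.nodes ≤ x ∧ x + 1 < o + e.nodes + f.nodes ∧
          (union e f).parent o x = f.parent (o + e.nodes) x ∧ x < f.parent (o + e.nodes) x ∧
          f.parent (o + e.nodes) x < o + e.nodes + f.nodes) ∨
        (x + 1 = o + e.nodes ∨ x + 1 = o + e.nodes + f.nodes) ∧
          (union e f).parent o x = o + e.nodes + f.nodes := by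
      intro x hx
      simp only [Finset.mem_Ico, nodes] at hx
      simp only [parent]
      split_ifs with h3 h4 h5
      · have := parent_bounds e o x hx.1 h3; simp; omega
      · simp; omega
      · have := parent_bounds f (o + e.nodes) x (by omega) h5; simp; omega
      · simp; omega
    rcases lt_trichotomy y (o + e.nodes + f.nodes) with hy | hy | hy
    · by_cases hy' : y < o + e.nodes
      · refine (Finset.card_le_card fun x hx => ?_).trans (ihe o y)
        simp only [Finset.mem_filter, Finset.mem_Ico] at hx ⊢
        have := hcases x (Finset.mem_Ico.2 hx.1)
        omega
      · refine (Finset.card_le_card fun x hx => ?_).trans (ihf (o + e.nodes) y)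
        simp only [Finset.mem_filter, Finset.mem_Ico] at hx ⊢
        have := hcases x (Finset.mem_Ico.2 hx.1)
        omega
    · refine (Finset.card_le_card (t := {o + e.nodes - 1, o + e.nodes + f.nodes - 1})
        fun x hx => ?_).trans Finset.card_le_two
      simp only [Finset.mem_filter, Finset.mem_Ico, Finset.mem_insert,
        Finset.mem_singleton] at hx ⊢
      have := hcases x (Finset.mem_Ico.2 hx.1)
      omega
    · refine (Finset.card_le_card (t := ∅) fun x hx => ?_).trans (by simp)
      simp only [Finset.mem_filter, Finset.mem_Ico] at hx
      have := hcases x (Finset.mem_Ico.2 hx.1)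
      omega

end

theorem mem_leaves_of_hasLabel (e : CWExpr V k) : ∀ v l, e.HasLabel v l → v ∈ e.leaves := by
  induction e with
  | vertex i u => intro v l h; simp [leaves, h.1]
  | join i j hij e ih => exact ih
  | relabel i j e ih => rintro v l ⟨l', h, -⟩; exact ih v l' h
  | union e f ihe ihf =>
    rintro v l (h | h) <;> simp only [leaves, List.mem_append]
    exacts [Or.inl (ihe v l h), Or.inr (ihf v l h)]

theorem mem_leaves_of_adj (e : CWExpr V k) :
    ∀ u v, e.Adj u v → u ∈ e.leaves ∧ v ∈ e.leaves := by
  induction e with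
  | vertex i u => intro _ _ h; exact h.elim
  | join i j hij e ih =>
    rintro u v (h | ⟨h1, h2⟩ | ⟨h1, h2⟩)
    · exact ih u v h
    · exact ⟨e.mem_leaves_of_hasLabel _ _ h1, e.mem_leaves_of_hasLabel _ _ h2⟩
    · exact ⟨e.mem_leaves_of_hasLabel _ _ h1, e.mem_leaves_of_hasLabel _ _ h2⟩
  | relabel i j e ih => exact ih
  | union e f ihe ihf =>
    rintro u v (h | h) <;> simp only [leaves, List.mem_append]
    exacts [⟨Or.inl (ihe u v h).1, Or.inl (ihe u v h).2⟩,
      ⟨Or.inr (ihf u v h).1, Or.inr (ihf u v h).2⟩]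

/-- `HasLabel` is a relation, which is functional only because no vertex is introduced on both sides
of a union. -/
theorem exists_hasLabel_iff (e : CWExpr V k) (hn : e.leaves.Nodup) :
    ∀ v ∈ e.leaves, ∃ l, ∀ l', e.HasLabel v l' ↔ l' = l := by
  induction e with
  | vertex i u =>
    intro v hv
    simp only [leaves, List.mem_singleton] at hv
    exact ⟨i, fun l' => by simp [HasLabel, hv]⟩
  | join i j hij e ih => exact ih hn
  | relabel i j e ih =>
    intro v hv
    obtain ⟨l, hl⟩ := ih hn v hv
    exact ⟨if l = i then j else l, fun l' => by simp [HasLabel, hl]⟩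
  | union e f ihe ihf =>
    simp only [leaves] at hn
    rw [List.nodup_append'] at hn
    intro v hv
    simp only [leaves, List.mem_append] at hv
    rcases hv with hv | hv
    · obtain ⟨l, hl⟩ := ihe hn.1 v hv
      refine ⟨l, fun l' => ?_⟩
      have : ¬ f.HasLabel v l' := fun h => hn.2.2 hv (f.mem_leaves_of_hasLabel _ _ h)
      simp [HasLabel, hl, this]
    · obtain ⟨l, hl⟩ := ihf hn.2.1 v hv
      refine ⟨l, fun l' => ?_⟩
      have : ¬ e.HasLabel v l' := fun h => hn.2.2 (e.mem_leaves_of_hasLabel _ _ h) hv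
      simp [HasLabel, hl, this]

theorem exists_label_of_root (e : CWExpr V k) (hn : e.leaves.Nodup) :
    ∃ lab : V → Fin k, ∀ u ∈ e.leaves, ∀ u' ∈ e.leaves, lab u = lab u' →
      ∀ l, e.HasLabel u l ↔ e.HasLabel u' l := by
  -- `choose!` needs a default label for vertices that are not leaves; some leaf or other operation
  -- of the expression supplies one.
  have hk : Nonempty (Fin k) := by
    clear hn
    induction e with
    | vertex i _ => exact ⟨i⟩
    | join i _ _ _ => exact ⟨i⟩
    | relabel i _ _ => exact ⟨i⟩
    | union _ _ ih => exact ih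
  classical
  choose! lab hlab using e.exists_hasLabel_iff hn
  refine ⟨lab, fun u hu u' hu' h l => ?_⟩
  rw [hlab u hu, hlab u' hu', h]

variable [DecidableEq V]

/-- The vertices below a node of the tree fall into at most `k` classes with respect to their
neighbors that are not below the node. -/
theorem exists_classes (e : CWExpr V k) (hn : e.leaves.Nodup) : ∀ o x, o ≤ x → x < o + e.nodes →
    ∃ lab : V → Fin k, ∀ u ∈ e.leaves, ∀ u' ∈ e.leaves,
      TreeLE (e.parent o) o (o + e.nodes - 1) (e.leafNode o u) x →
      TreeLE (e.parent o) o (o + e.nodes - 1) (e.leafNode o u') x → lab u = lab u' →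
      (∀ l, e.HasLabel u l ↔ e.HasLabel u' l) ∧ ∀ y ∈ e.leaves,
        ¬ TreeLE (e.parent o) o (o + e.nodes - 1) (e.leafNode o y) x → (e.Adj u y ↔ e.Adj u' y) := by
  -- The equality of the labels in the final graph is proved along with the claim: a join above the
  -- node adds neighbors according to labels only, and equal labels stay equal under relabeling.
  induction e with
  | vertex i v =>
    intro o x _ _
    refine ⟨fun _ => i, fun u hu u' hu' _ _ _ => ?_⟩
    simp only [leaves, List.mem_singleton] at hu hu'
    simp [hu, hu']
  | join i j hij e ih =>
    intro o x h1 h2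
    obtain ⟨lab, h⟩ := ih hn o x h1 h2
    refine ⟨lab, fun u hu u' hu' hx hx' hl => ?_⟩
    obtain ⟨h3, h4⟩ := h u hu u' hu' hx hx' hl
    exact ⟨h3, fun y hy hxy => by simp only [Adj]; rw [h4 y hy hxy, h3, h3]⟩
  | relabel i j e ih =>
    intro o x h1 h2
    obtain ⟨lab, h⟩ := ih hn o x h1 h2
    refine ⟨lab, fun u hu u' hu' hx hx' hl => ?_⟩
    obtain ⟨h3, h4⟩ := h u hu u' hu' hx hx' hl
    exact ⟨fun l => by simp only [HasLabel, h3], h4⟩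
  | union e f ihe ihf =>
    intro o x h1 h2
    have hpe := e.nodes_pos
    have hpf := f.nodes_pos
    have hnodes : o + (union e f).nodes - 1 = o + e.nodes + f.nodes := by simp only [nodes]; omega
    have hpar := (union e f).parent_bounds o
    rw [hnodes]
    have hle : ∀ {a b}, TreeLE ((union e f).parent o) o (o + e.nodes + f.nodes) a b → a ≤ b :=
      fun h => h.le fun x hx hx' => (hpar x hx (by simp only [nodes]; omega)).1
    have hn' := hn
    simp only [leaves] at hn'
    rw [List.nodup_append'] at hn'
    -- Paths to a node in the range of `e` do not leave this range, so there the tree of the union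
    -- agrees with the tree of `e`; `hF` is the same for `f`.
    have hE : ∀ a b, o ≤ a → b < o + e.nodes →
        (TreeLE ((union e f).parent o) o (o + e.nodes + f.nodes) a b ↔
          TreeLE (e.parent o) o (o + e.nodes - 1) a b) := by
      intro a b ha hb
      constructor
      · intro h
        induction h using Relation.ReflTransGen.head_induction_on with
        | refl => exact Relation.ReflTransGen.refl
        | @head a c hac hcb ih =>
          obtain ⟨h3, h4, h5⟩ := hac
          have hcb' := hle hcb
          have hac' := (hpar a h3 (by simp only [nodes]; omega)).1
          have h6 : a + 1 < o + e.nodes := by omega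
          simp only [parent, if_pos h6] at h5
          exact (Relation.ReflTransGen.single ⟨h3, by omega, h5⟩).trans
            (ih (by have := e.parent_bounds o a h3 h6; omega))
      · intro h
        refine Relation.ReflTransGen.mono (fun a b hab => ⟨hab.1, by omega, ?_⟩) _ _ h
        rw [parent, if_pos (by omega), hab.2.2]
    have hF : ∀ a b, o + e.nodes ≤ a → b < o + e.nodes + f.nodes →
        (TreeLE ((union e f).parent o) o (o + e.nodes + f.nodes) a b ↔
          TreeLE (f.parent (o + e.nodes)) (o + e.nodes) (o + e.nodes + f.nodes - 1) a b) := by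
      intro a b ha hb
      constructor
      · intro h
        induction h using Relation.ReflTransGen.head_induction_on with
        | refl => exact Relation.ReflTransGen.refl
        | @head a c hac hcb ih =>
          obtain ⟨h3, h4, h5⟩ := hac
          have hcb' := hle hcb
          have hac' := (hpar a h3 (by simp only [nodes]; omega)).1
          have h6 : a + 1 < o + e.nodes + f.nodes := by omega
          simp only [parent, if_neg (show ¬ a + 1 < o + e.nodes by omega),
            if_neg (show ¬ a + 1 = o + e.nodes by omega), if_pos h6] at h5
          exact (Relation.ReflTransGen.single ⟨ha, by omega, h5⟩).trans
            (ih (by have := f.parent_bounds (o + e.nodes) a ha h6; omega))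
      · intro h
        refine Relation.ReflTransGen.mono (fun a b hab => ⟨by omega, by omega, ?_⟩) _ _ h
        rw [parent, if_neg (by omega), if_neg (by omega), if_pos (by omega), hab.2.2]
    have leafE : ∀ u ∈ e.leaves, (union e f).leafNode o u = e.leafNode o u := fun u hu => by
      simp only [leafNode, if_pos hu]
    have leafF : ∀ u ∈ f.leaves, (union e f).leafNode o u = f.leafNode (o + e.nodes) u := by
      intro u hu
      have : u ∉ e.leaves := fun h => hn'.2.2 h hu
      simp only [leafNode, if_neg this]
    have notE : ∀ u ∈ f.leaves, ∀ v, ¬ e.Adj u v ∧ ∀ l, ¬ e.HasLabel u l := fun u hu v =>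
      ⟨fun h => hn'.2.2 (e.mem_leaves_of_adj _ _ h).1 hu,
        fun l h => hn'.2.2 (e.mem_leaves_of_hasLabel _ _ h) hu⟩
    have notF : ∀ u ∈ e.leaves, ∀ v, ¬ f.Adj u v ∧ ∀ l, ¬ f.HasLabel u l := fun u hu v =>
      ⟨fun h => hn'.2.2 hu (f.mem_leaves_of_adj _ _ h).1,
        fun l h => hn'.2.2 hu (f.mem_leaves_of_hasLabel _ _ h)⟩
    rcases lt_trichotomy x (o + e.nodes + f.nodes) with hx | hx | hx
    · by_cases hx' : x < o + e.nodes
      · obtain ⟨lab, h⟩ := ihe hn'.1 o x h1 hx'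
        have inE : ∀ u ∈ (union e f).leaves, TreeLE ((union e f).parent o) o
            (o + e.nodes + f.nodes) ((union e f).leafNode o u) x → u ∈ e.leaves := by
          intro u hu hux
          simp only [leaves, List.mem_append] at hu
          by_contra h
          have hf := hu.resolve_left h
          rw [leafF u hf] at hux
          have := leafNode_bounds f (o + e.nodes) u hf
          have := hle hux
          omega
        refine ⟨lab, fun u hu u' hu' hux hux' hl => ?_⟩
        have hue := inE u hu hux
        have hue' := inE u' hu' hux'
        rw [leafE u hue, hE _ _ (leafNode_bounds e o u hue).1 hx'] at hux
        rw [leafE u' hue', hE _ _ (leafNode_bounds e o u' hue').1 hx'] at hux'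
        obtain ⟨h3, h4⟩ := h u hue u' hue' hux hux' hl
        refine ⟨fun l => ?_, fun y hy hyx => ?_⟩
        · simp only [HasLabel, (notF u hue u).2, (notF u' hue' u).2, or_false, h3]
        · simp only [Adj, (notF u hue y).1, (notF u' hue' y).1, or_false]
          by_cases hye : y ∈ e.leaves
          · rw [leafE y hye, hE _ _ (leafNode_bounds e o y hye).1 hx'] at hyx
            exact h4 y hye hyx
          -- A vertex of the other argument of the union has no edges to `e` yet; later joins are
          -- handled by the equality of labels.
          · exact iff_of_false (fun h => hye (e.mem_leaves_of_adj _ _ h).2)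
              (fun h => hye (e.mem_leaves_of_adj _ _ h).2)
      · obtain ⟨lab, h⟩ := ihf hn'.2.1 (o + e.nodes) x (by omega) hx
        have inF : ∀ u ∈ (union e f).leaves, TreeLE ((union e f).parent o) o
            (o + e.nodes + f.nodes) ((union e f).leafNode o u) x → u ∈ f.leaves := by
          intro u hu hux
          simp only [leaves, List.mem_append] at hu
          by_contra h
          have he := hu.resolve_right h
          rw [leafE u he] at hux
          have hb := leafNode_bounds e o u he
          -- From the range of `e` a path continues in this range or jumps to the new root; it never
          -- meets a node of `f` such as `x`.
          have key : ∀ a, TreeLE ((union e f).parent o) o (o + e.nodes + f.nodes) a x →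
              o ≤ a → a < o + e.nodes → False := by
            intro a ha
            induction ha using Relation.ReflTransGen.head_induction_on with
            | refl => intros; omega
            | @head a c hac hcb ih =>
              intro h3 h4
              obtain ⟨h5, h6, h7⟩ := hac
              have hcx := hle hcb
              simp only [parent] at h7
              split_ifs at h7 with h8 h9
              · have := e.parent_bounds o a h3 h8
                exact ih (by omega) (by omega)
              · omega
              · omega
              · omega
          exact key _ hux hb.1 hb.2
        refine ⟨lab, fun u hu u' hu' hux hux' hl => ?_⟩
        have hue := inF u hu hux
        have hue' := inF u' hu' hux'
        rw [leafF u hue, hF _ _ (leafNode_bounds f _ u hue).1 hx] at hux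
        rw [leafF u' hue', hF _ _ (leafNode_bounds f _ u' hue').1 hx] at hux'
        obtain ⟨h3, h4⟩ := h u hue u' hue' hux hux' hl
        refine ⟨fun l => ?_, fun y hy hyx => ?_⟩
        · simp only [HasLabel, (notE u hue u).2, (notE u' hue' u).2, false_or, h3]
        · simp only [Adj, (notE u hue y).1, (notE u' hue' y).1, false_or]
          by_cases hye : y ∈ f.leaves
          · rw [leafF y hye, hF _ _ (leafNode_bounds f _ y hye).1 hx] at hyx
            exact h4 y hye hyx
          · exact iff_of_false (fun h => hye (f.mem_leaves_of_adj _ _ h).2)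
              (fun h => hye (f.mem_leaves_of_adj _ _ h).2)
    · obtain ⟨lab, h⟩ := (union e f).exists_label_of_root hn
      refine ⟨lab, fun u hu u' hu' _ _ hl => ⟨h u hu u' hu' hl, fun y hy hyx => ?_⟩⟩
      -- Everything is below the root, so there is no vertex `y` outside and only the labels matter.
      refine absurd ?_ hyx
      rw [hx]
      have hb := leafNode_bounds (union e f) o y hy
      refine treeLE_root (fun z hz hz' => ?_) _ hb.1 (by simp only [nodes] at hb; omega)
      have := hpar z hz (by simp only [nodes]; omega)
      simp only [nodes] at this
      omega
    · simp only [nodes] at h2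
      omega

end CWExpr

/-! ### Cut trees, abstracted from expressions. -/

/-- A rooted tree whose leaves are the vertices of `G`, with the properties used for balanced
separators. -/
structure CutTree {n : ℕ} (G : SimpleGraph (Fin n)) (k : ℕ) : Type where
  root : ℕ
  par : ℕ → ℕ
  leaf : Fin n → ℕ
  lt_par : ∀ x < root, x < par x
  par_le : ∀ x < root, par x ≤ root
  leaf_le : ∀ v, leaf v ≤ root
  leaf_inj : Function.Injective leaf
  par_ne_leaf : ∀ x < root, ∀ v, par x ≠ leaf v
  card_children : ∀ y, ((Finset.range root).filter fun x => par x = y).card ≤ 2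
  classes : ∀ x ≤ root, ∃ lab : Fin n → Fin k, ∀ u u',
    TreeLE par 0 root (leaf u) x → TreeLE par 0 root (leaf u') x → lab u = lab u' →
      ∀ y, ¬ TreeLE par 0 root (leaf y) x → (G.Adj u y ↔ G.Adj u' y)

/-- The tree of an expression. -/
def CWExpr.cutTree {n k : ℕ} {G : SimpleGraph (Fin n)} (e : CWExpr (Fin n) k)
    (h : e.Generates G) : CutTree G k where
  root := e.nodes - 1
  par := e.parent 0
  leaf := e.leafNode 0
  lt_par x hx := (e.parent_bounds 0 x (Nat.zero_le _) (by omega)).1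
  par_le x hx := by have := (e.parent_bounds 0 x (Nat.zero_le _) (by omega)).2; omega
  leaf_le v := by have := (e.leafNode_bounds 0 v (h.2.1 v)).2; omega
  leaf_inj u v huv := e.leafNode_injOn 0 u (h.2.1 u) v (h.2.1 v) huv
  par_ne_leaf x hx v := e.parent_ne_leafNode 0 x (Nat.zero_le _) (by omega) v (h.2.1 v)
  card_children y := by simpa using e.card_children_le 0 y
  classes x hx := by
    have hp := e.nodes_pos
    obtain ⟨lab, hl⟩ := e.exists_classes h.1 0 x (Nat.zero_le _) (by omega)
    simp only [zero_add] at hl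
    refine ⟨lab, fun u u' hu hu' huu y hy => ?_⟩
    rw [h.2.2, h.2.2]
    exact (hl u (h.2.1 u) u' (h.2.1 u') hu hu' huu).2 y (h.2.1 y) hy

/-! ### Balanced cuts of the tree -/

namespace CutTree

variable {n k : ℕ} {G : SimpleGraph (Fin n)} (T : CutTree G k)

/-- The position of the vertex `v` after the nodes `0, …, i - 1` have been processed, when every
vertex moves from its leaf upwards and stops at the first cut node. -/
def token (cut : ℕ → ℕ) : ℕ → Fin n → ℕ
  | 0, v => T.leaf v
  | i + 1, v => if token cut i v = i ∧ cut i = 0 then T.par i else token cut i v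

/-- The number of vertices that reach the node `x`. -/
def count (cut : ℕ → ℕ) (x : ℕ) : ℕ := (Finset.univ.filter fun v => T.token cut x v = x).card

/-- `comp x` is the first cut node on the path from `x` to the root. -/
structure IsComp (cut comp : ℕ → ℕ) : Prop where
  root : cut T.root ≠ 0
  self : ∀ x ≤ T.root, cut x ≠ 0 → comp x = x
  up : ∀ x ≤ T.root, cut x = 0 → comp x = comp (T.par x)

/-- The node `x` is the first one in its component that has at least a third of the vertices of the
component below it. -/
def Selected (cut comp : ℕ → ℕ) (x : ℕ) : Prop :=
  2 ≤ T.count cut (comp x) ∧ T.count cut (comp x) ≤ 3 * T.count cut x ∧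
    ∀ y < x, comp y = comp x → 3 * T.count cut y < T.count cut (comp x)

/-- The next set of cut nodes. -/
def IsNext (cut comp cut' : ℕ → ℕ) : Prop :=
  ∀ x ≤ T.root, cut' x ≠ 0 ↔ cut x ≠ 0 ∨ T.Selected cut comp x

variable {T} {cut comp cut' comp' : ℕ → ℕ}

theorem IsComp.lt_root (h : T.IsComp cut comp) {x : ℕ} (hx : x ≤ T.root) (hc : cut x = 0) :
    x < T.root := lt_of_le_of_ne hx fun hr => h.root (hr ▸ hc)

theorem IsComp.induction (h : T.IsComp cut comp) {P : ℕ → Prop}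
    (hcut : ∀ x ≤ T.root, cut x ≠ 0 → P x)
    (hup : ∀ x ≤ T.root, cut x = 0 → P (T.par x) → P x) : ∀ x ≤ T.root, P x := by
  suffices hs : ∀ m x, T.root - x = m → x ≤ T.root → P x from fun x => hs _ x rfl
  intro m
  induction m using Nat.strong_induction_on with
  | _ m ih =>
    intro x hm hx
    by_cases hc : cut x = 0
    · have hlt := h.lt_root hx hc
      have := T.lt_par x hlt
      have := T.par_le x hlt
      exact hup x hx hc (ih (T.root - T.par x) (by omega) _ rfl this)
    · exact hcut x hx hc

theorem IsComp.comp_spec (h : T.IsComp cut comp) : ∀ x ≤ T.root,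
    x ≤ comp x ∧ comp x ≤ T.root ∧ cut (comp x) ≠ 0 ∧ TreeLE T.par 0 T.root x (comp x) := by
  refine h.induction (fun x hx hc => ?_) (fun x hx hc ih => ?_)
  · rw [h.self x hx hc]
    exact ⟨le_rfl, hx, hc, Relation.ReflTransGen.refl⟩
  · rw [h.up x hx hc]
    have hlt := h.lt_root hx hc
    have := T.lt_par x hlt
    exact ⟨by omega, ih.2.1, ih.2.2.1,
      (Relation.ReflTransGen.single ⟨Nat.zero_le _, hlt, rfl⟩).trans ih.2.2.2⟩

/-- A moving vertex stays in the component of its leaf, as it passes only nodes that are not cut. A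
node behind the current index holds a vertex only if it is cut. -/
theorem IsComp.token_spec (h : T.IsComp cut comp) (v : Fin n) (i : ℕ) :
    T.token cut i v ≤ T.root ∧ comp (T.token cut i v) = comp (T.leaf v) ∧
      (T.token cut i v < i → cut (T.token cut i v) ≠ 0) := by
  induction i with
  | zero => exact ⟨T.leaf_le v, rfl, fun h => absurd h (by omega)⟩
  | succ i ih =>
    obtain ⟨h1, h2, h3⟩ := ih
    simp only [token]
    split_ifs with hc
    · have hlt := h.lt_root (by omega) hc.2
      have := T.lt_par i hlt
      rw [hc.1] at h2
      exact ⟨T.par_le i hlt, by rw [← h2, ← h.up i hlt.le hc.2], fun _ => by omega⟩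
    · refine ⟨h1, h2, fun hlt => ?_⟩
      by_cases he : T.token cut i v = i
      · rw [he]; exact fun h0 => hc ⟨he, h0⟩
      · exact h3 (by omega)

/-- A move at index `i` leads to a node beyond `i`, so the node `x` is not entered at an index `x`
or later: a vertex found there was there when `x` was processed. -/
theorem token_back (h : T.IsComp cut comp) {v : Fin n} {x : ℕ} :
    ∀ i, x ≤ i → T.token cut i v = x → T.token cut x v = x := by
  intro i
  induction i with
  | zero => intro hx h0; obtain rfl : x = 0 := by omega
            exact h0
  | succ i ih =>
    intro hx hi
    rcases hx.lt_or_eq with hlt | rfl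
    · refine ih (by omega) ?_
      simp only [token] at hi
      split_ifs at hi with hc
      · have h1 := (h.token_spec v i).1
        have := T.lt_par i (h.lt_root (by omega) hc.2)
        omega
      · exact hi
    · exact hi

/-- Vertices stop exactly at the cut node of their component, so its count is the size of the
component. -/
theorem count_of_cut (h : T.IsComp cut comp) {c : ℕ} (hc : c ≤ T.root) (hcut : cut c ≠ 0) :
    T.count cut c = (Finset.univ.filter fun v => comp (T.leaf v) = c).card := by
  unfold count
  congr 1
  ext v
  simp only [Finset.mem_filter, Finset.mem_univ, true_and]
  constructor
  · intro hv
    rw [← (h.token_spec v c).2.1, hv, h.self c hc hcut]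
  · intro hv
    obtain ⟨h1, h2, h3⟩ := h.token_spec v (T.root + 1)
    have h4 := h3 (by omega)
    refine token_back h (T.root + 1) (by omega) ?_
    rw [← hv, ← h2, h.self _ h1 h4]

/-- The recurrence behind `countBelow`: processing `i` hands its count to the parent, unless `i` is
cut. -/
theorem count_succ (i x : ℕ) (hx : i < x) :
    (Finset.univ.filter fun v => T.token cut (i + 1) v = x).card =
      (Finset.univ.filter fun v => T.token cut i v = x).card +
        if cut i = 0 ∧ T.par i = x then T.count cut i else 0 := by
  split_ifs with hc
  · rw [count, ← Finset.card_union_of_disjoint]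
    · congr 1
      ext v
      simp only [Finset.mem_filter, Finset.mem_univ, true_and, Finset.mem_union]
      simp only [token]
      split_ifs with h1
      · simp [h1.1, hc.2]
      · constructor
        · exact Or.inl
        · rintro (h2 | h2)
          exacts [h2, absurd ⟨h2, hc.1⟩ h1]
    · rw [Finset.disjoint_left]
      intro v h1 h2
      simp only [Finset.mem_filter, Finset.mem_univ, true_and] at h1 h2
      omega
  · rw [add_zero]
    congr 1
    ext v
    simp only [Finset.mem_filter, Finset.mem_univ, true_and]
    simp only [token]
    split_ifs with h1
    · rw [h1.1]
      constructor
      · intro h2; exact absurd ⟨h1.2, h2⟩ hc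
      · intro h2; omega
    · rfl

theorem token_mem_cases (h : T.IsComp cut comp) {v : Fin n} {x : ℕ} (hx : x ≤ T.root)
    (hv : T.token cut x v = x) : T.leaf v = x ∨
      ∃ y < T.root, T.par y = x ∧ cut y = 0 ∧ comp y = comp x ∧ T.token cut y v = y := by
  have : ∀ i ≤ x, T.token cut i v = x → T.leaf v = x ∨
      ∃ y < T.root, T.par y = x ∧ cut y = 0 ∧ comp y = comp x ∧ T.token cut y v = y := by
    intro i
    induction i with
    | zero => exact fun _ h0 => Or.inl h0
    | succ i ih =>
      intro hi h1
      simp only [token] at h1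
      split_ifs at h1 with hc
      · exact Or.inr ⟨i, by omega, h1, hc.2, by rw [h.up i (by omega) hc.2, h1], hc.1⟩
      · exact ih (by omega) h1
  exact this x le_rfl hv

/-- A leaf is no parent, so at most one vertex reaches it, which is at most two thirds of a
component of two or more vertices. Any other node receives its vertices from at most two children in
the same component, and these precede it, so by minimality each brings less than a third. -/
theorem Selected.count_le (h : T.IsComp cut comp) {x : ℕ} (hx : x ≤ T.root)
    (hs : T.Selected cut comp x) : 3 * T.count cut x ≤ 2 * T.count cut (comp x) := by
  obtain ⟨h2, -, hlt⟩ := hs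
  by_cases hleaf : ∃ v, T.leaf v = x
  · obtain ⟨v, hv⟩ := hleaf
    have : T.count cut x ≤ 1 := by
      refine Finset.card_le_one.2 fun a ha b hb => ?_
      simp only [Finset.mem_filter, Finset.mem_univ, true_and] at ha hb
      have key : ∀ a, T.token cut x a = x → T.leaf a = x := by
        intro a ha
        rcases token_mem_cases h hx ha with h' | ⟨y, hy, hp, -⟩
        · exact h'
        · exact absurd (hp.trans hv.symm) (T.par_ne_leaf y hy v)
      exact T.leaf_inj ((key a ha).trans (key b hb).symm)
    omega
  · set S := ((Finset.range T.root).filter fun y => T.par y = x).filter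
      fun y => comp y = comp x with hS
    have hsub : (Finset.univ.filter fun v => T.token cut x v = x) ⊆
        S.biUnion fun y => Finset.univ.filter fun v => T.token cut y v = y := by
      intro v hv
      simp only [Finset.mem_filter, Finset.mem_univ, true_and] at hv
      rcases token_mem_cases h hx hv with h' | ⟨y, hy, hp, -, hcy, ht⟩
      · exact absurd ⟨v, h'⟩ hleaf
      · simp only [Finset.mem_biUnion, Finset.mem_filter, Finset.mem_univ, true_and, hS,
          Finset.mem_range]
        exact ⟨y, ⟨⟨hy, hp⟩, hcy⟩, ht⟩
    have h3 : T.count cut x ≤ ∑ y ∈ S, T.count cut y :=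
      (Finset.card_le_card hsub).trans Finset.card_biUnion_le
    have h4 : ∑ y ∈ S, 3 * T.count cut y ≤ ∑ y ∈ S, T.count cut (comp x) := by
      refine Finset.sum_le_sum fun y hy => ?_
      simp only [hS, Finset.mem_filter, Finset.mem_range] at hy
      have := T.lt_par y hy.1.1
      exact (hlt y (by omega) hy.2).le
    have h5 : S.card ≤ 2 := (Finset.card_filter_le _ _).trans (T.card_children x)
    rw [← Finset.mul_sum] at h4
    rw [Finset.sum_const, smul_eq_mul] at h4
    have := Nat.mul_le_mul_right (T.count cut (comp x)) h5
    omega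

/-- The top node of a component holds all its vertices, which is more than two thirds. -/
theorem Selected.ne (h : T.IsComp cut comp) {x : ℕ} (hx : x ≤ T.root)
    (hs : T.Selected cut comp x) : x ≠ comp x ∧ cut x = 0 := by
  have h1 := hs.count_le h hx
  have h2 : x ≠ comp x := fun he => by
    have := hs.1
    rw [← he] at h1 this
    omega
  exact ⟨h2, by_contra fun hc => h2 (h.self x hx hc).symm⟩

theorem Selected.unique {x y : ℕ} (hx : T.Selected cut comp x) (hy : T.Selected cut comp y)
    (h : comp x = comp y) : x = y := by
  rcases lt_trichotomy x y with hlt | he | hlt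
  · have h1 := hy.2.2 x hlt h
    have h2 := hx.2.1
    rw [h] at h2; omega
  · exact he
  · have h1 := hx.2.2 y hlt h.symm
    have h2 := hy.2.1
    rw [← h] at h2; omega

/-- The node `c` itself has enough vertices; the selected node is the least one in the component
that does. -/
theorem exists_selected (h : T.IsComp cut comp) {c : ℕ} (hc : c ≤ T.root) (hcut : cut c ≠ 0)
    (h2 : 2 ≤ T.count cut c) : ∃ x ≤ T.root, T.Selected cut comp x ∧ comp x = c := by
  classical
  have hex : ∃ x, comp x = c ∧ T.count cut c ≤ 3 * T.count cut x :=
    ⟨c, h.self c hc hcut, by omega⟩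
  have hle : Nat.find hex ≤ c := Nat.find_min' hex ⟨h.self c hc hcut, by omega⟩
  obtain ⟨h3, h4⟩ := Nat.find_spec hex
  refine ⟨Nat.find hex, hle.trans hc, ⟨by rwa [h3], by rwa [h3], fun y hy hyc => ?_⟩, h3⟩
  have := Nat.find_min hex hy
  rw [h3] at hyc ⊢
  by_contra hcon
  exact this ⟨hyc, by omega⟩

section next

variable (h : T.IsComp cut comp) (hn : T.IsNext cut comp cut') (h' : T.IsComp cut' comp')

include h hn h'

/-- New cuts only refine components: the first new cut node above `x` is still below, or equal to,
the first old one. -/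
theorem comp_comp_next : ∀ x ≤ T.root, comp (comp' x) = comp x := by
  refine h'.induction (fun x hx hc => by rw [h'.self x hx hc]) (fun x hx hc ih => ?_)
  have hc0 : cut x = 0 := by
    by_contra hne
    exact (hn x hx).2 (Or.inl hne) hc
  rw [h'.up x hx hc, h.up x hx hc0, ih]

theorem comp_next_cases (x : ℕ) (hx : x ≤ T.root) :
    comp' x = comp x ∨ T.Selected cut comp (comp' x) := by
  obtain ⟨-, h1, h2, -⟩ := h'.comp_spec x hx
  rcases (hn _ h1).1 h2 with h3 | h3
  · left
    rw [← comp_comp_next h hn h' x hx, h.self _ h1 h3]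
  · exact Or.inr h3

/-- At most one node is selected in each component, so a component splits into at most two. Hence
one bit per level determines the new piece within the old one. -/
theorem comp_next_eq_iff {x y : ℕ} (hx : x ≤ T.root) (hy : y ≤ T.root) :
    comp' x = comp' y ↔ comp x = comp y ∧ (comp' x = comp x ↔ comp' y = comp y) := by
  have h1 := comp_comp_next h hn h' x hx
  have h2 := comp_comp_next h hn h' y hy
  constructor
  · intro he
    have : comp x = comp y := by rw [← h1, he, h2]
    exact ⟨this, by rw [he, this]⟩
  · rintro ⟨he, hs⟩
    by_cases hc : comp' x = comp x
    · rw [hc, hs.1 hc, he]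
    · have h3 := (comp_next_cases h hn h' x hx).resolve_left hc
      have h4 := (comp_next_cases h hn h' y hy).resolve_left fun h => hc (hs.2 h)
      exact h3.unique h4 (by rw [h1, h2, he])

/-- By uniqueness of the selected node, a vertex of this component passes no new cut before `t`. Its
new component is therefore that of `t` exactly if it reaches `t`. -/
theorem token_next {t : ℕ} (ht : t ≤ T.root) (hs : T.Selected cut comp t) (v : Fin n) :
    comp' (T.leaf v) = t ↔ T.token cut t v = t := by
  have hcut't : cut' t ≠ 0 := (hn t ht).2 (Or.inr hs)
  have stay : comp (T.leaf v) = comp t → ∀ i ≤ t, comp' (T.token cut i v) = comp' (T.leaf v) := by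
    intro hc i
    induction i with
    | zero => exact fun _ => rfl
    | succ i ih =>
      intro hi
      rw [← ih (by omega)]
      simp only [token]
      split_ifs with hm
      · rw [hm.1]
        have hcut' : cut' i = 0 := by
          by_contra hne
          rcases (hn i (by omega)).1 hne with h1 | h1
          · exact h1 hm.2
          · have h2 := (h.token_spec v i).2.1
            rw [hm.1, hc] at h2
            have := h1.unique hs h2
            omega
        rw [h'.up i (by omega) hcut']
      · rfl
  constructor
  · intro hv
    have hc : comp (T.leaf v) = comp t := by
      rw [← comp_comp_next h hn h' _ (T.leaf_le v), hv]
    have h1 := stay hc t le_rfl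
    rw [hv] at h1
    obtain ⟨h2, -, h3⟩ := h.token_spec v t
    have h4 := (h'.comp_spec _ h2).1
    rw [h1] at h4
    by_contra hne
    have h5 := (hn _ h2).2 (Or.inl (h3 (by omega)))
    rw [h'.self _ h2 h5] at h1
    exact hne h1
  · intro hv
    have h2 := (h.token_spec v t).2.1
    rw [hv] at h2
    rw [← stay h2.symm t le_rfl, hv, h'.self t ht hcut't]

/-- A new component is either the part below a selected node, with at most two thirds of the old
vertices, or what remains above it, after the loss of at least a third. Components that are not cut
have at most one vertex. -/
theorem card_next {c : ℕ} (hc : c ≤ T.root) {m : ℕ}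
    (hm : ∀ c ≤ T.root, (Finset.univ.filter fun v => comp (T.leaf v) = c).card ≤ m) :
    (Finset.univ.filter fun v => comp' (T.leaf v) = c).card ≤ 1 ∨
      3 * (Finset.univ.filter fun v => comp' (T.leaf v) = c).card ≤ 2 * m := by
  by_cases hcut' : cut' c = 0
  · left
    have : (Finset.univ.filter fun v => comp' (T.leaf v) = c) = ∅ := by
      rw [Finset.filter_eq_empty_iff]
      intro v _ hv
      exact (h'.comp_spec _ (T.leaf_le v)).2.2.1 (hv ▸ hcut')
    rw [this]; simp
  rcases (hn c hc).1 hcut' with h1 | h1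
  · have h2 := count_of_cut h hc h1
    by_cases h3 : 2 ≤ T.count cut c
    · right
      obtain ⟨t, ht, hs, htc⟩ := exists_selected h hc h1 h3
      have h4 : (Finset.univ.filter fun v => comp' (T.leaf v) = c) ⊆
          (Finset.univ.filter fun v => comp (T.leaf v) = c) \
            (Finset.univ.filter fun v => T.token cut t v = t) := by
        intro v hv
        simp only [Finset.mem_filter, Finset.mem_univ, true_and, Finset.mem_sdiff] at hv ⊢
        refine ⟨by rw [← comp_comp_next h hn h' _ (T.leaf_le v), hv, h.self c hc h1], fun h5 => ?_⟩
        rw [← token_next h hn h' ht hs, hv] at h5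
        exact (hs.ne h ht).1 (by rw [htc, h5])
      have h5 : (Finset.univ.filter fun v => T.token cut t v = t) ⊆
          (Finset.univ.filter fun v => comp (T.leaf v) = c) := by
        intro v hv
        simp only [Finset.mem_filter, Finset.mem_univ, true_and] at hv ⊢
        rw [← (h.token_spec v t).2.1, hv, htc]
      have h6 := Finset.card_le_card h4
      rw [Finset.card_sdiff_of_subset h5] at h6
      have h7 := hs.2.1
      rw [htc, h2] at h7
      have h8 := hm c hc
      unfold count at h7
      omega
    · left
      refine (Finset.card_le_card fun v hv => ?_).trans (show T.count cut c ≤ 1 by omega)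
      simp only [Finset.mem_filter, Finset.mem_univ, true_and] at hv ⊢
      have h4 : comp (T.leaf v) = c := by
        rw [← comp_comp_next h hn h' _ (T.leaf_le v), hv, h.self c hc h1]
      obtain ⟨h5, h6, h7⟩ := h.token_spec v (T.root + 1)
      refine token_back h (T.root + 1) (by omega) ?_
      rw [← h4, ← h6, h.self _ h5 (h7 (by omega))]
  · right
    have h2 : (Finset.univ.filter fun v => comp' (T.leaf v) = c).card = T.count cut c := by
      unfold count
      congr 1
      ext v
      simp only [Finset.mem_filter, Finset.mem_univ, true_and]
      exact token_next h hn h' hc h1 v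
    have h3 := h1.count_le h hc
    obtain ⟨-, h4, h5, -⟩ := h.comp_spec c hc
    rw [count_of_cut h h4 h5] at h3
    have := hm _ h4
    omega

/-- In every component, the vertices that are cut off fall into at most `k` classes with respect to
their neighbors in the rest of the component. -/
theorem classes_next {c : ℕ} : ∃ lab : Fin n → Fin k, ∀ u u' y,
    comp (T.leaf u) = c → comp (T.leaf u') = c → comp (T.leaf y) = c →
    comp' (T.leaf u) ≠ c → comp' (T.leaf u') ≠ c → comp' (T.leaf y) = c →
    lab u = lab u' → (G.Adj u y ↔ G.Adj u' y) := by
  by_cases hex : ∃ u, comp (T.leaf u) = c ∧ comp' (T.leaf u) ≠ c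
  · obtain ⟨u₀, h1, h2⟩ := hex
    -- All vertices cut off from the component share this new cut node `t` and are below it, so the
    -- classes of `t` serve for them. It remains to see that a vertex `y` which stays is not below
    -- `t`.
    set t := comp' (T.leaf u₀) with ht
    have hs : T.Selected cut comp t :=
      (comp_next_cases h hn h' _ (T.leaf_le u₀)).resolve_left (by rwa [h1])
    obtain ⟨-, htr, hct, -⟩ := h'.comp_spec _ (T.leaf_le u₀)
    rw [← ht] at htr hct
    have htc : comp t = c := by rw [ht, comp_comp_next h hn h' _ (T.leaf_le u₀), h1]
    obtain ⟨lab, hlab⟩ := T.classes t htr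
    have heq : ∀ u, comp (T.leaf u) = c → comp' (T.leaf u) ≠ c → comp' (T.leaf u) = t := by
      intro u hu hu'
      rw [ht, comp_next_eq_iff h hn h' (T.leaf_le u) (T.leaf_le u₀), hu, h1]
      exact ⟨rfl, iff_of_false hu' h2⟩
    have hle : ∀ u, comp (T.leaf u) = c → comp' (T.leaf u) ≠ c →
        TreeLE T.par 0 T.root (T.leaf u) t := by
      intro u hu hu'
      have := (h'.comp_spec _ (T.leaf_le u)).2.2.2
      rwa [heq u hu hu'] at this
    refine ⟨lab, fun u u' y hu hu' hy hu2 hu2' hy2 hl =>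
      hlab u u' (hle u hu hu2) (hle u' hu' hu2') hl y fun hyt => ?_⟩
    -- A path inside the component that ends in `t` meets no cut node before `t`: an old cut node
    -- would be the top of the component, and a new one would be a second selected node.
    have key : ∀ a, TreeLE T.par 0 T.root a t → comp a = c → comp' a = t := by
      intro a ha
      induction ha using Relation.ReflTransGen.head_induction_on with
      | refl => exact fun _ => h'.self t htr hct
      | @head a b hab hbt ih =>
        obtain ⟨-, har, hpb⟩ := hab
        have hbt' := TreeLE.le (fun x _ hx => T.lt_par x hx) hbt
        have hab' := T.lt_par a har
        intro hac
        have hc0 : cut a = 0 := by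
          by_contra hne
          have h3 := h.self a har.le hne
          have := (h.comp_spec t htr).1
          omega
        have hc0' : cut' a = 0 := by
          by_contra hne
          rcases (hn a har.le).1 hne with h3 | h3
          · exact h3 hc0
          · have := h3.unique hs (hac.trans htc.symm)
            omega
        rw [h'.up a har.le hc0', hpb]
        exact ih (by rw [← hpb, ← h.up a har.le hc0, hac])
    have := key _ hyt hy
    rw [hy2] at this
    exact (hs.ne h htr).1 (by rw [htc, this])
  -- Nothing is cut off; any map to `Fin k` will do, and this produces one.
  · obtain ⟨lab, -⟩ := T.classes T.root le_rfl
    exact ⟨lab, fun u u' y hu _ _ hu2 _ _ _ => absurd ⟨u, hu, hu2⟩ hex⟩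

end next

end CutTree

/-! ### Breadth-first search on the word RAM -/

namespace WordRAM

/-- The registers of the preprocessing program. -/
inductive PReg : Type
  | res | n | kk | root | lam | half | bits | pow | stride | wds | pos | ptr | nn | sp
  | i | j | v | u | c | x | h | tail | r | l
  deriving DecidableEq

/-- The arrays of the preprocessing program. -/
inductive PArr : Type
  | io | adj | off | len | par | leaf | stk | cut | cnt | sel | comp | comp' | cc | side | deg
  | done | rep | inN | num | inX | dist | que | start
  deriving DecidableEq

/-- Expressions of the preprocessing program. -/
abbrev PExp := Exp PReg PArr
/-- Statements of the preprocessing program. -/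
abbrev PStmt := Stmt PReg PArr
/-- Stores of the preprocessing program. -/
abbrev PStore := Store PReg PArr

infixr:40 " ;; " => Stmt.seq

/-- Addition of expressions. -/
def Exp.add {ρ α : Type} (x y : Exp ρ α) : Exp ρ α := .op .add x y

/-- The entry of an array at the index in a register. -/
def Exp.at {ρ α : Type} (a : α) (r : ρ) : Exp ρ α := .get a (.reg r)

open Exp Stmt

/-- For all neighbors `u` of `v`. -/
def forAdj (body : PStmt) : PStmt :=
  loop .j (.at .len .v) (set .u (.get .adj (.add (.at .off .v) (.reg .j))) ;; body)

/-- Breadth-first search from the vertices marked in `src`, within pieces with equal `cc`. -/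
def bfs (src : PArr) : PStmt :=
  set .tail (.const 0) ;;
  (loop .v (.reg .n) (put .dist (.reg .v) (.const 0) ;;
    cond .ne (.at src .v) (.const 0) (put .dist (.reg .v) (.const 1) ;;
      put .que (.reg .tail) (.reg .v) ;; set .tail (.add (.reg .tail) (.const 1)))) ;;
  loop .h (.reg .n) (cond .lt (.reg .h) (.reg .tail) (set .v (.at .que .h) ;;
    forAdj (cond .eq (.at .cc .u) (.at .cc .v) (cond .eq (.at .dist .u) (.const 0)
      (put .dist (.reg .u) (.add (.at .dist .v) (.const 1)) ;;
        put .que (.reg .tail) (.reg .u) ;; set .tail (.add (.reg .tail) (.const 1))))))))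

/-- The registers and arrays that hold the graph. -/
structure HasGraph {n : ℕ} (adj : Fin n → List (Fin n)) (s : PStore) : Prop where
  card : s.reg .n = n
  len : ∀ v : Fin n, s.arr .len v = (adj v).length
  adj : ∀ (v : Fin n) (i : ℕ) (hi : i < (adj v).length), s.arr .adj (s.arr .off v + i) = (adj v)[i]

theorem HasGraph.congr {n : ℕ} {adj : Fin n → List (Fin n)} {s s' : PStore} (h : HasGraph adj s)
    (hn : s'.reg .n = s.reg .n) (hl : s'.arr .len = s.arr .len) (ha : s'.arr .adj = s.arr .adj)
    (ho : s'.arr .off = s.arr .off) : HasGraph adj s' :=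
  ⟨by rw [hn, h.card], by rw [hl]; exact h.len, by rw [ha, ho]; exact h.adj⟩

theorem HasGraph.frame {n : ℕ} {adj : Fin n → List (Fin n)} {s s' : PStore} {p : PStmt}
    (h : HasGraph adj s) (hf : p.Frame s s')
    (hp : PReg.n ∉ p.wregs ∧ PArr.len ∉ p.warrs ∧ PArr.adj ∉ p.warrs ∧ PArr.off ∉ p.warrs) :
    HasGraph adj s' :=
  h.congr (hf.reg _ hp.1) (hf.arr _ hp.2.1) (hf.arr _ hp.2.2.1) (hf.arr _ hp.2.2.2)

theorem exists_prefix_of_lt {β : Type} (L : List β) (i : ℕ) (hi : i < L.length) :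
    L.take i ++ [L[i]] <+: L := by
  rw [List.take_append_getElem]
  exact List.take_prefix _ _

/-- The invariant is indexed by the list of neighbors already visited. The 13 extra steps per
neighbor are those of fetching it and of the loop itself. -/
theorem forAdj_runs {n M c b : ℕ} {adj : Fin n → List (Fin n)} {s : PStore} {v : Fin n}
    {body : PStmt} (I : List (Fin n) → PStore → Prop) (hg : HasGraph adj s) (hv : s.reg .v = v)
    (hw : PReg.v ∉ body.wregs ∧ PArr.len ∉ body.warrs ∧ PArr.adj ∉ body.warrs ∧
      PArr.off ∉ body.warrs) (h0 : I [] s)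
    (hstep : ∀ (l : List (Fin n)) (u : Fin n) (s' : PStore), (forAdj body).Frame s s' → l ++ [u] <+: adj v → I l s' →
      body.Runs (Guard.free _ M) ((s'.set .j l.length).set .u u) b (I (l ++ [u])))
    (hc : 5 + (adj v).length * (b + 13) ≤ c) :
    (forAdj body).Runs (Guard.free _ M) s c (I (adj v)) := by
  have hN : (Exp.at PArr.len PReg.v).eval s = (adj v).length := by
    simp only [Exp.at, Exp.eval, hv, hg.len]
  have hmain := Runs.loop_const (Γ := Guard.free PArr M) (r := PReg.j) (e := .at .len .v)
    (p := set .u (.get .adj (.add (.at .off .v) (.reg .j))) ;; body) (s := s) (c := c)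
    (fun i s' => I ((adj v).take i) s') (9 + b) (Exp.safe_free _ _) (by simpa using h0) ?_ ?_
  · rw [hN] at hmain
    simp only [List.take_length] at hmain
    exact hmain
  · intro i hi s' hf hI
    rw [hN] at hi
    have hlen : ((adj v).take i).length = i := by simp; omega
    have hv' : s'.reg .v = v := by
      rw [hf.reg, hv]
      simpa [wregs] using hw.1
    have ho : s'.arr .off = s.arr .off := hf.arr _ (by simpa [warrs] using hw.2.2.2)
    have ha : s'.arr .adj = s.arr .adj := hf.arr _ (by simpa [warrs] using hw.2.2.1)
    refine Runs.seq (Q' := fun s'' => s'' = (s'.set .j i).set .u (adj v)[i])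
      (Runs.straight rfl rfl (Nat.le_of_ble_eq_true rfl) ?_) ?_
    · simp only [den, Exp.eval, Exp.add, Exp.at, BinOp.eval, Store.set_reg, Store.set_arr, reduceCtorEq,
        if_true, if_false, hv', ho, ha, hg.adj v i hi]
    · rintro _ - rfl
      have := hstep ((adj v).take i) (adj v)[i] s' hf (exists_prefix_of_lt _ _ hi) hI
      rw [hlen] at this
      refine this.mono le_rfl fun s'' _ h => ?_
      rwa [List.take_append_getElem] at h
  · rw [hN]
    simp only [Exp.at, Exp.cost]
    rw [show 9 + b + 4 = b + 13 by omega]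
    exact hc

/-! ### The queue invariant of breadth-first search. -/

/-- The invariant of breadth-first search with queue `Q`, whose first `h` elements have been
processed. -/
structure BFSInv {n : ℕ} (H : SimpleGraph (Fin n)) (S : Set (Fin n)) (Q : List (Fin n)) (h : ℕ)
    (D : Fin n → ℕ) : Prop where
  nodup : Q.Nodup
  mem : ∀ v, v ∈ Q ↔ D v ≠ 0
  src : ∀ v ∈ S, D v = 1
  sound : ∀ v, D v ≠ 0 → ∃ s ∈ S, H.edist v s + 1 ≤ D v
  mono : Q.Pairwise fun a b => D a ≤ D b
  span : ∀ a ∈ Q.drop h, ∀ b ∈ Q, D b ≤ D a + 1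
  closed : ∀ a ∈ Q.take h, ∀ u, H.Adj a u → D u ≠ 0 ∧ D u ≤ D a + 1

/-- Unprocessed entries are at least the value of the head `v`, and all entries are at most `D v +
1`. So appending `u` with the value `D v + 1` keeps the queue sorted and of span one. -/
theorem BFSInv.visit {n : ℕ} {H : SimpleGraph (Fin n)} {S : Set (Fin n)} {Q : List (Fin n)} {h : ℕ}
    {D : Fin n → ℕ} (I : BFSInv H S Q h D) {v u : Fin n} (hh : h < Q.length) (hv : Q[h] = v)
    (hadj : H.Adj v u) (hu : D u = 0) :
    BFSInv H S (Q ++ [u]) h (Function.update D u (D v + 1)) := by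
  have huQ : u ∉ Q := fun h => (I.mem u).1 h hu
  have hD : ∀ a ∈ Q, Function.update D u (D v + 1) a = D a := fun a ha =>
    Function.update_of_ne (fun h => huQ (by rwa [h] at ha)) _ _
  have hvQ : v ∈ Q := hv ▸ List.getElem_mem hh
  have hdrop : Q.drop h = v :: Q.drop (h + 1) := by rw [← hv]; exact List.drop_eq_getElem_cons hh
  have hvd : v ∈ Q.drop h := by rw [hdrop]; exact List.mem_cons_self
  have hmin : ∀ a ∈ Q.drop h, D v ≤ D a := by
    have := I.mono.sublist (List.drop_sublist h Q)
    rw [hdrop, List.pairwise_cons] at this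
    intro a ha
    rw [hdrop, List.mem_cons] at ha
    rcases ha with rfl | ha
    exacts [le_rfl, this.1 a ha]
  have htake : (Q ++ [u]).take h = Q.take h := List.take_append_of_le_length hh.le
  refine ⟨?_, ?_, ?_, ?_, ?_, ?_, ?_⟩
  · rw [List.nodup_append']
    exact ⟨I.nodup, by simp, by simpa using huQ⟩
  · intro a
    by_cases ha : a = u
    · subst ha; simp
    · simp [ha, I.mem a]
  · intro a ha
    have := I.src a ha
    rw [Function.update_of_ne, this]
    rintro rfl
    omega
  · intro a ha
    by_cases hau : a = u
    · subst hau
      obtain ⟨s, hs, hd⟩ := I.sound v ((I.mem v).1 hvQ)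
      refine ⟨s, hs, ?_⟩
      rw [Function.update_self, Nat.cast_add, Nat.cast_one]
      gcongr
      refine le_trans ?_ hd
      refine (SimpleGraph.edist_triangle (v := v)).trans ?_
      rw [SimpleGraph.edist_eq_one_iff_adj.2 hadj.symm, add_comm]
    · rw [Function.update_of_ne hau] at ha ⊢
      exact I.sound a ha
  · rw [List.pairwise_append]
    refine ⟨I.mono.imp_of_mem fun ha hb hab => by rwa [hD _ ha, hD _ hb], by simp, ?_⟩
    intro a ha b hb
    rw [List.mem_singleton] at hb
    subst hb
    rw [hD a ha, Function.update_self]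
    exact I.span v hvd a ha
  · intro a ha b hb
    rw [List.drop_append_of_le_length hh.le, List.mem_append, List.mem_singleton] at ha
    rw [List.mem_append, List.mem_singleton] at hb
    rcases ha with ha | rfl <;> rcases hb with hb | rfl
    · rw [hD a (List.mem_of_mem_drop ha), hD b hb]; exact I.span a ha b hb
    · rw [hD a (List.mem_of_mem_drop ha), Function.update_self]
      have := hmin a ha
      omega
    · rw [hD b hb, Function.update_self]
      have := I.span v hvd b hb
      omega
    · omega
  · intro a ha b hab
    rw [htake] at ha
    obtain ⟨h1, h2⟩ := I.closed a ha b hab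
    have hbu : b ≠ u := fun h => h1 (by rw [h, hu])
    rw [hD a (List.mem_of_mem_take ha), Function.update_of_ne hbu]
    exact ⟨h1, h2⟩

theorem BFSInv.next {n : ℕ} {H : SimpleGraph (Fin n)} {S : Set (Fin n)} {Q : List (Fin n)} {h : ℕ}
    {D : Fin n → ℕ} (I : BFSInv H S Q h D) {v : Fin n} (hh : h < Q.length) (hv : Q[h] = v)
    (hadj : ∀ u, H.Adj v u → D u ≠ 0 ∧ D u ≤ D v + 1) : BFSInv H S Q (h + 1) D := by
  refine ⟨I.nodup, I.mem, I.src, I.sound, I.mono, fun a ha => I.span a ?_, fun a ha => ?_⟩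
  · rw [List.drop_eq_getElem_cons hh]
    exact List.mem_cons_of_mem _ ha
  · rw [← List.take_append_getElem hh, List.mem_append, List.mem_singleton, hv] at ha
    rcases ha with ha | rfl
    exacts [I.closed a ha, hadj]

/-- Loops are counted, so the search always makes `n` rounds; those after the end of the queue are
idle. -/
theorem BFSInv.skip {n : ℕ} {H : SimpleGraph (Fin n)} {S : Set (Fin n)} {Q : List (Fin n)} {h h' : ℕ}
    {D : Fin n → ℕ} (I : BFSInv H S Q h D) (hh : Q.length ≤ h) (hh' : Q.length ≤ h') :
    BFSInv H S Q h' D := by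
  refine ⟨I.nodup, I.mem, I.src, I.sound, I.mono, fun a ha => ?_, fun a ha => I.closed a ?_⟩
  · rw [List.drop_eq_nil_of_le hh'] at ha
    simp at ha
  · rw [List.take_of_length_le hh'] at ha
    rwa [List.take_of_length_le hh]

/-- The queue has no repetitions and hence at most `n` entries, so after `n` rounds all of them are
processed and `eq_distCode_setDist` applies. -/
theorem BFSInv.result {n : ℕ} {H : SimpleGraph (Fin n)} {S : Set (Fin n)} {Q : List (Fin n)}
    {D : Fin n → ℕ} (I : BFSInv H S Q n D) (v : Fin n) : D v = distCode (H.setDist S v) := by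
  refine eq_distCode_setDist I.src I.sound (fun a b hab ha => I.closed a ?_ b hab) v
  rw [List.take_of_length_le (by simpa using I.nodup.length_le_card)]
  exact (I.mem a).2 ha

/-- The list `Q` is in the queue. -/
def HasQueue {n : ℕ} (Q : List (Fin n)) (s : PStore) : Prop :=
  s.reg .tail = Q.length ∧ ∀ i (hi : i < Q.length), s.arr .que i = Q[i]

theorem HasQueue.push {n : ℕ} {Q : List (Fin n)} {s s' : PStore} (h : HasQueue Q s) (u : Fin n)
    (ht : s'.reg .tail = s.reg .tail + 1)
    (hq : ∀ i, s'.arr .que i = if i = s.reg .tail then (u : ℕ) else s.arr .que i) :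
    HasQueue (Q ++ [u]) s' := by
  refine ⟨by rw [ht, h.1]; simp, fun i hi => ?_⟩
  rw [hq]
  rw [List.length_append, List.length_singleton] at hi
  split_ifs with hc
  · have : i = Q.length := by rw [hc, h.1]
    subst this
    simp
  · have hlt : i < Q.length := by have := h.1; omega
    rw [List.getElem_append_left hlt]
    exact h.2 i hlt

theorem bfs_runs {n M : ℕ} {G : SimpleGraph (Fin n)} {adj : Fin n → List (Fin n)}
    (hadj : IsAdjLists G adj) {s : PStore} (hg : HasGraph adj s) {C : Fin n → ℕ}
    (hC : ∀ v : Fin n, s.arr .cc v = C v) {src : PArr} (hsrc : src ≠ .dist ∧ src ≠ .que)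
    {S : Set (Fin n)} (hS : ∀ v : Fin n, s.arr src v ≠ 0 ↔ v ∈ S) {c : ℕ}
    (hc : 50 * n + 50 * ∑ v, (adj v).length + 50 ≤ c) :
    (bfs src).Runs (Guard.free _ M) s c fun s' =>
      ∀ v : Fin n, s'.arr .dist v = distCode ((G.restrict C).setDist S v) := by
  set H := G.restrict C with hH
  have start : (set .tail (.const 0) : PStmt).Runs (Guard.free _ M) s 2
      (fun s' => s' = s.set .tail 0) := Runs.straight rfl rfl (Nat.le_of_ble_eq_true rfl) rfl
  have init := fun (s₁ : PStore) (hs₁ : s₁ = s.set .tail 0) =>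
    Runs.loop_const (Γ := Guard.free PArr M) (r := PReg.v) (e := .reg .n)
    (p := put .dist (.reg .v) (.const 0) ;;
      cond .ne (.at src .v) (.const 0) (put .dist (.reg .v) (.const 1) ;;
      put .que (.reg .tail) (.reg .v) ;; set .tail (.add (.reg .tail) (.const 1))))
    (s := s₁) (c := 3 + n * 30)
    (fun i s' => ∃ Q : List (Fin n), HasQueue Q s' ∧ Q.Nodup ∧
      (∀ v, v ∈ Q ↔ (v : ℕ) < i ∧ v ∈ S) ∧
      ∀ v : Fin n, (v : ℕ) < i → (v ∈ S → s'.arr .dist v = 1) ∧ (v ∉ S → s'.arr .dist v = 0))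
    26 (Exp.safe_free _ _) ⟨[], ⟨by simp [hs₁], fun i hi => absurd hi (by simp)⟩, by simp, by simp,
      fun v hv => absurd hv (by omega)⟩ (by
      rintro i hi s' hf ⟨Q, hQ, hnd, hmem, hd⟩
      subst hs₁
      have hi' : i < n := by simpa [Exp.eval, hg.card] using hi
      have hsrc' : s'.arr src = s.arr src := by
        rw [hf.arr src (by simpa [warrs] using hsrc)]; rfl
      refine Runs.straight rfl rfl (Nat.le_of_ble_eq_true rfl) ?_
      by_cases hv : (⟨i, hi'⟩ : Fin n) ∈ S
      · have h1 : s.arr src i ≠ 0 := (hS ⟨i, hi'⟩).2 hv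
        refine ⟨Q ++ [⟨i, hi'⟩], hQ.push _ ?_ ?_, ?_, ?_, ?_⟩
        · simp [den, Exp.eval, Exp.at, Exp.add, Cmp.Rel, BinOp.eval, hsrc.1, hsrc', h1]
        · intro i'
          simp [den, Exp.eval, Exp.at, Exp.add, Cmp.Rel, BinOp.eval, hsrc.1, hsrc', h1]
        · rw [List.nodup_append']
          refine ⟨hnd, by simp, ?_⟩
          simp only [List.disjoint_singleton]
          intro h
          have := ((hmem _).1 h).1
          simp at this
        · intro v
          simp only [List.mem_append, List.mem_singleton, hmem, Fin.ext_iff]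
          constructor
          · rintro (⟨h1, h2⟩ | h1)
            · exact ⟨by omega, h2⟩
            · exact ⟨by omega, by convert hv⟩
          · rintro ⟨h1, h2⟩
            by_cases h3 : (v : ℕ) = i
            · exact Or.inr h3
            · exact Or.inl ⟨by omega, h2⟩
        · intro v hvi
          simp only [den, Exp.eval, Exp.at, Exp.add, Cmp.Rel, BinOp.eval, Store.put_arr,
            Store.set_reg, Store.set_arr, Store.put_reg, if_true, hsrc.1, false_and, if_false,
            hsrc', ne_eq, h1, not_false_eq_true, reduceCtorEq, true_and]
          by_cases h3 : (v : ℕ) = i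
          · have : v = ⟨i, hi'⟩ := Fin.ext h3
            subst this
            simp [hv]
          · simpa [h3] using hd v (by omega)
      · have h1 : s.arr src i = 0 := by
          by_contra h; exact hv ((hS ⟨i, hi'⟩).1 h)
        have hden : (put .dist (.reg .v) (.const 0) ;;
            cond .ne (.at src .v) (.const 0) (put .dist (.reg .v) (.const 1) ;;
            put .que (.reg .tail) (.reg .v) ;; set .tail (.add (.reg .tail) (.const 1))) :
            PStmt).den (s'.set .v i) = (s'.set .v i).put .dist i 0 := by
          simp [den, Exp.eval, Exp.at, Cmp.Rel, hsrc.1, hsrc', h1]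
        rw [hden]
        refine ⟨Q, ⟨hQ.1, hQ.2⟩, hnd, ?_, ?_⟩
        · intro v
          rw [hmem]
          refine ⟨fun h => ⟨by omega, h.2⟩, fun h => ⟨?_, h.2⟩⟩
          have : (v : ℕ) ≠ i := fun h3 => hv (by convert h.2; exact h3.symm)
          omega
        · intro v hvi
          by_cases h3 : (v : ℕ) = i
          · have : v = ⟨i, hi'⟩ := Fin.ext h3
            subst this
            simp [hv]
          · simpa [h3] using hd v (by omega))
    (by simp [Exp.eval, Exp.cost, hs₁, hg.card])
  refine (start.seq fun s₁ _ hs₁ => (init s₁ hs₁).seq fun s₂ hf₂ hI₂ => ?_).mono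
    (show 2 + (3 + n * 30 + (3 + n * 20 + 45 * ∑ v, (adj v).length)) ≤ c by omega) fun s' _ h => h
  have hn₁ : s₁.reg .n = n := by simp [hs₁, hg.card]
  have hn₂ : s₂.reg .n = n := by
    rw [hf₂.reg _ (by simp [wregs]), hn₁]
  have hg₂ : HasGraph adj s₂ := by
    refine HasGraph.frame (s := s₁) ?_ hf₂ (by simp [wregs, warrs])
    rw [hs₁]
    exact hg.congr rfl rfl rfl rfl
  have hC₂ : ∀ v : Fin n, s₂.arr .cc v = C v := by
    intro v
    rw [hf₂.arr _ (by simp [warrs]), hs₁]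
    exact hC v
  simp only [Exp.eval, hn₁] at hI₂
  obtain ⟨Q, hQ, hnd, hmem, hd⟩ := hI₂
  have hD : ∀ v : Fin n, (v ∈ S → s₂.arr .dist v = 1) ∧ (v ∉ S → s₂.arr .dist v = 0) :=
    fun v => hd v v.2
  have hinv : BFSInv H S Q 0 (fun v => s₂.arr .dist v) := by
    have hone : ∀ v : Fin n, s₂.arr .dist v ≠ 0 → v ∈ S := fun v h => by
      by_contra hv; exact h ((hD v).2 hv)
    have hQS : ∀ v, v ∈ Q ↔ v ∈ S := fun v => by simp [hmem, v.2]
    have hQ1 : ∀ v : Fin n, v ∈ Q → s₂.arr .dist v = 1 := fun v hv => (hD v).1 ((hQS v).1 hv)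
    refine ⟨hnd, fun v => ?_, fun v hv => (hD v).1 hv, fun v hv => ⟨v, hone v hv, ?_⟩, ?_, ?_, ?_⟩
    · rw [hQS]
      refine ⟨fun h => ?_, hone v⟩
      rw [(hD v).1 h]
      exact one_ne_zero
    · rw [(hD v).1 (hone v hv)]
      simp
    · refine List.pairwise_of_forall_mem_list fun a ha b hb => ?_
      rw [hQ1 a ha, hQ1 b hb]
    · intro a ha b hb
      rw [hQ1 b hb]
      omega
    · intro a ha
      simp at ha
  -- The budget holds 20 steps for every remaining round, idle or not, and 45 for every adjacency
  -- entry of a vertex that has not been dequeued.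
  have main := Runs.loop_budget (Γ := Guard.free PArr M) (r := PReg.h) (e := .reg .n)
    (p := cond .lt (.reg .h) (.reg .tail) (set .v (.at .que .h) ;;
      forAdj (cond .eq (.at .cc .u) (.at .cc .v) (cond .eq (.at .dist .u) (.const 0)
      (put .dist (.reg .u) (.add (.at .dist .v) (.const 1)) ;;
        put .que (.reg .tail) (.reg .u) ;; set .tail (.add (.reg .tail) (.const 1)))))))
    (s := s₂) (c := 3 + n * 20 + 45 * ∑ v, (adj v).length)
    (fun i m s' => ∃ Q : List (Fin n), HasQueue Q s' ∧
      BFSInv H S Q i (fun v => s'.arr .dist v) ∧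
      m = (n - i) * 20 + 45 * ∑ v ∈ Finset.univ.filter fun v => v ∉ Q.take i, (adj v).length)
    (n * 20 + 45 * ∑ v, (adj v).length) (Exp.safe_free _ _) ⟨Q, hQ, hinv, by simp⟩ ?_
    (by simp only [Exp.cost]; omega)
  · refine main.mono le_rfl fun s' _ h v => ?_
    simp only [Exp.eval, hn₂] at h
    obtain ⟨_, Q, -, hI, -⟩ := h
    exact hI.result v
  · rintro i hi m s' hf ⟨Q, hQ, hI, rfl⟩
    have hi' : i < n := by simpa [Exp.eval, hn₂] using hi
    have hg' : HasGraph adj s' := hg₂.frame hf (by decide)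
    have hC' : ∀ v : Fin n, s'.arr .cc v = C v := by
      intro v; rw [hf.arr _ (by decide)]; exact hC₂ v
    by_cases hlt : i < Q.length
    · set v := Q[i] with hv
      have htake : Q.take (i + 1) = Q.take i ++ [v] := (List.take_append_getElem hlt).symm
      have hsum : ∑ w ∈ Finset.univ.filter fun w => w ∉ Q.take i, (adj w).length =
          (adj v).length + ∑ w ∈ Finset.univ.filter fun w => w ∉ Q.take (i + 1),
            (adj w).length := by
        have hvn : v ∉ Q.take i := by
          have := (List.nodup_append'.1 (htake ▸ hI.nodup.sublist (List.take_sublist (i + 1) Q))).2.2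
          simpa [List.disjoint_singleton] using this
        rw [← Finset.sum_insert (s := Finset.univ.filter fun w => w ∉ Q.take (i + 1)) (a := v)
          (f := fun w => (adj w).length) (by simp [htake])]
        congr 1
        ext w
        simp only [Finset.mem_filter, Finset.mem_univ, true_and, Finset.mem_insert, htake,
          List.mem_append, List.mem_singleton, not_or]
        constructor
        · intro h
          by_cases hw : w = v
          · exact Or.inl hw
          · exact Or.inr ⟨h, hw⟩
        · rintro (rfl | h)
          exacts [hvn, h.1]
      refine ⟨13 + (adj v).length * 45, (n - (i + 1)) * 20 + 45 * ∑ w ∈ Finset.univ.filter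
        fun w => w ∉ Q.take (i + 1), (adj w).length, ?_, ?_⟩
      · rw [hsum]
        omega
      refine Runs.cond (c := 4 + (5 + (adj v).length * 45)) (Exp.safe_free _ _)
        (Exp.safe_free _ _) (fun _ => ?_) (fun h => ?_) (by simp only [Exp.cost]; omega)
      · refine Runs.seq (Q' := fun s'' => s'' = ((s'.set .h i).set .v v))
          (Runs.straight rfl rfl (Nat.le_of_ble_eq_true rfl) ?_) ?_
        · simp [den, Exp.eval, Exp.at, hQ.2 i hlt, hv]
        · rintro s₃ - rfl
          -- The queue may grow to `Q'` while the neighbors are scanned, but its first `i + 1`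
          -- entries are fixed; in particular `v` remains the entry at `i`.
          refine Runs.mono (forAdj_runs (b := 32) (v := v) (adj := adj) (fun l s'' => ∃ Q' : List (Fin n),
            HasQueue Q' s'' ∧ BFSInv H S Q' i (fun v => s''.arr .dist v) ∧
            Q.take (i + 1) = Q'.take (i + 1) ∧ i < Q'.length ∧
            ∀ u ∈ l, H.Adj v u → s''.arr .dist u ≠ 0 ∧ s''.arr .dist u ≤ s''.arr .dist v + 1)
            (hg'.congr rfl rfl rfl rfl) (by simp) (by decide)
            ⟨Q, ⟨by simp [hQ.1], fun i hi => by simp [hQ.2 i hi]⟩, by simpa using hI, rfl, hlt,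
              by simp⟩
            ?_ le_rfl) le_rfl ?_
          · rintro l u s₄ hf₄ hpre ⟨Q', hQ', hI', hQQ, hlt', hl⟩
            have hu : u ∈ adj v := hpre.subset (by simp)
            have hGu : G.Adj v u := ((hadj v).2 u).1 hu
            have hv₄ : s₄.reg .v = v := by rw [hf₄.reg _ (by decide)]; simp
            have hcc₄ : ∀ w : Fin n, s₄.arr .cc w = C w := by
              intro w; rw [hf₄.arr _ (by decide)]; exact hC' w
            have hvQ : Q'[i] = v := by
              have h5 : Q'[i]? = Q[i]? := by
                have := congrArg (fun l => l[i]?) hQQ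
                simpa [List.getElem?_take] using this.symm
              rw [List.getElem?_eq_getElem hlt, List.getElem?_eq_getElem hlt'] at h5
              exact Option.some.inj h5
            refine Runs.straight rfl rfl (Nat.le_of_ble_eq_true rfl) ?_
            simp only [den, Exp.eval, Exp.at, Exp.add, Cmp.Rel, BinOp.eval, Store.set_reg,
              Store.set_arr, reduceCtorEq, if_true, if_false, hcc₄, hv₄]
            by_cases hcu : C u = C v
            · have hHu : H.Adj v u := ⟨hGu, hcu.symm⟩
              by_cases hdu : s₄.arr .dist u = 0
              · rw [if_pos hcu, if_pos hdu]
                have hvis := hI'.visit hlt' hvQ hHu hdu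
                have hfun : (fun w : Fin n => if (w : ℕ) = u then s₄.arr .dist v + 1
                    else s₄.arr .dist w) =
                    Function.update (fun w : Fin n => s₄.arr .dist w) u (s₄.arr .dist v + 1) := by
                  funext w
                  simp [Function.update_apply, Fin.ext_iff]
                have hvu : (v : ℕ) ≠ u := fun h => hHu.ne (Fin.ext h)
                refine ⟨Q' ++ [u], hQ'.push u (by simp) (fun i' => by simp), ?_, ?_, ?_, ?_⟩
                · rw [← hfun] at hvis
                  simpa using hvis
                · rw [hQQ, List.take_append_of_le_length (by omega)]
                · simp; omega
                · intro w hw hvw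
                  rw [List.mem_append, List.mem_singleton] at hw
                  by_cases hwu : (w : ℕ) = u
                  · simp [hwu, hvu]
                  · have := hl w (hw.resolve_right fun h => hwu (by rw [h])) hvw
                    simpa [hwu, hvu] using this
              · rw [if_pos hcu, if_neg hdu]
                refine ⟨Q', ⟨by simp [hQ'.1], fun i hi => by simp [hQ'.2 i hi]⟩, by simpa using hI',
                  hQQ, hlt', fun w hw hvw => ?_⟩
                rw [List.mem_append, List.mem_singleton] at hw
                rcases hw with hw | rfl
                · simpa using hl w hw hvw
                · refine ⟨by simpa using hdu, ?_⟩
                  -- A neighbor that was found earlier is in the queue, so the span condition bounds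
                  -- its value by `D v + 1`.
                  refine hI'.span v ?_ w ((hI'.mem w).2 hdu)
                  rw [List.drop_eq_getElem_cons hlt', hvQ]
                  exact List.mem_cons_self
            · rw [if_neg hcu]
              refine ⟨Q', ⟨by simp [hQ'.1], fun i hi => by simp [hQ'.2 i hi]⟩, by simpa using hI',
                hQQ, hlt', fun w hw hvw => ?_⟩
              rw [List.mem_append, List.mem_singleton] at hw
              rcases hw with hw | rfl
              · simpa using hl w hw hvw
              · exact absurd hvw.2.symm hcu
          · rintro s₅ - ⟨Q', hQ', hI', hQQ, hlt', hl⟩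
            refine ⟨Q', hQ', hI'.next hlt' ?_ fun u hu => hl u (((hadj v).2 u).2 hu.1) hu, ?_⟩
            · have h5 : Q'[i]? = Q[i]? := by
                have := congrArg (fun l => l[i]?) hQQ
                simpa [List.getElem?_take] using this.symm
              rw [List.getElem?_eq_getElem hlt, List.getElem?_eq_getElem hlt'] at h5
              exact Option.some.inj h5
            · rw [hQQ]
      · exact absurd (show i < Q.length from hlt) (by simpa [Cmp.Rel, Exp.eval, hQ.1] using h)
    · refine ⟨4, (n - (i + 1)) * 20 + 45 * ∑ w ∈ Finset.univ.filter
        fun w => w ∉ Q.take (i + 1), (adj w).length, ?_, ?_⟩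
      · rw [List.take_of_length_le (by omega), List.take_of_length_le (by omega)]
        omega
      · refine Runs.cond (c := 0) (Exp.safe_free _ _) (Exp.safe_free _ _)
          (fun h => ?_) (fun _ => ?_) (by simp [Exp.cost])
        · exact absurd (show i < Q.length by simpa [Cmp.Rel, Exp.eval, hQ.1] using h) hlt
        · refine ⟨Q, ⟨by simp [hQ.1], fun i hi => by simp [hQ.2 i hi]⟩, ?_, rfl⟩
          simpa using hI.skip (by omega) (by omega)

end WordRAM

/-! ### Classes of vertices with equal neighborhoods across the cuts -/

namespace WordRAM

open Exp Stmt

theorem Stmt.Runs.cons {ρ α : Type} [DecidableEq ρ] [DecidableEq α] {p q : Stmt ρ α}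
    {s s₁ : Store ρ α} {M c c₂ : ℕ} {Q : Store ρ α → Prop} (h1 : p.slow = true)
    (h2 : p.straight = true) (hs : p.den s = s₁) (hq : q.Runs (Guard.free α M) s₁ c₂ Q)
    (hc : p.maxCost + c₂ ≤ c) : (p.seq q).Runs (Guard.free α M) s c Q :=
  ((Runs.straight (Q := fun s' => s' = s₁) h1 h2 le_rfl hs).seq fun _ _ h => h ▸ hq).mono hc
    fun _ _ h => h

/-- For all vertices `v`. -/
def forV (body : PStmt) : PStmt := loop .v (.reg .n) body

theorem forV_runs {n M c : ℕ} {s : PStore} {body : PStmt} (I : ℕ → PStore → Prop) (b : Fin n → ℕ)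
    (hn : s.reg .n = n) (h0 : I 0 s)
    (hstep : ∀ (v : Fin n) s', (forV body).Frame s s' → I v s' →
      body.Runs (Guard.free _ M) (s'.set .v v) (b v) (I (v + 1)))
    (hc : 3 + 4 * n + ∑ v, b v ≤ c) : (forV body).Runs (Guard.free _ M) s c (I n) := by
  have hN : (Exp.reg (α := PArr) PReg.n).eval s = n := hn
  have := Runs.loop_sum (Γ := Guard.free PArr M) (r := PReg.v) (e := .reg .n) (p := body) (s := s)
    (c := c) I (fun i => if h : i < n then b ⟨i, h⟩ else 0) (Exp.safe_free _ _) h0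
    (fun i hi s' hf hI => ?_) ?_
  · rw [hN] at this
    exact this
  · rw [hN] at hi
    rw [dif_pos hi]
    exact hstep ⟨i, hi⟩ s' hf hI
  · rw [hN, Finset.sum_add_distrib, Finset.sum_const, Finset.card_range, smul_eq_mul,
      Finset.sum_range fun i => if h : i < n then b ⟨i, h⟩ else 0]
    simp only [Fin.is_lt, dite_true, Exp.cost, Fin.eta]
    omega

theorem forV_map {n M c : ℕ} {s : PStore} {body : PStmt} (P : Fin n → PStore → Prop) (b : Fin n → ℕ)
    (hn : s.reg .n = n)
    (hstep : ∀ (v : Fin n) s', (forV body).Frame s s' →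
      body.Runs (Guard.free _ M) (s'.set .v v) (b v)
        fun s'' => P v s'' ∧ ∀ w, w ≠ v → P w s' → P w s'')
    (hc : 3 + 4 * n + ∑ v, b v ≤ c) :
    (forV body).Runs (Guard.free _ M) s c fun s' => ∀ v, P v s' := by
  refine (forV_runs (fun i s' => ∀ w : Fin n, (w : ℕ) < i → P w s') b hn
    (fun w hw => absurd hw (by omega)) (fun v s' hf hI => ?_) hc).mono le_rfl
      fun s' _ h v => h v v.2
  refine (hstep v s' hf).mono le_rfl fun s'' _ h w hw => ?_
  by_cases hwv : w = v
  · rw [hwv]; exact h.1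
  · refine h.2 w hwv (hI w ?_)
    have : (w : ℕ) ≠ v := fun h => hwv (Fin.ext h)
    omega

variable {n : ℕ} {G : SimpleGraph (Fin n)} {adj : Fin n → List (Fin n)} {C side : Fin n → ℕ}

/-- The pieces and the sides of the vertices are stored in the arrays `cc` and `side`. -/
structure HasPieces (adj : Fin n → List (Fin n)) (C side : Fin n → ℕ) (s : PStore) : Prop
    extends HasGraph adj s where
  cc : ∀ v : Fin n, s.arr .cc v = C v
  side : ∀ v : Fin n, s.arr .side v = side v

/-- The registers and arrays of `HasPieces` are not written. -/
def Keeps (p : PStmt) : Bool :=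
  (PReg.n ∉ p.wregs) && (PArr.len ∉ p.warrs) && (PArr.adj ∉ p.warrs) && (PArr.off ∉ p.warrs) &&
    (PArr.cc ∉ p.warrs) && (PArr.side ∉ p.warrs)

theorem HasPieces.frame {s s' : PStore} {p : PStmt} (h : HasPieces adj C side s)
    (hf : p.Frame s s') (hp : Keeps p = true) : HasPieces adj C side s' := by
  simp only [Keeps, Bool.and_eq_true, decide_eq_true_eq] at hp
  obtain ⟨⟨⟨⟨⟨h1, h2⟩, h3⟩, h4⟩, h5⟩, h6⟩ := hp
  exact ⟨h.toHasGraph.frame hf ⟨h1, h2, h3, h4⟩, by rw [hf.arr _ h5]; exact h.cc,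
    by rw [hf.arr _ h6]; exact h.side⟩

theorem HasPieces.set {s : PStore} (h : HasPieces adj C side s) {a : PReg} (hr : a ≠ .n) (x : ℕ) :
    HasPieces adj C side (s.set a x) :=
  ⟨h.toHasGraph.congr (by simp [hr.symm]) rfl rfl rfl, h.cc, h.side⟩

open Classical in
/-- The neighbors of `v` in its piece that are not on the side that is cut off. -/
noncomputable def across (G : SimpleGraph (Fin n)) (C side : Fin n → ℕ) (v : Fin n) :
    Finset (Fin n) := Finset.univ.filter fun u => G.Adj v u ∧ C u = C v ∧ side u = 0

theorem mem_across {u v : Fin n} :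
    u ∈ across G C side v ↔ G.Adj v u ∧ C u = C v ∧ side u = 0 := by simp [across]

theorem card_filter_adj (hadj : IsAdjLists G adj) (v : Fin n) (P : Fin n → Prop) [DecidablePred P]
    (S : Finset (Fin n)) (hS : ∀ u, u ∈ S ↔ G.Adj v u ∧ P u) :
    ((adj v).filter P).length = S.card := by
  classical
  rw [← List.toFinset_card_of_nodup ((hadj v).1.filter _)]
  congr 1
  ext u
  simp [hS, (hadj v).2]

/-- Count the neighbors across the cut, and mark the vertices that have none. -/
def countAcross : PStmt :=
  forV (put .done (.reg .v) (.const 1) ;; put .deg (.reg .v) (.const 0) ;;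
    cond .ne (.at .side .v) (.const 0) (forAdj (cond .eq (.at .cc .u) (.at .cc .v)
      (cond .eq (.at .side .u) (.const 0) (put .deg (.reg .v) (.add (.at .deg .v) (.const 1)) ;;
        put .done (.reg .v) (.const 0))))))

theorem sum_linear_le (a b : ℕ) (f : Fin n → ℕ) :
    ∑ v, (a + b * f v) = a * n + b * ∑ v, f v := by
  rw [Finset.sum_add_distrib, ← Finset.mul_sum]
  simp [mul_comm]

/-- `done` starts as 1 and is cleared when a neighbor across the cut is seen. So the pending
vertices are those that are cut off and have an edge to the rest; the others need not be covered. -/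
theorem countAcross_runs {M c : ℕ} (hadj : IsAdjLists G adj) {s : PStore}
    (hp : HasPieces adj C side s) (hc : 100 * n + 100 * ∑ v, (adj v).length + 100 ≤ c) :
    countAcross.Runs (Guard.free _ M) s c fun s' => ∀ v : Fin n,
      (side v ≠ 0 → s'.arr .deg v = (across G C side v).card) ∧
      (s'.arr .done v = 0 ↔ side v ≠ 0 ∧ (across G C side v).Nonempty) := by
  refine forV_map _ (fun v => 50 + 50 * (adj v).length) hp.card (fun v s' hf => ?_)
    (by rw [sum_linear_le]; omega)
  have hp' := hp.frame hf rfl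
  set s₂ := ((s'.set .v v).put .done v 1).put .deg v 0 with hs₂
  refine Runs.mono (c := 50 + 50 * (adj v).length) (Q := fun s₃ : PStore =>
    (∀ w : ℕ, w ≠ v → s₃.arr .deg w = s'.arr .deg w ∧ s₃.arr .done w = s'.arr .done w) ∧
    (side v ≠ 0 → s₃.arr .deg v = (across G C side v).card) ∧
    (s₃.arr .done v = 0 ↔ side v ≠ 0 ∧ (across G C side v).Nonempty))
    (Runs.cons rfl rfl (s₁ := (s'.set .v v).put .done v 1) (by simp [den, Exp.eval])
    (Runs.cons rfl rfl (s₁ := s₂) (by simp [den, Exp.eval, hs₂])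
    (Runs.cond (c := 5 + (adj v).length * (32 + 13)) (Exp.safe_free _ _) (Exp.safe_free _ _)
      ?_ ?_ le_rfl) le_rfl) (by simp only [maxCost, Exp.at, Exp.cost]; omega)) le_rfl ?_
  · intro hside
    have hside' : side v ≠ 0 := by
      rw [hs₂] at hside
      simpa [Cmp.Rel, Exp.eval, Exp.at, hp'.side] using hside
    have hp₂ : HasPieces adj C side s₂ := by
      rw [hs₂]
      exact ⟨hp'.toHasGraph.congr rfl rfl rfl rfl, hp'.cc, hp'.side⟩
    refine Runs.mono (forAdj_runs (b := 32) (v := v) (adj := adj) (fun l (s₃ : PStore) =>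
      (∀ w : ℕ, w ≠ v → s₃.arr .deg w = s'.arr .deg w ∧ s₃.arr .done w = s'.arr .done w) ∧
      s₃.arr .deg v = (l.filter fun u => C u = C v ∧ side u = 0).length ∧
      (s₃.arr .done v = 0 ↔ ∃ u ∈ l, C u = C v ∧ side u = 0))
      hp₂.toHasGraph (by simp [hs₂]) (by decide) ?_ ?_ le_rfl) le_rfl ?_
    · refine ⟨fun w hw => ?_, by simp [hs₂], by simp [hs₂]⟩
      simp [hs₂, hw]
    · rintro l u s₃ hf₃ hpre ⟨h1, h2, h3⟩
      have hp₃ : HasPieces adj C side s₃ := hp₂.frame hf₃ rfl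
      have hv₃ : s₃.reg .v = v := by rw [hf₃.reg _ (by decide)]; simp [hs₂]
      refine Runs.straight rfl rfl (Nat.le_of_ble_eq_true rfl) ?_
      simp only [den, Exp.eval, Exp.at, Exp.add, Cmp.Rel, BinOp.eval, Store.set_reg,
        Store.set_arr, reduceCtorEq, if_true, if_false, hp₃.cc, hp₃.side, hv₃]
      by_cases hcu : C u = C v
      · by_cases hsu : side u = 0
        · rw [if_pos hcu, if_pos hsu]
          refine ⟨fun w hw => ?_, ?_, ?_⟩
          · simpa [hw, hv₃] using h1 w hw
          · simp [h2, hcu, hsu, hv₃]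
          · simp [hcu, hsu, hv₃]
        · rw [if_pos hcu, if_neg hsu]
          refine ⟨fun w hw => by simpa using h1 w hw, ?_, ?_⟩
          · simp [h2, hsu]
          · simp [h3, hsu]
      · rw [if_neg hcu]
        refine ⟨fun w hw => by simpa using h1 w hw, ?_, ?_⟩
        · simp [h2, hcu]
        · simp [h3, hcu]
    · rintro s₃ - ⟨h1, h2, h3⟩
      refine ⟨h1, fun _ => ?_, ?_⟩
      · rw [h2]
        exact card_filter_adj hadj v _ _ fun u => mem_across
      · rw [h3]
        constructor
        · rintro ⟨u, hu, h4⟩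
          exact ⟨hside', u, mem_across.2 ⟨((hadj v).2 u).1 hu, h4⟩⟩
        · rintro ⟨-, u, hu⟩
          obtain ⟨h4, h5⟩ := mem_across.1 hu
          exact ⟨u, ((hadj v).2 u).2 h4, h5⟩
  · intro hside
    have hside' : side v = 0 := by
      rw [hs₂] at hside
      simpa [Cmp.Rel, Exp.eval, Exp.at, hp'.side] using hside
    refine ⟨fun w hw => by simp [hs₂, hw], by simp [hside'], by simp [hs₂, hside']⟩
  · rintro s₃ - ⟨h1, h2⟩
    refine ⟨h2, fun w hw h3 => ?_⟩
    have hwv : (w : ℕ) ≠ v := fun h => hw (Fin.ext h)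
    rw [(h1 w hwv).1, (h1 w hwv).2]
    exact h3

end WordRAM

namespace WordRAM

open Exp Stmt

variable {n : ℕ} {G : SimpleGraph (Fin n)} {adj : Fin n → List (Fin n)} {C side : Fin n → ℕ}

/-! ### One bipartite round: representatives, their neighborhoods and their classes. -/

/-- Choose a representative among the unmarked vertices of every piece that has some. -/
def pickReps : PStmt :=
  loop .c (.reg .nn) (put .rep (.reg .c) (.const 0)) ;;
  forV (cond .eq (.at .done .v) (.const 0)
    (put .rep (.at .cc .v) (.add (.reg .v) (.const 1))))

/-- The last pending vertex of a piece wins. Representatives are stored plus one, so that 0 stands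
for a piece without pending vertices. -/
theorem pickReps_runs {M c N : ℕ} {s : PStore} (hp : HasPieces adj C side s) (hN : s.reg .nn = N)
    (hc : 50 * n + 50 * N + 50 ≤ c) :
    pickReps.Runs (Guard.free _ M) s c fun s' =>
      (∀ v : Fin n, C v < N → s'.arr .rep (C v) ≠ 0 →
        ∃ r : Fin n, s'.arr .rep (C v) = r + 1 ∧ C r = C v ∧ s.arr .done r = 0) ∧
      ∀ v : Fin n, s.arr .done v = 0 → s'.arr .rep (C v) ≠ 0 := by
  have h1 := Runs.loop_const (Γ := Guard.free PArr M) (r := PReg.c) (e := .reg .nn)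
    (p := put .rep (.reg .c) (.const 0)) (s := s) (c := 3 + N * 8)
    (fun i s' => ∀ j < i, s'.arr .rep j = 0) 4 (Exp.safe_free _ _)
    (fun j hj => absurd hj (by omega)) (fun i hi s' hf hI => by
      refine Runs.straight rfl rfl (Nat.le_of_ble_eq_true rfl) fun j hj => ?_
      have := hI j
      simp only [den, Exp.eval, Store.put_arr, Store.set_reg, Store.set_arr, if_true, true_and]
      split_ifs with hji
      · rfl
      · exact this (by omega)) (by simp [Exp.cost, Exp.eval, hN])
  refine (h1.seq (c₂ := 3 + 4 * n + 20 * n) fun s₁ hf₁ hI₁ => ?_).mono (by omega) fun _ _ h => h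
  have hp₁ := hp.frame hf₁ rfl
  have hd₁ : s₁.arr .done = s.arr .done := hf₁.arr _ (by decide)
  simp only [Exp.eval, hN] at hI₁
  refine (forV_runs (fun i s' =>
    (∀ v : Fin n, C v < N → s'.arr .rep (C v) ≠ 0 →
      ∃ r : Fin n, s'.arr .rep (C v) = r + 1 ∧ C r = C v ∧ s.arr .done r = 0) ∧
    ∀ v : Fin n, (v : ℕ) < i → s.arr .done v = 0 → s'.arr .rep (C v) ≠ 0) (fun _ => 20) hp₁.card
    ⟨fun v hv h => absurd (hI₁ _ hv) h, fun v hv => absurd hv (by omega)⟩ ?_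
    (by simp; omega)).mono le_rfl fun s' _ h => ⟨h.1, fun v hv => h.2 v v.2 hv⟩
  rintro v s' hf ⟨h2, h3⟩
  have hp' := hp₁.frame hf rfl
  have hd' : s'.arr .done = s.arr .done := by rw [← hd₁]; exact hf.arr _ (by decide)
  refine Runs.straight rfl rfl (Nat.le_of_ble_eq_true rfl) ?_
  simp only [den, Exp.eval, Exp.at, Exp.add, Cmp.Rel, BinOp.eval, Store.set_reg,
    Store.set_arr, if_true, hp'.cc, hd']
  split_ifs with hd
  · simp only [Store.put_arr, true_and]
    refine ⟨fun w hw h => ?_, fun w hw h => ?_⟩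
    · split_ifs with hwv
      · exact ⟨v, by simp, hwv.symm, hd⟩
      · rw [if_neg hwv] at h
        exact h2 w hw h
    · split_ifs with hwv
      · simp
      · exact h3 w (by
          have : (w : ℕ) ≠ v := fun h => hwv (by rw [Fin.ext h])
          omega) h
  · refine ⟨h2, fun w hw h => h3 w ?_ h⟩
    have : (w : ℕ) ≠ v := fun h' => hd (by rw [← h']; exact h)
    omega

/-- Mark the neighbors across the cut of the representatives. -/
def markN : PStmt :=
  forV (put .inN (.reg .v) (.const 0) ;; put .num (.reg .v) (.const 0)) ;;
  forV (cond .eq (.get .rep (.at .cc .v)) (.add (.reg .v) (.const 1))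
    (forAdj (cond .eq (.at .cc .u) (.at .cc .v) (cond .eq (.at .side .u) (.const 0)
      (put .inN (.reg .u) (.const 1))))))

/-- One array serves all pieces: neighborhoods across a cut stay inside the piece, so the marks of
different representatives are told apart by `C`. -/
theorem markN_runs {M c : ℕ} (hadj : IsAdjLists G adj) {s : PStore} (hp : HasPieces adj C side s)
    (hc : 100 * n + 100 * ∑ v, (adj v).length + 100 ≤ c) :
    markN.Runs (Guard.free _ M) s c fun s' =>
      (∀ u : Fin n, s'.arr .num u = 0) ∧
      ∀ u : Fin n, s'.arr .inN u ≠ 0 ↔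
        ∃ v : Fin n, s.arr .rep (C v) = v + 1 ∧ u ∈ across G C side v := by
  have h1 := forV_map (M := M) (c := 3 + 4 * n + 20 * n) (s := s)
    (body := put .inN (.reg .v) (.const 0) ;; put .num (.reg .v) (.const 0))
    (fun v s' => s'.arr .inN v = 0 ∧ s'.arr .num v = 0) (fun _ => 20) hp.card
    (fun v s' hf => Runs.straight rfl rfl (Nat.le_of_ble_eq_true rfl) (by
      refine ⟨by simp [den, Exp.eval], fun w hw h => ?_⟩
      have hwv : (w : ℕ) ≠ v := fun h => hw (Fin.ext h)
      simpa [den, Exp.eval, hwv] using h)) (by simp; omega)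
  refine (h1.seq (c₂ := 3 + 4 * n + (50 * n + 50 * ∑ v, (adj v).length))
    fun s₁ hf₁ hI₁ => ?_).mono (by omega) fun _ _ h => h
  have hp₁ := hp.frame hf₁ rfl
  have hr₁ : s₁.arr .rep = s.arr .rep := hf₁.arr _ (by decide)
  refine (forV_runs (fun i s' => (∀ u : Fin n, s'.arr .num u = 0) ∧
    ∀ u : Fin n, s'.arr .inN u ≠ 0 ↔
      ∃ v : Fin n, (v : ℕ) < i ∧ s.arr .rep (C v) = v + 1 ∧ u ∈ across G C side v)
    (fun v => 50 + 50 * (adj v).length) hp₁.card ⟨fun u => (hI₁ u).2, fun u => by simp [(hI₁ u).1]⟩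
    ?_ (by rw [sum_linear_le])).mono le_rfl fun s' _ h => ⟨h.1, fun u => by
      rw [h.2 u]; exact exists_congr fun v => by simp [v.2]⟩
  rintro v s' hf ⟨h0, h2⟩
  have hp' := hp₁.frame hf rfl
  have hr' : s'.arr .rep = s.arr .rep := by rw [← hr₁]; exact hf.arr _ (by decide)
  have hsplit : ∀ u, (∃ w : Fin n, (w : ℕ) < v + 1 ∧ s.arr .rep (C w) = w + 1 ∧
      u ∈ across G C side w) ↔ s'.arr .inN u ≠ 0 ∨
        (s.arr .rep (C v) = v + 1 ∧ u ∈ across G C side v) := by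
    intro u
    rw [h2]
    constructor
    · rintro ⟨w, hw, h3⟩
      by_cases hwv : w = v
      · exact Or.inr (hwv ▸ h3)
      · refine Or.inl ⟨w, ?_, h3⟩
        have : (w : ℕ) ≠ v := fun h => hwv (Fin.ext h)
        omega
    · rintro (⟨w, hw, h3⟩ | h3)
      exacts [⟨w, by omega, h3⟩, ⟨v, by omega, h3⟩]
  refine Runs.cond (c := 5 + (adj v).length * (27 + 13)) (Exp.safe_free _ _) (Exp.safe_free _ _)
    (fun hr => ?_) (fun hr => ?_) (by simp only [Exp.at, Exp.add, Exp.cost]; omega)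
  · have hrv : s.arr .rep (C v) = v + 1 := by
      simpa [Cmp.Rel, Exp.eval, Exp.at, Exp.add, BinOp.eval, hp'.cc, hr'] using hr
    refine Runs.mono (forAdj_runs (b := 27) (v := v) (adj := adj) (fun l (s₃ : PStore) =>
      (∀ u : Fin n, s₃.arr .num u = 0) ∧ ∀ u : Fin n, s₃.arr .inN u ≠ 0 ↔ s'.arr .inN u ≠ 0 ∨
        (u ∈ l ∧ C u = C v ∧ side u = 0))
      (hp'.set (by decide) _).toHasGraph (by simp) (by decide) ⟨h0, by simp⟩ ?_ le_rfl) le_rfl ?_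
    · rintro l u s₃ hf₃ hpre ⟨h4, h3⟩
      have hp₃ : HasPieces adj C side s₃ := (hp'.set (by decide) _).frame hf₃ rfl
      have hv₃ : s₃.reg .v = v := by rw [hf₃.reg _ (by decide)]; simp
      refine Runs.straight rfl rfl (Nat.le_of_ble_eq_true rfl) ?_
      simp only [den, Exp.eval, Exp.at, Cmp.Rel, Store.set_reg,
        Store.set_arr, reduceCtorEq, if_true, if_false, hp₃.cc, hp₃.side, hv₃]
      by_cases hcu : C u = C v
      · by_cases hsu : side u = 0
        · rw [if_pos hcu, if_pos hsu]
          refine ⟨by simpa using h4, fun w => ?_⟩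
          by_cases hwu : w = u
          · subst hwu
            simp [hcu, hsu]
          · have hwu' : (w : ℕ) ≠ u := fun h => hwu (Fin.ext h)
            simpa [hwu, hwu'] using h3 w
        · rw [if_pos hcu, if_neg hsu]
          refine ⟨by simpa using h4, fun w => ?_⟩
          by_cases hwu : w = u
          · subst hwu
            simpa [hsu] using h3 w
          · simpa [hwu] using h3 w
      · rw [if_neg hcu]
        refine ⟨by simpa using h4, fun w => ?_⟩
        by_cases hwu : w = u
        · subst hwu
          simpa [hcu] using h3 w
        · simpa [hwu] using h3 w
    · rintro s₃ - ⟨h4, h3⟩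
      refine ⟨h4, fun u => ?_⟩
      rw [hsplit, h3, mem_across, (hadj v).2]
      simp [hrv]
  · have hrv : ¬ s.arr .rep (C v) = v + 1 := by
      simpa [Cmp.Rel, Exp.eval, Exp.at, Exp.add, BinOp.eval, hp'.cc, hr'] using hr
    refine ⟨h0, fun u => ?_⟩
    rw [hsplit]
    simp [hrv]

/-- Count the marked neighbors of all vertices within their pieces. -/
def countN : PStmt :=
  forV (cond .ne (.at .inN .v) (.const 0) (forAdj (cond .eq (.at .cc .u) (.at .cc .v)
    (put .num (.reg .u) (.add (.at .num .u) (.const 1))))))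

-- The count is collected from the side of the marked vertices, each of which adds one to its
-- neighbors in the piece. The split at `v` uses that an adjacency list names every neighbor once.
open Classical in
theorem countN_runs {M c : ℕ} (hadj : IsAdjLists G adj) {s : PStore} (hp : HasPieces adj C side s)
    (h0 : ∀ u : Fin n, s.arr .num u = 0)
    (hc : 100 * n + 100 * ∑ v, (adj v).length + 100 ≤ c) :
    countN.Runs (Guard.free _ M) s c fun s' => ∀ u : Fin n, s'.arr .num u =
      (Finset.univ.filter fun v : Fin n => s.arr .inN v ≠ 0 ∧ G.Adj u v ∧ C v = C u).card := by
  refine (forV_runs (fun i s' => ∀ u : Fin n, s'.arr .num u = (Finset.univ.filter fun v : Fin n =>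
    (v : ℕ) < i ∧ s.arr .inN v ≠ 0 ∧ G.Adj u v ∧ C v = C u).card)
    (fun v => 50 + 50 * (adj v).length) hp.card (fun u => by simp [h0])
    ?_ (by rw [sum_linear_le]; omega)).mono le_rfl fun s' _ h u => by
      rw [h u]; congr 1; ext v; simp
  rintro v s' hf h2
  have hp' := hp.frame hf rfl
  have hr' : s'.arr .inN = s.arr .inN := hf.arr _ (by decide)
  have hsplit : ∀ u : Fin n, (Finset.univ.filter fun w : Fin n =>
      (w : ℕ) < v + 1 ∧ s.arr .inN w ≠ 0 ∧ G.Adj u w ∧ C w = C u).card = s'.arr .num u +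
        if s.arr .inN v ≠ 0 ∧ G.Adj v u ∧ C u = C v then 1 else 0 := by
    intro u
    rw [h2]
    have hset : (Finset.univ.filter fun w : Fin n =>
        (w : ℕ) < v + 1 ∧ s.arr .inN w ≠ 0 ∧ G.Adj u w ∧ C w = C u) =
        (Finset.univ.filter fun w : Fin n =>
        (w : ℕ) < v ∧ s.arr .inN w ≠ 0 ∧ G.Adj u w ∧ C w = C u) ∪
        if s.arr .inN v ≠ 0 ∧ G.Adj v u ∧ C u = C v then {v} else ∅ := by
      ext w
      simp only [Finset.mem_filter, Finset.mem_univ, true_and, Finset.mem_union]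
      by_cases hwv : w = v
      · subst hwv
        rw [G.adj_comm u w, eq_comm (a := C w)]
        split_ifs with h
        · simp [h]
        · simp [h]
      · have : (w : ℕ) ≠ v := fun h => hwv (Fin.ext h)
        have h3 : (w : ℕ) < v + 1 ↔ (w : ℕ) < v := by omega
        split_ifs <;> simp [hwv, h3]
    rw [hset, Finset.card_union_of_disjoint]
    · split_ifs <;> simp
    · split_ifs <;> simp
  refine Runs.cond (c := 5 + (adj v).length * (27 + 13)) (Exp.safe_free _ _) (Exp.safe_free _ _)
    (fun hr => ?_) (fun hr => ?_) (by simp only [Exp.at, Exp.cost]; omega)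
  · have hrv : s.arr .inN v ≠ 0 := by
      simpa [Cmp.Rel, Exp.eval, Exp.at, hr'] using hr
    refine Runs.mono (forAdj_runs (b := 27) (v := v) (adj := adj) (fun l (s₃ : PStore) =>
      ∀ u : Fin n, s₃.arr .num u = s'.arr .num u + if u ∈ l ∧ C u = C v then 1 else 0)
      (hp'.set (by decide) _).toHasGraph (by simp) (by decide) (by simp) ?_ le_rfl) le_rfl ?_
    · rintro l u s₃ hf₃ hpre h3
      have hp₃ : HasPieces adj C side s₃ := (hp'.set (by decide) _).frame hf₃ rfl
      have hv₃ : s₃.reg .v = v := by rw [hf₃.reg _ (by decide)]; simp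
      have hul : u ∉ l := by
        have := ((hadj v).1.sublist hpre.sublist)
        rw [List.nodup_append'] at this
        simpa [List.disjoint_singleton] using this.2.2
      refine Runs.straight rfl rfl (Nat.le_of_ble_eq_true rfl) ?_
      simp only [den, Exp.eval, Exp.at, Exp.add, Cmp.Rel, BinOp.eval, Store.set_reg,
        Store.set_arr, reduceCtorEq, if_true, if_false, hp₃.cc, hv₃]
      by_cases hcu : C u = C v
      · rw [if_pos hcu]
        intro w
        by_cases hwu : w = u
        · subst hwu
          simp [hcu, h3, hul]
        · have hwu' : (w : ℕ) ≠ u := fun h => hwu (Fin.ext h)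
          simpa [hwu, hwu'] using h3 w
      · rw [if_neg hcu]
        intro w
        by_cases hwu : w = u
        · subst hwu
          simpa [hcu] using h3 w
        · simpa [hwu] using h3 w
    · rintro s₃ - h3 u
      rw [hsplit, h3, ← (hadj v).2]
      simp [hrv]
  · have hrv : s.arr .inN v = 0 := by
      simpa [Cmp.Rel, Exp.eval, Exp.at, hr'] using hr
    intro u
    rw [hsplit]
    simp [hrv]

/-- Mark the vertices with the same neighbors across the cut as the representative. -/
def markX : PStmt :=
  forV (put .inX (.reg .v) (.const 0) ;; cond .ne (.at .side .v) (.const 0)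
    (cond .ne (.get .rep (.at .cc .v)) (.const 0)
      (cond .eq (.at .num .v) (.get .deg (.op .sub (.get .rep (.at .cc .v)) (.const 1)))
        (cond .eq (.at .deg .v) (.get .deg (.op .sub (.get .rep (.at .cc .v)) (.const 1)))
          (put .inX (.reg .v) (.const 1) ;; put .done (.reg .v) (.const 1))))))

theorem markX_runs {M c : ℕ} {s : PStore} (hp : HasPieces adj C side s)
    (hc : 100 * n + 100 ≤ c) :
    markX.Runs (Guard.free _ M) s c fun s' => ∀ v : Fin n,
      (s'.arr .inX v ≠ 0 ↔ side v ≠ 0 ∧ ∃ r, s.arr .rep (C v) = r + 1 ∧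
        s.arr .num v = s.arr .deg r ∧ s.arr .deg v = s.arr .deg r) ∧
      (s'.arr .done v = 0 ↔ s.arr .done v = 0 ∧ s'.arr .inX v = 0) := by
  refine (forV_runs (fun i s' => ∀ v : Fin n,
      ((v : ℕ) < i → (s'.arr .inX v ≠ 0 ↔ side v ≠ 0 ∧ ∃ r, s.arr .rep (C v) = r + 1 ∧
        s.arr .num v = s.arr .deg r ∧ s.arr .deg v = s.arr .deg r) ∧
        (s'.arr .done v = 0 ↔ s.arr .done v = 0 ∧ s'.arr .inX v = 0)) ∧
      (i ≤ v → s'.arr .done v = s.arr .done v)) (fun _ => 70) hp.card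
    (fun v => ⟨fun h => absurd h (by omega), fun _ => rfl⟩) ?_
    (by simp; omega)).mono le_rfl fun s' _ h v => (h v).1 v.2
  intro v s' hf hI
  have hp' := hp.frame hf rfl
  have hrep : s'.arr .rep = s.arr .rep := hf.arr _ (by decide)
  have hnum : s'.arr .num = s.arr .num := hf.arr _ (by decide)
  have hdeg : s'.arr .deg = s.arr .deg := hf.arr _ (by decide)
  have hdone := (hI v).2 le_rfl
  refine Runs.straight rfl rfl (Nat.le_of_ble_eq_true rfl) ?_
  -- Entries of other vertices are not written, so the claim reduces to the current vertex `v`.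
  have key : ∀ s'' : PStore,
      (∀ w : Fin n, w ≠ v → s''.arr .inX w = s'.arr .inX w ∧ s''.arr .done w = s'.arr .done w) →
      ((s''.arr .inX v ≠ 0 ↔ side v ≠ 0 ∧ ∃ r, s.arr .rep (C v) = r + 1 ∧
        s.arr .num v = s.arr .deg r ∧ s.arr .deg v = s.arr .deg r) ∧
        (s''.arr .done v = 0 ↔ s.arr .done v = 0 ∧ s''.arr .inX v = 0)) →
      ∀ w : Fin n, ((w : ℕ) < v + 1 → (s''.arr .inX w ≠ 0 ↔ side w ≠ 0 ∧ ∃ r,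
        s.arr .rep (C w) = r + 1 ∧ s.arr .num w = s.arr .deg r ∧ s.arr .deg w = s.arr .deg r) ∧
        (s''.arr .done w = 0 ↔ s.arr .done w = 0 ∧ s''.arr .inX w = 0)) ∧
        (v + 1 ≤ (w : ℕ) → s''.arr .done w = s.arr .done w) := by
    intro s'' h1 h2 w
    by_cases hwv : w = v
    · subst hwv
      exact ⟨fun _ => h2, fun h => absurd h (by omega)⟩
    · have : (w : ℕ) ≠ v := fun h => hwv (Fin.ext h)
      rw [(h1 w hwv).1, (h1 w hwv).2]
      exact ⟨fun h => (hI w).1 (by omega), fun h => (hI w).2 (by omega)⟩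
  have hne : ∀ w : Fin n, w ≠ v → (w : ℕ) ≠ v := fun w h h' => h (Fin.ext h')
  have hcond : (side v ≠ 0 ∧ ∃ r, s.arr .rep (C v) = r + 1 ∧ s.arr .num v = s.arr .deg r ∧
      s.arr .deg v = s.arr .deg r) ↔ side v ≠ 0 ∧ s.arr .rep (C v) ≠ 0 ∧
        s.arr .num v = s.arr .deg (s.arr .rep (C v) - 1) ∧
        s.arr .deg v = s.arr .deg (s.arr .rep (C v) - 1) := by
    refine and_congr_right fun _ => ⟨?_, fun h => ⟨_, ?_, h.2.1, h.2.2⟩⟩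
    · rintro ⟨r, hr, h⟩
      rw [hr]
      exact ⟨by omega, h⟩
    · have := h.1
      omega
  apply key
  · intro w hw
    simp only [den, Exp.eval, Exp.at, Cmp.Rel, BinOp.eval, Store.set_reg, Store.put_reg,
      Store.set_arr, Store.put_arr, if_true]
    split_ifs <;> simp [hne w hw]
  · rw [hcond]
    simp only [den, Exp.eval, Exp.at, Cmp.Rel, BinOp.eval, Store.set_reg, Store.put_reg,
      Store.set_arr, Store.put_arr, if_true, reduceCtorEq, false_and, if_false, hp'.cc, hp'.side,
      hrep, hnum, hdeg]
    split_ifs with h1 h2 h3 h4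
    · simp only [Store.put_arr, reduceCtorEq, and_self, false_and, if_true, if_false]
      simp [h1, h2, h3, h4, -and_imp]
    · simp [h1, h2, h4, hdone, -and_imp, Store.put_arr]
    · simp [h1, h2, h3, hdone, Store.put_arr]
    · simp [h1, h2, hdone, Store.put_arr]
    · simp [h1, hdone, Store.put_arr]

end WordRAM

/-! ### One level of the labels: bipartite rounds for all pieces -/

namespace WordRAM

open Exp Stmt

variable {n : ℕ} {G : SimpleGraph (Fin n)} {adj : Fin n → List (Fin n)} {C side : Fin n → ℕ}

/-- The labels are written from the addresses `st v` on, without overlaps in the first `W` words. -/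
structure HasStart (W : ℕ) (st : Fin n → ℕ) (s : PStore) : Prop where
  start : ∀ v : Fin n, s.arr .start v = st v
  inj : ∀ v w q q', q < W → q' < W → st v + q = st w + q' → v = w ∧ q = q'

theorem HasStart.frame {W : ℕ} {st : Fin n → ℕ} {s s' : PStore} {p : PStmt} (h : HasStart W st s)
    (hf : p.Frame s s') (hp : decide (PArr.start ∉ p.warrs) = true) : HasStart W st s' :=
  ⟨by rw [hf.arr _ (of_decide_eq_true hp)]; exact h.start, h.inj⟩

/-- Append one word to every label. -/
def emit (a : PArr) : PStmt :=
  forV (put .io (.add (.at .start .v) (.reg .pos)) (.at a .v)) ;;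
  set .pos (.add (.reg .pos) (.const 1))

theorem emit_runs {M c W p : ℕ} {st : Fin n → ℕ} {a : PArr} (ha : a ≠ .io) {s : PStore}
    (hn : s.reg .n = n) (hst : HasStart W st s) (hpos : s.reg .pos = p) (hp : p < W)
    (hc : 30 * n + 30 ≤ c) :
    (emit a).Runs (Guard.free _ M) s c fun s' => s'.reg .pos = p + 1 ∧
      (∀ v, s'.arr .io (st v + p) = s.arr a v) ∧
      ∀ v, ∀ q < W, q ≠ p → s'.arr .io (st v + q) = s.arr .io (st v + q) := by
  have h1 := forV_runs (M := M) (c := 3 + 4 * n + ∑ _ : Fin n, 20) (s := s)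
    (body := put .io (.add (.at .start .v) (.reg .pos)) (.at a .v))
    (fun i s' => (∀ v : Fin n, (v : ℕ) < i → s'.arr .io (st v + p) = s.arr a v) ∧
      ∀ v, ∀ q < W, q ≠ p → s'.arr .io (st v + q) = s.arr .io (st v + q)) (fun _ => 20) hn
    ⟨fun v hv => absurd hv (by omega), fun _ _ _ _ => rfl⟩ (fun v s' hf ⟨h1, h2⟩ => by
      have ha' : s'.arr a = s.arr a := hf.arr _ (by simpa [forV, warrs] using ha)
      have hs' := (hst.frame hf rfl).start v
      have hp' : s'.reg .pos = p := by rw [hf.reg _ (by simp [forV, wregs]), hpos]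
      refine Runs.straight rfl rfl (Nat.le_of_ble_eq_true rfl) ?_
      simp only [den, Exp.eval, Exp.at, Exp.add, BinOp.eval, Store.put_arr, Store.set_arr,
        Store.set_reg, if_true, hs', hp', ha', reduceCtorEq, if_false, true_and]
      refine ⟨fun w hw => ?_, fun w q hq hqp => ?_⟩
      · split_ifs with h
        · rw [(hst.inj _ _ _ _ hp hp h).1]
        · refine h1 w ?_
          have : (w : ℕ) ≠ v := fun h' => h (by rw [Fin.ext h'])
          omega
      · rw [if_neg fun h => hqp (hst.inj _ _ _ _ hq hp h).2]
        exact h2 w q hq hqp) le_rfl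
  refine (h1.seq (c₂ := 10) fun s₁ hf₁ hI₁ => Runs.straight rfl rfl (Nat.le_of_ble_eq_true rfl)
    (Q := fun (s' : PStore) => s'.reg .pos = p + 1 ∧ (∀ v, s'.arr .io (st v + p) = s.arr a v) ∧
      ∀ v, ∀ q < W, q ≠ p → s'.arr .io (st v + q) = s.arr .io (st v + q)) ?_).mono
    (by simp; omega) fun _ _ h => h
  have hp' : s₁.reg .pos = p := by rw [hf₁.reg _ (by simp [forV, wregs]), hpos]
  simpa [den, Exp.eval, Exp.add, BinOp.eval, hp'] using hI₁

/-- One round: a bipartite subgraph for every piece, with the distances to its sides. -/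
def round : PStmt :=
  pickReps ;; markN ;; countN ;; markX ;; bfs .inN ;; emit .dist ;; bfs .inX ;; emit .dist

/-- Two finite sets are equal exactly if their intersection has the size of both. Here `m` is the
size of the intersection of the two neighborhoods, which replaces a comparison element by element.
-/
theorem across_eq_of_card {N : Set (Fin n)} {v r : Fin n} (hN : ∀ u, C u = C v → (u ∈ N ↔ u ∈ across G C side r))
    {m : ℕ} (hm : ∀ S : Finset (Fin n), (∀ u, u ∈ S ↔ u ∈ N ∧ G.Adj v u ∧ C u = C v) → S.card = m) :
    across G C side v = across G C side r ↔
      m = (across G C side r).card ∧ (across G C side v).card = (across G C side r).card := by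
  classical
  have hm' := hm (across G C side v ∩ across G C side r) fun u => by
    rw [Finset.mem_inter, mem_across]
    constructor
    · rintro ⟨⟨h1, h2, h3⟩, h4⟩
      exact ⟨(hN u h2).2 h4, h1, h2⟩
    · rintro ⟨h1, h2, h3⟩
      have h4 := (hN u h3).1 h1
      exact ⟨⟨h2, h3, (mem_across.1 h4).2.2⟩, h4⟩
  constructor
  · intro h
    rw [h, Finset.inter_self] at hm'
    exact ⟨hm'.symm, by rw [h]⟩
  · rintro ⟨h1, h2⟩
    have h3 := Finset.eq_of_subset_of_card_le (Finset.inter_subset_left (s₁ := across G C side v)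
      (s₂ := across G C side r)) (by omega)
    have h4 := Finset.eq_of_subset_of_card_le (Finset.inter_subset_right (s₁ := across G C side v)
      (s₂ := across G C side r)) (by omega)
    rw [← h3, h4]

-- `X` and `Y` are unions over all pieces of the sides of one complete bipartite graph each. The
-- last clause is the progress: in a piece with a pending vertex, the whole class of a pending
-- representative enters `X`.
set_option maxRecDepth 4000 in
theorem round_runs {M c W N p : ℕ} {st : Fin n → ℕ} (hadj : IsAdjLists G adj) {s : PStore}
    (hp : HasPieces adj C side s) (hN : s.reg .nn = N) (hCN : ∀ v, C v < N)
    (hst : HasStart W st s) (hpos : s.reg .pos = p) (hpW : p + 1 < W)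
    (hdeg : ∀ v : Fin n, side v ≠ 0 → s.arr .deg v = (across G C side v).card)
    (hdone : ∀ v : Fin n, s.arr .done v = 0 → side v ≠ 0)
    (hc : 600 * n + 600 * ∑ v, (adj v).length + 100 * N + 600 ≤ c) :
    round.Runs (Guard.free _ M) s c fun s' => s'.reg .pos = p + 2 ∧
      (∀ v, ∀ q < p, s'.arr .io (st v + q) = s.arr .io (st v + q)) ∧
      ∃ X Y : Set (Fin n), (∀ x ∈ X, ∀ y ∈ Y, C x = C y → G.Adj x y) ∧
        (∀ v, s'.arr .io (st v + p) = distCode ((G.restrict C).setDist Y v)) ∧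
        (∀ v, s'.arr .io (st v + (p + 1)) = distCode ((G.restrict C).setDist X v)) ∧
        (∀ v : Fin n, s'.arr .done v = 0 ↔ s.arr .done v = 0 ∧ v ∉ X) ∧
        (∀ x ∈ X, ↑(across G C side x) ⊆ Y) ∧
        ∀ v : Fin n, s.arr .done v = 0 → ∃ r : Fin n, s.arr .done r = 0 ∧ C r = C v ∧
          ∀ w, C w = C v → side w ≠ 0 → across G C side w = across G C side r → w ∈ X := by
  classical
  set S' := ∑ v, (adj v).length with hS'
  refine ((pickReps_runs (c := 50 * n + 50 * N + 50) hp hN le_rfl).seq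
    (c₂ := 500 * n + 400 * S' + 500) fun s₁ f₁ h₁ => ?_).mono (by omega) fun _ _ h => h
  have hp₁ := hp.frame f₁ rfl
  refine ((markN_runs (c := 100 * n + 100 * S' + 100) hadj hp₁ le_rfl).seq
    (c₂ := 380 * n + 300 * S' + 400) fun s₂ f₂ h₂ => ?_).mono (by omega) fun _ _ h => h
  have hp₂ := hp₁.frame f₂ rfl
  refine ((countN_runs (c := 100 * n + 100 * S' + 100) hadj hp₂ h₂.1 le_rfl).seq
    (c₂ := 260 * n + 200 * S' + 300) fun s₃ f₃ h₃ => ?_).mono (by omega) fun _ _ h => h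
  have hp₃ := hp₂.frame f₃ rfl
  refine ((markX_runs (c := 100 * n + 100) hp₃ le_rfl).seq
    (c₂ := 160 * n + 100 * S' + 200) fun s₄ f₄ h₄ => ?_).mono (by omega) fun _ _ h => h
  have hp₄ := hp₃.frame f₄ rfl
  have hNs₄ : s₄.arr .inN = s₂.arr .inN := by
    rw [f₄.arr _ (by decide), f₃.arr _ (by decide)]
  set Y : Set (Fin n) := {u | s₂.arr .inN u ≠ 0} with hY
  set X : Set (Fin n) := {u | s₄.arr .inX u ≠ 0} with hX
  refine ((bfs_runs (c := 50 * n + 50 * S' + 50) hadj hp₄.toHasGraph hp₄.cc (src := .inN)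
    (by decide) (S := Y) (fun v => by rw [hNs₄]; rfl) le_rfl).seq
    (c₂ := 110 * n + 50 * S' + 120) fun s₅ f₅ h₅ => ?_).mono (by omega) fun _ _ h => h
  have hp₅ := hp₄.frame f₅ rfl
  have hst₅ := ((((hst.frame f₁ rfl).frame f₂ rfl).frame f₃ rfl).frame f₄ rfl).frame f₅ rfl
  have pos₅ : s₅.reg .pos = p := by
    rw [f₅.reg _ (by decide), f₄.reg _ (by decide), f₃.reg _ (by decide), f₂.reg _ (by decide),
      f₁.reg _ (by decide), hpos]
  have io₅ : s₅.arr .io = s.arr .io := by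
    rw [f₅.arr _ (by decide), f₄.arr _ (by decide), f₃.arr _ (by decide), f₂.arr _ (by decide),
      f₁.arr _ (by decide)]
  refine ((emit_runs (c := 30 * n + 30) (a := .dist) (by decide) hp₅.card hst₅ pos₅ (by omega)
    le_rfl).seq
    (c₂ := 80 * n + 50 * S' + 80) fun s₆ f₆ h₆ => ?_).mono (by omega)
    fun _ _ h => h
  have hp₆ := hp₅.frame f₆ rfl
  have hXs₆ : s₆.arr .inX = s₄.arr .inX := by
    rw [f₆.arr _ (by decide), f₅.arr _ (by decide)]
  refine ((bfs_runs (c := 50 * n + 50 * S' + 50) hadj hp₆.toHasGraph hp₆.cc (src := .inX)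
    (by decide) (S := X) (fun v => by rw [hXs₆]; rfl) le_rfl).seq
    (c₂ := 30 * n + 30) fun s₇ f₇ h₇ => ?_).mono (by omega) fun _ _ h => h
  have hp₇ := hp₆.frame f₇ rfl
  have hst₇ := (hst₅.frame f₆ rfl).frame f₇ rfl
  have pos₇ : s₇.reg .pos = p + 1 := by rw [f₇.reg _ (by decide), h₆.1]
  have io₇ : s₇.arr .io = s₆.arr .io := f₇.arr _ (by decide)
  refine Runs.mono (emit_runs (c := 30 * n + 30) (a := .dist) (by decide) hp₇.card hst₇ pos₇
    (by omega) le_rfl) le_rfl fun s₈ f₈ h₈ => ?_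
  have hdone₈ : s₈.arr .done = s₄.arr .done := by
    rw [f₈.arr _ (by decide), f₇.arr _ (by decide), f₆.arr _ (by decide), f₅.arr _ (by decide)]
  have hdone₃ : s₃.arr .done = s.arr .done := by
    rw [f₃.arr _ (by decide), f₂.arr _ (by decide), f₁.arr _ (by decide)]
  have hdeg₃ : s₃.arr .deg = s.arr .deg := by
    rw [f₃.arr _ (by decide), f₂.arr _ (by decide), f₁.arr _ (by decide)]
  have hrep₃ : s₃.arr .rep = s₁.arr .rep := by
    rw [f₃.arr _ (by decide), f₂.arr _ (by decide)]
  -- Inside a piece, `Y` is the neighborhood across the cut of its representative; marks made for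
  -- other pieces cannot interfere.
  have hYv : ∀ v r : Fin n, C r = C v → s₁.arr .rep (C v) = r + 1 →
      ∀ u, C u = C v → (u ∈ Y ↔ u ∈ across G C side r) := by
    intro v r hr hrep u hu
    rw [hY, Set.mem_ofPred_eq, h₂.2]
    constructor
    · rintro ⟨r', h3, h4⟩
      have h5 := (mem_across.1 h4).2.1
      rw [← h5, hu, hrep] at h3
      rw [Fin.ext (show (r : ℕ) = r' by omega)]
      exact h4
    · exact fun h => ⟨r, by rw [hr, hrep], h⟩
  have hXv : ∀ v r : Fin n, C r = C v → s₁.arr .rep (C v) = r + 1 → side r ≠ 0 →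
      (v ∈ X ↔ side v ≠ 0 ∧ across G C side v = across G C side r) := by
    intro v r hr hrep hsr
    have hm : ∀ S : Finset (Fin n), (∀ u, u ∈ S ↔ u ∈ Y ∧ G.Adj v u ∧ C u = C v) →
        S.card = s₃.arr .num v := by
      intro S hS
      rw [h₃]
      congr 1
      ext u
      simp [hS, hY]
    rw [across_eq_of_card (hYv v r hr hrep) hm, hX, Set.mem_ofPred_eq, (h₄ v).1, hrep₃, hdeg₃]
    refine and_congr_right fun hsv => ?_
    rw [hdeg v hsv, ← hdeg r hsr]
    constructor
    · rintro ⟨r', h1, h2⟩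
      obtain rfl : (r : ℕ) = r' := by omega
      exact h2
    · exact fun h => ⟨r, hrep, h⟩
  have hXr : ∀ v ∈ X, ∃ r : Fin n, C r = C v ∧ s₁.arr .rep (C v) = r + 1 ∧
      side r ≠ 0 ∧ across G C side v = across G C side r := by
    intro v hv
    have h1 := hv
    rw [hX, Set.mem_ofPred_eq, (h₄ v).1, hrep₃] at h1
    obtain ⟨-, r', h2, -⟩ := h1
    obtain ⟨r, h3, h4, h5⟩ := h₁.1 v (hCN v) (by omega)
    exact ⟨r, h4, h3, hdone r h5, ((hXv v r h4 h3 (hdone r h5)).1 hv).2⟩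
  refine ⟨h₈.1, fun v q hq => ?_, X, Y, ?_, fun v => ?_, fun v => ?_, fun v => ?_, ?_, ?_⟩
  · rw [h₈.2.2 v q (by omega) (by omega), io₇, h₆.2.2 v q (by omega) (by omega), io₅]
  · intro x hx y hy hxy
    obtain ⟨r, h1, h2, -, h4⟩ := hXr x hx
    have := (hYv x r h1 h2 y hxy.symm).1 hy
    rw [← h4] at this
    exact (mem_across.1 this).1
  · rw [h₈.2.2 v p (by omega) (by omega), io₇, h₆.2.1, h₅]
  · rw [h₈.2.1, h₇]
  · rw [hdone₈, (h₄ v).2, hdone₃, hX]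
    simp
  · intro x hx y hy
    obtain ⟨r, h1, h2, -, h4⟩ := hXr x hx
    have hy' : y ∈ across G C side x := hy
    exact (hYv x r h1 h2 y (mem_across.1 hy').2.1).2 (h4 ▸ hy')
  · intro v hv
    obtain ⟨r, h3, h4, h5⟩ := h₁.1 v (hCN v) (h₁.2 v hv)
    refine ⟨r, h5, h4, fun w hw hsw hwr => ?_⟩
    exact (hXv w r (h4.trans hw.symm) (by rw [hw, h3]) (hdone r h5)).2 ⟨hsw, hwr⟩

/-- All rounds of a level. -/
def rounds : PStmt := loop .r (.reg .kk) round

/-- In every piece, the number of different neighborhoods across the cut among pending vertices is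
at most `K - r` after `r` rounds. After `K` rounds nothing is pending, so every edge across a cut is
covered by some round. -/
theorem rounds_runs {M c W N K p : ℕ} {st : Fin n → ℕ} (hadj : IsAdjLists G adj) {s : PStore}
    (hp : HasPieces adj C side s) (hN : s.reg .nn = N) (hCN : ∀ v, C v < N)
    (hst : HasStart W st s) (hpos : s.reg .pos = p) (hK : s.reg .kk = K) (hpW : p + 2 * K ≤ W)
    (hdeg : ∀ v : Fin n, side v ≠ 0 → s.arr .deg v = (across G C side v).card)
    (hdone : ∀ v : Fin n, s.arr .done v = 0 ↔ side v ≠ 0 ∧ (across G C side v).Nonempty)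
    (hcard : ∀ c, ((Finset.univ.filter fun v => side v ≠ 0 ∧ (across G C side v).Nonempty ∧
      C v = c).image (across G C side)).card ≤ K)
    (hc : 3 + K * (600 * n + 600 * ∑ v, (adj v).length + 100 * N + 604) ≤ c) :
    rounds.Runs (Guard.free _ M) s c fun s' => s'.reg .pos = p + 2 * K ∧
      (∀ v, ∀ q < p, s'.arr .io (st v + q) = s.arr .io (st v + q)) ∧
      ∃ X Y : ℕ → Set (Fin n),
        (∀ r < K, ∀ x ∈ X r, ∀ y ∈ Y r, C x = C y → G.Adj x y) ∧
        (∀ x y, G.Adj x y → C x = C y → side x ≠ 0 → side y = 0 →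
          ∃ r < K, x ∈ X r ∧ y ∈ Y r) ∧
        (∀ r < K, ∀ v, s'.arr .io (st v + (p + 2 * r)) =
          distCode ((G.restrict C).setDist (Y r) v)) ∧
        ∀ r < K, ∀ v, s'.arr .io (st v + (p + 2 * r + 1)) =
          distCode ((G.restrict C).setDist (X r) v) := by
  classical
  refine (Runs.loop_const (fun r (s' : PStore) => s'.reg .pos = p + 2 * r ∧
      (∀ v, ∀ q < p, s'.arr .io (st v + q) = s.arr .io (st v + q)) ∧
      (∀ v : Fin n, s'.arr .done v = 0 → s.arr .done v = 0) ∧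
      (∀ c, ((Finset.univ.filter fun v : Fin n => s'.arr .done v = 0 ∧ C v = c).image
        (across G C side)).card ≤ K - r) ∧
      ∃ X Y : ℕ → Set (Fin n),
        (∀ j < r, ∀ x ∈ X j, ∀ y ∈ Y j, C x = C y → G.Adj x y) ∧
        (∀ v : Fin n, s.arr .done v = 0 → s'.arr .done v = 0 ∨
          ∃ j < r, v ∈ X j ∧ ↑(across G C side v) ⊆ Y j) ∧
        (∀ j < r, ∀ v, s'.arr .io (st v + (p + 2 * j)) =
          distCode ((G.restrict C).setDist (Y j) v)) ∧
        ∀ j < r, ∀ v, s'.arr .io (st v + (p + 2 * j + 1)) =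
          distCode ((G.restrict C).setDist (X j) v))
    (600 * n + 600 * ∑ v, (adj v).length + 100 * N + 600) (Exp.safe_free _ _) ?_ ?_
    (by simpa [Exp.cost, Exp.eval, hK] using hc)).mono le_rfl ?_
  · refine ⟨by simpa using hpos, fun _ _ _ => rfl, fun _ h => h, fun c => ?_, fun _ => ∅,
      fun _ => ∅, fun j hj => absurd hj (by omega), fun v h => Or.inl h,
      fun j hj => absurd hj (by omega), fun j hj => absurd hj (by omega)⟩
    simp only [hdone, Nat.sub_zero, and_assoc]
    exact hcard c
  · rintro r hr s' hf ⟨h1, h2, h3, h4, X, Y, h5, h6, h7, h8⟩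
    have hrK : r < K := by simpa [Exp.eval, hK] using hr
    have hp' := hp.frame hf rfl
    have hdeg' : s'.arr .deg = s.arr .deg := hf.arr _ (by decide)
    have hN' : s'.reg .nn = N := by rw [hf.reg _ (by decide), hN]
    refine (round_runs hadj (hp'.set (a := .r) (by decide) r) (by simpa using hN') hCN
      (W := W) (st := st) (p := p + 2 * r) ⟨(hst.frame hf rfl).start, hst.inj⟩ (by simpa using h1)
      (by omega) (by simpa [hdeg'] using hdeg) (fun v hv => ((hdone v).1 (h3 v (by simpa using hv))).1)
      le_rfl).mono le_rfl ?_
    rintro s'' - ⟨g1, g2, X', Y', g3, g4, g5, g6, g7, g8⟩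
    simp only [Store.set_arr] at g2 g6 g8
    refine ⟨by rw [g1]; ring, fun v q hq => by rw [g2 v q (by omega), h2 v q hq],
      fun v hv => h3 v ((g6 v).1 hv).1, fun c => ?_, Function.update X r X',
      Function.update Y r Y', ?_, ?_, ?_, ?_⟩
    · by_cases hex : ∃ v : Fin n, s'.arr .done v = 0 ∧ C v = c
      · obtain ⟨v, hv, rfl⟩ := hex
        obtain ⟨w, hw1, hw2, hw3⟩ := g8 v hv
        -- The neighborhood of the representative `w` disappears from the pending ones, so their
        -- number strictly drops.
        have hsub : (Finset.univ.filter fun u : Fin n => s''.arr .done u = 0 ∧ C u = C v).image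
            (across G C side) ⊂ (Finset.univ.filter fun u : Fin n =>
              s'.arr .done u = 0 ∧ C u = C v).image (across G C side) := by
          rw [Finset.ssubset_iff_of_subset]
          · refine ⟨across G C side w, ?_, ?_⟩
            · exact Finset.mem_image_of_mem _ (by simp [hw1, hw2])
            · simp only [Finset.mem_image, Finset.mem_filter, Finset.mem_univ, true_and, not_exists,
                not_and]
              rintro u ⟨hu1, hu2⟩ hu3
              obtain ⟨hu4, hu5⟩ := (g6 u).1 hu1
              exact hu5 (hw3 u hu2 ((hdone u).1 (h3 u hu4)).1 hu3)
          · refine Finset.image_subset_image fun u hu => ?_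
            simp only [Finset.mem_filter, Finset.mem_univ, true_and] at hu ⊢
            exact ⟨((g6 u).1 hu.1).1, hu.2⟩
        have := Finset.card_lt_card hsub
        have := h4 (C v)
        omega
      · have : (Finset.univ.filter fun u : Fin n => s''.arr .done u = 0 ∧ C u = c) = ∅ := by
          ext u
          simp only [Finset.mem_filter, Finset.mem_univ, true_and, Finset.notMem_empty, iff_false]
          rintro ⟨hu1, hu2⟩
          exact hex ⟨u, ((g6 u).1 hu1).1, hu2⟩
        rw [this]
        simp
    · intro j hj
      by_cases hjr : j = r
      · subst hjr; simpa using g3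
      · simpa [hjr] using h5 j (by omega)
    · intro v hv
      by_cases hv'' : s''.arr .done v = 0
      · exact Or.inl hv''
      rcases h6 v hv with h | ⟨j, hj, hj1, hj2⟩
      · have hvX : v ∈ X' := by
          by_contra hvX
          exact hv'' ((g6 v).2 ⟨h, hvX⟩)
        exact Or.inr ⟨r, by omega, by simpa using hvX, by simpa using g7 v hvX⟩
      · exact Or.inr ⟨j, by omega, by rwa [Function.update_of_ne (by omega)],
          by rwa [Function.update_of_ne (by omega)]⟩
    · intro j hj v
      by_cases hjr : j = r
      · subst hjr; simpa using g4 v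
      · rw [g2 v _ (by omega), h7 j (by omega), Function.update_of_ne hjr]
    · intro j hj v
      by_cases hjr : j = r
      · subst hjr; simpa using g5 v
      · rw [g2 v _ (by omega), h8 j (by omega), Function.update_of_ne hjr]
  · rintro s' - ⟨h1, h2, h3, h4, X, Y, h5, h6, h7, h8⟩
    -- With `K - K = 0` classes left, the set of pending vertices of every piece is empty.
    simp only [Exp.eval, hK, Nat.sub_self, Nat.le_zero, Finset.card_eq_zero, Finset.image_eq_empty]
      at h1 h4 h5 h6 h7 h8
    refine ⟨h1, h2, X, Y, h5, fun x y hxy hC hx hy => ?_, h7, h8⟩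
    have hyx : y ∈ across G C side x := mem_across.2 ⟨hxy, hC.symm, hy⟩
    rcases h6 x ((hdone x).2 ⟨hx, y, hyx⟩) with h | ⟨j, hj, hj1, hj2⟩
    · have hmem : x ∈ Finset.univ.filter fun v : Fin n => s'.arr .done v = 0 ∧ C v = C x := by
        simp [h]
      rw [h4] at hmem
      simp at hmem
    · exact ⟨j, hj, hj1, hj2 hyx⟩

end WordRAM

/-! ### Balanced cuts on the word RAM -/

namespace WordRAM

open Exp Stmt

variable {n k : ℕ} {G : SimpleGraph (Fin n)} {adj : Fin n → List (Fin n)} {T : CutTree G k}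

/-- The registers and arrays that hold the tree. -/
structure HasTree (T : CutTree G k) (s : PStore) : Prop where
  card : s.reg .n = n
  root : s.reg .root = T.root
  nn : s.reg .nn = T.root + 1
  par : ∀ x < T.root, s.arr .par x = T.par x
  leaf : ∀ v : Fin n, s.arr .leaf v = T.leaf v

/-- The registers and arrays of `HasTree` are not written. -/
def KeepsTree (p : PStmt) : Bool :=
  (PReg.n ∉ p.wregs) && (PReg.root ∉ p.wregs) && (PReg.nn ∉ p.wregs) && (PArr.par ∉ p.warrs) &&
    (PArr.leaf ∉ p.warrs)

theorem HasTree.frame {s s' : PStore} {p : PStmt} (h : HasTree T s) (hf : p.Frame s s')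
    (hp : KeepsTree p = true) : HasTree T s' := by
  simp only [KeepsTree, Bool.and_eq_true, decide_eq_true_eq] at hp
  obtain ⟨⟨⟨⟨h1, h2⟩, h3⟩, h4⟩, h5⟩ := hp
  exact ⟨by rw [hf.reg _ h1, h.card], by rw [hf.reg _ h2, h.root], by rw [hf.reg _ h3, h.nn],
    by rw [hf.arr _ h4]; exact h.par, by rw [hf.arr _ h5]; exact h.leaf⟩

/-- For all nodes `i`. -/
def forNode (body : PStmt) : PStmt := loop .i (.reg .nn) body

theorem forNode_runs {M c N b : ℕ} {s : PStore} {body : PStmt} (I : ℕ → PStore → Prop)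
    (hn : s.reg .nn = N) (h0 : I 0 s)
    (hstep : ∀ i < N, ∀ s', (forNode body).Frame s s' → I i s' →
      body.Runs (Guard.free _ M) (s'.set .i i) b (I (i + 1)))
    (hc : 3 + N * (b + 4) ≤ c) : (forNode body).Runs (Guard.free _ M) s c (I N) := by
  have hN : (Exp.reg (α := PArr) PReg.nn).eval s = N := hn
  have := Runs.loop_const (Γ := Guard.free PArr M) (r := PReg.i) (e := .reg .nn) (p := body)
    (s := s) (c := c) I b (Exp.safe_free _ _) h0
    (fun i hi s' hf hI => hstep i (hN ▸ hi) s' hf hI) (by rw [hN]; exact hc)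
  rwa [hN] at this

/-- Count the vertices below the nodes within their components. -/
def countBelow : PStmt :=
  forNode (put .cnt (.reg .i) (.const 0)) ;;
  forV (put .cnt (.at .leaf .v) (.const 1)) ;;
  loop .i (.reg .root) (cond .eq (.at .cut .i) (.const 0)
    (put .cnt (.at .par .i) (.add (.get .cnt (.at .par .i)) (.at .cnt .i))))

/-- When node `i` is due, `cnt` holds the final counts of earlier nodes and, for the others, the
number of vertices standing there; `CutTree.count_succ` describes a round. -/
theorem countBelow_runs {M c : ℕ} (hM : n ≤ M) {s : PStore} (ht : HasTree T s)
    (hc : 60 * (T.root + 1) + 60 * n + 60 ≤ c) :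
    countBelow.Runs (Guard.free _ M) s c fun s' =>
      ∀ x ≤ T.root, s'.arr .cnt x = T.count (s.arr .cut) x := by
  set cut := s.arr .cut with hcut
  refine ((forNode_runs (b := 10) (c := 3 + (T.root + 1) * 14) (fun i s' => ∀ x < i,
    s'.arr .cnt x = 0) ht.nn (fun x hx => absurd hx (by omega)) (fun i hi s' hf hI => ?_)
    le_rfl).seq (c₂ := 60 * n + 30 * (T.root + 1) + 50) fun s₁ hf₁ h₁ => ?_).mono (by omega)
    fun _ _ h => h
  · refine Runs.straight rfl rfl (Nat.le_of_ble_eq_true rfl) fun x hx => ?_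
    have := hI x
    simp only [den, Exp.eval, Store.put_arr, Store.set_reg, Store.set_arr, if_true, true_and]
    split_ifs with h
    exacts [rfl, this (by omega)]
  have ht₁ := ht.frame hf₁ rfl
  refine ((forV_runs (c := 3 + 4 * n + ∑ _ : Fin n, 10) (fun i s' =>
    (∀ v : Fin n, (v : ℕ) < i → s'.arr .cnt (T.leaf v) = 1) ∧
    ∀ x ≤ T.root, (∀ v : Fin n, (v : ℕ) < i → T.leaf v ≠ x) → s'.arr .cnt x = 0)
    (fun _ => 10) ht₁.card ⟨fun v hv => absurd hv (by omega), fun x hx _ => h₁ x (by omega)⟩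
    (fun v s' hf hI => ?_) le_rfl).seq (c₂ := 30 * (T.root + 1) + 30)
    fun s₂ hf₂ h₂ => ?_).mono (by simp; omega) fun _ _ h => h
  · have ht' := ht₁.frame hf rfl
    refine Runs.straight rfl rfl (Nat.le_of_ble_eq_true rfl) ?_
    simp only [den, Exp.eval, Exp.at, Store.put_arr, Store.set_reg, Store.set_arr, if_true,
      true_and, ht'.leaf]
    refine ⟨fun w hw => ?_, fun x hx h => ?_⟩
    · split_ifs with h
      · rfl
      · refine hI.1 w ?_
        have : (w : ℕ) ≠ v := fun h' => h (by rw [Fin.ext h'])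
        omega
    · rw [if_neg fun h' => h v (by omega) h'.symm]
      exact hI.2 x hx fun w hw => h w (by omega)
  have ht₂ := ht₁.frame hf₂ rfl
  have hcut₂ : s₂.arr .cut = cut := by
    rw [hf₂.arr _ (by decide), hf₁.arr _ (by decide)]
  have hroot : (Exp.reg (α := PArr) PReg.root).eval s₂ = T.root := ht₂.root
  have h₃ := Runs.loop_const (Γ := Guard.free PArr M) (r := PReg.i) (e := .reg .root)
    (p := cond .eq (.at .cut .i) (.const 0)
      (put .cnt (.at .par .i) (.add (.get .cnt (.at .par .i)) (.at .cnt .i))))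
    (s := s₂) (c := 30 * (T.root + 1) + 30) (fun i s' =>
      (∀ x < i, s'.arr .cnt x = T.count cut x) ∧ ∀ x, i ≤ x → x ≤ T.root →
        s'.arr .cnt x = (Finset.univ.filter fun v => T.token cut i v = x).card) 20
    (Exp.safe_free _ _) ⟨fun x hx => absurd hx (by omega), fun x _ hx => ?_⟩
    (fun i hi s' hf ⟨h3, h4⟩ => ?_) (by rw [hroot]; simp only [Exp.cost]; omega)
  · refine h₃.mono le_rfl fun s' _ h x hx => ?_
    rw [hroot] at h
    rcases hx.lt_or_eq with hx | rfl
    exacts [h.1 x hx, h.2 _ le_rfl le_rfl]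
  · simp only [CutTree.token]
    by_cases hex : ∃ v, T.leaf v = x
    · obtain ⟨v, rfl⟩ := hex
      rw [h₂.1 v v.2, Finset.card_eq_one.2 ⟨v, ?_⟩]
      ext w
      simp [T.leaf_inj.eq_iff]
    · rw [h₂.2 x hx fun v _ hv => hex ⟨v, hv⟩, eq_comm, Finset.card_eq_zero]
      refine Finset.eq_empty_of_forall_notMem fun w hw => hex ⟨w, ?_⟩
      exact (Finset.mem_filter.1 hw).2
  · rw [hroot] at hi
    have hpar := (ht₂.par i hi)
    have hpar' : s'.arr .par i = T.par i := by rw [hf.arr _ (by decide), hpar]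
    have hcut' : s'.arr .cut = cut := by rw [hf.arr _ (by decide), hcut₂]
    have hlt := T.lt_par i hi
    have hle := T.par_le i hi
    have hi' : s'.arr .cnt i = T.count cut i := h4 i le_rfl hi.le
    have hsucc : ∀ x, i + 1 ≤ x → x ≤ T.root →
        (Finset.univ.filter fun v => T.token cut (i + 1) v = x).card =
          s'.arr .cnt x + if cut i = 0 ∧ T.par i = x then T.count cut i else 0 := fun x hx hx' => by
      rw [CutTree.count_succ i x hx, h4 x (by omega) hx']
    have hdone : ∀ x < i + 1, s'.arr .cnt x = T.count cut x := fun x hx => by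
      rcases Nat.lt_succ_iff_lt_or_eq.1 hx with hx | rfl
      exacts [h3 x hx, hi']
    refine Runs.cond (c := 14) (Exp.safe_free _ _) (Exp.safe_free _ _) (fun h0 => ?_) (fun h0 => ?_)
      (Nat.le_of_ble_eq_true rfl)
    · have h0' : cut i = 0 := by simpa [Cmp.Rel, Exp.eval, Exp.at, hcut'] using h0
      -- The sum of two array entries might double values and is not `slow`. It is the size of a set
      -- of vertices, hence at most `n ≤ M`.
      refine ⟨⟨Exp.safe_free _ _, Exp.safe_free _ _, trivial, Or.inr ?_⟩,
        Nat.le_of_ble_eq_true rfl, ?_⟩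
      · simp only [Exp.eval, Exp.at, Exp.add, BinOp.eval, Store.set_reg, Store.set_arr, if_true,
          hpar', hi']
        have := hsucc (T.par i) hlt hle
        rw [if_pos ⟨h0', rfl⟩] at this
        rw [← this]
        exact (Finset.card_le_univ _).trans (by rw [Fintype.card_fin]; exact hM)
      · simp only [den, Exp.eval, Exp.at, Exp.add, BinOp.eval, Store.set_reg, Store.set_arr,
          Store.put_arr, if_true, hpar', hi', true_and]
        refine ⟨fun x hx => ?_, fun x hx hx' => ?_⟩
        · rw [if_neg (by omega), hdone x hx]
        · rw [hsucc x hx hx']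
          by_cases hxp : x = T.par i
          · simp [hxp, h0']
          · simp [hxp, Ne.symm hxp]
    · have h0' : ¬ cut i = 0 := by simpa [Cmp.Rel, Exp.eval, Exp.at, hcut'] using h0
      refine ⟨hdone, fun x hx hx' => ?_⟩
      rw [hsucc x hx hx', if_neg fun h => h0' h.1, add_zero]
      rfl

/-- Cut the components at balanced nodes. -/
def selectCuts : PStmt :=
  forNode (put .sel (.reg .i) (.const 0)) ;;
  forNode (cond .eq (.get .sel (.at .comp .i)) (.const 0)
    (cond .le (.const 2) (.get .cnt (.at .comp .i))
      (cond .le (.get .cnt (.at .comp .i)) (.add (.at .cnt .i) (.add (.at .cnt .i) (.at .cnt .i)))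
        (put .sel (.at .comp .i) (.const 1) ;; put .cut (.reg .i) (.const 1)))))

/-- Nodes are scanned in increasing order, and `sel` records which components already have a node
with a third of the vertices. So the first such node is chosen, as `CutTree.Selected` requires. -/
theorem selectCuts_runs {M c : ℕ} {s : PStore} (ht : HasTree T s) {cut : ℕ → ℕ}
    (hcomp : ∀ x ≤ T.root, s.arr .comp x ≤ T.root)
    (hcut : s.arr .cut = cut) (hcnt : ∀ x ≤ T.root, s.arr .cnt x = T.count cut x)
    (hc : 100 * (T.root + 1) + 60 ≤ c) :
    selectCuts.Runs (Guard.free _ M) s c fun s' => T.IsNext cut (s.arr .comp) (s'.arr .cut) := by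
  refine ((forNode_runs (b := 10) (c := 3 + (T.root + 1) * 14) (fun i s' => ∀ x < i,
    s'.arr .sel x = 0) ht.nn (fun x hx => absurd hx (by omega)) (fun i hi s' hf hI => ?_)
    le_rfl).seq (c₂ := 70 * (T.root + 1) + 50) fun s₁ hf₁ h₁ => ?_).mono (by omega)
    fun _ _ h => h
  · refine Runs.straight rfl rfl (Nat.le_of_ble_eq_true rfl) fun x hx => ?_
    have := hI x
    simp only [den, Exp.eval, Store.put_arr, Store.set_reg, Store.set_arr, if_true, true_and]
    split_ifs with h
    exacts [rfl, this (by omega)]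
  have ht₁ := ht.frame hf₁ rfl
  have hcut₁ : s₁.arr .cut = cut := by rw [hf₁.arr _ (by decide), hcut]
  have hcnt₁ : s₁.arr .cnt = s.arr .cnt := hf₁.arr _ (by decide)
  have hcomp₁ : s₁.arr .comp = s.arr .comp := hf₁.arr _ (by decide)
  set comp := s.arr .comp with hcompd
  refine (forNode_runs (b := 60) (fun i s' =>
    (∀ x ≤ T.root, s'.arr .cut x ≠ 0 ↔ cut x ≠ 0 ∨ x < i ∧ T.Selected cut comp x) ∧
    ∀ d ≤ T.root, s'.arr .sel d ≠ 0 ↔ ∃ y < i, comp y = d ∧ 2 ≤ T.count cut d ∧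
      T.count cut d ≤ 3 * T.count cut y) ht₁.nn ⟨fun x hx => by simp [hcut₁], fun d hd => ?_⟩
    (fun i hi s' hf ⟨h2, h3⟩ => ?_) (by omega)).mono le_rfl fun s' _ h x hx => ?_
  · simp [h₁ d (by omega)]
  · have hcnt' : s'.arr .cnt = s.arr .cnt := by rw [hf.arr _ (by decide), hcnt₁]
    have hcomp' : s'.arr .comp = comp := by rw [hf.arr _ (by decide), hcomp₁]
    refine Runs.straight rfl rfl (Nat.le_of_ble_eq_true rfl) ?_
    have hir : i ≤ T.root := by omega
    have hci := hcomp i hir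
    have hsel : s'.arr .sel (comp i) = 0 → (T.Selected cut comp i ↔ 2 ≤ T.count cut (comp i) ∧
        T.count cut (comp i) ≤ 3 * T.count cut i) := by
      intro h4
      constructor
      · exact fun h => ⟨h.1, h.2.1⟩
      · rintro ⟨h5, h6⟩
        refine ⟨h5, h6, fun y hy hyc => ?_⟩
        by_contra hcon
        exact (h3 _ hci).2 ⟨y, hy, hyc, h5, by omega⟩ h4
    have hsel' : s'.arr .sel (comp i) ≠ 0 → ¬ T.Selected cut comp i := by
      intro h4 h5
      obtain ⟨y, hy, h6, h7, h8⟩ := (h3 _ hci).1 h4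
      have := h5.2.2 y hy h6
      omega
    have hno : ¬ T.Selected cut comp i → (s'.arr .sel (comp i) ≠ 0 ∨
        ¬ (2 ≤ T.count cut (comp i) ∧ T.count cut (comp i) ≤ 3 * T.count cut i)) →
        (∀ x ≤ T.root, s'.arr .cut x ≠ 0 ↔ cut x ≠ 0 ∨ x < i + 1 ∧ T.Selected cut comp x) ∧
        ∀ d ≤ T.root, s'.arr .sel d ≠ 0 ↔ ∃ y < i + 1, comp y = d ∧ 2 ≤ T.count cut d ∧
          T.count cut d ≤ 3 * T.count cut y := by
      intro h4 h5
      refine ⟨fun x hx => ?_, fun d hd => ?_⟩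
      · rw [h2 x hx]
        refine or_congr_right ⟨fun h => ⟨by omega, h.2⟩, fun h => ⟨?_, h.2⟩⟩
        have : x ≠ i := fun h' => h4 (h' ▸ h.2)
        omega
      · rw [h3 d hd]
        constructor
        · rintro ⟨y, hy, h⟩
          exact ⟨y, by omega, h⟩
        · rintro ⟨y, hy, h6, h⟩
          rcases Nat.lt_succ_iff_lt_or_eq.1 hy with hy | rfl
          · exact ⟨y, hy, h6, h⟩
          · subst h6
            exact (h3 _ hci).1 (h5.resolve_right fun h' => h' h)
    simp only [den, Exp.eval, Exp.at, Exp.add, BinOp.eval, Cmp.Rel, Store.set_reg, Store.set_arr,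
      if_true, hcomp', hcnt']
    rw [hcnt _ hci, hcnt _ hir,
      show T.count cut i + (T.count cut i + T.count cut i) = 3 * T.count cut i by ring]
    split_ifs with g1 g2 g3
    · have hs := (hsel g1).2 ⟨g2, g3⟩
      simp only [Store.put_arr, Store.put_reg, Store.set_arr, Store.set_reg, reduceCtorEq,
        false_and, true_and, if_false, if_true]
      refine ⟨fun x hx => ?_, fun d hd => ?_⟩
      · split_ifs with hxi
        · subst hxi
          simp [hs]
        · rw [h2 x hx]
          exact or_congr_right (and_congr_left' (by omega))
      · split_ifs with hdi
        · subst hdi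
          simp only [ne_eq, one_ne_zero, not_false_eq_true, true_iff]
          exact ⟨i, by omega, rfl, g2, g3⟩
        · rw [h3 d hd]
          constructor
          · rintro ⟨y, hy, h⟩
            exact ⟨y, by omega, h⟩
          · rintro ⟨y, hy, h6, h⟩
            refine ⟨y, ?_, h6, h⟩
            have : y ≠ i := fun h' => hdi (by rw [← h6, h'])
            omega
    · exact hno (fun h => g3 h.2.1) (Or.inr fun h => g3 h.2)
    · exact hno (fun h => g2 h.1) (Or.inr fun h => g2 h.1)
    · exact hno (hsel' g1) (Or.inl g1)
  · rw [h.1 x hx]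
    exact or_congr_right ⟨fun h => h.2, fun h => ⟨by omega, h⟩⟩

/-- Find the components of the new cuts. -/
def findComps : PStmt :=
  forNode (set .x (.op .sub (.reg .root) (.reg .i)) ;; put .comp' (.reg .x) (.reg .x) ;;
    cond .eq (.at .cut .x) (.const 0) (put .comp' (.reg .x) (.get .comp' (.at .par .x))))

/-- Nodes are visited from the root downwards, as `x = root - i`. The parent has the larger number,
so its component is known when `x` is reached. -/
theorem findComps_runs {M c : ℕ} {s : PStore} (ht : HasTree T s) (hroot : s.arr .cut T.root ≠ 0)
    (hc : 60 * (T.root + 1) + 60 ≤ c) :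
    findComps.Runs (Guard.free _ M) s c fun s' => T.IsComp (s.arr .cut) (s'.arr .comp') := by
  refine (forNode_runs (b := 50) (fun i s' => ∀ x ≤ T.root, T.root < x + i →
    (s.arr .cut x ≠ 0 → s'.arr .comp' x = x) ∧
    (s.arr .cut x = 0 → s'.arr .comp' x = s'.arr .comp' (T.par x))) ht.nn
    (fun x hx hx' => absurd hx' (by omega)) (fun i hi s' hf hI => ?_) (by omega)).mono le_rfl
    fun s' _ h => ⟨hroot, fun x hx => (h x hx (by omega)).1, fun x hx => (h x hx (by omega)).2⟩
  have ht' := ht.frame hf rfl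
  have hcut' : s'.arr .cut = s.arr .cut := hf.arr _ (by decide)
  refine Runs.straight rfl rfl (Nat.le_of_ble_eq_true rfl) fun x hx hxi => ?_
  simp only [den, Exp.eval, Exp.at, BinOp.eval, Cmp.Rel, Store.set_reg, Store.set_arr,
    Store.put_arr, Store.put_reg, reduceCtorEq, if_true, if_false, false_and, ht'.root, hcut']
  by_cases hxx : x = T.root - i
  · rw [← hxx]
    by_cases h0 : s.arr .cut x = 0
    · have hlt : x < T.root := lt_of_le_of_ne hx fun h => hroot (h ▸ h0)
      have := T.lt_par x hlt
      have hne : T.par x ≠ x := by omega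
      simp [h0, Store.put_arr, ht'.par x hlt, hne]
    · simp [h0, Store.put_arr]
  · have hI' := hI x hx (by omega)
    have hne : s.arr .cut x = 0 → T.par x ≠ T.root - i := fun h0 => by
      have hlt : x < T.root := lt_of_le_of_ne hx fun h => hroot (h ▸ h0)
      have := T.lt_par x hlt
      omega
    refine ⟨fun h => ?_, fun h => ?_⟩
    · split_ifs <;> simpa [hxx, Store.put_arr] using hI'.1 h
    · have := hne h
      split_ifs <;> simpa [hxx, this, Store.put_arr] using hI'.2 h

/-- Find the pieces and the sides of the vertices. -/
def findPieces : PStmt :=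
  forV (put .cc (.reg .v) (.get .comp (.at .leaf .v)) ;; put .side (.reg .v) (.const 0) ;;
    cond .ne (.get .comp' (.at .leaf .v)) (.get .comp (.at .leaf .v))
      (put .side (.reg .v) (.const 1)))

theorem findPieces_runs {M c : ℕ} {s : PStore} (ht : HasTree T s) (hc : 60 * n + 60 ≤ c) :
    findPieces.Runs (Guard.free _ M) s c fun s' => ∀ v : Fin n,
      s'.arr .cc v = s.arr .comp (T.leaf v) ∧ s'.arr .side v =
        if s.arr .comp' (T.leaf v) = s.arr .comp (T.leaf v) then 0 else 1 := by
  refine forV_map _ (fun _ => 50) ht.card (fun v s' hf => ?_) (by simp; omega)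
  have ht' := ht.frame hf rfl
  have hc1 : s'.arr .comp = s.arr .comp := hf.arr _ (by decide)
  have hc2 : s'.arr .comp' = s.arr .comp' := hf.arr _ (by decide)
  refine Runs.straight rfl rfl (Nat.le_of_ble_eq_true rfl) ?_
  simp only [den, Exp.eval, Exp.at, Cmp.Rel, Store.set_reg, Store.set_arr, ht'.leaf,
    Store.put_arr, Store.put_reg, reduceCtorEq, if_true, if_false, false_and, hc1, hc2]
  have hne : ∀ w : Fin n, w ≠ v → (w : ℕ) ≠ v := fun w h h' => h (Fin.ext h')
  by_cases h : s.arr .comp' (T.leaf v) = s.arr .comp (T.leaf v)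
  · simp only [h, ne_eq, not_true_eq_false, if_false, Store.put_arr, true_and, if_true,
      reduceCtorEq, false_and]
    intro w hw h'
    simpa [hne w hw] using h'
  · simp only [h, ne_eq, not_false_eq_true, Store.put_arr, true_and, if_true, if_false,
      reduceCtorEq, false_and]
    intro w hw h'
    simpa [hne w hw] using h'

/-- The new components become the current ones. -/
def copyComps : PStmt := forNode (put .comp (.reg .i) (.at .comp' .i))

theorem copyComps_runs {M c : ℕ} {s : PStore} (ht : HasTree T s)
    (hc : 30 * (T.root + 1) + 60 ≤ c) :
    copyComps.Runs (Guard.free _ M) s c fun s' =>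
      ∀ x ≤ T.root, s'.arr .comp x = s.arr .comp' x := by
  refine (forNode_runs (b := 20) (fun i s' => ∀ x < i, s'.arr .comp x = s.arr .comp' x) ht.nn
    (fun x hx => absurd hx (by omega)) (fun i hi s' hf hI => ?_) (by omega)).mono le_rfl
    fun s' _ h x hx => h x (by omega)
  have hc2 : s'.arr .comp' = s.arr .comp' := hf.arr _ (by decide)
  refine Runs.straight rfl rfl (Nat.le_of_ble_eq_true rfl) fun x hx => ?_
  have := hI x
  simp only [den, Exp.eval, Exp.at, Store.put_arr, Store.set_reg, Store.set_arr, if_true, true_and,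
    hc2]
  split_ifs with h
  exacts [by rw [h], this (by omega)]

end WordRAM

/-! ### The levels of the labels -/

namespace WordRAM

open Exp Stmt

variable {n k : ℕ} {G : SimpleGraph (Fin n)} {adj : Fin n → List (Fin n)} {T : CutTree G k}

/-- One level of the labels. -/
def level : PStmt :=
  countBelow ;; selectCuts ;; findComps ;; findPieces ;; emit .side ;; countAcross ;; rounds ;;
  copyComps

/-- The invariant of the labels after `l` levels. -/
structure LevelInv (T : CutTree G k) (adj : Fin n → List (Fin n)) (st : Fin n → ℕ) (W K B : ℕ)
    (head : ℕ → ℕ) (l : ℕ) (s : PStore) : Prop where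
  graph : HasGraph adj s
  tree : HasTree T s
  start : HasStart W st s
  kk : s.reg .kk = K
  pos : s.reg .pos = recPos K l
  comp : T.IsComp (s.arr .cut) (s.arr .comp)
  size : ∀ c ≤ T.root, (Finset.univ.filter fun v => s.arr .comp (T.leaf v) = c).card ≤ 1 ∨
    3 ^ l * (Finset.univ.filter fun v => s.arr .comp (T.leaf v) = c).card ≤ 2 ^ l * n
  head : ∀ v, ∀ q < 3, s.arr .io (st v + q) = head q
  word_le : ∀ v, ∀ q < recPos K l, s.arr .io (st v + q) ≤ B
  query : ∀ u v, QueryInv G (fun w => s.arr .comp (T.leaf w)) u v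
    (queryFold K (fun q => s.arr .io (st u + q)) (fun q => s.arr .io (st v + q)) l)

/-- On `S`, the map `f` factors through `g`. -/
theorem card_image_le_card_image {α β γ : Type} [DecidableEq β] [DecidableEq γ] (S : Finset α)
    (f : α → β) (g : α → γ) (h : ∀ a ∈ S, ∀ b ∈ S, g a = g b → f a = f b) :
    (S.image f).card ≤ (S.image g).card := by
  classical
  rcases S.eq_empty_or_nonempty with rfl | ⟨a₀, -⟩
  · simp
  refine (Finset.card_le_card (t := (S.image g).image fun i =>
    if h : ∃ a ∈ S, g a = i then f h.choose else f a₀) fun b hb => ?_).trans Finset.card_image_le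
  obtain ⟨a, ha, rfl⟩ := Finset.mem_image.1 hb
  refine Finset.mem_image.2 ⟨g a, Finset.mem_image_of_mem _ ha, ?_⟩
  have hex : ∃ a' ∈ S, g a' = g a := ⟨a, ha, rfl⟩
  rw [dif_pos hex]
  exact h _ hex.choose_spec.1 _ ha hex.choose_spec.2

/-- The piece of a tree component that is cut off by the next cuts. -/
def cutSide (T : CutTree G k) (comp comp' : ℕ → ℕ) (v : Fin n) : ℕ :=
  if comp' (T.leaf v) = comp (T.leaf v) then 0 else 1

theorem cutSide_ne_zero {comp comp' : ℕ → ℕ} {v : Fin n} :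
    cutSide T comp comp' v ≠ 0 ↔ comp' (T.leaf v) ≠ comp (T.leaf v) := by
  unfold cutSide; split_ifs with h <;> simp [h]

theorem cutSide_eq_zero {comp comp' : ℕ → ℕ} {v : Fin n} :
    cutSide T comp comp' v = 0 ↔ comp' (T.leaf v) = comp (T.leaf v) := by
  unfold cutSide; split_ifs with h <;> simp [h]

theorem cutSide_eq_iff {comp comp' : ℕ → ℕ} {u v : Fin n} :
    cutSide T comp comp' u = cutSide T comp comp' v ↔
      (comp' (T.leaf u) = comp (T.leaf u) ↔ comp' (T.leaf v) = comp (T.leaf v)) := by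
  unfold cutSide; split_ifs with h1 h2 h2 <;> simp [h1, h2]

/-- By `CutTree.classes_next`, equal classes give equal neighborhoods across the cut, so `k` rounds
suffice; `n` rounds suffice trivially. The minimum keeps the number of rounds below `2 ^ lg n`. -/
theorem card_across_le {cut comp cut' comp' : ℕ → ℕ} (h : T.IsComp cut comp)
    (hn : T.IsNext cut comp cut') (h' : T.IsComp cut' comp') (c : ℕ) :
    ((Finset.univ.filter fun v => cutSide T comp comp' v ≠ 0 ∧
      (across G (fun w => comp (T.leaf w)) (cutSide T comp comp') v).Nonempty ∧
      comp (T.leaf v) = c).image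
        (across G (fun w => comp (T.leaf w)) (cutSide T comp comp'))).card ≤ min k n := by
  classical
  refine le_min ?_ (Finset.card_image_le.trans ((Finset.card_le_univ _).trans (by simp)))
  obtain ⟨lab, hlab⟩ := CutTree.classes_next h hn h' (c := c)
  refine (card_image_le_card_image _ _ lab ?_).trans ((Finset.card_le_univ _).trans (by simp))
  intro u hu v hv huv
  simp only [Finset.mem_filter, Finset.mem_univ, true_and, cutSide_ne_zero] at hu hv
  obtain ⟨hu1, -, hu2⟩ := hu
  obtain ⟨hv1, -, hv2⟩ := hv
  ext y
  rw [mem_across, mem_across, hu2, hv2]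
  refine and_congr_left fun ⟨h1, h2⟩ => hlab u v y hu2 hv2 h1 (hu2 ▸ hu1) (hv2 ▸ hv1) ?_ huv
  rw [cutSide_eq_zero] at h2
  rw [h2, h1]

theorem size_next {cut comp cut' comp' : ℕ → ℕ} (h : T.IsComp cut comp)
    (hn : T.IsNext cut comp cut') (h' : T.IsComp cut' comp') {l : ℕ}
    (hs : ∀ c ≤ T.root, (Finset.univ.filter fun v => comp (T.leaf v) = c).card ≤ 1 ∨
      3 ^ l * (Finset.univ.filter fun v => comp (T.leaf v) = c).card ≤ 2 ^ l * n)
    {c : ℕ} (hc : c ≤ T.root) : (Finset.univ.filter fun v => comp' (T.leaf v) = c).card ≤ 1 ∨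
      3 ^ (l + 1) * (Finset.univ.filter fun v => comp' (T.leaf v) = c).card ≤ 2 ^ (l + 1) * n := by
  have h3 : 0 < 3 ^ l := by positivity
  -- `card_next` wants one bound for all components; the `max` covers single vertices, when the
  -- fraction of `n` has dropped below one.
  have hm := CutTree.card_next h hn h' hc (m := max 1 (2 ^ l * n / 3 ^ l)) fun c hc => by
    rcases hs c hc with h1 | h1
    · exact h1.trans (le_max_left _ _)
    · exact ((Nat.le_div_iff_mul_le h3).2 (by rwa [mul_comm])).trans (le_max_right _ _)
  rcases hm with hm | hm
  · exact Or.inl hm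
  rcases le_total 1 (2 ^ l * n / 3 ^ l) with h1 | h1
  · rw [max_eq_right h1] at hm
    right
    have h2 := Nat.mul_div_le (2 ^ l * n) (3 ^ l)
    calc _ = 3 ^ l * (3 * (Finset.univ.filter fun v => comp' (T.leaf v) = c).card) := by ring
      _ ≤ 3 ^ l * (2 * (2 ^ l * n / 3 ^ l)) := by gcongr
      _ = 2 * (3 ^ l * (2 ^ l * n / 3 ^ l)) := by ring
      _ ≤ 2 * (2 ^ l * n) := by gcongr
      _ = _ := by ring
  · rw [max_eq_left h1] at hm
    left
    omega

theorem level_cost {n K S N : ℕ} (hK : 1 ≤ K) (hN : N ≤ 2 * n) :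
    500 * N + 500 * n + 100 * S + 500 + (3 + K * (600 * n + 600 * S + 100 * N + 604)) ≤
      3000 * (K * (n + S + 1)) := by
  have h1 : n + S + 1 ≤ K * (n + S + 1) := Nat.le_mul_of_pos_left _ hK
  have h2 : K * (600 * n + 600 * S + 100 * N + 604) ≤ K * (800 * (n + S + 1)) :=
    Nat.mul_le_mul_left _ (by omega)
  have h3 : K * (800 * (n + S + 1)) = 800 * (K * (n + S + 1)) := by ring
  omega

-- A level appends one record, the side followed by `K` pairs of distances to `Y r` and `X r`,
-- measured in the old pieces. Earlier records are untouched, so the old query invariant carries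
-- over and `QueryInv.step` advances it.
set_option maxRecDepth 4000 in
theorem level_runs {M c W K B l : ℕ} {st : Fin n → ℕ} {head : ℕ → ℕ} (hadj : IsAdjLists G adj)
    (hM : n ≤ M) (hK : K = min k n) (hK1 : 1 ≤ K) (hroot : T.root + 1 ≤ 2 * n)
    (hB : n ≤ B) {s : PStore}
    (hI : LevelInv T adj st W K B head l s) (hW : recPos K (l + 1) ≤ W)
    (hc : 3000 * (K * (n + ∑ v, (adj v).length + 1)) ≤ c) :
    level.Runs (Guard.free _ M) s c (LevelInv T adj st W K B head (l + 1)) := by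
  classical
  set S := ∑ v, (adj v).length with hS
  set N := T.root + 1 with hN
  have hcost := level_cost (S := S) hK1 hroot
  set R := K * (600 * n + 600 * S + 100 * N + 604) with hR
  set cut := s.arr .cut with hcut
  set comp := s.arr .comp with hcomp
  have hrec := recPos_succ K l
  have compLe : ∀ x ≤ T.root, comp x ≤ T.root := fun x hx => (hI.comp.comp_spec x hx).2.1
  refine ((countBelow_runs (c := 60 * N + 60 * n + 60) hM hI.tree le_rfl).seq
    (c₂ := 190 * N + 190 * n + 100 * S + 400 + (3 + R)) fun s₁ f₁ h₁ => ?_).mono (by omega)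
    fun _ _ h => h
  have t₁ := hI.tree.frame f₁ rfl
  have comp₁ : s₁.arr .comp = comp := f₁.arr _ (by decide)
  have cut₁ : s₁.arr .cut = cut := f₁.arr _ (by decide)
  refine ((selectCuts_runs (c := 100 * N + 60) t₁ (by rw [comp₁]; exact compLe) cut₁ h₁
    le_rfl).seq (c₂ := 90 * N + 190 * n + 100 * S + 340 + (3 + R)) fun s₂ f₂ h₂ => ?_).mono
    (by omega) fun _ _ h => h
  rw [comp₁] at h₂
  have t₂ := t₁.frame f₂ rfl
  refine ((findComps_runs (c := 60 * N + 60) t₂ ((h₂ _ le_rfl).2 (Or.inl hI.comp.root))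
    le_rfl).seq (c₂ := 30 * N + 190 * n + 100 * S + 280 + (3 + R)) fun s₃ f₃ h₃ => ?_).mono
    (by omega) fun _ _ h => h
  have t₃ := t₂.frame f₃ rfl
  set cut' := s₂.arr .cut with hcut'
  set comp' := s₃.arr .comp' with hcomp'
  have comp₃ : s₃.arr .comp = comp := by rw [f₃.arr _ (by decide), f₂.arr _ (by decide), comp₁]
  refine ((findPieces_runs (c := 60 * n + 60) t₃ le_rfl).seq
    (c₂ := 30 * N + 130 * n + 100 * S + 220 + (3 + R)) fun s₄ f₄ h₄ => ?_).mono
    (by omega) fun _ _ h => h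
  have t₄ := t₃.frame f₄ rfl
  rw [comp₃, ← hcomp'] at h₄
  set C : Fin n → ℕ := fun w => comp (T.leaf w) with hC
  set side := cutSide T comp comp' with hside
  have g₄ : HasGraph adj s₄ := (((hI.graph.frame f₁ (by decide)).frame f₂ (by decide)).frame f₃
    (by decide)).frame f₄ (by decide)
  have p₄ : HasPieces adj C side s₄ := ⟨g₄, fun v => (h₄ v).1, fun v => (h₄ v).2⟩
  have st₄ := (((hI.start.frame f₁ rfl).frame f₂ rfl).frame f₃ rfl).frame f₄ rfl
  have pos₄ : s₄.reg .pos = recPos K l := by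
    rw [f₄.reg _ (by decide), f₃.reg _ (by decide), f₂.reg _ (by decide), f₁.reg _ (by decide),
      hI.pos]
  have io₄ : s₄.arr .io = s.arr .io := by
    rw [f₄.arr _ (by decide), f₃.arr _ (by decide), f₂.arr _ (by decide), f₁.arr _ (by decide)]
  refine ((emit_runs (c := 30 * n + 30) (a := .side) (by decide) p₄.card st₄ pos₄ (by omega)
    le_rfl).seq (c₂ := 30 * N + 100 * n + 100 * S + 190 + (3 + R)) fun s₅ f₅ h₅ => ?_).mono
    (by omega) fun _ _ h => h
  have p₅ := p₄.frame f₅ rfl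
  have st₅ := st₄.frame f₅ rfl
  refine ((countAcross_runs (c := 100 * n + 100 * S + 100) hadj p₅ le_rfl).seq
    (c₂ := 30 * N + 90 + (3 + R)) fun s₆ f₆ h₆ => ?_).mono (by omega) fun _ _ h => h
  have p₆ := p₅.frame f₆ rfl
  have st₆ := st₅.frame f₆ rfl
  have t₆ := (t₄.frame f₅ rfl).frame f₆ rfl
  have pos₆ : s₆.reg .pos = recPos K l + 1 := by rw [f₆.reg _ (by decide), h₅.1]
  have io₆ : s₆.arr .io = s₅.arr .io := f₆.arr _ (by decide)
  have kk₆ : s₆.reg .kk = K := by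
    rw [f₆.reg _ (by decide), f₅.reg _ (by decide), f₄.reg _ (by decide), f₃.reg _ (by decide),
      f₂.reg _ (by decide), f₁.reg _ (by decide), hI.kk]
  refine ((rounds_runs (c := 3 + R) hadj p₆ t₆.nn (fun v => Nat.lt_succ_of_le
    (compLe _ (T.leaf_le v))) st₆ pos₆ kk₆ (by omega) (fun v => (h₆ v).1) (fun v => (h₆ v).2)
    (fun c => hK ▸ card_across_le hI.comp h₂ h₃ c) le_rfl).seq (c₂ := 30 * N + 60)
    fun s₇ f₇ h₇ => ?_).mono (by omega) fun _ _ h => h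
  have t₇ := t₆.frame f₇ rfl
  refine Runs.mono (copyComps_runs (c := 30 * N + 60) t₇ le_rfl) le_rfl fun s₈ f₈ h₈ => ?_
  have comp₇ : s₇.arr .comp' = comp' := by
    rw [f₇.arr _ (by decide), f₆.arr _ (by decide), f₅.arr _ (by decide), f₄.arr _ (by decide)]
  rw [comp₇] at h₈
  have cut₈ : s₈.arr .cut = cut' := by
    rw [f₈.arr _ (by decide), f₇.arr _ (by decide), f₆.arr _ (by decide), f₅.arr _ (by decide),
      f₄.arr _ (by decide), f₃.arr _ (by decide)]
  have io₈ : s₈.arr .io = s₇.arr .io := f₈.arr _ (by decide)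
  obtain ⟨h₇1, h₇2, X, Y, h₇3, h₇4, h₇5, h₇6⟩ := h₇
  have leaf₈ : ∀ v, s₈.arr .comp (T.leaf v) = comp' (T.leaf v) := fun v => h₈ _ (T.leaf_le v)
  have old : ∀ v, ∀ q < recPos K l, s₈.arr .io (st v + q) = s.arr .io (st v + q) := by
    intro v q hq
    rw [io₈, h₇2 v q (by omega), io₆, h₅.2.2 v q (by omega) (by omega), io₄]
  have sideW : ∀ v, s₈.arr .io (st v + recPos K l) = side v := fun v => by
    rw [io₈, h₇2 v _ (by omega), io₆, h₅.2.1, (h₄ v).2]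
    rfl
  have w5 : ∀ r < K, ∀ v, s₈.arr .io (st v + (recPos K l + 1 + 2 * r)) =
      distCode ((G.restrict C).setDist (Y r) v) := fun r hr v => by rw [io₈]; exact h₇5 r hr v
  have w6 : ∀ r < K, ∀ v, s₈.arr .io (st v + (recPos K l + 2 + 2 * r)) =
      distCode ((G.restrict C).setDist (X r) v) := fun r hr v => by
    rw [io₈, ← h₇6 r hr v, show recPos K l + 2 + 2 * r = recPos K l + 1 + 2 * r + 1 by omega]
  have h3 : 3 ≤ recPos K l := Nat.le_add_right _ _
  refine ⟨p₆.toHasGraph.frame f₇ (by decide) |>.frame f₈ (by decide), t₇.frame f₈ rfl,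
    (st₆.frame f₇ rfl).frame f₈ rfl, by rw [f₈.reg _ (by decide), f₇.reg _ (by decide), kk₆],
    by rw [f₈.reg _ (by decide), h₇1, hrec]; omega, ⟨by rw [cut₈]; exact h₃.root,
      fun x hx h => ?_, fun x hx h => ?_⟩, ?_, fun v q hq => ?_, fun v q hq => ?_, fun u v => ?_⟩
  · rw [h₈ x hx]; exact h₃.self x hx (by rwa [cut₈] at h)
  · rw [cut₈] at h
    rw [h₈ x hx, h₃.up x hx h, h₈ _ (T.par_le x (h₃.lt_root hx h))]
  · intro c hc
    simp only [leaf₈]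
    exact size_next hI.comp h₂ h₃ hI.size hc
  · rw [old v q (by omega), hI.head v q hq]
  · by_cases hq1 : q < recPos K l
    · rw [old v q hq1]; exact hI.word_le v q hq1
    by_cases hq2 : q = recPos K l
    · rw [hq2, sideW, hside]
      have : 1 ≤ n := hK1.trans (hK ▸ min_le_right _ _)
      unfold cutSide
      split_ifs <;> omega
    obtain ⟨r, hr, rfl | rfl⟩ : ∃ r < K, q = recPos K l + 1 + 2 * r ∨
        q = recPos K l + 2 + 2 * r := ⟨(q - (recPos K l + 1)) / 2, by omega, by omega⟩
    · rw [w5 r hr]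
      exact (distCode_setDist_le _ _ _).trans (by simpa using hB)
    · rw [w6 r hr]
      exact (distCode_setDist_le _ _ _).trans (by simpa using hB)
  · simp only [leaf₈]
    have hq := hI.query u v
    rw [queryFold_congr (f' := fun q => s₈.arr .io (st u + q)) (g' := fun q => s₈.arr .io (st v + q))
      (fun p hp => (old u p hp).symm) (fun p hp => (old v p hp).symm)] at hq
    refine hq.step (f := fun q => s₈.arr .io (st u + q)) (g := fun q => s₈.arr .io (st v + q))
      (C' := fun w => comp' (T.leaf w)) (side := side) (fun u v => ?_) h₇3
      (fun x y hxy hxyC hs => ?_) (sideW u) (sideW v) (fun r hr => w5 r hr u)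
      (fun r hr => w6 r hr u) (fun r hr => w5 r hr v) (fun r hr => w6 r hr v)
    · rw [CutTree.comp_next_eq_iff hI.comp h₂ h₃ (T.leaf_le u) (T.leaf_le v), cutSide_eq_iff]
    -- The rounds cover edges oriented from the part cut off to the rest; an edge across the cut has
    -- exactly one such orientation.
    · by_cases hx : side x = 0
      · obtain ⟨r, hr, h⟩ := h₇4 y x hxy.symm hxyC.symm (fun hy => hs (hx.trans hy.symm)) hx
        exact ⟨r, hr, Or.inr h⟩
      · have hy : side y = 0 := by
          rw [hside, cutSide] at hs hx ⊢
          by_contra hy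
          rw [cutSide] at hs
          split_ifs at hs hx hy <;> simp_all
        obtain ⟨r, hr, h⟩ := h₇4 x y hxy hxyC hx hy
        exact ⟨r, hr, Or.inl h⟩

/-- All levels of the labels. -/
def levels : PStmt := loop .l (.reg .lam) level

theorem levels_runs {M c W K B Λ : ℕ} {st : Fin n → ℕ} {head : ℕ → ℕ} (hadj : IsAdjLists G adj)
    (hM : n ≤ M) (hK : K = min k n) (hK1 : 1 ≤ K) (hroot : T.root + 1 ≤ 2 * n)
    (hB : n ≤ B) {s : PStore} (hΛ : s.reg .lam = Λ)
    (hI : LevelInv T adj st W K B head 0 s) (hW : recPos K Λ ≤ W)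
    (hc : 3 + Λ * (3000 * (K * (n + ∑ v, (adj v).length + 1)) + 4) ≤ c) :
    levels.Runs (Guard.free _ M) s c (LevelInv T adj st W K B head Λ) := by
  have hev : (Exp.reg (α := PArr) PReg.lam).eval s = Λ := hΛ
  have := Runs.loop_const (Γ := Guard.free PArr M) (r := PReg.l) (e := .reg .lam) (p := level)
    (s := s) (c := c) (LevelInv T adj st W K B head)
    (3000 * (K * (n + ∑ v, (adj v).length + 1))) (Exp.safe_free _ _) hI (fun l hl s' hf hI' => ?_)
    (by rw [hev]; exact hc)
  · rwa [hev] at this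
  · rw [hev] at hl
    refine level_runs hadj hM hK hK1 hroot hB (l := l) ?_ ?_ le_rfl
    · exact ⟨hI'.graph.congr (by simp) rfl rfl rfl,
        ⟨by simpa using hI'.tree.card, by simpa using hI'.tree.root, by simpa using hI'.tree.nn,
          hI'.tree.par, hI'.tree.leaf⟩, ⟨hI'.start.start, hI'.start.inj⟩, by simpa using hI'.kk,
        by simpa using hI'.pos, hI'.comp, hI'.size, hI'.head, hI'.word_le, hI'.query⟩
    · refine le_trans ?_ hW
      unfold recPos
      gcongr
      omega

/-- After sufficiently many levels, the pieces are single vertices. -/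
theorem LevelInv.result {W K B : ℕ} {st : Fin n → ℕ} {head : ℕ → ℕ} {s : PStore}
    (h : LevelInv T adj st W K B head (2 * (lg n - 1)) s) (h1 : head 1 = K)
    (h2 : head 2 = 2 * (lg n - 1)) (u v : Fin n) :
    ofCode (queryResult (fun q => s.arr .io (st u + q)) fun q => s.arr .io (st v + q)) =
      G.edist u v := by
  have hq := h.query u v
  refine QueryInv.result (C := fun w => s.arr .comp (T.leaf w)) ?_ fun x y hxy => ?_
  · simp only [h.head _ 1 (by omega), h.head _ 2 (by omega), h1, h2]
    exact hq
  · set c := s.arr .comp (T.leaf x) with hc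
    have hcr : c ≤ T.root := (h.comp.comp_spec _ (T.leaf_le x)).2.1
    have hle : (Finset.univ.filter fun v => s.arr .comp (T.leaf v) = c).card ≤ 1 := by
      rcases h.size c hcr with h3 | h3
      · exact h3
      set m := (Finset.univ.filter fun v => s.arr .comp (T.leaf v) = c).card
      have hlt : n < 2 ^ (Nat.log 2 n + 1) := Nat.lt_pow_succ_log_self (by omega) n
      simp only [lg, Nat.add_sub_cancel] at h3
      set a := Nat.log 2 n
      by_contra hm
      have hm2 : 2 ≤ m := by omega
      -- With `a = log₂ n`, a piece of at least two vertices would give `2 * 9 ^ a ≤ 4 ^ a * n < 2 *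
      -- 8 ^ a`. Two levels shrink pieces by `4 / 9 < 1 / 2`, hence the `2 * a` levels.
      have h4 : 2 ^ (2 * a) * n < 2 ^ (2 * a) * 2 ^ (a + 1) := by gcongr
      have h5 : 2 ^ (2 * a) * 2 ^ (a + 1) = 8 ^ a * 2 := by
        rw [← pow_add, show 2 * a + (a + 1) = 3 * a + 1 by ring, pow_succ, pow_mul]; norm_num
      have h6 : 8 ^ a ≤ 3 ^ (2 * a) := by
        rw [pow_mul]; exact Nat.pow_le_pow_left (by norm_num) a
      have h7 : 8 ^ a * 2 ≤ 3 ^ (2 * a) * m := Nat.mul_le_mul h6 hm2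
      omega
    exact Finset.card_le_one.1 hle x (by simp [hc]) y (by simp [hxy])

end WordRAM

/-! ### Reading the input -/

namespace CWExpr

variable {V : Type} {n k : ℕ}

/-- The operations of an expression in postorder, as triples of numbers. -/
def triples : CWExpr (Fin n) k → List (ℕ × ℕ × ℕ)
  | vertex i v => [(0, (i : ℕ), (v : ℕ))]
  | union e f => e.triples ++ f.triples ++ [(1, 0, 0)]
  | join i j _ e => e.triples ++ [(2, (i : ℕ), (j : ℕ))]
  | relabel i j e => e.triples ++ [(3, (i : ℕ), (j : ℕ))]

theorem tokens_eq (e : CWExpr (Fin n) k) :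
    e.tokens = e.triples.flatMap fun t => [t.1, t.2.1, t.2.2] := by
  induction e <;> simp_all [tokens, triples]

theorem length_triples (e : CWExpr (Fin n) k) : e.triples.length = e.size := by
  induction e <;> simp_all [triples, size, add_assoc]

theorem nodes_add_one (e : CWExpr V k) : e.nodes + 1 = 2 * e.leaves.length := by
  induction e <;> simp only [nodes, leaves, List.length_append, List.length_singleton] <;> omega

theorem nodes_le_size (e : CWExpr V k) : e.nodes ≤ e.size := by
  induction e <;> simp only [nodes, size] <;> omega

theorem length_leaves {G : SimpleGraph (Fin n)} {e : CWExpr (Fin n) k} (h : e.Generates G) :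
    e.leaves.length = n := by
  have h1 : e.leaves.toFinset = Finset.univ := by
    ext v; simp [h.2.1 v]
  rw [← List.toFinset_card_of_nodup h.1, h1, Finset.card_univ, Fintype.card_fin]

/-- The state of the construction of the tree of an expression. -/
structure TreeState : Type where
  card : ℕ
  stack : List ℕ
  par : ℕ → ℕ
  leaf : ℕ → ℕ

/-- One step of the construction of the tree of an expression. -/
def treeStep (st : TreeState) (t : ℕ × ℕ × ℕ) : Option TreeState :=
  if t.1 = 0 then
    some ⟨st.card + 1, st.card :: st.stack, st.par, Function.update st.leaf t.2.2 st.card⟩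
  else if t.1 = 1 then
    match st.stack with
    | a :: b :: l => some ⟨st.card + 1, st.card :: l,
        Function.update (Function.update st.par a st.card) b st.card, st.leaf⟩
    | _ => none
  else some st

/-- Generalized over the state before: reading an expression pushes its root and sets the parents of
all its other nodes. The parent of the root remains unset until the enclosing union is read. -/
theorem foldlM_triples (e : CWExpr (Fin n) k) (hnd : e.leaves.Nodup) : ∀ o S P F,
    ∃ P' F', e.triples.foldlM treeStep ⟨o, S, P, F⟩ =
        some ⟨o + e.nodes, (o + e.nodes - 1) :: S, P', F'⟩ ∧
      (∀ x, o ≤ x → x + 1 < o + e.nodes → P' x = e.parent o x) ∧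
      (∀ x, x < o ∨ o + e.nodes ≤ x + 1 → P' x = P x) ∧
      (∀ v ∈ e.leaves, F' v = e.leafNode o v) ∧ ∀ v : Fin n, v ∉ e.leaves → F' v = F v := by
  induction e with
  | vertex i v =>
    intro o S P F
    refine ⟨P, Function.update F v o, ?_, ?_, fun _ _ => rfl, ?_, ?_⟩
    · simp [triples, treeStep, nodes]
    · intro x hx hx'
      simp only [nodes] at hx'
      omega
    · intro w hw
      simp only [leaves, List.mem_singleton] at hw
      simp [hw, leafNode]
    · intro w hw
      simp only [leaves, List.mem_singleton] at hw
      exact Function.update_of_ne (fun h => hw (Fin.ext h)) _ _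
  | join i j hij e ih =>
    intro o S P F
    obtain ⟨P', F', h, h'⟩ := ih hnd o S P F
    refine ⟨P', F', ?_, h'⟩
    rw [triples, List.foldlM_append, h]
    simp [treeStep, nodes]
  | relabel i j e ih =>
    intro o S P F
    obtain ⟨P', F', h, h'⟩ := ih hnd o S P F
    refine ⟨P', F', ?_, h'⟩
    rw [triples, List.foldlM_append, h]
    simp [treeStep, nodes]
  | union e f ihe ihf =>
    intro o S P F
    have hnd' := hnd
    simp only [leaves, List.nodup_append'] at hnd'
    have hdis : ∀ v, v ∈ e.leaves → v ∉ f.leaves := fun v h h' => hnd'.2.2 h h'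
    obtain ⟨P₁, F₁, h1, h2, h3, h4, h5⟩ := ihe hnd'.1 o S P F
    obtain ⟨P₂, F₂, h6, h7, h8, h9, h10⟩ :=
      ihf hnd'.2.1 (o + e.nodes) ((o + e.nodes - 1) :: S) P₁ F₁
    have he := e.nodes_pos
    have hf := f.nodes_pos
    set m := o + e.nodes + f.nodes with hm
    -- The two top entries of the stack are the roots `m - 1` of `f` and `o + e.nodes - 1` of `e`,
    -- the last nodes of their ranges.
    refine ⟨Function.update (Function.update P₂ (m - 1) m) (o + e.nodes - 1) m, F₂, ?_, ?_, ?_, ?_,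
      ?_⟩
    · rw [triples, List.foldlM_append, List.foldlM_append, h1]
      simp only [Option.bind_eq_bind, Option.bind_some, h6]
      simp only [treeStep, nodes, List.foldlM_cons, List.foldlM_nil, one_ne_zero, if_false, if_true,
        Option.bind_eq_bind, Option.bind_some, Option.pure_def, hm]
      rw [show o + (e.nodes + f.nodes + 1) = o + e.nodes + f.nodes + 1 by ring]
      rfl
    · intro x hx hx'
      simp only [nodes] at hx'
      simp only [parent]
      by_cases hx1 : x = o + e.nodes - 1
      · subst hx1
        rw [Function.update_self, if_neg (by omega), if_pos (by omega)]
      rw [Function.update_of_ne hx1]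
      by_cases hx2 : x = m - 1
      · subst hx2
        rw [Function.update_self, if_neg (by omega), if_neg (by omega), if_neg (by omega)]
      rw [Function.update_of_ne hx2]
      by_cases hx3 : x + 1 < o + e.nodes
      · rw [if_pos hx3, h8 x (by omega), h2 x hx hx3]
      · rw [if_neg hx3, if_neg (by omega), if_pos (by omega), h7 x (by omega) (by omega)]
    · intro x hx
      simp only [nodes] at hx
      rw [Function.update_of_ne (by omega), Function.update_of_ne (by omega), h8 x (by omega),
        h3 x (by omega)]
    · intro v hv
      simp only [leaves, List.mem_append] at hv
      simp only [leafNode]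
      split_ifs with h
      · rw [h10 v (hdis v h), h4 v h]
      · exact h9 v (hv.resolve_left h)
    · intro v hv
      simp only [leaves, List.mem_append, not_or] at hv
      rw [h10 v hv.2, h5 v hv.1]

end CWExpr

theorem List.getD_flatMap_triple (l : List (ℕ × ℕ × ℕ)) (rest : List ℕ) :
    ∀ (i : ℕ) (hi : i < l.length),
      ((l.flatMap fun t => [t.1, t.2.1, t.2.2]) ++ rest).getD (3 * i) 0 = l[i].1 ∧
      ((l.flatMap fun t => [t.1, t.2.1, t.2.2]) ++ rest).getD (3 * i + 2) 0 = l[i].2.2 := by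
  induction l with
  | nil => intro i hi; simp at hi
  | cons t l ih =>
    intro i hi
    cases i with
    | zero => simp
    | succ i =>
      have := ih i (by simpa using hi)
      rw [show 3 * (i + 1) = 3 * i + 3 by ring, show 3 * i + 3 + 2 = 3 * i + 2 + 3 by ring]
      simpa using this

/-! ### Reading the expression with a stack, and the adjacency lists. -/

namespace WordRAM

open Exp Stmt

variable {n k : ℕ} {G : SimpleGraph (Fin n)} {adj : Fin n → List (Fin n)}

/-- Build the tree of the expression. -/
def readTree : PStmt :=
  set .n (.get .io (.const 0)) ;; set .kk (.get .io (.const 1)) ;; set .h (.get .io (.const 2)) ;;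
  set .ptr (.const 3) ;; set .nn (.const 0) ;; set .sp (.const 0) ;;
  loop .i (.reg .h) (set .c (.at .io .ptr) ;;
    set .x (.get .io (.add (.reg .ptr) (.const 2))) ;;
    cond .eq (.reg .c) (.const 0) (put .leaf (.reg .x) (.reg .nn) ;;
      put .stk (.reg .sp) (.reg .nn) ;; set .sp (.add (.reg .sp) (.const 1)) ;;
      set .nn (.add (.reg .nn) (.const 1))) ;;
    cond .eq (.reg .c) (.const 1) (set .sp (.op .sub (.reg .sp) (.const 1)) ;;
      put .par (.at .stk .sp) (.reg .nn) ;;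
      set .x (.op .sub (.reg .sp) (.const 1)) ;;
      put .par (.at .stk .x) (.reg .nn) ;; put .stk (.reg .x) (.reg .nn) ;;
      set .nn (.add (.reg .nn) (.const 1))) ;;
    set .ptr (.add (.reg .ptr) (.const 3)))

/-- The stack `l` is stored from the bottom to the top. -/
def StackAt (a : ℕ → ℕ) : List ℕ → Prop
  | [] => True
  | x :: l => a l.length = x ∧ StackAt a l

theorem StackAt.congr {a a' : ℕ → ℕ} {l : List ℕ} (h : StackAt a l)
    (ha : ∀ i < l.length, a' i = a i) : StackAt a' l := by
  induction l with
  | nil => trivial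
  | cons x l ih =>
    exact ⟨by rw [ha _ (by simp), h.1], ih h.2 fun i hi => ha i (by simp; omega)⟩

/-- The state of the construction of the tree is in the store. -/
structure HasTreeState (st : CWExpr.TreeState) (s : PStore) : Prop where
  card : s.reg .nn = st.card
  sp : s.reg .sp = st.stack.length
  stack : StackAt (s.arr .stk) st.stack
  par : ∀ x, s.arr .par x = st.par x
  leaf : ∀ x, s.arr .leaf x = st.leaf x

/-- If the complete run succeeds, no step of it can fail; the program therefore needs no error
branch. -/
theorem foldlM_take_succ {σ τ : Type} {f : σ → τ → Option σ} {l : List τ} {a b : σ}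
    (h : l.foldlM f a = some b) {i : ℕ} (hi : i < l.length) {a' : σ}
    (h' : (l.take i).foldlM f a = some a') :
    ∃ a'', f a' l[i] = some a'' ∧ (l.take (i + 1)).foldlM f a = some a'' := by
  have h1 : (l.take (i + 1)).foldlM f a = f a' l[i] := by
    rw [← List.take_append_getElem hi, List.foldlM_append, h']
    simp
  rw [← List.take_append_drop (i + 1) l, List.foldlM_append, h1] at h
  cases h2 : f a' l[i] with
  | none => rw [h2] at h; simp at h
  | some a'' => exact ⟨a'', rfl, h1.trans h2⟩

theorem readTree_runs {M c : ℕ} {e : CWExpr (Fin n) k} (hgen : e.Generates G) {s : PStore}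
    {rest : List ℕ} (hio : ∀ i, s.arr .io i = ([n, k, e.size] ++ e.tokens ++ rest).getD i 0)
    (hc : 100 * e.size + 100 ≤ c) :
    readTree.Runs (Guard.free _ M) s c fun s' => s'.reg .n = n ∧ s'.reg .kk = k ∧
      s'.reg .ptr = 3 + 3 * e.size ∧ s'.reg .nn = e.nodes ∧
      (∀ x < (e.cutTree hgen).root, s'.arr .par x = (e.cutTree hgen).par x) ∧
      ∀ v : Fin n, s'.arr .leaf v = (e.cutTree hgen).leaf v := by
  obtain ⟨P', F', h1, h2, -, h3, -⟩ := e.foldlM_triples hgen.1 0 [] (s.arr .par) (s.arr .leaf)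
  have io0 : s.arr .io 0 = n := by rw [hio]; simp
  have io1 : s.arr .io 1 = k := by rw [hio]; simp
  have io2 : s.arr .io 2 = e.size := by rw [hio]; simp
  have ioc : ∀ i (hi : i < e.triples.length), s.arr .io (3 + 3 * i) = e.triples[i].1 ∧
      s.arr .io (3 + 3 * i + 2) = e.triples[i].2.2 := by
    intro i hi
    have := List.getD_flatMap_triple e.triples rest i hi
    rw [← e.tokens_eq] at this
    rw [hio, hio, show 3 + 3 * i = 3 * i + 3 by ring, show 3 * i + 3 + 2 = 3 * i + 2 + 3 by ring]
    simpa using this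
  refine Runs.cons rfl rfl (s₁ := s.set .n n) (by simp [den, Exp.eval, io0]) (c₂ := 100 * e.size + 90)
    ?_ ((Nat.add_le_add_right (Nat.le_of_ble_eq_true rfl : _ ≤ 10) _).trans (by omega))
  refine Runs.cons rfl rfl (s₁ := (s.set .n n).set .kk k) (by simp [den, Exp.eval, io1])
    (c₂ := 100 * e.size + 80)
    ?_ ((Nat.add_le_add_right (Nat.le_of_ble_eq_true rfl : _ ≤ 10) _).trans (by omega))
  refine Runs.cons rfl rfl (s₁ := ((s.set .n n).set .kk k).set .h e.size)
    (by simp [den, Exp.eval, io2]) (c₂ := 100 * e.size + 70)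
    ?_ ((Nat.add_le_add_right (Nat.le_of_ble_eq_true rfl : _ ≤ 10) _).trans (by omega))
  refine Runs.cons rfl rfl (s₁ := (((s.set .n n).set .kk k).set .h e.size).set .ptr 3)
    (by simp [den, Exp.eval]) (c₂ := 100 * e.size + 60)
    ?_ ((Nat.add_le_add_right (Nat.le_of_ble_eq_true rfl : _ ≤ 10) _).trans (by omega))
  refine Runs.cons rfl rfl (s₁ := ((((s.set .n n).set .kk k).set .h e.size).set .ptr 3).set .nn 0)
    (by simp [den, Exp.eval]) (c₂ := 100 * e.size + 50)
    ?_ ((Nat.add_le_add_right (Nat.le_of_ble_eq_true rfl : _ ≤ 10) _).trans (by omega))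
  set s₀ := (((((s.set .n n).set .kk k).set .h e.size).set .ptr 3).set .nn 0).set .sp 0 with hs₀
  refine Runs.cons rfl rfl (s₁ := s₀)
    (by simp [den, Exp.eval, hs₀]) (c₂ := 100 * e.size + 40)
    ?_ ((Nat.add_le_add_right (Nat.le_of_ble_eq_true rfl : _ ≤ 10) _).trans (by omega))
  have hL : (Exp.reg (α := PArr) PReg.h).eval s₀ = e.size := by simp [Exp.eval, hs₀]
  refine (Runs.loop_const (s := s₀) (r := PReg.i) (e := .reg .h) (fun i s' => s'.reg .ptr = 3 + 3 * i ∧ ∃ st,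
    (e.triples.take i).foldlM CWExpr.treeStep ⟨0, [], s.arr .par, s.arr .leaf⟩ = some st ∧
      HasTreeState st s') 90 (Exp.safe_free _ _) ⟨by simp [hs₀], ⟨0, [], s.arr .par, s.arr .leaf⟩, rfl,
        by simp [hs₀], by simp [hs₀], trivial, fun _ => rfl, fun _ => rfl⟩ ?_
      (by rw [hL]; simp only [Exp.cost]; omega)).mono le_rfl ?_
  · rintro i hi s' hf ⟨hp, st, hst, hI⟩
    rw [hL, ← e.length_triples] at hi
    obtain ⟨st', hst', hfold⟩ := foldlM_take_succ h1 hi hst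
    obtain ⟨hio1, hio2⟩ := ioc i hi
    have hio' : s'.arr .io = s.arr .io := by rw [hf.arr _ (by decide)]; rfl
    refine Runs.straight rfl rfl (Nat.le_of_ble_eq_true rfl) ?_
    simp only [den, Exp.eval, Exp.at, Exp.add, BinOp.eval, Cmp.Rel, Store.set_reg, Store.set_arr,
      Store.put_arr, Store.put_reg, reduceCtorEq, if_true, if_false, hp, hio', hio1, hio2]
    set t := e.triples[i]
    unfold CWExpr.treeStep at hst'
    by_cases ht0 : t.1 = 0
    · rw [if_pos ht0, Option.some_inj] at hst'
      simp only [ht0, if_true, Store.set_reg, Store.put_reg, reduceCtorEq, if_false, zero_ne_one]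
      refine ⟨by rw [hp]; ring, st', hfold, ?_⟩
      subst hst'
      refine ⟨?_, ?_, ?_, ?_, ?_⟩
      · simp [hI.card]
      · simp [hI.sp]
      · simp only [StackAt, Store.set_arr, Store.put_arr, hI.sp, hI.card, true_and]
        refine ⟨by simp, hI.stack.congr fun j hj => ?_⟩
        simp [hj.ne]
      · intro x; simpa using hI.par x
      · intro x
        simp only [Store.set_arr, Store.put_arr, reduceCtorEq, false_and, if_false, true_and,
          hI.card, hI.leaf, Function.update_apply]
    rw [if_neg ht0] at hst'
    by_cases ht1 : t.1 = 1
    · rw [if_pos ht1] at hst'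
      obtain ⟨card, stack, par, leaf⟩ := st
      -- A shorter stack would make `treeStep` fail, contrary to `hst'`.
      match stack, hst' with
      | a :: b :: l, hst' =>
        rw [Option.some_inj] at hst'
        obtain ⟨hs1, hs2, hs3⟩ := hI.stack
        have hsp := hI.sp
        simp only [List.length_cons] at hsp hs1
        simp only [ht1, if_true, one_ne_zero, if_false, Store.set_reg, Store.put_reg, reduceCtorEq,
          Store.set_arr, false_and, hsp, Nat.add_sub_cancel, hs1, hs2]
        refine ⟨by rw [hp]; ring, st', hfold, ?_⟩
        subst hst'
        refine ⟨?_, ?_, ?_, ?_, ?_⟩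
        · simp [hI.card]
        · simp
        · simp only [StackAt, Store.set_arr, Store.put_arr, hI.card, true_and, reduceCtorEq,
            false_and, if_false]
          refine ⟨by simp, hs3.congr fun j hj => ?_⟩
          simp [hj.ne]
        · intro x
          simp only [Store.set_arr, Store.put_arr, reduceCtorEq, false_and, if_false, true_and,
            hI.card, Function.update_apply, hI.par]
        · intro x; simpa using hI.leaf x
    · rw [if_neg ht1, Option.some_inj] at hst'
      simp only [ht0, ht1, if_false, Store.set_reg, reduceCtorEq, if_true]
      refine ⟨by rw [hp]; ring, st', hfold, ?_⟩
      subst hst'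
      exact ⟨by simpa using hI.card, by simpa using hI.sp, hI.stack, hI.par, hI.leaf⟩
  · rintro s' hf ⟨hp, st, hst, hI⟩
    rw [hL] at hp hst
    rw [← e.length_triples, List.take_length, h1, Option.some_inj] at hst
    subst hst
    refine ⟨?_, ?_, hp, by simpa using hI.card, fun x hx => ?_, fun v => ?_⟩
    · rw [hf.reg _ (by decide)]; simp [hs₀]
    · rw [hf.reg _ (by decide)]; simp [hs₀]
    · rw [hI.par]
      exact h2 x (Nat.zero_le _) (by change x < e.nodes - 1 at hx; omega)
    · rw [hI.leaf]
      exact h3 v (hgen.2.1 v)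

/-- Read the adjacency lists, and copy them. -/
def readGraph : PStmt :=
  forV (put .len (.reg .v) (.at .io .ptr) ;; set .ptr (.add (.reg .ptr) (.const 1)) ;;
    put .off (.reg .v) (.reg .ptr) ;;
    loop .j (.at .len .v) (put .adj (.reg .ptr) (.at .io .ptr) ;;
      set .ptr (.add (.reg .ptr) (.const 1))))

theorem readGraph_runs {M c : ℕ} {s : PStore} (hn : s.reg .n = n)
    (hio : ∀ i, s.arr .io (s.reg .ptr + i) = (adjTokens adj).getD i 0)
    (hc : 50 * n + 50 * ∑ v, (adj v).length + 50 ≤ c) :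
    readGraph.Runs (Guard.free _ M) s c (HasGraph adj) := by
  set g : Fin n → List ℕ := fun v => (adj v).length :: (adj v).map (fun u : Fin n => (u : ℕ)) with hg
  -- `A i` is the input address after the first `i` lists. Copies keep their input addresses, so the
  -- entries for `v` start at `A v + 1`, behind the length, and later writes lie beyond them.
  set A : ℕ → ℕ := fun i => s.reg .ptr + (((List.finRange n).take i).flatMap g).length with hA
  have split : ∀ v : Fin n, (List.finRange n).take (v + 1) = (List.finRange n).take v ++ [v] := by
    intro v
    have hv : (v : ℕ) < (List.finRange n).length := by simp
    rw [← List.take_append_getElem hv]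
    simp
  have hA1 : ∀ v : Fin n, A (v + 1) = A v + 1 + (adj v).length := by
    intro v
    simp only [hA, split, List.flatMap_append, List.length_append]
    simp [hg]
    ring
  have hAio : ∀ (v : Fin n) (j : ℕ), j < (g v).length → s.arr .io (A v + j) = (g v).getD j 0 := by
    intro v j hj
    have hfr : List.finRange n = (List.finRange n).take v ++ [v] ++ (List.finRange n).drop (v + 1) := by
      rw [← split, List.take_append_drop]
    have hgt : adjTokens adj = (List.finRange n).flatMap g := by
      simp [adjTokens, hg, List.map_eq_flatMap]
    have hgt' : adjTokens adj = ((List.finRange n).take v).flatMap g ++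
        (g v ++ ((List.finRange n).drop (v + 1)).flatMap g) := by
      rw [hgt]
      conv_lhs => rw [hfr]
      simp
    simp only [hA]
    rw [add_assoc, hio, hgt', List.getD_append_right _ _ _ _ (Nat.le_add_right _ _),
      Nat.add_sub_cancel_left, List.getD_append _ _ _ _ hj]
  have hAlen : ∀ v : Fin n, s.arr .io (A v) = (adj v).length := fun v => by
    simpa [hg] using hAio v 0 (by simp [hg])
  have hAadj : ∀ (v : Fin n) (j : ℕ) (hj : j < (adj v).length),
      s.arr .io (A v + 1 + j) = (adj v)[j] := fun v j hj => by
    rw [add_assoc, add_comm 1 j, hAio v (j + 1) (by simpa [hg] using hj)]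
    simp [hg, hj]
  refine (forV_runs (fun i s' => s'.reg .ptr = A i ∧ ∀ v : Fin n, (v : ℕ) < i →
      s'.arr .len v = (adj v).length ∧ s'.arr .off v = A v + 1 ∧
      A v + 1 + (adj v).length ≤ A i ∧
      ∀ j (hj : j < (adj v).length), s'.arr .adj (A v + 1 + j) = (adj v)[j])
    (fun v => 30 + 20 * (adj v).length) hn ⟨by simp [hA], fun v hv => absurd hv (by omega)⟩ ?_
    (by rw [sum_linear_le]; omega)).mono le_rfl ?_
  · rintro v s' hf ⟨hp, hI⟩
    have hio' : s'.arr .io = s.arr .io := hf.arr _ (by decide)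
    set s₁ := (s'.set .v v).put .len v (adj v).length with hs₁
    set s₃ := (s₁.set .ptr (A v + 1)).put .off v (A v + 1) with hs₃
    have hL : (Exp.at PArr.len PReg.v).eval s₃ = (adj v).length := by
      simp [Exp.eval, Exp.at, hs₃, hs₁]
    refine Runs.cons rfl rfl (s₁ := s₁) (by simp [den, Exp.eval, Exp.at, hs₁, hp, hio', hAlen])
      (c₂ := 22 + 20 * (adj v).length) ?_
      ((Nat.add_le_add_right (Nat.le_of_ble_eq_true rfl : _ ≤ 8) _).trans (by omega))
    refine Runs.cons rfl rfl (s₁ := s₁.set .ptr (A v + 1))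
      (by simp [den, Exp.eval, Exp.add, BinOp.eval, hs₁, hp]) (c₂ := 16 + 20 * (adj v).length) ?_
      ((Nat.add_le_add_right (Nat.le_of_ble_eq_true rfl : _ ≤ 6) _).trans (by omega))
    refine Runs.cons rfl rfl (s₁ := s₃)
      (by simp [den, Exp.eval, hs₁, hs₃]) (c₂ := 10 + 20 * (adj v).length) ?_
      ((Nat.add_le_add_right (Nat.le_of_ble_eq_true rfl : _ ≤ 6) _).trans (by omega))
    have hloop := Runs.loop_const (Γ := Guard.free PArr M) (r := PReg.j) (e := .at .len .v)
      (p := put .adj (.reg .ptr) (.at .io .ptr) ;; set .ptr (.add (.reg .ptr) (.const 1)))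
      (s := s₃) (c := 10 + 20 * (adj v).length) (fun i s'' => s''.reg .ptr = A v + 1 + i ∧
        (∀ q < A v + 1, s''.arr .adj q = s'.arr .adj q) ∧
        ∀ j < i, s''.arr .adj (A v + 1 + j) = s.arr .io (A v + 1 + j)) 16 (Exp.safe_free _ _)
      ⟨by simp [hs₃], fun q hq => by simp [hs₃, hs₁], fun j hj => absurd hj (by omega)⟩
      (fun i hi s'' hf'' ⟨h1, h2, h3⟩ => ?_) (by rw [hL]; simp only [Exp.cost, Exp.at]; omega)
    · rw [hL] at hloop
      refine hloop.mono le_rfl fun s'' hf'' ⟨h1, h2, h3⟩ => ⟨by rw [h1, hA1], fun w hw => ?_⟩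
      have hlen : s''.arr .len = s₃.arr .len := hf''.arr _ (by decide)
      have hoff : s''.arr .off = s₃.arr .off := hf''.arr _ (by decide)
      rw [hlen, hoff, hA1]
      by_cases hwv : w = v
      · subst hwv
        refine ⟨by simp [hs₃, hs₁], by simp [hs₃, hs₁], le_rfl, fun j hj => ?_⟩
        rw [h3 j hj, hAadj w j hj]
      · have hwv' : (w : ℕ) ≠ v := fun h => hwv (Fin.ext h)
        obtain ⟨g1, g2, g3, g4⟩ := hI w (by omega)
        refine ⟨by simpa [hs₃, hs₁, hwv'] using g1, by simpa [hs₃, hs₁, hwv'] using g2, by omega,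
          fun j hj => ?_⟩
        rw [h2 _ (by omega), g4 j hj]
    · have hio'' : s''.arr .io = s.arr .io := by
        rw [hf''.arr _ (by decide), ← hio']; ext; simp [hs₃, hs₁]
      refine Runs.straight rfl rfl (Nat.le_of_ble_eq_true rfl) ?_
      simp only [den, Exp.eval, Exp.at, Exp.add, BinOp.eval, Store.set_reg, Store.set_arr,
        Store.put_arr, Store.put_reg, reduceCtorEq, if_true, if_false, h1, hio'', true_and]
      refine ⟨by ring, fun q hq => ?_, fun j hj => ?_⟩
      · rw [if_neg (by omega), h2 q hq]
      · split_ifs with h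
        · rw [h]
        · exact h3 j (by omega)
  · rintro s' hf ⟨-, hI⟩
    refine ⟨by rw [hf.reg _ (by decide), hn], fun v => (hI v v.2).1, fun v j hj => ?_⟩
    rw [(hI v v.2).2.1]
    exact (hI v v.2).2.2.2 j hj

end WordRAM

/-! ### The preprocessing program -/

namespace WordRAM

open Exp Stmt

theorem Stmt.Runs.set_seq {ρ α : Type} [DecidableEq ρ] [DecidableEq α] {r : ρ} {e : Exp ρ α}
    {q : Stmt ρ α} {s : Store ρ α} {x M c c₂ : ℕ} {Q : Store ρ α → Prop} (hx : e.eval s = x)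
    (hM : x ≤ M) (hq : q.Runs (Guard.free α M) (s.set r x) c₂ Q) (hc : e.cost + 1 + c₂ ≤ c) :
    ((Stmt.set r e).seq q).Runs (Guard.free α M) s c Q := by
  subst hx
  exact ⟨⟨⟨e.safe_free s, Or.inr hM⟩, hq.1⟩, (Nat.add_le_add_left hq.2.1 _).trans hc, hq.2.2⟩

variable {n k : ℕ} {G : SimpleGraph (Fin n)} {adj : Fin n → List (Fin n)} {T : CutTree G k}

/-! ### Word length, layout of the labels and initial values. -/

/-- Compute the number of binary digits of `n`. -/
def findBits : PStmt :=
  set .bits (.const 0) ;; set .pow (.const 1) ;;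
  loop .i (.reg .n) (cond .le (.reg .pow) (.reg .n) (set .half (.reg .pow) ;;
    set .pow (.add (.reg .pow) (.reg .pow)) ;; set .bits (.add (.reg .bits) (.const 1))))

theorem lt_lg_iff {m n : ℕ} (hn : 1 ≤ n) : m < lg n ↔ 2 ^ m ≤ n := by
  unfold lg
  rw [Nat.lt_succ_iff, Nat.le_log_iff_pow_le (by omega) (by omega)]

theorem lg_le {n : ℕ} (hn : 1 ≤ n) : lg n ≤ n := by
  by_contra h
  have := (lt_lg_iff hn).1 (not_le.1 h)
  exact absurd this (not_le.2 (Nat.lt_two_pow_self))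

/-- A counted loop of `n ≥ lg n` rounds replaces a loop with a test; once `pow` exceeds `n` the body
is idle, hence the `min` in the invariant. `half` lags one doubling behind `pow`. -/
theorem findBits_runs {M c : ℕ} {s : PStore} (hn : s.reg .n = n) (hn1 : 1 ≤ n) (hM : 2 * n ≤ M)
    (hc : 30 * n + 30 ≤ c) :
    findBits.Runs (Guard.free _ M) s c fun s' =>
      s'.reg .bits = lg n ∧ s'.reg .half = 2 ^ (lg n - 1) := by
  refine Runs.cons rfl rfl (s₁ := s.set .bits 0) (by simp [den, Exp.eval]) (c₂ := 30 * n + 20) ?_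
    ((Nat.add_le_add_right (Nat.le_of_ble_eq_true rfl : _ ≤ 10) _).trans (by omega))
  set s₀ := (s.set .bits 0).set .pow 1 with hs₀
  refine Runs.cons rfl rfl (s₁ := s₀) (by simp [den, Exp.eval, hs₀]) (c₂ := 30 * n + 10) ?_
    ((Nat.add_le_add_right (Nat.le_of_ble_eq_true rfl : _ ≤ 10) _).trans (by omega))
  have hL : (Exp.reg (α := PArr) PReg.n).eval s₀ = n := by simp [Exp.eval, hs₀, hn]
  refine (Runs.loop_const (s := s₀) (r := PReg.i) (e := .reg .n) (fun i s' =>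
    s'.reg .bits = min i (lg n) ∧ s'.reg .pow = 2 ^ min i (lg n) ∧
      (1 ≤ i → s'.reg .half = 2 ^ (min i (lg n) - 1))) 20 (Exp.safe_free _ _)
    ⟨by simp [hs₀], by simp [hs₀], fun h => absurd h (by omega)⟩ (fun i hi s' hf ⟨h1, h2, h3⟩ => ?_)
    (by rw [hL]; simp only [Exp.cost]; omega)).mono le_rfl fun s' _ h => ?_
  · have hn' : s'.reg .n = n := by rw [hf.reg _ (by decide)]; simpa [Exp.eval] using hL
    refine Runs.cond (c := 14) (Exp.safe_free _ _) (Exp.safe_free _ _) (fun h => ?_) (fun h => ?_)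
      (Nat.le_of_ble_eq_true rfl)
    · simp only [Cmp.Rel, Exp.eval, Store.set_reg, reduceCtorEq, if_false, h2, hn'] at h
      have hlt := (lt_lg_iff hn1).2 h
      have hi1 : min i (lg n) = i := by omega
      have hi2 : min (i + 1) (lg n) = i + 1 := by omega
      rw [hi1] at h1 h2 h
      refine Runs.cons rfl rfl (s₁ := (s'.set .i i).set .half (2 ^ i))
        (by simp [den, Exp.eval, h2]) (c₂ := 10) ?_ (Nat.le_of_ble_eq_true rfl)
      refine Runs.set_seq (x := 2 ^ (i + 1)) (c₂ := 5) ?_ ?_ ?_ (Nat.le_of_ble_eq_true rfl)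
      · simp [Exp.eval, Exp.add, BinOp.eval, h2]; ring
      · rw [pow_succ]; omega
      · refine Runs.straight rfl rfl (Nat.le_of_ble_eq_true rfl) ?_
        rw [hi2]
        simp [den, Exp.eval, Exp.add, BinOp.eval, h1]
    · simp only [Cmp.Rel, Exp.eval, Store.set_reg, reduceCtorEq, if_false, h2, hn'] at h
      have hge := mt (lt_lg_iff hn1).1 h
      have hi2 : min (i + 1) (lg n) = min i (lg n) := by omega
      rw [hi2]
      refine ⟨by simpa using h1, by simpa using h2, fun _ => ?_⟩
      have : 1 ≤ lg n := Nat.le_add_left _ _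
      simpa using h3 (by omega)
  · rw [hL, min_eq_right (lg_le hn1)] at h
    exact ⟨h.1, h.2.2 hn1⟩

/-- Compute the layout of the labels. -/
def findLayout : PStmt :=
  cond .lt (.reg .n) (.reg .kk) (set .kk (.reg .n)) ;;
  set .root (.op .sub (.reg .nn) (.const 1)) ;;
  set .lam (.add (.op .sub (.reg .bits) (.const 1)) (.op .sub (.reg .bits) (.const 1))) ;;
  set .wds (.op .mul (.reg .lam) (.add (.add (.reg .kk) (.reg .kk)) (.const 1))) ;;
  set .wds (.add (.reg .wds) (.const 3)) ;; set .stride (.add (.reg .wds) (.const 1)) ;;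
  set .res (.op .mul (.reg .n) (.reg .stride)) ;; set .pos (.const 3)

/-- The registers that hold the layout of the labels. -/
structure HasLayout (n K b W : ℕ) (s : PStore) : Prop where
  card : s.reg .n = n
  bits : s.reg .bits = b
  kk : s.reg .kk = K
  lam : s.reg .lam = 2 * (b - 1)
  wds : s.reg .wds = W
  stride : s.reg .stride = W + 1
  res : s.reg .res = n * (W + 1)

/-- The registers of `HasLayout` are not written. -/
def KeepsLayout (p : PStmt) : Bool :=
  (PReg.n ∉ p.wregs) && (PReg.bits ∉ p.wregs) && (PReg.kk ∉ p.wregs) && (PReg.lam ∉ p.wregs) &&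
    (PReg.wds ∉ p.wregs) && (PReg.stride ∉ p.wregs) && (PReg.res ∉ p.wregs)

theorem HasLayout.frame {K b W : ℕ} {s s' : PStore} {p : PStmt} (h : HasLayout n K b W s)
    (hf : p.Frame s s') (hp : KeepsLayout p = true) : HasLayout n K b W s' := by
  simp only [KeepsLayout, Bool.and_eq_true, decide_eq_true_eq] at hp
  obtain ⟨⟨⟨⟨⟨⟨h1, h2⟩, h3⟩, h4⟩, h5⟩, h6⟩, h7⟩ := hp
  exact ⟨by rw [hf.reg _ h1, h.card], by rw [hf.reg _ h2, h.bits], by rw [hf.reg _ h3, h.kk],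
    by rw [hf.reg _ h4, h.lam], by rw [hf.reg _ h5, h.wds], by rw [hf.reg _ h6, h.stride],
    by rw [hf.reg _ h7, h.res]⟩

theorem findLayout_runs {M K W b N c : ℕ} {s : PStore} (hn : s.reg .n = n) (hk : s.reg .kk = k)
    (hb : s.reg .bits = b) (hN : s.reg .nn = N) (hK : K = min k n)
    (hW : W = recPos K (2 * (b - 1))) (hM : W ≤ M) (hM' : n * (W + 1) ≤ M) (hc : 50 ≤ c) :
    findLayout.Runs (Guard.free _ M) s c fun s' =>
      HasLayout n K b W s' ∧ s'.reg .root = N - 1 ∧ s'.reg .pos = 3 := by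
  have hrec : W = 2 * (b - 1) * (2 * K + 1) + 3 := by rw [hW, recPos, add_comm]
  have hlam : 2 * (b - 1) ≤ W := by
    rw [hrec]
    have := Nat.le_mul_of_pos_right (2 * (b - 1)) (show 0 < 2 * K + 1 by omega)
    omega
  refine Runs.mono (c := 50) ?_ hc fun _ _ h => h
  refine Runs.cons rfl rfl (s₁ := s.set .kk K) ?_ (c₂ := 44) ?_ (Nat.le_of_ble_eq_true rfl)
  · simp only [den, Exp.eval, Cmp.Rel, hn, hk]
    split_ifs with h
    · rw [hK, min_eq_right h.le]
    · rw [hK, min_eq_left (not_lt.1 h), ← hk]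
      cases s
      simp only [Store.set, Store.mk.injEq, and_true]
      ext z
      by_cases hz : z = PReg.kk <;> simp [hz]
  refine Runs.cons rfl rfl (s₁ := (s.set .kk K).set .root (N - 1))
    (by simp [den, Exp.eval, BinOp.eval, hN]) (c₂ := 40) ?_ (Nat.le_of_ble_eq_true rfl)
  refine Runs.set_seq (x := 2 * (b - 1)) (c₂ := 32) ?_ (hlam.trans hM) ?_
    (Nat.le_of_ble_eq_true rfl)
  · simp [Exp.eval, Exp.add, BinOp.eval, hb]; ring
  refine Runs.set_seq (x := 2 * (b - 1) * (2 * K + 1)) (c₂ := 24) ?_ (by omega) ?_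
    (Nat.le_of_ble_eq_true rfl)
  · simp [Exp.eval, Exp.add, BinOp.eval]; left; ring
  refine Runs.set_seq (x := W) (c₂ := 20) ?_ hM ?_ (Nat.le_of_ble_eq_true rfl)
  · simp [Exp.eval, Exp.add, BinOp.eval, hrec]
  refine Runs.cons rfl rfl rfl (c₂ := 16) ?_ (Nat.le_of_ble_eq_true rfl)
  refine Runs.set_seq (x := n * (W + 1)) (c₂ := 12) ?_ hM' ?_ (Nat.le_of_ble_eq_true rfl)
  · simp [Exp.eval, Exp.add, BinOp.eval, den, hn]
  refine Runs.straight rfl rfl (Nat.le_of_ble_eq_true rfl) ?_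
  refine ⟨⟨?_, ?_, ?_, ?_, ?_, ?_, ?_⟩, ?_, ?_⟩ <;>
    simp [den, Exp.eval, Exp.add, BinOp.eval, hn, hb]

/-- Write the heads of the labels. -/
def writeHeads : PStmt :=
  set .x (.const 0) ;;
  forV (put .start (.reg .v) (.add (.reg .x) (.const 1)) ;;
    put .io (.add (.reg .x) (.const 1)) (.reg .half) ;;
    put .io (.add (.reg .x) (.const 2)) (.reg .kk) ;;
    put .io (.add (.reg .x) (.const 3)) (.reg .lam) ;;
    set .x (.add (.reg .x) (.reg .stride)))

theorem label_inj {W : ℕ} {v w q q' : ℕ} (hq : q < W + 1) (hq' : q' < W + 1)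
    (h : v * (W + 1) + q = w * (W + 1) + q') : v = w ∧ q = q' := by
  have h1 : (v * (W + 1) + q) / (W + 1) = v := by
    rw [mul_comm, Nat.mul_add_div (by omega), Nat.div_eq_of_lt hq, add_zero]
  have h2 : (w * (W + 1) + q') / (W + 1) = w := by
    rw [mul_comm, Nat.mul_add_div (by omega), Nat.div_eq_of_lt hq', add_zero]
  have h3 : v = w := by rw [← h1, h, h2]
  exact ⟨h3, by rw [h3] at h; omega⟩

/-- Each label occupies `W + 1` cells, the first of which is reserved for its length. The word
`half` lets the decoder recover the number of bits per word; the other two give the number of rounds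
and of levels. -/
theorem writeHeads_runs {M K b W c : ℕ} {s : PStore} (hl : HasLayout n K b W s) (hW : 3 ≤ W)
    (hM : n * (W + 1) ≤ M) (hc : 60 * n + 60 ≤ c) :
    writeHeads.Runs (Guard.free _ M) s c fun s' => ∀ v : Fin n,
      s'.arr .start v = v * (W + 1) + 1 ∧ s'.arr .io (v * (W + 1) + 1) = s.reg .half ∧
      s'.arr .io (v * (W + 1) + 2) = K ∧ s'.arr .io (v * (W + 1) + 3) = 2 * (b - 1) := by
  refine Runs.cons rfl rfl (s₁ := s.set .x 0) (by simp [den, Exp.eval]) (c₂ := 60 * n + 50) ?_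
    ((Nat.add_le_add_right (Nat.le_of_ble_eq_true rfl : _ ≤ 10) _).trans (by omega))
  refine (forV_runs (fun i s' => s'.reg .x = i * (W + 1) ∧ ∀ v : Fin n, (v : ℕ) < i →
      s'.arr .start v = v * (W + 1) + 1 ∧ s'.arr .io (v * (W + 1) + 1) = s.reg .half ∧
      s'.arr .io (v * (W + 1) + 2) = K ∧ s'.arr .io (v * (W + 1) + 3) = 2 * (b - 1)) (fun _ => 40)
    (by simpa using hl.card) ⟨by simp, fun v hv => absurd hv (by omega)⟩ ?_ (by simp; omega)).mono
    le_rfl fun s' _ h v => h.2 v v.2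
  rintro v s' hf ⟨hx, hI⟩
  have hl' : HasLayout n K b W s' := HasLayout.frame (s := s.set .x 0)
    ⟨by simpa using hl.card, by simpa using hl.bits, by simpa using hl.kk, by simpa using hl.lam,
      by simpa using hl.wds, by simpa using hl.stride, by simpa using hl.res⟩ hf rfl
  have hh : s'.reg .half = s.reg .half := by rw [hf.reg _ (by decide)]; simp
  set X := (v : ℕ) * (W + 1) with hX
  refine Runs.cons rfl rfl (s₁ := (s'.set .v v).put .start v (X + 1))
    (by simp [den, Exp.eval, Exp.add, BinOp.eval, hx]) (c₂ := 34) ?_ (Nat.le_of_ble_eq_true rfl)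
  refine Runs.cons rfl rfl (s₁ := ((s'.set .v v).put .start v (X + 1)).put .io (X + 1) (s.reg .half))
    (by simp [den, Exp.eval, Exp.add, BinOp.eval, hx, hh]) (c₂ := 26) ?_
    (Nat.le_of_ble_eq_true rfl)
  refine Runs.cons rfl rfl (s₁ := (((s'.set .v v).put .start v (X + 1)).put .io (X + 1)
    (s.reg .half)).put .io (X + 2) K)
    (by simp [den, Exp.eval, Exp.add, BinOp.eval, hx, hl'.kk]) (c₂ := 18) ?_
    (Nat.le_of_ble_eq_true rfl)
  refine Runs.cons rfl rfl (s₁ := ((((s'.set .v v).put .start v (X + 1)).put .io (X + 1)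
    (s.reg .half)).put .io (X + 2) K).put .io (X + 3) (2 * (b - 1)))
    (by simp [den, Exp.eval, Exp.add, BinOp.eval, hx, hl'.lam]) (c₂ := 10) ?_
    (Nat.le_of_ble_eq_true rfl)
  have hev : (Exp.add (.reg .x) (.reg .stride) : PExp).eval (((((s'.set .v v).put .start v
      (X + 1)).put .io (X + 1) (s.reg .half)).put .io (X + 2) K).put .io (X + 3) (2 * (b - 1))) =
      (v + 1) * (W + 1) := by
    simp [Exp.eval, Exp.add, BinOp.eval, hx, hl'.stride]; ring
  refine ⟨⟨Exp.safe_free _ _, Or.inr ?_⟩, Nat.le_of_ble_eq_true rfl, ?_⟩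
  · rw [hev]
    exact (Nat.mul_le_mul_right _ v.2).trans hM
  simp only [den, hev]
  refine ⟨by simp, fun w hw => ?_⟩
  by_cases hwv : w = v
  · subst hwv
    simp [hX]
  · have hwv' : (w : ℕ) ≠ v := fun h => hwv (Fin.ext h)
    obtain ⟨h1, h2, h3, h4⟩ := hI w (by omega)
    have key : ∀ q q', q < W + 1 → q' < W + 1 → (w : ℕ) * (W + 1) + q ≠ X + q' :=
      fun q q' hq hq' h => hwv' (label_inj hq hq' h).1
    have k1 := fun q hq => key 1 q (by omega) hq
    have k2 := fun q hq => key 2 q (by omega) hq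
    have k3 := fun q hq => key 3 q (by omega) hq
    simp only [Store.set_arr, Store.put_arr, reduceCtorEq, false_and, true_and, if_false, hwv', h1,
      h2, h3, h4, k1 1 (by omega), k1 2 (by omega), k1 3 (by omega), k2 1 (by omega),
      k2 2 (by omega), k2 3 (by omega), k3 1 (by omega), k3 2 (by omega), k3 3 (by omega), and_self]

/-- The initial component is the whole tree. -/
def initComps : PStmt :=
  forNode (put .cut (.reg .i) (.const 0) ;; put .comp (.reg .i) (.reg .root)) ;;
  put .cut (.reg .root) (.const 1)

theorem initComps_runs {M c : ℕ} {s : PStore} (ht : HasTree T s)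
    (hc : 30 * (T.root + 1) + 30 ≤ c) :
    initComps.Runs (Guard.free _ M) s c fun s' => s'.arr .cut T.root ≠ 0 ∧
      (∀ x < T.root, s'.arr .cut x = 0) ∧ ∀ x ≤ T.root, s'.arr .comp x = T.root := by
  refine ((forNode_runs (b := 20) (c := 3 + (T.root + 1) * 24) (fun i s' => ∀ x < i,
    s'.arr .cut x = 0 ∧ s'.arr .comp x = T.root) ht.nn (fun x hx => absurd hx (by omega))
    (fun i hi s' hf hI => ?_) le_rfl).seq (c₂ := 10) fun s₁ hf₁ h₁ => Runs.straight rfl rfl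
    (Nat.le_of_ble_eq_true rfl) ?_).mono (by omega) fun _ _ h => h
  · have hr : s'.reg .root = T.root := (ht.frame hf rfl).root
    refine Runs.straight rfl rfl (Nat.le_of_ble_eq_true rfl) fun x hx => ?_
    have := hI x
    simp only [den, Exp.eval, Store.put_arr, Store.set_reg, Store.put_reg, Store.set_arr, if_true,
      true_and, reduceCtorEq, false_and, if_false, hr]
    split_ifs with h
    exacts [⟨rfl, rfl⟩, this (by omega)]
  · have hr : s₁.reg .root = T.root := (ht.frame hf₁ rfl).root
    refine ⟨by simp [den, Exp.eval, hr], fun x hx => ?_, fun x hx => ?_⟩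
    · simpa [den, Exp.eval, hr, hx.ne] using (h₁ x (by omega)).1
    · simpa [den, Exp.eval] using (h₁ x (by omega)).2

/-- Write the lengths of the labels and the table of their addresses. -/
def writeTable : PStmt :=
  set .tail (.op .mul (.reg .wds) (.reg .bits)) ;; set .x (.const 0) ;;
  forV (put .io (.reg .x) (.reg .tail) ;; put .io (.add (.reg .res) (.reg .v)) (.reg .x) ;;
    set .x (.add (.reg .x) (.reg .stride)))

/-- The table begins at `n * (W + 1)`, directly behind the labels. Lengths go to the reserved cells,
so the words of the labels are preserved. -/
theorem writeTable_runs {M K b W c : ℕ} {s : PStore} (hl : HasLayout n K b W s)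
    (hM : n * (W + 1) ≤ M) (hM' : W * b ≤ M) (hc : 60 * n + 60 ≤ c) :
    writeTable.Runs (Guard.free _ M) s c fun s' => ∀ v : Fin n,
      s'.arr .io (n * (W + 1) + v) = v * (W + 1) ∧ s'.arr .io (v * (W + 1)) = W * b ∧
      ∀ q < W, s'.arr .io (v * (W + 1) + 1 + q) = s.arr .io (v * (W + 1) + 1 + q) := by
  refine Runs.set_seq (x := W * b) (c₂ := 60 * n + 50) ?_ hM' ?_
    ((Nat.add_le_add_right (Nat.le_of_ble_eq_true rfl : _ ≤ 10) _).trans (by omega))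
  · simp [Exp.eval, BinOp.eval, hl.wds, hl.bits]
  set s₀ := (s.set .tail (W * b)).set .x 0 with hs₀
  refine Runs.cons rfl rfl (s₁ := s₀) (by simp [den, Exp.eval, hs₀]) (c₂ := 60 * n + 40) ?_
    ((Nat.add_le_add_right (Nat.le_of_ble_eq_true rfl : _ ≤ 10) _).trans (by omega))
  have hl₀ : HasLayout n K b W s₀ := by
    constructor <;> simp [hs₀, hl.card, hl.bits, hl.kk, hl.lam, hl.wds, hl.stride, hl.res]
  have lt_table : ∀ (v : Fin n) (q : ℕ), q < W + 1 → (v : ℕ) * (W + 1) + q < n * (W + 1) := by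
    intro v q hq
    have := Nat.mul_le_mul_right (W + 1) (show (v : ℕ) + 1 ≤ n from v.2)
    rw [add_mul, one_mul] at this
    omega
  refine (forV_runs (fun i s' => s'.reg .x = i * (W + 1) ∧
      (∀ v : Fin n, (v : ℕ) < i → s'.arr .io (n * (W + 1) + v) = v * (W + 1) ∧
        s'.arr .io (v * (W + 1)) = W * b) ∧
      ∀ v : Fin n, ∀ q < W, s'.arr .io (v * (W + 1) + 1 + q) = s.arr .io (v * (W + 1) + 1 + q))
    (fun _ => 40) hl₀.card ⟨by simp [hs₀], fun v hv => absurd hv (by omega), fun v q hq => by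
      simp [hs₀]⟩ ?_ (by simp; omega)).mono le_rfl fun s' _ h v =>
    ⟨(h.2.1 v v.2).1, (h.2.1 v v.2).2, h.2.2 v⟩
  rintro v s' hf ⟨hx, hI, hJ⟩
  have hl' := hl₀.frame hf rfl
  have ht : s'.reg .tail = W * b := by rw [hf.reg _ (by decide)]; simp [hs₀]
  set X := (v : ℕ) * (W + 1) with hX
  refine Runs.cons rfl rfl (s₁ := (s'.set .v v).put .io X (W * b))
    (by simp [den, Exp.eval, hx, ht]) (c₂ := 30) ?_ (Nat.le_of_ble_eq_true rfl)
  refine Runs.cons rfl rfl (s₁ := ((s'.set .v v).put .io X (W * b)).put .io (n * (W + 1) + v) X)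
    (by simp [den, Exp.eval, Exp.add, BinOp.eval, hx, hl'.res]) (c₂ := 20) ?_
    (Nat.le_of_ble_eq_true rfl)
  have hev : (Exp.add (.reg .x) (.reg .stride) : PExp).eval (((s'.set .v v).put .io X
      (W * b)).put .io (n * (W + 1) + v) X) = (v + 1) * (W + 1) := by
    simp [Exp.eval, Exp.add, BinOp.eval, hx, hl'.stride]; ring
  refine ⟨⟨Exp.safe_free _ _, Or.inr ?_⟩, Nat.le_of_ble_eq_true rfl, ?_⟩
  · rw [hev]
    exact (Nat.mul_le_mul_right _ v.2).trans hM
  simp only [den, hev]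
  have h0 := lt_table v 0 (by omega)
  refine ⟨by simp, fun w hw => ?_, fun w q hq => ?_⟩
  · have h1 := lt_table w 0 (by omega)
    by_cases hwv : w = v
    · subst hwv
      rw [add_zero] at h1
      have h2 : X ≠ n * (W + 1) + w := by omega
      simp [hX ▸ h2, hX]
    · have hwv' : (w : ℕ) ≠ v := fun h => hwv (Fin.ext h)
      obtain ⟨h2, h3⟩ := hI w (by omega)
      have h4 : (w : ℕ) * (W + 1) ≠ X := fun h =>
        hwv' (label_inj (q := 0) (q' := 0) (W := W) (by omega) (by omega) (by rw [add_zero, add_zero]; exact h)).1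
      have h5 : (w : ℕ) * (W + 1) ≠ n * (W + 1) + v := by omega
      have h6 : n * (W + 1) + (w : ℕ) ≠ X := by omega
      simp only [Store.set_arr, Store.put_arr, true_and, Nat.add_left_cancel_iff, hwv', if_false,
        h4, h5, h6, h2, h3, and_self]
  · have h1 := lt_table w (1 + q) (by omega)
    rw [← add_assoc] at h1
    have h2 : (w : ℕ) * (W + 1) + 1 + q ≠ n * (W + 1) + v := by omega
    have h3 : (w : ℕ) * (W + 1) + 1 + q ≠ X := fun h => by
      have := (label_inj (v := w) (w := v) (q := 1 + q) (q' := 0) (W := W) (by omega) (by omega)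
        (by rw [add_zero, ← add_assoc]; exact h)).2
      omega
    simp only [Store.set_arr, Store.put_arr, true_and, h2, h3, if_false, hJ w q hq]

/-- The preprocessing program. -/
def prep : PStmt :=
  readTree ;; readGraph ;; findBits ;; findLayout ;; writeHeads ;; initComps ;; levels ;; writeTable

/-- The number of words of a label. -/
def labelWords (n k : ℕ) : ℕ := recPos (min k n) (2 * (lg n - 1))

theorem prep_cost {L n K S b : ℕ} (hK : 1 ≤ K) (hb : 1 ≤ b) :
    100 * L + 100 + (600 * n + 100 * S + 600) +
      (3 + 2 * (b - 1) * (3000 * (K * (n + S + 1)) + 4)) ≤ 8000 * (K * (L + (n + S + 1) * b)) := by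
  obtain ⟨b, rfl⟩ := Nat.exists_eq_add_of_le' hb
  have h1 : L + (n + S + 1) * (b + 1) ≤ K * (L + (n + S + 1) * (b + 1)) :=
    Nat.le_mul_of_pos_left _ hK
  have h2 : K * ((n + S + 1) * b) ≤ K * (L + (n + S + 1) * (b + 1)) :=
    Nat.mul_le_mul_left _ (by nlinarith)
  have h3 : b ≤ (n + S + 1) * b := Nat.le_mul_of_pos_left _ (by omega)
  have h4 : (n + S + 1) * (b + 1) = (n + S + 1) * b + (n + S + 1) := by ring
  have h5 : 2 * (b + 1 - 1) * (3000 * (K * (n + S + 1)) + 4) =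
      6000 * (K * ((n + S + 1) * b)) + 8 * b := by
    rw [Nat.add_sub_cancel]; ring
  omega

-- The labels overwrite the input in `io`, which is harmless: tree and graph have been copied to
-- other arrays by then. The bound `M` is needed for the products of the layout, the powers of two
-- and the counts.
set_option maxRecDepth 4000 in
theorem prep_runs {M c : ℕ} {e : CWExpr (Fin n) k} (hgen : e.Generates G) (hadj : IsAdjLists G adj)
    {s : PStore} (hio : ∀ i, s.arr .io i = (dlsInput e adj).getD i 0) (hk1 : 1 ≤ k) (hn1 : 1 ≤ n)
    (hM : 2 * n ≤ M) (hM1 : n * (labelWords n k + 1) ≤ M) (hM2 : labelWords n k * lg n ≤ M)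
    (hc : 8000 * (min k n * (e.size + (n + ∑ v, (adj v).length + 1) * lg n)) ≤ c) :
    prep.Runs (Guard.free _ M) s c fun s' =>
      s'.reg .res = n * (labelWords n k + 1) ∧
      ∃ word : Fin n → ℕ → ℕ, (∀ v : Fin n,
        s'.arr .io (n * (labelWords n k + 1) + v) = v * (labelWords n k + 1) ∧
        s'.arr .io (v * (labelWords n k + 1)) = labelWords n k * lg n ∧
        ∀ q < labelWords n k, s'.arr .io (v * (labelWords n k + 1) + 1 + q) = word v q) ∧
      (∀ v, ∀ q < labelWords n k, word v q < 2 ^ lg n) ∧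
      (∀ v, word v 0 = 2 ^ (lg n - 1) ∧ word v 1 = min k n ∧ word v 2 = 2 * (lg n - 1)) ∧
      ∀ u v, ofCode (queryResult (word u) (word v)) = G.edist u v := by
  set K := min k n with hK
  set b := lg n with hb
  have hK1 : 1 ≤ K := le_min hk1 hn1
  have hb1 : 1 ≤ b := Nat.le_add_left _ _
  set W := labelWords n k with hW
  have hW' : W = recPos K (2 * (b - 1)) := rfl
  have hW3 : 3 ≤ W := Nat.le_add_right _ _
  have hbn : b ≤ n := lg_le hn1
  have hMW : W ≤ M := (Nat.le_mul_of_pos_right _ hb1).trans hM2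
  have hnodes := e.nodes_add_one
  rw [CWExpr.length_leaves hgen] at hnodes
  have hpos := e.nodes_pos
  set T := e.cutTree hgen with hT
  have hroot : T.root + 1 = e.nodes := by change e.nodes - 1 + 1 = _; omega
  set S := ∑ v, (adj v).length with hS
  have hlt : n < 2 ^ b := Nat.lt_pow_succ_log_self (by omega) n
  have hcost := prep_cost (L := e.size) (n := n) (S := S) hK1 hb1
  set R := 2 * (b - 1) * (3000 * (K * (n + S + 1)) + 4) with hR
  refine ((readTree_runs (c := 100 * e.size + 100) (rest := adjTokens adj) hgen hio le_rfl).seq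
    (c₂ := 600 * n + 100 * S + 600 + (3 + R)) fun s₁ f₁ h₁ => ?_).mono (by omega) fun _ _ h => h
  obtain ⟨n₁, k₁, p₁, nn₁, par₁, leaf₁⟩ := h₁
  have io₁ : s₁.arr .io = s.arr .io := f₁.arr _ (by decide)
  refine ((readGraph_runs (c := 50 * n + 50 * S + 50) (adj := adj) n₁ (fun i => ?_) le_rfl).seq
    (c₂ := 500 * n + 500 + (3 + R)) fun s₂ f₂ h₂ => ?_).mono (by omega) fun _ _ h => h
  · rw [io₁, hio, p₁, dlsInput, List.getD_append_right]
    · congr 1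
      rw [List.length_append, e.tokens_eq, List.length_flatMap]
      simp [CWExpr.length_triples]
      omega
    · rw [List.length_append, e.tokens_eq, List.length_flatMap]
      simp [CWExpr.length_triples]
      omega
  refine ((findBits_runs (c := 30 * n + 30) h₂.card hn1 hM le_rfl).seq
    (c₂ := 400 * n + 400 + (3 + R)) fun s₃ f₃ h₃ => ?_).mono (by omega) fun _ _ h => h
  have g₃ : HasGraph adj s₃ := h₂.frame f₃ (by decide)
  have k₃ : s₃.reg .kk = k := by rw [f₃.reg _ (by decide), f₂.reg _ (by decide), k₁]
  have nn₃ : s₃.reg .nn = e.nodes := by rw [f₃.reg _ (by decide), f₂.reg _ (by decide), nn₁]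
  refine ((findLayout_runs (c := 50) (K := K) (W := W) g₃.card k₃ h₃.1 nn₃ hK hW' hMW hM1
    le_rfl).seq (c₂ := 350 * n + 350 + (3 + R)) fun s₄ f₄ h₄ => ?_).mono (by omega) fun _ _ h => h
  obtain ⟨l₄, root₄, pos₄⟩ := h₄
  have g₄ : HasGraph adj s₄ := g₃.frame f₄ (by decide)
  have half₄ : s₄.reg .half = 2 ^ (b - 1) := by rw [f₄.reg _ (by decide), h₃.2]
  refine ((writeHeads_runs (c := 60 * n + 60) l₄ hW3 hM1 le_rfl).seq
    (c₂ := 250 * n + 250 + (3 + R)) fun s₅ f₅ h₅ => ?_).mono (by omega) fun _ _ h => h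
  rw [half₄] at h₅
  have g₅ : HasGraph adj s₅ := g₄.frame f₅ (by decide)
  have l₅ := l₄.frame f₅ rfl
  have t₅ : HasTree T s₅ := by
    refine ⟨g₅.card, ?_, ?_, ?_, ?_⟩
    · rw [f₅.reg _ (by decide), root₄]; rfl
    · rw [f₅.reg _ (by decide), f₄.reg _ (by decide), nn₃, hroot]
    · rw [f₅.arr _ (by decide), f₄.arr _ (by decide), f₃.arr _ (by decide), f₂.arr _ (by decide)]
      exact par₁
    · rw [f₅.arr _ (by decide), f₄.arr _ (by decide), f₃.arr _ (by decide), f₂.arr _ (by decide)]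
      exact leaf₁
  refine ((initComps_runs (c := 30 * (T.root + 1) + 30) t₅ le_rfl).seq
    (c₂ := 60 * n + 60 + (3 + R)) fun s₆ f₆ h₆ => ?_).mono (by omega) fun _ _ h => h
  have l₆ := l₅.frame f₆ rfl
  have io₆ : s₆.arr .io = s₅.arr .io := f₆.arr _ (by decide)
  have start₆ : s₆.arr .start = s₅.arr .start := f₆.arr _ (by decide)
  obtain ⟨c1, c2, c3⟩ := h₆
  set head : ℕ → ℕ := fun q => if q = 0 then 2 ^ (b - 1) else if q = 1 then K else 2 * (b - 1)
    with hhead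
  have hhalf : 2 * 2 ^ (b - 1) = 2 ^ b := by
    rw [← pow_succ', Nat.sub_add_cancel hb1]
  -- Used to see that the number `2 * (b - 1)` of levels fits into a word of `b` bits.
  have hpow : b - 1 < 2 ^ (b - 1) := Nat.lt_two_pow_self
  have headW : ∀ (v : Fin n), ∀ q < 3, s₆.arr .io (v * (W + 1) + 1 + q) = head q := by
    intro v q hq
    rw [io₆]
    obtain ⟨-, h6, h7, h8⟩ := h₅ v
    interval_cases q
    · exact h6
    · exact h7
    · exact h8
  -- At the start the only component is the whole tree, and a query has found nothing yet.
  have inv : LevelInv T adj (fun v => v * (W + 1) + 1) W K (2 ^ b - 1) head 0 s₆ := by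
    refine ⟨g₅.frame f₆ (by decide), t₅.frame f₆ rfl, ⟨fun v => ?_, fun v w q q' hq hq' h => ?_⟩,
      l₆.kk, ?_, ⟨c1, fun x hx hcut => ?_, fun x hx hcut => ?_⟩, fun c _ => Or.inr ?_, headW,
      fun v q hq => ?_, fun u v => ?_⟩
    · rw [start₆]
      exact (h₅ v).1
    · obtain ⟨h1, h2⟩ := label_inj (v := v) (w := w) (q := 1 + q) (q' := 1 + q') (W := W)
        (by omega) (by omega) (by rw [← add_assoc, ← add_assoc]; exact h)
      exact ⟨Fin.ext h1, by omega⟩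
    · rw [f₆.reg _ (by decide), f₅.reg _ (by decide), pos₄]; simp [recPos]
    · rw [c3 x hx]
      by_contra hne
      exact hcut (c2 x (by omega))
    · have hlt : x < T.root := lt_of_le_of_ne hx fun h => c1 (h ▸ hcut)
      rw [c3 x hx, c3 _ (T.par_le x hlt)]
    · rw [pow_zero, one_mul, pow_zero, one_mul]
      exact (Finset.card_le_univ _).trans (by simp)
    · rw [headW v q (by simpa [recPos] using hq), hhead]
      have : K ≤ n := min_le_right _ _
      dsimp only
      split_ifs <;> omega
    · refine QueryInv.init (fun u v => ?_) u v
      rw [c3 _ (T.leaf_le u), c3 _ (T.leaf_le v)]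
  refine ((levels_runs (c := 3 + R) hadj (by omega) hK hK1 (by omega) (by omega) l₆.lam inv
    hW'.ge le_rfl).seq (c₂ := 60 * n + 60) fun s₇ f₇ h₇ => ?_).mono (by omega) fun _ _ h => h
  have l₇ := l₆.frame f₇ rfl
  refine Runs.mono (writeTable_runs (c := 60 * n + 60) l₇ hM1 hM2 le_rfl) le_rfl fun s₈ f₈ h₈ => ?_
  refine ⟨(l₇.frame f₈ rfl).res, fun v q => s₇.arr .io (v * (W + 1) + 1 + q), h₈,
    fun v q hq => ?_, fun v => ⟨?_, ?_, ?_⟩, fun u v => ?_⟩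
  · change s₇.arr .io (v * (W + 1) + 1 + q) < _
    have := h₇.word_le v q (hW' ▸ hq)
    omega
  · exact h₇.head v 0 (by omega)
  · exact h₇.head v 1 (by omega)
  · exact h₇.head v 2 (by omega)
  · exact h₇.result rfl rfl u v

end WordRAM

/-! ### The query program -/

namespace WordRAM

open Exp Stmt

/-- The registers of the query program. -/
inductive QReg : Type
  | res | kk | lam | pos | sep | l | r | x | y | t
  deriving DecidableEq

/-- The arrays of the query program: the two labels. -/
inductive QArr : Type
  | fst | snd
  deriving DecidableEq

/-- Statements of the query program. -/
abbrev QStmt := Stmt QReg QArr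
/-- Stores of the query program. -/
abbrev QStore := Store QReg QArr

theorem Stmt.Runs.assign {ρ α : Type} [DecidableEq ρ] [DecidableEq α] {Γ : Guard α} {r : ρ}
    {e : Exp ρ α} {s : Store ρ α} {c : ℕ} {Q : Store ρ α → Prop} (hs : e.Safe Γ s)
    (hb : e.slow = true ∨ e.eval s ≤ Γ.bound) (hc : e.cost + 1 ≤ c) (hQ : Q (s.set r (e.eval s))) :
    (Stmt.set r e).Runs Γ s c Q := ⟨⟨hs, hb⟩, hc, hQ⟩

theorem Stmt.Runs.assign_seq {ρ α : Type} [DecidableEq ρ] [DecidableEq α] {Γ : Guard α} {r : ρ}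
    {e : Exp ρ α} {q : Stmt ρ α} {s : Store ρ α} {x c c₂ : ℕ} {Q : Store ρ α → Prop}
    (hs : e.Safe Γ s) (hx : e.eval s = x) (hb : e.slow = true ∨ x ≤ Γ.bound)
    (hq : q.Runs Γ (s.set r x) c₂ Q) (hc : e.cost + 1 + c₂ ≤ c) :
    ((Stmt.set r e).seq q).Runs Γ s c Q := by
  subst hx
  exact ⟨⟨⟨hs, hb⟩, hq.1⟩, (Nat.add_le_add_left hq.2.1 _).trans hc, hq.2.2⟩

/-- Update the best distance by the sum of the registers `x` and `y`. -/
def improve : QStmt :=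
  cond .ne (.reg .x) (.const 0) (cond .ne (.reg .y) (.const 0)
    (set .x (.add (.reg .x) (.reg .y)) ;;
      cond .eq (.reg .res) (.const 0) (set .res (.reg .x)) ;;
      cond .lt (.reg .x) (.reg .res) (set .res (.reg .x))))

theorem improve_runs {Γ : Guard QArr} {s : QStore} (h : s.reg .x + s.reg .y ≤ Γ.bound) :
    improve.Runs Γ s 30 fun s' =>
      s'.reg .res = combine (s.reg .res) (s.reg .x) (s.reg .y) := by
  have hden : (improve.den s).reg .res = combine (s.reg .res) (s.reg .x) (s.reg .y) := by
    unfold combine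
    simp only [improve, den, Exp.eval, Exp.add, BinOp.eval, Cmp.Rel]
    by_cases h1 : s.reg .x = 0
    · simp [h1]
    by_cases h2 : s.reg .y = 0
    · simp [h1, h2]
    by_cases h3 : s.reg .res = 0
    · simp [h1, h2, h3]
    by_cases h4 : s.reg .x + s.reg .y < s.reg .res
    · simp [h1, h2, h3, h4]
    · simp [h1, h2, h3, h4]
  exact ⟨⟨trivial, trivial, fun _ => ⟨trivial, trivial, fun _ => ⟨⟨⟨trivial, trivial⟩, Or.inr h⟩,
    ⟨trivial, trivial, fun _ => ⟨trivial, Or.inl rfl⟩⟩,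
    trivial, trivial, fun _ => ⟨trivial, Or.inl rfl⟩⟩⟩⟩,
    (improve.cost_le_maxCost rfl s).trans (Nat.le_of_ble_eq_true rfl), hden⟩

/-- Evaluate one round of a query. -/
def askRound : QStmt :=
  set .x (.at .fst .t) ;; set .y (.get .snd (.add (.reg .t) (.const 1))) ;; improve ;;
  set .x (.get .fst (.add (.reg .t) (.const 1))) ;; set .y (.at .snd .t) ;; improve ;;
  set .t (.add (.reg .t) (.const 2))

/-- The words of two labels are in the arrays, one position later. -/
structure HasWords (W B : ℕ) (f g : ℕ → ℕ) (s : QStore) : Prop where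
  fst : ∀ p < W, s.arr .fst (p + 1) = f p
  snd : ∀ p < W, s.arr .snd (p + 1) = g p
  fst_le : ∀ p < W, f p ≤ B
  snd_le : ∀ p < W, g p ≤ B

theorem HasWords.frame {W B : ℕ} {f g : ℕ → ℕ} {s s' : QStore} {p : QStmt}
    (h : HasWords W B f g s) (hf : p.Frame s s') (hp : p.warrs = []) : HasWords W B f g s' := by
  refine ⟨?_, ?_, h.fst_le, h.snd_le⟩
  · rw [hf.arr _ (by simp [hp])]; exact h.fst
  · rw [hf.arr _ (by simp [hp])]; exact h.snd

/-- The obligations of the query program. -/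
def queryGuard (M W : ℕ) : Guard QArr := ⟨M, fun _ i => i ≤ W⟩

/-- Cell 0 of the arrays holds the length of the label, so register `t` points one past the position
of the word in `queryRound`. -/
theorem askRound_runs {M W B : ℕ} {f g : ℕ → ℕ} (hM : 2 * B ≤ M) {s : QStore}
    (h : HasWords W B f g s) {pos r : ℕ} (ht : s.reg .t = pos + 2 + 2 * r)
    (hW : pos + 2 + 2 * r < W) :
    askRound.Runs (queryGuard M W) s 100 fun s' => s'.reg .t = pos + 2 + 2 * (r + 1) ∧
      s'.reg .res = queryRound f g pos r (s.reg .res) := by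
  have f1 := h.fst (pos + 1 + 2 * r) (by omega)
  have f2 := h.fst (pos + 2 + 2 * r) (by omega)
  have g1 := h.snd (pos + 1 + 2 * r) (by omega)
  have g2 := h.snd (pos + 2 + 2 * r) (by omega)
  rw [show pos + 1 + 2 * r + 1 = pos + 2 + 2 * r by ring] at f1 g1
  have lf1 := h.fst_le (pos + 1 + 2 * r) (by omega)
  have lf2 := h.fst_le (pos + 2 + 2 * r) (by omega)
  have lg1 := h.snd_le (pos + 1 + 2 * r) (by omega)
  have lg2 := h.snd_le (pos + 2 + 2 * r) (by omega)
  have le1 : pos + 2 + 2 * r ≤ W := by omega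
  have le2 : pos + 2 + 2 * r + 1 ≤ W := by omega
  refine Runs.assign_seq (x := f (pos + 1 + 2 * r)) (c₂ := 96) ⟨trivial, ?_⟩ ?_ (Or.inl rfl) ?_
    (Nat.le_of_ble_eq_true rfl)
  · simpa [Exp.eval, ht, queryGuard] using le1
  · simpa [Exp.eval, Exp.at, ht] using f1
  refine Runs.assign_seq (x := g (pos + 2 + 2 * r)) (c₂ := 90) ⟨⟨trivial, trivial⟩, ?_⟩ ?_
    (Or.inl rfl) ?_ (Nat.le_of_ble_eq_true rfl)
  · simpa [Exp.eval, Exp.add, BinOp.eval, ht, queryGuard] using le2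
  · simpa [Exp.eval, Exp.add, BinOp.eval, ht] using g2
  set s₂ := (s.set .x (f (pos + 1 + 2 * r))).set .y (g (pos + 2 + 2 * r)) with hs₂
  have hx₂ : s₂.reg .x = f (pos + 1 + 2 * r) := by simp [hs₂]
  have hy₂ : s₂.reg .y = g (pos + 2 + 2 * r) := by simp [hs₂]
  refine ((improve_runs (Γ := queryGuard M W) (s := s₂)
    (by rw [hx₂, hy₂]; change _ ≤ M; omega)).seq (c₂ := 60)
    fun s₃ f₃ h₃ => ?_).mono (Nat.le_of_ble_eq_true rfl) fun _ _ h => h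
  have t₃ : s₃.reg .t = pos + 2 + 2 * r := by rw [f₃.reg _ (by decide)]; simp [hs₂, ht]
  have a₃ : ∀ a, s₃.arr a = s.arr a := fun a => by rw [f₃.arr _ (by simp [improve, warrs])]; rfl
  have res₂ : s₂.reg .res = s.reg .res := by simp [hs₂]
  rw [hx₂, hy₂, res₂] at h₃
  refine Runs.assign_seq (x := f (pos + 2 + 2 * r)) (c₂ := 52) ⟨⟨trivial, trivial⟩, ?_⟩ ?_
    (Or.inl rfl) ?_ (Nat.le_of_ble_eq_true rfl)
  · simpa [Exp.eval, Exp.add, BinOp.eval, t₃, queryGuard] using le2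
  · simpa [Exp.eval, Exp.add, BinOp.eval, t₃, a₃] using f2
  refine Runs.assign_seq (x := g (pos + 1 + 2 * r)) (c₂ := 40) ⟨trivial, ?_⟩ ?_ (Or.inl rfl) ?_
    (Nat.le_of_ble_eq_true rfl)
  · simpa [Exp.eval, t₃, queryGuard] using le1
  · simpa [Exp.eval, Exp.at, t₃, a₃] using g1
  set s₅ := (s₃.set .x (f (pos + 2 + 2 * r))).set .y (g (pos + 1 + 2 * r)) with hs₅
  have hx₅ : s₅.reg .x = f (pos + 2 + 2 * r) := by simp [hs₅]
  have hy₅ : s₅.reg .y = g (pos + 1 + 2 * r) := by simp [hs₅]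
  refine ((improve_runs (Γ := queryGuard M W) (s := s₅)
    (by rw [hx₅, hy₅]; change _ ≤ M; omega)).seq (c₂ := 6)
    fun s₆ f₆ h₆ => ?_).mono (Nat.le_of_ble_eq_true rfl) fun _ _ h => h
  have t₆ : s₆.reg .t = pos + 2 + 2 * r := by rw [f₆.reg _ (by decide)]; simp [hs₅, t₃]
  have res₅ : s₅.reg .res = s₃.reg .res := by simp [hs₅]
  rw [hx₅, hy₅, res₅, h₃] at h₆
  refine Runs.assign ⟨trivial, trivial⟩ (Or.inl rfl) (Nat.le_of_ble_eq_true rfl) ⟨?_, ?_⟩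
  · simp [Exp.eval, Exp.add, BinOp.eval, t₆]; ring
  · simpa [queryRound] using h₆

/-- The query program. -/
def ask : QStmt :=
  set .kk (.get .fst (.const 2)) ;; set .lam (.get .fst (.const 3)) ;; set .pos (.const 4) ;;
  set .sep (.const 0) ;; set .res (.const 0) ;;
  loop .l (.reg .lam) (cond .eq (.reg .sep) (.const 0)
    (set .t (.add (.reg .pos) (.const 1)) ;; loop .r (.reg .kk) askRound ;;
      cond .ne (.at .fst .pos) (.at .snd .pos) (set .sep (.const 1)) ;;
      set .pos (.reg .t))) ;;
  cond .eq (.reg .sep) (.const 0) (set .res (.const 1))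

/-- After separation the remaining rounds of the counted loop are idle and `pos` is stale, hence its
value is asserted only while `sep` is 0. -/
theorem ask_runs {M W B K Λ c : ℕ} {f g : ℕ → ℕ} (hM : 2 * B ≤ M) {s : QStore}
    (h : HasWords W B f g s) (hK : f 1 = K) (hΛ : f 2 = Λ) (hW : recPos K Λ ≤ W)
    (hc : Λ * (104 * K + 60) + 60 ≤ c) :
    ask.Runs (queryGuard M W) s c fun s' => s'.reg .res = queryResult f g := by
  have hW3 : 3 ≤ W := (Nat.le_add_right _ _).trans hW
  set s₀ := ((((s.set .kk K).set .lam Λ).set .pos 4).set .sep 0).set .res 0 with hs₀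
  have loopL := Runs.loop_const (Γ := queryGuard M W) (s := s₀) (r := QReg.l) (e := .reg .lam)
    (p := cond .eq (.reg .sep) (.const 0)
    (set .t (.add (.reg .pos) (.const 1)) ;; loop .r (.reg .kk) askRound ;;
      cond .ne (.at .fst .pos) (.at .snd .pos) (set .sep (.const 1)) ;;
      set .pos (.reg .t))) (c := Λ * (104 * K + 60) + 3)
    (fun l s' => s'.reg .sep = (queryFold K f g l).1 ∧ s'.reg .res = (queryFold K f g l).2 ∧
      (s'.reg .sep = 0 → s'.reg .pos = recPos K l + 1)) (104 * K + 50) trivial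
    ⟨by simp [hs₀, queryFold, iter], by simp [hs₀, queryFold, iter], by simp [hs₀, recPos]⟩
    (fun l hl s' hf ⟨h1, h2, h3⟩ => ?_) ?_
  · have hev : (Exp.reg (α := QArr) QReg.lam).eval s₀ = Λ := by simp [Exp.eval, hs₀]
    rw [hev] at loopL
    refine Runs.assign_seq (x := K) (c₂ := Λ * (104 * K + 60) + 56) ⟨trivial, ?_⟩ ?_ (Or.inl rfl) ?_
      ((Nat.add_le_add_right (Nat.le_of_ble_eq_true rfl : _ ≤ 4) _).trans (by omega))
    · change 2 ≤ W; omega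
    · simp [Exp.eval, h.fst 1 (by omega), hK]
    refine Runs.assign_seq (x := Λ) (c₂ := Λ * (104 * K + 60) + 52) ⟨trivial, ?_⟩ ?_ (Or.inl rfl) ?_
      ((Nat.add_le_add_right (Nat.le_of_ble_eq_true rfl : _ ≤ 4) _).trans (by omega))
    · change 3 ≤ W; omega
    · simp [Exp.eval, h.fst 2 (by omega), hΛ]
    refine Runs.assign_seq (x := 4) (c₂ := Λ * (104 * K + 60) + 48) trivial rfl (Or.inl rfl) ?_
      ((Nat.add_le_add_right (Nat.le_of_ble_eq_true rfl : _ ≤ 4) _).trans (by omega))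
    refine Runs.assign_seq (x := 0) (c₂ := Λ * (104 * K + 60) + 44) trivial rfl (Or.inl rfl) ?_
      ((Nat.add_le_add_right (Nat.le_of_ble_eq_true rfl : _ ≤ 4) _).trans (by omega))
    refine Runs.assign_seq (x := 0) (c₂ := Λ * (104 * K + 60) + 40) trivial rfl (Or.inl rfl) ?_
      ((Nat.add_le_add_right (Nat.le_of_ble_eq_true rfl : _ ≤ 4) _).trans (by omega))
    refine (loopL.seq (c₂ := 10) fun s₁ f₁ h₁ => ?_).mono (by omega) fun _ _ h => h
    have hres : queryResult f g = if s₁.reg .sep = 0 then 1 else s₁.reg .res := by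
      rw [queryResult, hK, hΛ, h₁.1, h₁.2.1]
    refine Runs.cond (c := 5) trivial trivial (fun h0 => ?_) (fun h0 => ?_)
      (Nat.le_of_ble_eq_true rfl)
    · simp only [Cmp.Rel, Exp.eval] at h0
      rw [if_pos h0] at hres
      exact Runs.assign trivial (Or.inl rfl) (Nat.le_of_ble_eq_true rfl) (by simp [Exp.eval, hres])
    · simp only [Cmp.Rel, Exp.eval] at h0
      rw [hres, if_neg h0]
  · have hl' : l < Λ := by simpa [Exp.eval, hs₀] using hl
    have hrec : recPos K (l + 1) ≤ W := by
      refine le_trans ?_ hW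
      unfold recPos
      gcongr
      omega
    rw [recPos_succ] at hrec
    have hk' : s'.reg .kk = K := by rw [hf.reg _ (by decide)]; simp [hs₀]
    have hw' : HasWords W B f g s' := by
      refine HasWords.frame (s := s₀) ?_ hf (by simp [warrs, improve, askRound])
      exact ⟨h.fst, h.snd, h.fst_le, h.snd_le⟩
    set P := recPos K l with hP
    have hfold : queryFold K f g (l + 1) = queryLevel K f g l (queryFold K f g l) := rfl
    refine Runs.cond (c := 104 * K + 45) trivial trivial (fun h0 => ?_) (fun h0 => ?_) ?_
    · simp only [Cmp.Rel, Exp.eval, Store.set_reg, reduceCtorEq, if_false] at h0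
      have hpos := h3 h0
      set s₁ := (s'.set .l l).set .t (P + 2) with hs₁
      have hw₁ : HasWords W B f g s₁ := ⟨hw'.fst, hw'.snd, hw'.fst_le, hw'.snd_le⟩
      have hk₁ : (Exp.reg (α := QArr) QReg.kk).eval s₁ = K := by simp [Exp.eval, hs₁, hk']
      refine Runs.assign_seq (x := P + 2) (c₂ := 104 * K + 40) ⟨trivial, trivial⟩ ?_ (Or.inl rfl) ?_
        ((Nat.add_le_add_right (Nat.le_of_ble_eq_true rfl : _ ≤ 4) _).trans (by omega))
      · simp [Exp.eval, Exp.add, BinOp.eval, hpos]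
      refine ((Runs.loop_const (c := 104 * K + 3) (s := s₁) (r := QReg.r) (e := .reg .kk)
        (fun r s'' => s''.reg .t = P + 2 + 2 * r ∧
          s''.reg .res = iter (queryRound f g P) r (s₁.reg .res)) 100 trivial
        ⟨by simp [hs₁], rfl⟩ (fun r hr s'' hf'' ⟨h4, h5⟩ => ?_)
        (by rw [hk₁]; simp only [Exp.cost]; omega)).seq (c₂ := 20) fun s₂ f₂ h₂ => ?_).mono
        (by omega) fun _ _ h => h
      · rw [hk₁] at hr
        have hw'' : HasWords W B f g (s''.set .r r) := by
          have := hw₁.frame hf'' (by simp [warrs, improve, askRound])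
          exact ⟨this.fst, this.snd, this.fst_le, this.snd_le⟩
        refine (askRound_runs hM hw'' (by simpa using h4) (by omega)).mono le_rfl
          fun s₃ _ ⟨h6, h7⟩ => ⟨h6, ?_⟩
        rw [h7]
        simp only [iter]
        rw [← h5]
        simp
      · rw [hk₁] at h₂
        have hw₂ := hw₁.frame f₂ (by simp [warrs, improve, askRound])
        have hp₂ : s₂.reg .pos = P + 1 := by rw [f₂.reg _ (by decide)]; simp [hs₁, hpos]
        have hsep₂ : s₂.reg .sep = 0 := by rw [f₂.reg _ (by decide)]; simp [hs₁, h0]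
        have hF := hw₂.fst P (by omega)
        have hG := hw₂.snd P (by omega)
        have hres₁ : s₁.reg .res = (queryFold K f g l).2 := by simp [hs₁, h2]
        have hnew : queryFold K f g (l + 1) = (if f P = g P then 0 else 1, s₂.reg .res) := by
          rw [hfold, queryLevel, if_pos (by rw [← h1, h0]), h₂.2, hres₁]
        have hle : P + 1 ≤ W := by omega
        refine ⟨⟨⟨⟨trivial, ?_⟩, ⟨trivial, ?_⟩, fun _ => ⟨trivial, Or.inl rfl⟩⟩, trivial,
          Or.inl rfl⟩, (Stmt.cost_le_maxCost _ rfl _).trans (Nat.le_of_ble_eq_true rfl), ?_⟩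
        · simpa [Exp.eval, hp₂, queryGuard] using hle
        · simpa [Exp.eval, hp₂, queryGuard] using hle
        · rw [hnew]
          simp only [den, Exp.eval, Exp.at, Cmp.Rel, hp₂, hF, hG]
          by_cases hfg : f P = g P
          · simp [hfg, hsep₂, h₂.1, recPos_succ]
            omega
          · simp [hfg]
    · simp only [Cmp.Rel, Exp.eval, Store.set_reg, reduceCtorEq, if_false] at h0
      rw [hfold, queryLevel, if_neg (by rw [← h1]; exact h0)]
      exact ⟨by simpa using h1, by simpa using h2, fun h => absurd (by simpa using h) h0⟩
    · simp only [Exp.cost]; omega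
  · simp only [Exp.cost, Exp.eval, hs₀, Store.set_reg, reduceCtorEq, if_false, if_true]
    rw [show 104 * K + 50 + 4 = 104 * K + 54 by ring]
    have := Nat.mul_le_mul_left Λ (show 104 * K + 54 ≤ 104 * K + 60 by omega)
    omega

end WordRAM

/-! ### Labels as bit strings, and the query program on the word RAM -/

namespace WordRAM

/-- The bit string with the words `f 0`, …, `f (W - 1)` of `b` bits each. -/
def encodeWords (b W : ℕ) (f : ℕ → ℕ) : List Bool :=
  (List.range (W * b)).map fun i => (f (i / b)).testBit (i % b)

@[simp] theorem length_encodeWords (b W : ℕ) (f : ℕ → ℕ) : (encodeWords b W f).length = W * b := by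
  simp [encodeWords]

theorem sum_testBit (x b : ℕ) :
    ∑ i ∈ Finset.range b, (x.testBit i).toNat * 2 ^ i = x % 2 ^ b := by
  induction b with
  | zero => simp [Nat.mod_one]
  | succ b ih => rw [Finset.sum_range_succ, ih, Nat.mod_pow_succ, Nat.toNat_testBit, mul_comm]

theorem block_encodeWords {b W j : ℕ} {f : ℕ → ℕ} (hj : j < W) (hf : f j < 2 ^ b) :
    block b (encodeWords b W f) j = f j := by
  rw [block, ← Nat.mod_eq_of_lt hf, ← sum_testBit]
  refine Finset.sum_congr rfl fun i hi => ?_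
  rw [Finset.mem_range] at hi
  have h1 : j * b + i < W * b := by
    have := Nat.mul_le_mul_right b (show j + 1 ≤ W from hj)
    rw [Nat.add_mul] at this
    omega
  have h2 : (j * b + i) / b = j := by
    rw [mul_comm, Nat.mul_add_div (by omega), Nat.div_eq_of_lt hi, add_zero]
  have h3 : (j * b + i) % b = i := by
    rw [mul_comm, Nat.mul_add_mod, Nat.mod_eq_of_lt hi]
  rw [List.getD_eq_getElem _ _ (by simpa using h1)]
  simp [encodeWords, h2, h3]

/-- The number of bits per word, which is read off from the first word. -/
def wordBits (x : List Bool) : ℕ := x.findIdx id + 1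

/-- The decoder is not told `n`. The first word is `2 ^ (b - 1)`, least significant bit first, so
the first set bit of the string is at position `b - 1`. -/
theorem wordBits_encodeWords {b W : ℕ} {f : ℕ → ℕ} (hb : 1 ≤ b) (hW : 1 ≤ W)
    (hf : f 0 = 2 ^ (b - 1)) : wordBits (encodeWords b W f) = b := by
  have hlt : b ≤ W * b := Nat.le_mul_of_pos_left _ hW
  have hbit : ∀ i (hi : i < b), (encodeWords b W f)[i]'(by simp; omega) = decide (b - 1 = i) := by
    intro i hi
    simp [encodeWords, Nat.div_eq_of_lt hi, Nat.mod_eq_of_lt hi, hf, Nat.testBit_two_pow]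
  have : (encodeWords b W f).findIdx id = b - 1 := by
    rw [List.findIdx_eq (by simp; omega)]
    refine ⟨?_, fun j hj => ?_⟩
    · rw [hbit _ (by omega)]; simp
    · rw [hbit _ (by omega)]; simp; omega
  rw [wordBits, this]
  omega

/-- The decoding function. -/
def decode (x y : List Bool) : ℕ∞ :=
  ofCode (queryResult (block (wordBits x) x) (block (wordBits x) y))

theorem decode_encodeWords {b K W : ℕ} {f g : ℕ → ℕ} (hb : 1 ≤ b)
    (hW : W = recPos K (2 * (b - 1))) (hf : ∀ q < W, f q < 2 ^ b) (hg : ∀ q < W, g q < 2 ^ b)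
    (h0 : f 0 = 2 ^ (b - 1)) (h1 : f 1 = K) (h2 : f 2 = 2 * (b - 1)) :
    decode (encodeWords b W f) (encodeWords b W g) = ofCode (queryResult f g) := by
  have hW3 : 3 ≤ W := hW ▸ Nat.le_add_right _ _
  have e1 : ∀ q < W, block b (encodeWords b W f) q = f q := fun q hq =>
    block_encodeWords hq (hf q hq)
  have e2 : ∀ q < W, block b (encodeWords b W g) q = g q := fun q hq =>
    block_encodeWords hq (hg q hq)
  rw [decode, wordBits_encodeWords hb (by omega) h0]
  unfold queryResult
  rw [e1 1 (by omega), e1 2 (by omega), h1, h2,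
    queryFold_congr (fun p hp => e1 p (hW ▸ hp)) (fun p hp => e2 p (hW ▸ hp))]

theorem recPos_le {b K : ℕ} (hb : 1 ≤ b) (hK : 1 ≤ K) : recPos K (2 * (b - 1)) ≤ 6 * (K * b) := by
  obtain ⟨b, rfl⟩ := Nat.exists_eq_add_of_le' hb
  obtain ⟨K, rfl⟩ := Nat.exists_eq_add_of_le' hK
  unfold recPos
  rw [Nat.add_sub_cancel]
  nlinarith [Nat.zero_le (K * b)]

/-! ### The query program as machine code. -/

/-- The placement of the registers of the query program. -/
def queryLayout : Layout QReg QArr where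
  enc q := q.ctorIdx + 2
  breg a := a.ctorIdx
  top := 12
  enc_inj a b h := by
    have h' : a.ctorIdx = b.ctorIdx := Nat.add_right_cancel h
    rw [← QReg.ofNat_ctorIdx a, ← QReg.ofNat_ctorIdx b, h']
  enc_lt q := by cases q <;> decide
  breg_lt a := by cases a <;> decide
  enc_ne q a := by cases a <;> cases q <;> decide

/-- Set the registers `2`, …, `m + 1` to `0`. -/
def clear : ℕ → Prog
  | 0 => .skip
  | m + 1 => .seq (clear m) (.const (m + 2) 0)

/-- Nothing is known about the registers when a query starts, apart from the two addresses; clearing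
makes them represent a store of zeros. -/
theorem exec_clear (w m : ℕ) (t : State) : ∃ t', Exec w (clear m) t (m + 1) t' ∧
    t'.mem = t.mem ∧ (∀ r, 2 ≤ r → r < m + 2 → t'.regs r = 0) ∧ ∀ r < 2, t'.regs r = t.regs r := by
  induction m with
  | zero => exact ⟨t, Exec.skip t, rfl, fun r h1 h2 => absurd h1 (by omega), fun _ _ => rfl⟩
  | succ m ih =>
    obtain ⟨t', h1, h2, h3, h4⟩ := ih
    refine ⟨_, Exec.seq h1 (Exec.const t' (m + 2) 0 (by positivity)), h2, fun r hr hr' => ?_,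
      fun r hr => ?_⟩
    · by_cases h : r = m + 2
      · simp [State.setReg, h]
      · simp only [State.setReg, Function.update_of_ne h]
        exact h3 r hr (by omega)
    · simp only [State.setReg, Function.update_of_ne (show r ≠ m + 2 by omega)]
      exact h4 r hr

/-- The query program as a program of the word RAM. -/
def queryProg : Prog := .seq (clear 10) (.seq (ask.compile queryLayout 12) (.move 0 2))

/-- All numbers involved are bounded by powers of `x = 2 ^ b`, so a word size proportional to `b`
excludes overflow. Only the cells of the two labels are addressed, which is what the validity `i ≤
W` of `queryGuard` expresses. -/
theorem answersQuery_queryProg {b K W w T : ℕ} {f g : ℕ → ℕ} (hb : 1 ≤ b) (hK : 1 ≤ K)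
    (hKb : K ≤ 2 ^ b) (hW : W = recPos K (2 * (b - 1))) (hf : ∀ q < W, f q < 2 ^ b)
    (hg : ∀ q < W, g q < 2 ^ b) (h1 : f 1 = K) (h2 : f 2 = 2 * (b - 1)) (hw : 61 * b ≤ w)
    (hT : 400 * (K * b) ≤ T) :
    AnswersQuery w b queryProg (encodeWords b W f) (encodeWords b W g) (ofCode (queryResult f g))
      T := by
  intro t hx hy
  obtain ⟨t₀, e₀, m₀, z₀, b₀⟩ := exec_clear w 10 t
  set base : QArr → ℕ := fun a => t.regs a.ctorIdx with hbase
  -- Beyond the labels the arrays are declared zero: the memory there is unknown and could violate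
  -- the common bound.
  set s : QStore := ⟨fun _ => 0, fun a i => if i ≤ W then t.mem (base a + i) else 0⟩ with hs
  have stored : ∀ {p : ℕ} {f : ℕ → ℕ}, (∀ q < W, f q < 2 ^ b) →
      StoredAt w b t.mem p (encodeWords b W f) → p < 2 ^ w ∧ t.mem p = W * b ∧
      ∀ q < W, p + 1 + q < 2 ^ w ∧ t.mem (p + 1 + q) = f q := by
    intro p f hf hx
    refine ⟨hx.1, by simpa using hx.2.1, fun q hq => ?_⟩
    have := hx.2.2 q (by rw [length_encodeWords]; exact Nat.mul_lt_mul_of_pos_right hq hb)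
    rwa [block_encodeWords hq (hf q hq)] at this
  have st : ∀ a, ∃ h : ℕ → ℕ, (∀ q < W, h q < 2 ^ b) ∧ base a < 2 ^ w ∧ t.mem (base a) = W * b ∧
      ∀ q < W, base a + 1 + q < 2 ^ w ∧ t.mem (base a + 1 + q) = h q := by
    rintro (_ | _)
    exacts [⟨f, hf, stored hf hx⟩, ⟨g, hg, stored hg hy⟩]
  have words : HasWords W (2 ^ b) f g s := by
    refine ⟨fun p hp => ?_, fun p hp => ?_, fun p hp => (hf p hp).le, fun p hp => (hg p hp).le⟩
    · simp only [hs, if_pos (show p + 1 ≤ W from hp)]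
      rw [add_comm p 1, ← add_assoc]
      exact ((stored hf hx).2.2 p hp).2
    · simp only [hs, if_pos (show p + 1 ≤ W from hp)]
      rw [add_comm p 1, ← add_assoc]
      exact ((stored hg hy).2.2 p hp).2
  have runs := ask_runs (M := 2 * 2 ^ b) (c := 328 * (K * b)) le_rfl words h1 h2 hW.ge (by
    obtain ⟨b, rfl⟩ := Nat.exists_eq_add_of_le' hb
    rw [Nat.add_sub_cancel]
    nlinarith [Nat.mul_le_mul_left b hK])
  obtain ⟨safe, cost, res⟩ := runs
  set x := 2 ^ b with hx
  have hx2 : 2 ≤ x := by rw [hx]; exact Nat.le_self_pow (by omega) 2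
  have hbx : b ≤ x := Nat.lt_two_pow_self.le
  have hKbx : K * b ≤ x ^ 2 := by rw [sq]; exact Nat.mul_le_mul hKb hbx
  have pow_le : ∀ m, 2 ^ m ≤ x ^ m := fun m => Nat.pow_le_pow_left hx2 m
  have mono : ∀ {i j : ℕ}, i ≤ j → x ^ i ≤ x ^ j := fun h => Nat.pow_le_pow_right (by omega) h
  have hWb : W * b ≤ x ^ 6 := by
    calc W * b ≤ 6 * (K * b) * b := Nat.mul_le_mul_right _ (hW ▸ recPos_le hb hK)
      _ ≤ 2 ^ 3 * x ^ 2 * x := by gcongr; norm_num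
      _ ≤ x ^ 3 * x ^ 2 * x := by gcongr
      _ = x ^ 6 := by ring
  have h8 : 8 ≤ x ^ 6 := (pow_le 3).trans (mono (by norm_num))
  have bound : 2 * x ≤ x ^ 6 := by
    calc 2 * x ≤ x * x := Nat.mul_le_mul_right _ hx2
      _ = x ^ 2 := (sq x).symm
      _ ≤ _ := mono (by norm_num)
  have bdd : s.Bdd (x ^ 6) := by
    refine ⟨fun _ => Nat.zero_le _, fun a i => ?_⟩
    simp only [hs]
    split_ifs with hi
    · obtain ⟨h, hh, -, h3, h4⟩ := st a
      rcases i with _ | i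
      · rw [add_zero, h3]; exact hWb
      · rw [add_comm i 1, ← add_assoc, (h4 i hi).2]
        have := hh i hi
        omega
    · exact Nat.zero_le _
  have hV : x ^ 6 + 8 * ask.cost s ≤ x ^ 15 := by
    calc x ^ 6 + 8 * ask.cost s ≤ x ^ 14 + 2 ^ 12 * x ^ 2 := by
          have := mono (show 6 ≤ 14 by norm_num)
          omega
      _ ≤ x ^ 14 + x ^ 12 * x ^ 2 := by gcongr
      _ = 2 * x ^ 14 := by ring
      _ ≤ x * x ^ 14 := Nat.mul_le_mul_right _ hx2
      _ = x ^ 15 := by ring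
  -- Stored values stay below `x ^ 15` and expressions have degree at most 4, so all values are at
  -- most `2 ^ (60 * b)`; this is where `61 * b ≤ w` is used.
  have hw' : (x ^ 15) ^ 4 < 2 ^ w := by
    rw [hx, ← pow_mul, ← pow_mul]
    exact Nat.pow_lt_pow_right (by norm_num) (by omega)
  obtain ⟨ok, -⟩ := ask.ok_of_safe (w := w) (D := 4) (valid := fun _ i => i ≤ W) (by norm_num)
    (by norm_num) hw' (fun _ _ h _ => h) rfl s _ h8 bound bdd safe hV
  have rep : Represents queryLayout base (fun _ i => i ≤ W) s t₀ := by
    refine ⟨fun _ => z₀ _ (Nat.le_add_left _ _) (queryLayout.enc_lt _), fun a => ?_,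
      fun a i hi => ?_⟩
    · exact b₀ _ (by cases a <;> decide)
    · rw [m₀]
      simp only [hs, if_pos hi]
  have valid_lt : ∀ (a : QArr) (i : ℕ), i ≤ W → base a + i < 2 ^ w := by
    intro a i hi
    obtain ⟨h, -, h2, -, h4⟩ := st a
    rcases i with _ | i
    · exact h2
    · rw [add_comm i 1, ← add_assoc]
      exact (h4 i hi).1
  -- The query writes no array, so no disjointness of the two labels has to be shown.
  obtain ⟨t₁, e₁, r₁, -⟩ := ask.exec_compile valid_lt (fun a ha => absurd ha (by
    simp [ask, askRound, improve, Stmt.warrs])) 12 s t₀ le_rfl rep ok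
  refine ⟨_, _, Exec.seq e₀ (Exec.seq e₁ (Exec.move t₁ 0 2)), ?_, ?_⟩
  · have : 1 ≤ K * b := Nat.mul_pos hK hb
    omega
  · rw [distCode_ofCode, ← res, ← r₁.reg]
    simp [State.setReg, queryLayout]
    rfl

end WordRAM

/-! ### The preprocessing program on the word RAM -/

namespace WordRAM

/-- The placement of the registers of the preprocessing program. -/
def prepLayout : Layout PReg PArr where
  enc q := q.ctorIdx
  breg a := a.ctorIdx + 24
  top := 47
  enc_inj a b h := by
    have h' : a.ctorIdx = b.ctorIdx := h
    rw [← PReg.ofNat_ctorIdx a, ← PReg.ofNat_ctorIdx b, h']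
  enc_lt q := by cases q <;> decide
  breg_lt a := by cases a <;> decide
  enc_ne q a := by
    have : q.ctorIdx < 24 := by cases q <;> decide
    omega

/-! ### Base addresses for the arrays of the preprocessing. -/

/-- Square the register `48` repeatedly. -/
def squarings : ℕ → Prog
  | 0 => .skip
  | m + 1 => .seq (squarings m) (.op .mul 48 48 48)

/-- Set the registers `24`, …, `m + 23` to the first multiples of the register `48`. -/
def multiples : ℕ → Prog
  | 0 => .skip
  | m + 1 => .seq (multiples m) (.seq (.const 47 m) (.op .mul (m + 24) 47 48))

theorem exec_squarings {w m : ℕ} {t : State} (hx : 1 ≤ t.regs 48)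
    (h : t.regs 48 ^ 2 ^ m < 2 ^ w) : ∃ t', Exec w (squarings m) t (m + 1) t' ∧
      t'.mem = t.mem ∧ t'.regs 48 = t.regs 48 ^ 2 ^ m ∧ ∀ r, r < 47 → t'.regs r = t.regs r := by
  induction m with
  | zero => exact ⟨t, Exec.skip t, rfl, by simp, fun _ _ => rfl⟩
  | succ m ih =>
    obtain ⟨t', h1, h2, h3, h4⟩ := ih (lt_of_le_of_lt
      (Nat.pow_le_pow_right hx (Nat.pow_le_pow_right (by norm_num) (Nat.le_succ m))) h)
    have hval : BinOp.mul.eval (t'.regs 48) (t'.regs 48) = t.regs 48 ^ 2 ^ (m + 1) := by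
      rw [h3, BinOp.eval, ← pow_add]
      congr 1
      ring
    refine ⟨_, Exec.seq h1 (Exec.op t' .mul 48 48 48 (hval ▸ h)), h2, ?_, fun r hr => ?_⟩
    · simp [State.setReg, hval]
    · simp only [State.setReg, Function.update_of_ne (show r ≠ 48 by omega)]
      exact h4 r hr

theorem exec_multiples {w m : ℕ} {t : State} (hm : m ≤ 23) (hm' : 23 < 2 ^ w)
    (h : 23 * t.regs 48 < 2 ^ w) : ∃ t', Exec w (multiples m) t (m * 2 + 1) t' ∧
      t'.mem = t.mem ∧ t'.regs 48 = t.regs 48 ∧ (∀ r < 24, t'.regs r = t.regs r) ∧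
      ∀ i < m, t'.regs (i + 24) = i * t.regs 48 := by
  induction m with
  | zero => exact ⟨t, Exec.skip t, rfl, rfl, fun _ _ => rfl, fun i hi => absurd hi (by omega)⟩
  | succ m ih =>
    obtain ⟨t', h1, h2, h3, h4, h5⟩ := ih (by omega)
    have hval : BinOp.mul.eval ((t'.setReg 47 m).regs 47) ((t'.setReg 47 m).regs 48) =
        m * t.regs 48 := by
      simp [State.setReg, BinOp.eval, h3]
    have e₁ := Exec.const (w := w) t' 47 m (by omega)
    have e₂ := Exec.op (w := w) (t'.setReg 47 m) .mul (m + 24) 47 48 (by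
      rw [hval]
      exact (Nat.mul_le_mul_right _ (by omega)).trans_lt h)
    have e₃ := Exec.seq h1 (Exec.seq e₁ e₂)
    rw [show m * 2 + 1 + (1 + 1) = (m + 1) * 2 + 1 by ring] at e₃
    refine ⟨_, e₃, h2, ?_, fun r hr => ?_, fun i hi => ?_⟩
    · simp only [State.setReg]
      rw [Function.update_of_ne (by omega), Function.update_of_ne (by omega), h3]
    · simp only [State.setReg]
      rw [Function.update_of_ne (by omega), Function.update_of_ne (by omega), h4 r hr]
    · rw [hval]
      simp only [State.setReg]
      by_cases him : i = m
      · rw [him, Function.update_self]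
      · rw [Function.update_of_ne (by omega), Function.update_of_ne (by omega), h5 i (by omega)]

/-- Compute the base addresses of the arrays. -/
def prologue : Prog :=
  .seq (.seq (.seq (.seq (.seq (.seq (.seq (.seq (.const 47 1) (.load 48 47)) (.const 47 2))
    (.load 49 47)) (.op .add 48 48 49)) (.const 47 1)) (.op .add 48 48 47)) (squarings 7))
    (multiples 23)

/-- Cells 1 and 2 hold `k` and the size `L` for a preprocessing input, so `x = k + L + 1`. Seven
squarings give `x ^ 128`, the distance of consecutive base addresses. The array number 0 is `io`,
which thereby coincides with the input. -/
theorem exec_prologue {w x : ℕ} {input : List ℕ} (hx : x = input.getD 1 0 + input.getD 2 0 + 1)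
    (hw : 23 * x ^ 128 < 2 ^ w) : ∃ t, Exec w prologue (inputState input) 62 t ∧
      t.mem = (fun i => input.getD i 0) ∧ (∀ r < 24, t.regs r = 0) ∧
      ∀ i < 23, t.regs (i + 24) = i * x ^ 128 := by
  have hx1 : 1 ≤ x := by omega
  have hxx : x ≤ x ^ 128 := Nat.le_self_pow (by norm_num) x
  have hp : 1 ≤ x ^ 128 := Nat.one_le_pow _ _ hx1
  set t₀ := inputState input with ht₀
  have e₁ := Exec.const (w := w) t₀ 47 1 (by omega)
  set t₁ := t₀.setReg 47 1 with ht₁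
  have e₂ := Exec.load (w := w) t₁ 48 47
  set t₂ := t₁.setReg 48 (t₁.mem (t₁.regs 47)) with ht₂
  have e₃ := Exec.const (w := w) t₂ 47 2 (by omega)
  set t₃ := t₂.setReg 47 2 with ht₃
  have e₄ := Exec.load (w := w) t₃ 49 47
  set t₄ := t₃.setReg 49 (t₃.mem (t₃.regs 47)) with ht₄
  have a₄ : t₄.regs 48 = input.getD 1 0 := by
    simp [ht₄, ht₃, ht₂, ht₁, ht₀, inputState, State.setReg]
  have b₄ : t₄.regs 49 = input.getD 2 0 := by
    simp [ht₄, ht₃, ht₂, ht₁, ht₀, inputState, State.setReg]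
  have e₅ := Exec.op (w := w) t₄ .add 48 48 49 (by rw [a₄, b₄, BinOp.eval]; omega)
  rw [a₄, b₄, BinOp.eval] at e₅
  set t₅ := t₄.setReg 48 (input.getD 1 0 + input.getD 2 0) with ht₅
  have e₆ := Exec.const (w := w) t₅ 47 1 (by omega)
  set t₆ := t₅.setReg 47 1 with ht₆
  have a₆ : BinOp.add.eval (t₆.regs 48) (t₆.regs 47) = x := by
    simp [ht₆, ht₅, State.setReg, BinOp.eval, hx]
  have e₇ := Exec.op (w := w) t₆ .add 48 48 47 (by rw [a₆]; omega)
  rw [a₆] at e₇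
  set t₇ := t₆.setReg 48 x with ht₇
  have a₇ : t₇.regs 48 = x := by simp [ht₇, State.setReg]
  have low : ∀ r < 47, t₇.regs r = 0 := by
    intro r hr
    simp only [ht₇, ht₆, ht₅, ht₄, ht₃, ht₂, ht₁, ht₀, State.setReg, inputState]
    iterate 7 rw [Function.update_of_ne (by omega)]
  obtain ⟨t₈, e₈, m₈, a₈, l₈⟩ := exec_squarings (w := w) (m := 7) (t := t₇) (by omega)
    (by rw [a₇]; norm_num; omega)
  rw [a₇] at a₈
  norm_num at a₈
  obtain ⟨t₉, e₉, m₉, -, l₉, b₉⟩ := exec_multiples (w := w) (m := 23) (t := t₈) le_rfl (by omega)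
    (by rw [a₈]; exact hw)
  refine ⟨t₉, ?_, ?_, fun r hr => ?_, fun i hi => ?_⟩
  · exact Exec.seq (Exec.seq (Exec.seq (Exec.seq (Exec.seq (Exec.seq (Exec.seq (Exec.seq e₁ e₂) e₃)
      e₄) e₅) e₆) e₇) e₈) e₉
  · rw [m₉, m₈]; rfl
  · rw [l₉ r hr, l₈ r (by omega), low r (by omega)]
  · rw [b₉ i hi, a₈]

theorem _root_.CWExpr.pos {V : Type} {k : ℕ} (e : CWExpr V k) : 1 ≤ k := by
  induction e with
  | vertex i v => exact i.pos
  | union e f ihe ihf => exact ihe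
  | join i j hij e ih => exact ih
  | relabel i j e ih => exact ih

theorem _root_.CWExpr.length_tokens {n k : ℕ} (e : CWExpr (Fin n) k) :
    e.tokens.length = 3 * e.size := by
  induction e <;> simp only [CWExpr.tokens, CWExpr.size, List.length_append, List.length_cons,
    List.length_nil] <;> omega

theorem _root_.CWExpr.le_of_mem_tokens {n k : ℕ} (e : CWExpr (Fin n) k) {y : ℕ}
    (hy : y ∈ e.tokens) : y ≤ n + k + 3 := by
  induction e with
  | vertex i v =>
    simp only [CWExpr.tokens, List.mem_cons, List.not_mem_nil, or_false] at hy
    omega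
  | union e f ihe ihf =>
    simp only [CWExpr.tokens, List.mem_append, List.mem_cons, List.not_mem_nil, or_false] at hy
    rcases hy with (hy | hy) | hy
    exacts [ihe hy, ihf hy, by omega]
  | join i j hij e ih =>
    simp only [CWExpr.tokens, List.mem_append, List.mem_cons, List.not_mem_nil, or_false] at hy
    rcases hy with hy | hy
    exacts [ih hy, by omega]
  | relabel i j e ih =>
    simp only [CWExpr.tokens, List.mem_append, List.mem_cons, List.not_mem_nil, or_false] at hy
    rcases hy with hy | hy
    exacts [ih hy, by omega]

variable {n k : ℕ} {G : SimpleGraph (Fin n)} {e : CWExpr (Fin n) k} {adj : Fin n → List (Fin n)}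

theorem length_adj_le (hadj : IsAdjLists G adj) (v : Fin n) : (adj v).length ≤ n := by
  simpa using (hadj v).1.length_le_card

/-- The handshake lemma, by which running times in terms of adjacency lists become bounds in `m`. -/
theorem sum_length_adj (hadj : IsAdjLists G adj) :
    ∑ v, (adj v).length = 2 * G.edgeSet.ncard := by
  classical
  rw [Set.ncard_eq_toFinset_card', ← SimpleGraph.edgeFinset, ← G.sum_degrees_eq_twice_card_edges]
  refine Finset.sum_congr rfl fun v _ => ?_
  rw [← List.toFinset_card_of_nodup (hadj v).1, ← SimpleGraph.card_neighborFinset_eq_degree]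
  congr 1
  ext u
  simp [(hadj v).2 u]

theorem length_adjTokens (adj : Fin n → List (Fin n)) :
    (adjTokens adj).length = n + ∑ v, (adj v).length := by
  rw [adjTokens, List.length_flatMap]
  simp only [List.length_cons, List.length_map]
  rw [← Fin.sum_univ_def, Finset.sum_add_distrib]
  simp [add_comm]

theorem getD_dlsInput_le (hadj : IsAdjLists G adj) (i : ℕ) :
    (dlsInput e adj).getD i 0 ≤ n + k + e.size + 3 := by
  by_cases hi : i < (dlsInput e adj).length
  · rw [List.getD_eq_getElem _ _ hi]
    have := List.getElem_mem hi
    generalize (dlsInput e adj)[i] = y at this ⊢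
    simp only [dlsInput, List.mem_append, List.mem_cons, List.not_mem_nil, or_false] at this
    rcases this with (h | h) | h
    · omega
    · have := e.le_of_mem_tokens h
      omega
    · simp only [adjTokens, List.mem_flatMap, List.mem_cons] at h
      obtain ⟨v, -, h | h⟩ := h
      · have := length_adj_le hadj v
        omega
      · obtain ⟨u, -, rfl⟩ := by simpa using h
        omega
  · rw [List.getD_eq_default _ _ (by omega)]
    exact Nat.zero_le _

/-- The preprocessing program as a program of the word RAM. -/
def prepProg : Prog := .seq prologue (prep.compile prepLayout 47)

theorem lt_two_pow_lg (m : ℕ) : m < 2 ^ lg m := Nat.lt_pow_succ_log_self (by norm_num) m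

/-- Everything is polynomial in `x`; as `3 ≤ x`, numerical factors are absorbed into powers, 9 by `x
^ 2` and 256000 by `x ^ 12`. -/
theorem prep_bounds {n K b W L S x : ℕ} (hx : 3 ≤ x) (hn : n ≤ x) (hK : K ≤ x) (hb : b ≤ x)
    (hL : L ≤ x) (hS : S ≤ n * n) (hW : W ≤ 6 * (K * b)) :
    n * (W + 1) + n ≤ x ^ 6 ∧ W * b ≤ x ^ 6 ∧ 9 * x ^ 2 ≤ x ^ 6 ∧
      8 * (8000 * (K * (L + (n + S + 1) * b))) ≤ x ^ 16 := by
  have mono : ∀ {i j : ℕ}, i ≤ j → x ^ i ≤ x ^ j := fun h => Nat.pow_le_pow_right (by omega) h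
  have hW2 : W ≤ 6 * x ^ 2 := hW.trans (by rw [sq]; gcongr)
  have mul9 : ∀ m, 9 * x ^ m ≤ x ^ (m + 2) := fun m => by
    rw [pow_add, mul_comm]; exact Nat.mul_le_mul_left _ (Nat.pow_le_pow_left hx 2)
  have h1 : 1 ≤ x ^ 2 := Nat.one_le_pow _ _ (by omega)
  have hx2 : x ≤ x ^ 2 := Nat.le_self_pow (by norm_num) x
  refine ⟨?_, ?_, (mul9 2).trans (mono (by norm_num)), ?_⟩
  · calc n * (W + 1) + n ≤ x * (7 * x ^ 2) + x * x ^ 2 :=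
          Nat.add_le_add (Nat.mul_le_mul hn (by omega)) (hn.trans (Nat.le_mul_of_pos_right _ h1))
      _ = 8 * x ^ 3 := by ring
      _ ≤ 9 * x ^ 3 := by omega
      _ ≤ x ^ 5 := mul9 3
      _ ≤ x ^ 6 := mono (by norm_num)
  · calc W * b ≤ 6 * x ^ 2 * x := Nat.mul_le_mul hW2 hb
      _ = 6 * x ^ 3 := by ring
      _ ≤ 9 * x ^ 3 := by omega
      _ ≤ x ^ 5 := mul9 3
      _ ≤ x ^ 6 := mono (by norm_num)
  · have hS2 : S ≤ x ^ 2 := hS.trans (by rw [sq]; gcongr)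
    calc 8 * (8000 * (K * (L + (n + S + 1) * b)))
        ≤ 8 * (8000 * (x * (x ^ 3 + (x ^ 2 + x ^ 2 + x ^ 2) * x))) := by
          gcongr
          · exact hL.trans (Nat.le_self_pow (by norm_num) x)
          · exact hn.trans hx2
      _ = 256000 * x ^ 4 := by ring
      _ ≤ 3 ^ 12 * x ^ 4 := by gcongr; norm_num
      _ ≤ x ^ 12 * x ^ 4 := by gcongr
      _ = x ^ 16 := by ring

/-- The contents of registers and arrays at the start of the preprocessing. -/
def prepStore (input : List ℕ) : PStore :=
  ⟨fun _ => 0, fun a i => if a = .io then input.getD i 0 else 0⟩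

/-- Stored values stay below `x ^ 17`, so indices are at most `(x ^ 17) ^ 4 < x ^ 128` and never
leave the space of their array. This is why the preprocessing can be verified with `Guard.free`. -/
theorem exec_prepProg {w x : ℕ} {input : List ℕ} (hx3 : 3 ≤ x)
    (hx : x = input.getD 1 0 + input.getD 2 0 + 1) (hw : 23 * x ^ 128 < 2 ^ w)
    (hlen : input.length ≤ x ^ 6) (hin : ∀ i, input.getD i 0 ≤ x ^ 6)
    (safe : prep.Safe (Guard.free _ (x ^ 6)) (prepStore input))
    (hcost : 8 * prep.cost (prepStore input) ≤ x ^ 16) :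
    ∃ t, Exec w prepProg (inputState input) (62 + prep.cost (prepStore input)) t ∧
      t.regs 0 = (prep.den (prepStore input)).reg .res ∧
      ∀ i < x ^ 128, t.mem i = (prep.den (prepStore input)).arr .io i := by
  have mono : ∀ {i j : ℕ}, i ≤ j → x ^ i ≤ x ^ j := fun h => Nat.pow_le_pow_right (by omega) h
  have hV : x ^ 6 + 8 * prep.cost (prepStore input) ≤ x ^ 17 := by
    calc x ^ 6 + 8 * prep.cost (prepStore input) ≤ x ^ 16 + x ^ 16 :=
          Nat.add_le_add (mono (by norm_num)) hcost
      _ = x ^ 16 * 2 := (Nat.mul_two _).symm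
      _ ≤ x ^ 16 * x := Nat.mul_le_mul_left _ (by omega)
      _ = x ^ 17 := (pow_succ x 16).symm
  have hV4 : (x ^ 17) ^ 4 < x ^ 128 := by
    rw [← pow_mul]
    exact Nat.pow_lt_pow_right (by omega) (by norm_num)
  have h6 : x ^ 6 < x ^ 128 := Nat.pow_lt_pow_right (by omega) (by norm_num)
  have h8 : 8 ≤ x ^ 6 := le_trans (by norm_num) (Nat.pow_le_pow_left hx3 6)
  obtain ⟨t, e₀, m₀, z₀, b₀⟩ := exec_prologue hx hw
  -- From here on only the inequalities for the spacing matter; the power is made opaque.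
  generalize x ^ 128 = B at *
  have bdd : (prepStore input).Bdd (x ^ 6) := by
    refine ⟨fun _ => Nat.zero_le _, fun a i => ?_⟩
    simp only [prepStore]
    split_ifs
    exacts [hin i, Nat.zero_le _]
  obtain ⟨ok, -⟩ := prep.ok_of_safe (w := w) (D := 4) (V' := x ^ 17) (valid := fun _ i => i < B)
    (by norm_num) (by norm_num) (by omega) (fun _ _ _ h => h.trans_lt hV4) rfl _ (x ^ 6)
    h8 le_rfl bdd safe hV
  set base : PArr → ℕ := fun a => a.ctorIdx * B with hbase
  have idx : ∀ a : PArr, a.ctorIdx < 23 := fun a => by cases a <;> decide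
  have rep : Represents prepLayout base (fun _ i => i < B) (prepStore input) t := by
    refine ⟨fun q => z₀ _ (by cases q <;> decide), fun a => b₀ _ (idx a), fun a i hi => ?_⟩
    rw [m₀]
    by_cases ha : a = .io
    · subst ha
      simp [prepStore, hbase, PArr.ctorIdx]
    · have : 1 ≤ a.ctorIdx := by
        rcases Nat.eq_zero_or_pos a.ctorIdx with h | h
        · exact absurd (by rw [← PArr.ofNat_ctorIdx a, h]; rfl) ha
        · exact h
      -- All other arrays lie beyond the input, where the memory is initially 0.
      have h1 : B ≤ base a := Nat.le_mul_of_pos_left _ this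
      simp only [prepStore, if_neg ha]
      exact List.getD_eq_default _ _ (by omega)
  have lt_pow : ∀ (a : PArr) (i : ℕ), i < B → base a + i < 2 ^ w := by
    intro a i hi
    have := Nat.mul_le_mul_right B (show a.ctorIdx + 1 ≤ 23 from idx a)
    rw [Nat.add_mul] at this
    simp only [hbase]
    omega
  obtain ⟨t', e₁, r₁, -⟩ := prep.exec_compile lt_pow (fun a _ a' i i' hi hi' h => by
    have key : ∀ (a : PArr) (i : ℕ), i < B → (base a + i) / B = a.ctorIdx := fun a i hi => by
      simp only [hbase]
      rw [mul_comm, Nat.mul_add_div (by omega), Nat.div_eq_of_lt hi, add_zero]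
    have h1 : a'.ctorIdx = a.ctorIdx := by rw [← key a i hi, ← key a' i' hi', h]
    have h2 : a' = a := by rw [← PArr.ofNat_ctorIdx a, ← PArr.ofNat_ctorIdx a', h1]
    subst h2
    exact ⟨rfl, Nat.add_left_cancel h⟩) 47 _ t le_rfl rep ok
  refine ⟨t', Exec.seq e₀ e₁, r₁.reg .res, fun i hi => ?_⟩
  have := r₁.mem .io i hi
  rwa [show base .io = 0 from Nat.zero_mul _, zero_add] at this

theorem exists_words (hgen : e.Generates G) (hadj : IsAdjLists G adj) :
    ∃ word : Fin n → ℕ → ℕ, (∀ v, ∀ q < labelWords n k, word v q < 2 ^ lg n) ∧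
      (∀ v, word v 0 = 2 ^ (lg n - 1) ∧ word v 1 = min k n ∧ word v 2 = 2 * (lg n - 1)) ∧
      (∀ u v, ofCode (queryResult (word u) (word v)) = G.edist u v) ∧
      ∀ w, 134 * lg (k + e.size) ≤ w → ComputesLabels w prepProg e adj
        (fun v => encodeWords (lg n) (labelWords n k) (word v))
        (8000 * (min k n * (e.size + (n + ∑ v, (adj v).length + 1) * lg n)) + 62) := by
  have hk1 : 1 ≤ k := e.pos
  have hnodes := e.nodes_add_one
  rw [CWExpr.length_leaves hgen] at hnodes
  have hpos := e.nodes_pos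
  have hsize := e.nodes_le_size
  have hn1 : 1 ≤ n := by omega
  have hb1 : 1 ≤ lg n := Nat.le_add_left _ _
  have hSn : ∑ v, (adj v).length ≤ n * n := by
    calc ∑ v, (adj v).length ≤ ∑ _v : Fin n, n :=
          Finset.sum_le_sum fun v _ => length_adj_le hadj v
      _ = n * n := by simp
  obtain ⟨x, hx⟩ : ∃ x, x = k + e.size + 1 := ⟨_, rfl⟩
  obtain ⟨hnW, hWb, h9, hC⟩ := prep_bounds (n := n) (K := min k n) (b := lg n)
    (W := labelWords n k) (L := e.size) (x := x) (by omega) (by omega) (by omega)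
    ((lg_le hn1).trans (by omega)) (by omega) hSn (recPos_le hb1 (le_min hk1 hn1))
  have hx2 : x ≤ x ^ 2 := Nat.le_self_pow (by norm_num) x
  obtain ⟨safe, cost, res, word, table, small, head, dist⟩ := prep_runs (M := x ^ 6)
    (s := prepStore (dlsInput e adj)) hgen hadj (fun i => by simp [prepStore]) hk1 hn1 (by omega)
    ((Nat.le_add_right _ _).trans hnW) hWb le_rfl
  refine ⟨word, small, head, dist, fun w hw => ?_⟩
  -- All 23 arrays lie below `23 * x ^ 128 ≤ x ^ 131`, and `x ≤ 2 ^ lg (k + L)`; so `w > 131 * lg (k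
  -- + L)` suffices, which the factor 134 guarantees.
  have hw1 : 23 * x ^ 128 < 2 ^ w := by
    have hxw : x ≤ 2 ^ lg (k + e.size) := hx ▸ lt_two_pow_lg _
    calc 23 * x ^ 128 ≤ 3 ^ 3 * x ^ 128 := by gcongr; norm_num
      _ ≤ x ^ 3 * x ^ 128 := by gcongr; omega
      _ = x ^ 131 := (pow_add x 3 128).symm
      _ ≤ (2 ^ lg (k + e.size)) ^ 131 := Nat.pow_le_pow_left hxw _
      _ = 2 ^ (lg (k + e.size) * 131) := (pow_mul _ _ _).symm
      _ < 2 ^ w := Nat.pow_lt_pow_right (by norm_num) (by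
          have : 1 ≤ lg (k + e.size) := Nat.le_add_left _ _
          omega)
  have hlen : (dlsInput e adj).length ≤ x ^ 6 := by
    have : (dlsInput e adj).length = 3 + 3 * e.size + (n + ∑ v, (adj v).length) := by
      rw [dlsInput, List.length_append, List.length_append, e.length_tokens, length_adjTokens]
      rfl
    have h1 : n * n ≤ x ^ 2 := by
      rw [sq]; exact Nat.mul_le_mul (by omega) (by omega)
    omega
  obtain ⟨t, exec, r0, mem'⟩ := exec_prepProg (input := dlsInput e adj) (x := x) (by omega) hx hw1 hlen
    (fun i => (getD_dlsInput_le hadj i).trans (by omega)) safe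
    ((Nat.mul_le_mul_left 8 cost).trans hC)
  have h6 : x ^ 6 < x ^ 128 := Nat.pow_lt_pow_right (by omega) (by norm_num)
  rw [res] at r0
  refine ⟨_, t, exec, by omega, fun v => ?_⟩
  obtain ⟨h1, h2, h3⟩ := table v
  have hv : v * (labelWords n k + 1) + (labelWords n k + 1) ≤ n * (labelWords n k + 1) := by
    have := Nat.mul_le_mul_right (labelWords n k + 1) (show (v : ℕ) + 1 ≤ n from v.2)
    rwa [Nat.add_mul, one_mul] at this
  have hvn := v.2
  generalize x ^ 128 = B at *
  rw [r0, mem' _ (by omega), h1]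
  refine ⟨by omega, by omega, ?_, fun j hj => ?_⟩
  · rw [mem' _ (by omega), h2, length_encodeWords]
  · rw [length_encodeWords] at hj
    have hjW : j < labelWords n k := Nat.lt_of_mul_lt_mul_right hj
    rw [mem' _ (by omega), h3 j hjW, block_encodeWords hjW (small v j hjW)]
    exact ⟨by omega, rfl⟩

end WordRAM

/-! ### The theorem, with its constants. -/

open WordRAM in
theorem mainTheorem3 :
    ∃ (κ c : ℕ) (enc dec : WordRAM.Prog) (D : List Bool → List Bool → ℕ∞),
      ∀ (n k : ℕ) (G : SimpleGraph (Fin n)) (e : CWExpr (Fin n) k) (adj : Fin n → List (Fin n)),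
        e.Generates G → IsAdjLists G adj →
        ∃ label : Fin n → List Bool,
          (∀ u v, D (label u) (label v) = G.edist u v) ∧
          (∀ v, (label v).length ≤ c * k * lg n ^ 2) ∧
          (∀ w, κ * lg (k + e.size) ≤ w →
            ComputesLabels w enc e adj label
              (c * k * (e.size + (n + G.edgeSet.ncard) * lg n))) ∧
          (∀ w, κ * lg n ≤ w → ∀ u v,
            AnswersQuery w (lg n) dec (label u) (label v) (D (label u) (label v))
              (c * k * lg n)) := by
  refine ⟨134, 17000, prepProg, queryProg, decode, fun n k G e adj hgen hadj => ?_⟩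
  obtain ⟨word, small, head, dist, hcomp⟩ := exists_words hgen hadj
  have hk1 : 1 ≤ k := e.pos
  have hnodes := e.nodes_add_one
  rw [CWExpr.length_leaves hgen] at hnodes
  have hpos := e.nodes_pos
  have hn1 : 1 ≤ n := by omega
  have hb1 : 1 ≤ lg n := Nat.le_add_left _ _
  have hK1 : 1 ≤ min k n := le_min hk1 hn1
  have hdec : ∀ u v, decode (encodeWords (lg n) (labelWords n k) (word u))
      (encodeWords (lg n) (labelWords n k) (word v)) = ofCode (queryResult (word u) (word v)) :=
    fun u v => decode_encodeWords hb1 rfl (small u) (small v) (head u).1 (head u).2.1 (head u).2.2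
  refine ⟨fun v => encodeWords (lg n) (labelWords n k) (word v), fun u v => ?_, fun v => ?_,
    fun w hw => ?_, fun w hw u v => ?_⟩
  · rw [hdec, dist]
  · rw [length_encodeWords]
    calc labelWords n k * lg n ≤ 6 * (min k n * lg n) * lg n :=
          Nat.mul_le_mul_right _ (recPos_le hb1 hK1)
      _ ≤ 17000 * (k * lg n) * lg n := by gcongr; exacts [by norm_num, min_le_left _ _]
      _ = _ := by ring
  · obtain ⟨t, s, h1, h2, h3⟩ := hcomp w hw
    refine ⟨t, s, h1, h2.trans ?_, h3⟩
    rw [sum_length_adj hadj]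
    set m := G.edgeSet.ncard
    -- Here `1 ≤ n` absorbs the summand 1. The factor 2 turns 8000 into 16000, and the rest of 17000
    -- pays for the 62 steps of the prologue.
    have h4 : (n + 2 * m + 1) * lg n ≤ 2 * ((n + m) * lg n) := by
      rw [← mul_assoc]
      exact Nat.mul_le_mul_right _ (by omega)
    have h5 : min k n * (e.size + (n + 2 * m + 1) * lg n) ≤
        2 * (k * (e.size + (n + m) * lg n)) := by
      calc min k n * (e.size + (n + 2 * m + 1) * lg n)
          ≤ k * (2 * (e.size + (n + m) * lg n)) := Nat.mul_le_mul (min_le_left _ _) (by omega)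
        _ = _ := by ring
    have h6 : 1 ≤ k * (e.size + (n + m) * lg n) :=
      Nat.mul_pos hk1 (by have := e.nodes_le_size; omega)
    rw [mul_assoc]
    omega
  · rw [hdec]
    refine answersQuery_queryProg hb1 hK1 ?_ rfl (small u) (small v) (head u).2.1 (head u).2.2
      (by omega) ?_
    · exact (min_le_right _ _).trans (lt_two_pow_lg n).le
    · calc 400 * (min k n * lg n) ≤ 17000 * (k * lg n) := by
            gcongr
            exacts [by norm_num, min_le_left _ _]
        _ = _ := by ring
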